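/- Let $n\ge 3$ and let $(M,g_0)$ be a smooth $n$-dimensional Riemannian manifold, not necessarily complete, with volume measure $d\mu$, total volume $1$ and scalar curvature $S_0$. For a positive function $u$ and $g=u^{4/(n-2)}g_0$ write $d\mathrm{Vol}_g=u^{2n/(n-2)}d\mu$, and let $H^1(M,g)$ be the space of functions with weak gradient for which $\|f\|_{H^1(M,g)}^2=\int_M f^2\,d\mathrm{Vol}_g+\int_M|\nabla f|_g^2\,d\mathrm{Vol}_g<\infty$; $H^1(M)=H^1(M,g_0)$. Assume that $(M,g_0)$ is admissible: (i) for every $\varepsilon>0$ there are finitely many open balls $B_{2R_i}(x_i)\subset M$ (not reaching the missing boundary points of $M$) with $\mu(M\setminus\bigcup_i B_{R_i}(x_i))\le\varepsilon$; (ii) $C_c^\infty(M)$ is dense in $H^1(M)$; (iii) there are $A_0,B_0>0$ with $\|f\|^2_{L^{2n/(n-2)}(M)}\le A_0\|\nabla f\|^2_{L^2(M)}+B_0\|f\|^2_{L^2(M)}$ for all $f\in H^1(M)$. Assume also that the Yamabe constant $$Y(M,g_0)=\inf_{v\in H^1(M)\setminus\{0\}}\frac{\int_M\frac{4(n-1)}{n-2}|\nabla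 v|^2+S_0v^2\,d\mu}{\|v\|^2_{L^{2n/(n-2)}(M)}}$$ is positive, that $S_0\in L^{\frac{n^2}{2(n-2)}}(M)$, and that $(S_0)_-=-\min\{S_0,0\}\in L^\infty(M)$. Let $T>0$ and let $A(T),B(T)>0$ be constants. Then there is a constant $0<C(T)<\infty$, depending only on $T$ and on $S_0$ (that is, on $T$, on the initial manifold $(M,g_0)$ and on the Sobolev constants $A(T),B(T)$, but not on the flow), such that the following holds. Let $g(t)=u(t)^{4/(n-2)}g_0$, $t\in[0,T]$, $u>0$, $u(0)=1$, be a weak normalized Yamabe flow $\partial_tg=-(S-\rho)g$, i.e. $u(t)\in H^1(M)$ for each $t$, $u\in C^0([0,T];L^2(M))$ and $\partial_tu=-\frac{n-2}4(S-\rho)u$ in $L^2(M)$ on $(0,T)$, where $S=u^{-\frac{n+2}{n-2}}\bigl(S_0u-\frac{4(n-1)}{n-2}\Delta_0u\bigr)$ (weakly) is the scalar curvature of $g(t)$ and $\rho(t)=\mathrm{Vol}_{g}(M)^{-1}\int_MS\,d\mathrm{Vol}_{g}$. Assume that 1. $S\in C^0([0,T];H^1(M,g))\cap C^1((0,T);H^1(M,g))$;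 2. $H^1(M)=H^1(M,g(t))$ for all $t\in[0,T]$, with norms equivalent uniformly in $t$; 3. for all $t\in[0,T]$ and all $f\in H^1(M,g(t))$: $\|f\|^2_{L^{2n/(n-2)}(M,g)}\le A(T)\|\nabla f\|^2_{L^2(M,g)}+B(T)\|f\|^2_{L^2(M,g)}$; 4. $S$ solves $\partial_tS-(n-1)\Delta S=S(S-\rho)$ weakly, with $\Delta$ the Laplacian of $g(t)$: for all $t\in(0,T)$ and $\phi\in C_c^\infty(M)$, $$\int_M\partial_tS\,\phi\,d\mathrm{Vol}_g+(n-1)\int_M(\nabla S,\nabla\phi)_g\,d\mathrm{Vol}_g=\int_MS(S-\rho)\phi\,d\mathrm{Vol}_g.$$ Then $$\|S\|_{L^\infty(M\times[T/2,T])}\le C(T),$$ and indeed $\|S(t)\|_{L^\infty(M)}\le C(T)$ for every $t\in[T/2,T]$. -/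

import Mathlib

open MeasureTheory Set Filter Topology Manifold Bundle
open scoped ENNReal NNReal ContDiff

noncomputable section

namespace YamabeFlow

/-! The background manifold `(M, g₀)` is a Riemannian manifold in Mathlib's sense, modelled on
`ℝⁿ`; `inner ℝ` on the tangent spaces is `g₀`. A conformal metric `g = u ^ (4 / (n - 2)) • g₀`
is represented by its conformal factor `u : M → ℝ`; the factor `1` gives `g₀` itself. -/

section Coordinates

variable (n : ℕ) {M : Type*} [TopologicalSpace M] [ChartedSpace (EuclideanSpace ℝ (Fin n)) M]

/-- The coordinate vector field `∂_i` of the preferred chart at `p`, at the point with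
coordinates `y`. -/
def coordField (p : M) (i : Fin n) (y : EuclideanSpace ℝ (Fin n)) :
    TangentSpace (𝓡 n) ((chartAt (EuclideanSpace ℝ (Fin n)) p).symm y) :=
  mfderiv (𝓡 n) (𝓡 n) (chartAt (EuclideanSpace ℝ (Fin n)) p).symm y
    (EuclideanSpace.single i (1 : ℝ) : EuclideanSpace ℝ (Fin n))

/-- The partial derivative `∂_i F` of a function on `ℝⁿ`. -/
def partialDeriv (i : Fin n) (F : EuclideanSpace ℝ (Fin n) → ℝ) (y : EuclideanSpace ℝ (Fin n)) :
    ℝ :=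
  fderiv ℝ F y (EuclideanSpace.single i (1 : ℝ))

variable [RiemannianBundle (fun x : M => TangentSpace (𝓡 n) x)]

/-- The matrix `g_{ij}` of `g₀` in the preferred chart at `p`. -/
def metricCoeff (p : M) (y : EuclideanSpace ℝ (Fin n)) : Matrix (Fin n) (Fin n) ℝ :=
  Matrix.of fun i j => inner ℝ (coordField n p i y) (coordField n p j y)

/-- The Christoffel symbol `Γ^k_{ij}` in the preferred chart at `p`. -/
def christoffel (p : M) (k i j : Fin n) (y : EuclideanSpace ℝ (Fin n)) : ℝ :=
  (1 / 2) * ∑ l, (metricCoeff n p y)⁻¹ k l *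
    (partialDeriv n i (fun z => metricCoeff n p z j l) y
      + partialDeriv n j (fun z => metricCoeff n p z i l) y
      - partialDeriv n l (fun z => metricCoeff n p z i j) y)

/-- The Ricci curvature `R_{ij} = ∂_k Γ^k_{ij} - ∂_j Γ^k_{ik} + Γ^k_{kl} Γ^l_{ij}
- Γ^k_{jl} Γ^l_{ik}` in the preferred chart at `p`. -/
def ricci (p : M) (i j : Fin n) (y : EuclideanSpace ℝ (Fin n)) : ℝ :=
  (∑ k, (partialDeriv n k (christoffel n p k i j) y
      - partialDeriv n j (christoffel n p k i k) y))
    + ∑ k, ∑ l, (christoffel n p k k l y * christoffel n p l i j y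
      - christoffel n p k j l y * christoffel n p l i k y)

/-- The scalar curvature `S₀ = g^{ij} R_{ij}` of `g₀`. -/
def scalarCurvature (x : M) : ℝ :=
  ∑ i, ∑ j, (metricCoeff n x (chartAt (EuclideanSpace ℝ (Fin n)) x x))⁻¹ i j *
    ricci n x i j (chartAt (EuclideanSpace ℝ (Fin n)) x x)

/-- The measure `√(det g_{ij}) dy` of the preferred chart at `p`, carried over to `M`. -/
def chartVolume [MeasurableSpace M] (p : M) : Measure M :=
  Measure.map (chartAt (EuclideanSpace ℝ (Fin n)) p).symm
    ((volume.restrict (chartAt (EuclideanSpace ℝ (Fin n)) p).target).withDensity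
      fun y => ENNReal.ofReal (Real.sqrt (metricCoeff n p y).det))

variable (M) in
/-- The Riemannian volume measure `dμ` of `g₀`. The chart measures agree on overlaps of the chart
domains, so their supremum is the measure that coincides with each of them on its domain. -/
def riemannianVolume [MeasurableSpace M] : Measure M :=
  ⨆ p : M, chartVolume n p

/-- `X` is a weak gradient of `f` with respect to `g₀`: in each chart, the function
`g₀(X, ∂_i)` is the weak `i`-th partial derivative of `f`. -/
def HasWeakGradient (f : M → ℝ) (X : ∀ x : M, TangentSpace (𝓡 n) x) : Prop :=
  ∀ p : M,
    let e := chartAt (EuclideanSpace ℝ (Fin n)) p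
    LocallyIntegrableOn (fun y => f (e.symm y)) e.target ∧
    ∀ i : Fin n,
      LocallyIntegrableOn (fun y => inner ℝ (X (e.symm y)) (coordField n p i y)) e.target ∧
      ∀ φ : EuclideanSpace ℝ (Fin n) → ℝ,
        ContDiff ℝ ∞ φ → HasCompactSupport φ → tsupport φ ⊆ e.target →
        ∫ y, f (e.symm y) * partialDeriv n i φ y
          = - ∫ y, inner ℝ (X (e.symm y)) (coordField n p i y) * φ y

open Classical in
/-- The weak gradient `∇f` with respect to `g₀` (unique almost everywhere if it exists; `0` if
there is none). -/
def weakGrad (f : M → ℝ) : ∀ x : M, TangentSpace (𝓡 n) x :=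
  if h : ∃ X : ∀ x : M, TangentSpace (𝓡 n) x, HasWeakGradient n f X then h.choose else 0

end Coordinates

section Sobolev

variable (n : ℕ) {M : Type*} [TopologicalSpace M] [ChartedSpace (EuclideanSpace ℝ (Fin n)) M]
  [RiemannianBundle (fun x : M => TangentSpace (𝓡 n) x)] [MeasurableSpace M]

/-- The volume measure `dVol_g = u ^ (2n / (n - 2)) dμ` of `g = u ^ (4 / (n - 2)) • g₀`. -/
def confVolume (u : M → ℝ) : Measure M :=
  (riemannianVolume n M).withDensity fun x =>
    ENNReal.ofReal (u x ^ (2 * (n : ℝ) / ((n : ℝ) - 2)))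

/-- `‖∇f‖²` in `L²(M, g)` for `g = u ^ (4 / (n - 2)) • g₀`; the pointwise norm is
`|∇f|²_g = u ^ (-4 / (n - 2)) |∇f|²_{g₀}`. -/
def gradNormSq (u f : M → ℝ) : ℝ≥0∞ :=
  ∫⁻ x, ENNReal.ofReal (u x ^ (-4 / ((n : ℝ) - 2))) * ‖weakGrad n f x‖ₑ ^ 2 ∂(confVolume n u)

/-- `‖f‖²` in `L²(M, g)`. -/
def l2NormSq (u f : M → ℝ) : ℝ≥0∞ :=
  ∫⁻ x, ‖f x‖ₑ ^ 2 ∂(confVolume n u)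

/-- `‖f‖²` in `H¹(M, g)`. -/
def h1NormSq (u f : M → ℝ) : ℝ≥0∞ :=
  l2NormSq n u f + gradNormSq n u f

/-- `f ∈ H¹(M, g)` for `g = u ^ (4 / (n - 2)) • g₀`. -/
def MemH1 (u f : M → ℝ) : Prop :=
  (∃ X : ∀ x : M, TangentSpace (𝓡 n) x, HasWeakGradient n f X) ∧
    AEStronglyMeasurable f (riemannianVolume n M) ∧ h1NormSq n u f < ⊤

/-- `φ ∈ C_c^∞(M)`. -/
def IsTestFunction (φ : M → ℝ) : Prop :=
  ContMDiff (𝓡 n) 𝓘(ℝ, ℝ) ∞ φ ∧ HasCompactSupport φ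

/-- `g₀(∇f, ∇φ) = dφ(∇f)` for a smooth function `φ`. -/
def gradPairing (f φ : M → ℝ) (x : M) : ℝ :=
  mfderiv (𝓡 n) 𝓘(ℝ, ℝ) φ x (weakGrad n f x)

/-- The Sobolev inequality
`‖f‖²_{L^{2n/(n-2)}(M,g)} ≤ A ‖∇f‖²_{L²(M,g)} + B ‖f‖²_{L²(M,g)}` for all `f ∈ H¹(M, g)`. -/
def SobolevInequality (u : M → ℝ) (A B : ℝ) : Prop :=
  ∀ f : M → ℝ, MemH1 n u f →
    eLpNorm f (ENNReal.ofReal (2 * (n : ℝ) / ((n : ℝ) - 2))) (confVolume n u) ^ 2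
      ≤ ENNReal.ofReal A * gradNormSq n u f + ENNReal.ofReal B * l2NormSq n u f

variable (M) in
/-- The Yamabe constant of `(M, g₀)`. (If the quotient is not bounded below, the real `sInf` is
`0`, so positivity of this number is positivity of the true infimum.) -/
def yamabeConstant : ℝ :=
  sInf {r : ℝ | ∃ v : M → ℝ, MemH1 n 1 v ∧ ¬ (v =ᵐ[riemannianVolume n M] 0) ∧
    r = (∫ x, (4 * ((n : ℝ) - 1) / ((n : ℝ) - 2) * ‖weakGrad n v x‖ ^ 2
          + scalarCurvature n x * v x ^ 2) ∂(riemannianVolume n M)) /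
        (eLpNorm v (ENNReal.ofReal (2 * (n : ℝ) / ((n : ℝ) - 2)))
          (riemannianVolume n M)).toReal ^ 2}

/-- `S ∈ C⁰([0,T]; H¹(M, g))` with `g = g(t) = u(t) ^ (4 / (n - 2)) • g₀`. -/
def ContinuousInH1 (T : ℝ) (u S : ℝ → M → ℝ) : Prop :=
  ∀ t ∈ Icc 0 T, MemH1 n (u t) (S t) ∧
    Tendsto (fun s => h1NormSq n (u t) (S s - S t)) (𝓝[Icc 0 T] t) (𝓝 0)

/-- `S ∈ C¹((0,T); H¹(M, g))` with time derivative `S'`. -/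
def ContDiffInH1 (T : ℝ) (u S S' : ℝ → M → ℝ) : Prop :=
  ∀ t ∈ Ioo 0 T, MemH1 n (u t) (S' t) ∧
    Tendsto (fun s => h1NormSq n (u t) ((s - t)⁻¹ • (S s - S t) - S' t)) (𝓝[≠] t) (𝓝 0) ∧
    Tendsto (fun s => h1NormSq n (u t) (S' s - S' t)) (𝓝 t) (𝓝 0)

/-- `H¹(M) = H¹(M, g(t))` for all `t ∈ [0,T]`, with norms that are equivalent uniformly in
`t`. -/
def SobolevSpacesAgree (T : ℝ) (u : ℝ → M → ℝ) : Prop :=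
  (∀ t ∈ Icc 0 T, ∀ f : M → ℝ, MemH1 n 1 f ↔ MemH1 n (u t) f) ∧
  ∃ K : ℝ≥0, ∀ t ∈ Icc 0 T, ∀ f : M → ℝ, MemH1 n 1 f →
    h1NormSq n (u t) f ≤ K * h1NormSq n 1 f ∧ h1NormSq n 1 f ≤ K * h1NormSq n (u t) f

/-- The average `ρ = Vol_g(M)⁻¹ ∫_M S dVol_g`. -/
def average (u S : M → ℝ) : ℝ :=
  (confVolume n u univ).toReal⁻¹ * ∫ x, S x ∂(confVolume n u)

/-- `g(t) = u(t) ^ (4 / (n - 2)) • g₀`, `t ∈ [0,T]`, is a (weak) normalized Yamabe flow with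
`g(0) = g₀` and `S(t)` is the scalar curvature of `g(t)`. -/
structure IsYamabeFlow (T : ℝ) (u S : ℝ → M → ℝ) : Prop where
  pos : ∀ t ∈ Icc 0 T, ∀ᵐ x ∂(riemannianVolume n M), 0 < u t x
  initial : ∀ᵐ x ∂(riemannianVolume n M), u 0 x = 1
  memH1 : ∀ t ∈ Icc 0 T, MemH1 n 1 (u t)
  /-- `u ∈ C⁰([0,T]; L²(M))`. -/
  continuous : ∀ t ∈ Icc 0 T,
    Tendsto (fun s => eLpNorm (u s - u t) 2 (riemannianVolume n M)) (𝓝[Icc 0 T] t) (𝓝 0)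
  /-- `∂_t g = -(S - ρ) g`, that is, `∂_t u = - (n - 2) / 4 * (S - ρ) u`, in `L²(M)`. -/
  flow : ∀ t ∈ Ioo 0 T,
    Tendsto (fun s => eLpNorm
      (fun x => (s - t)⁻¹ * (u s x - u t x)
        - (-(((n : ℝ) - 2) / 4) * (S t x - average n (u t) (S t)) * u t x))
      2 (riemannianVolume n M)) (𝓝[≠] t) (𝓝 0)
  /-- `S = u ^ (-(n + 2) / (n - 2)) L₀ u` weakly, where `L₀ = S₀ - 4 (n - 1) / (n - 2) Δ₀`. -/
  scalar : ∀ t ∈ Icc 0 T, ∀ φ : M → ℝ, IsTestFunction n φ →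
    ∫ x, S t x * u t x ^ (((n : ℝ) + 2) / ((n : ℝ) - 2)) * φ x ∂(riemannianVolume n M)
      = 4 * ((n : ℝ) - 1) / ((n : ℝ) - 2)
          * ∫ x, gradPairing n (u t) φ x ∂(riemannianVolume n M)
        + ∫ x, scalarCurvature n x * u t x * φ x ∂(riemannianVolume n M)

/-- The weak form of `∂_t S - (n - 1) Δ S = S (S - ρ)` on `M × (0,T)`, where `S'` is the time
derivative of `S`, and `Δ` is the Laplacian of `g(t) = u(t) ^ (4 / (n - 2)) • g₀`. The integrand
`(∇S, ∇φ)_g` equals `u ^ (-4 / (n - 2)) g₀(∇S, ∇φ)` with `g₀`-gradients on the right. -/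
def WeakScalarEvolution (T : ℝ) (u S S' : ℝ → M → ℝ) : Prop :=
  ∀ t ∈ Ioo 0 T, ∀ φ : M → ℝ, IsTestFunction n φ →
    ∫ x, S' t x * φ x ∂(confVolume n (u t))
      + ((n : ℝ) - 1)
        * ∫ x, u t x ^ (-4 / ((n : ℝ) - 2)) * gradPairing n (S t) φ x ∂(confVolume n (u t))
      = ∫ x, S t x * (S t x - average n (u t) (S t)) * φ x ∂(confVolume n (u t))

end Sobolev

section Admissible

variable (n : ℕ) (M : Type*) [EMetricSpace M] [ChartedSpace (EuclideanSpace ℝ (Fin n)) M]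
  [RiemannianBundle (fun x : M => TangentSpace (𝓡 n) x)] [MeasurableSpace M]

/-- Admissibility of `(M, g₀)`. That the ball `B_{2R}(x)` lies in `M` (it does not reach the
missing boundary points of the possibly incomplete manifold `M`) means that all concentric balls
of smaller radius are relatively compact in `M`. -/
structure IsAdmissible : Prop where
  finite_volume : riemannianVolume n M univ < ⊤
  exhaustion : ∀ ε : ℝ, 0 < ε → ∃ (N : ℕ) (x : Fin N → M) (R : Fin N → ℝ),
    (∀ i, 0 < R i) ∧
    (∀ i, ∀ r < 2 * R i, IsCompact (closure {y : M | edist y (x i) < ENNReal.ofReal r})) ∧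
    riemannianVolume n M (univ \ ⋃ i, {y : M | edist y (x i) < ENNReal.ofReal (R i)})
      ≤ ENNReal.ofReal ε
  /-- `C_c^∞(M)` is dense in `H¹(M)`. -/
  dense : ∀ f : M → ℝ, MemH1 n 1 f → ∀ ε : ℝ≥0∞, 0 < ε →
    ∃ φ : M → ℝ, IsTestFunction n φ ∧ h1NormSq n 1 (f - φ) < ε
  sobolev : ∃ A₀ B₀ : ℝ, 0 < A₀ ∧ 0 < B₀ ∧ SobolevInequality n (1 : M → ℝ) A₀ B₀

end Admissible

end YamabeFlow

end

open YamabeFlow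

/-! The scalar curvature solves a heat equation with quadratic reaction. It is bounded below by a
maximum principle in integral form and above by Moser iteration, with constants that involve only
`T`, the initial manifold and `A`, `B`.

Three facts come without any estimate. The volume stays 1. The average `ρ` is nonnegative, because
`∫ S dVol_g` is the Yamabe energy of `u`. And `ρ' = -(n-2)/2 ∫ (S-ρ)² dVol_g`, so that `ρ ≤ ∫ S₀ dμ`
and the time integral of `∫ S² dVol_g` is bounded (`RegularFlow.hasDerivAt_average`).

Lower bound (`RegularFlow.neg_le`): let `F` be convex, positive exactly below `-m`. The integral of
`F(S) u^((n+2)/(n-2))` is differentiated and the evolution equation is tested with `F'(S)/u`. The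
gradient of `1/u` is exchanged, through the equation for the scalar curvature, for a term without
derivatives; all contributions of the form `S F(S)` cancel, and Gronwall's inequality applies.

Upper bound: testing with a power of `S` and using the Sobolev inequality bounds the derivative of
`∫ S^p` by a negative multiple of `(∫ S^(pn/(n-2)))^((n-2)/n)` plus a reaction term. For `p = n/2`
the part of order `p+1` in the reaction has coefficient zero; what is left is of order `S²` and is
paid for by the decay of `ρ`. Hence `b = (∫ S^(n²/(2(n-2))))^((n-2)/n)` is integrable in time. For
`p ≥ n/2`, Hölder and Young bound the reaction by half of the dissipation plus `C p^(n/2) b ∫ S^p`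
(`RegularFlow.hasDerivAt_powEnergy_le`). At `p = n²/(2(n-2))` this is a linear inequality with
integrable coefficient, so the assumed integrability of `S₀` propagates
(`RegularFlow.truncEnergy_critExp_le`) and `b` becomes bounded. From there each passage from `p` to
`pn/(n-2)` costs a short time: the dissipation supplies one good time, and Gronwall carries the
bound forward (`RegularFlow.truncEnergy_gain_le`). The time steps form a geometric series with sum
`T/2`, and the limit of the `L^p` bounds is the supremum bound.

As `S` is only in `H¹`, powers are replaced by `trunc L S` and `powExt p L S`, with bounds uniform
in `L`. The hypotheses on the flow are condensed into `RegularFlow` by `exists_regularFlow`. Its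
main point is that equivalence of the `H¹` norms confines `u` to an interval `[K⁻¹, K]`
(`conformalFactor_bounds`), as is seen on rapidly oscillating functions. `K` depends on the flow; it
makes integrals finite and differentiable but enters no final constant. The calculus in `H¹` rests
on the density of test functions. -/

set_option linter.unusedSectionVars false

noncomputable section

namespace YamabeFlow

/-! ### The Riemannian volume in charts -/

section Charts

variable {n : ℕ} {M : Type*} [TopologicalSpace M] [ChartedSpace (EuclideanSpace ℝ (Fin n)) M]
  [IsManifold (𝓡 n) ∞ M]

lemma mdifferentiable_chartAt (p : M) :
    (chartAt (EuclideanSpace ℝ (Fin n)) p).MDifferentiable (𝓡 n) (𝓡 n) :=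
  mdifferentiable_chart p

/-- The coordinate frame as a linear equivalence. -/
lemma mfderiv_symm_bijective (p : M) {y : EuclideanSpace ℝ (Fin n)}
    (hy : y ∈ (chartAt (EuclideanSpace ℝ (Fin n)) p).target) :
    Function.Bijective (mfderiv (𝓡 n) (𝓡 n) (chartAt (EuclideanSpace ℝ (Fin n)) p).symm y) :=
  (mdifferentiable_chartAt p).symm.mfderiv_bijective hy

lemma linearIndependent_coordField (p : M) {y : EuclideanSpace ℝ (Fin n)}
    (hy : y ∈ (chartAt (EuclideanSpace ℝ (Fin n)) p).target) :
    LinearIndependent ℝ (fun i => coordField n p i y) := by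
  have h := (EuclideanSpace.basisFun (Fin n) ℝ).toBasis.linearIndependent
  have := h.map' (mfderiv (𝓡 n) (𝓡 n) (chartAt (EuclideanSpace ℝ (Fin n)) p).symm y).toLinearMap
    (LinearMap.ker_eq_bot.2 (mfderiv_symm_bijective p hy).1)
  have e : (fun i => coordField n p i y) =
      (mfderiv (𝓡 n) (𝓡 n) (chartAt (EuclideanSpace ℝ (Fin n)) p).symm y).toLinearMap ∘
        (EuclideanSpace.basisFun (Fin n) ℝ).toBasis := by
    funext i
    have h1 : (EuclideanSpace.basisFun (Fin n) ℝ).toBasis i = EuclideanSpace.single i (1 : ℝ) := by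
      simp
    exact congrArg (mfderiv (𝓡 n) (𝓡 n) (chartAt (EuclideanSpace ℝ (Fin n)) p).symm y) h1.symm
  rw [e]
  exact this

lemma span_coordField (p : M) {y : EuclideanSpace ℝ (Fin n)}
    (hy : y ∈ (chartAt (EuclideanSpace ℝ (Fin n)) p).target)
    (X : TangentSpace (𝓡 n) ((chartAt (EuclideanSpace ℝ (Fin n)) p).symm y)) :
    ∃ c : Fin n → ℝ, X = ∑ i, c i • coordField n p i y := by
  obtain ⟨v, rfl⟩ := (mfderiv_symm_bijective p hy).2 X
  let w : EuclideanSpace ℝ (Fin n) := v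
  refine ⟨fun i => w i, ?_⟩
  have : w = ∑ i, w i • EuclideanSpace.single i (1 : ℝ) := by
    conv_lhs => rw [← (EuclideanSpace.basisFun (Fin n) ℝ).sum_repr w]
    simp
  simp only [coordField]
  change mfderiv (𝓡 n) (𝓡 n) (chartAt (EuclideanSpace ℝ (Fin n)) p).symm y w = _
  conv_lhs => rw [this]
  erw [map_sum]
  refine Finset.sum_congr rfl fun i _ => ?_
  erw [map_smul]

/-- The field is the image of a constant section over `ℝⁿ` under the tangent map of the inverse
chart, which is continuous because the inverse chart is `C¹`. -/
lemma continuousOn_coordField (p : M) (i : Fin n) :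
    ContinuousOn (fun y => (⟨(chartAt (EuclideanSpace ℝ (Fin n)) p).symm y, coordField n p i y⟩ :
      TangentBundle (𝓡 n) M)) (chartAt (EuclideanSpace ℝ (Fin n)) p).target := by
  have h1 : ContMDiffOn (𝓡 n) (𝓡 n) 1 (chartAt (EuclideanSpace ℝ (Fin n)) p).symm
      (chartAt (EuclideanSpace ℝ (Fin n)) p).target := contMDiffOn_chart_symm
  have h2 := h1.continuousOn_tangentMapWithin le_rfl
    (chartAt (EuclideanSpace ℝ (Fin n)) p).open_target.uniqueMDiffOn
  have h3 : Continuous (fun y : EuclideanSpace ℝ (Fin n) =>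
      (⟨y, (EuclideanSpace.single i (1 : ℝ) : EuclideanSpace ℝ (Fin n))⟩ :
        TangentBundle (𝓡 n) (EuclideanSpace ℝ (Fin n)))) := by
    rw [← (tangentBundleModelSpaceHomeomorph (𝓡 n)
      (H := EuclideanSpace ℝ (Fin n))).comp_continuous_iff]
    exact continuous_id.prodMk continuous_const
  have h4 := h2.comp (s := (chartAt (EuclideanSpace ℝ (Fin n)) p).target) h3.continuousOn
    (fun y hy => hy)
  refine h4.congr fun y hy => ?_
  simp only [Function.comp_apply, tangentMapWithin, coordField]
  rw [mfderivWithin_eq_mfderiv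
    ((chartAt (EuclideanSpace ℝ (Fin n)) p).open_target.uniqueMDiffWithinAt hy)
    ((mdifferentiable_chartAt p).mdifferentiableAt_symm hy)]

variable [RiemannianBundle (fun x : M => TangentSpace (𝓡 n) x)]

lemma metricCoeff_posDef (p : M) {y : EuclideanSpace ℝ (Fin n)}
    (hy : y ∈ (chartAt (EuclideanSpace ℝ (Fin n)) p).target) :
    (metricCoeff n p y).PosDef :=
  Matrix.posDef_gram_of_linearIndependent (linearIndependent_coordField p hy)

variable [IsContMDiffRiemannianBundle (𝓡 n) ∞ (EuclideanSpace ℝ (Fin n))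
      (fun x : M => TangentSpace (𝓡 n) x)]

variable (n M) in
lemma isContinuousRiemannianBundle_tangentSpace :
    IsContinuousRiemannianBundle (EuclideanSpace ℝ (Fin n))
      (fun x : M => TangentSpace (𝓡 n) x) := by
  obtain ⟨g, hg, hg'⟩ := IsContMDiffRiemannianBundle.exists_contMDiff (IB := 𝓡 n) (n := ∞)
    (F := EuclideanSpace ℝ (Fin n)) (E := fun x : M => TangentSpace (𝓡 n) x)
  exact ⟨g, hg.continuous, hg'⟩

lemma continuousOn_metricCoeff (p : M) (i j : Fin n) :
    ContinuousOn (fun y => metricCoeff n p y i j)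
      (chartAt (EuclideanSpace ℝ (Fin n)) p).target := by
  have := isContinuousRiemannianBundle_tangentSpace n M
  exact (continuousOn_coordField p i).inner_bundle (continuousOn_coordField p j)

lemma continuousOn_metricCoeff_matrix (p : M) :
    ContinuousOn (metricCoeff n p) (chartAt (EuclideanSpace ℝ (Fin n)) p).target :=
  continuousOn_pi.2 fun i => continuousOn_pi.2 fun j => continuousOn_metricCoeff p i j

lemma continuousOn_volumeDensity (p : M) :
    ContinuousOn (fun y => Real.sqrt (metricCoeff n p y).det)
      (chartAt (EuclideanSpace ℝ (Fin n)) p).target :=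
  Real.continuous_sqrt.comp_continuousOn
    ((continuous_id.matrix_det).comp_continuousOn (continuousOn_metricCoeff_matrix p))

lemma volumeDensity_pos (p : M) {y : EuclideanSpace ℝ (Fin n)}
    (hy : y ∈ (chartAt (EuclideanSpace ℝ (Fin n)) p).target) :
    0 < Real.sqrt (metricCoeff n p y).det :=
  Real.sqrt_pos.2 (metricCoeff_posDef p hy).det_pos

variable [MeasurableSpace M] [BorelSpace M]

lemma aemeasurable_chartAt_symm (p : M) {ν : Measure (EuclideanSpace ℝ (Fin n))}
    (hν : ν ≪ volume.restrict (chartAt (EuclideanSpace ℝ (Fin n)) p).target) :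
    AEMeasurable (chartAt (EuclideanSpace ℝ (Fin n)) p).symm ν :=
  ((chartAt (EuclideanSpace ℝ (Fin n)) p).continuousOn_symm.aemeasurable
    (chartAt (EuclideanSpace ℝ (Fin n)) p).open_target.measurableSet).mono_ac hν

lemma aemeasurable_volumeDensity (p : M) :
    AEMeasurable (fun y => ENNReal.ofReal (Real.sqrt (metricCoeff n p y).det))
      (volume.restrict (chartAt (EuclideanSpace ℝ (Fin n)) p).target) :=
  ((continuousOn_volumeDensity p).aemeasurable
    (chartAt (EuclideanSpace ℝ (Fin n)) p).open_target.measurableSet).ennreal_ofReal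

/-- The volume density is positive on the chart target, so weighting by it creates no new null sets.
-/
lemma ae_volume_withDensity (p : M) :
    ae ((volume.restrict (chartAt (EuclideanSpace ℝ (Fin n)) p).target).withDensity
      fun y => ENNReal.ofReal (Real.sqrt (metricCoeff n p y).det)) =
    ae (volume.restrict (chartAt (EuclideanSpace ℝ (Fin n)) p).target) := by
  refine le_antisymm (withDensity_absolutelyContinuous _ _).ae_le
    (withDensity_absolutelyContinuous' (aemeasurable_volumeDensity p) ?_).ae_le
  filter_upwards [ae_restrict_mem (chartAt (EuclideanSpace ℝ (Fin n)) p).open_target.measurableSet]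
    with y hy
  simpa using volumeDensity_pos p hy

lemma ae_chartVolume_iff (p : M) {P : M → Prop} (hP : MeasurableSet {x | P x}) :
    (∀ᵐ x ∂(chartVolume n p), P x) ↔
      ∀ᵐ y ∂(volume.restrict (chartAt (EuclideanSpace ℝ (Fin n)) p).target),
        P ((chartAt (EuclideanSpace ℝ (Fin n)) p).symm y) := by
  rw [chartVolume, ae_map_iff (aemeasurable_chartAt_symm p
    (withDensity_absolutelyContinuous _ _)) hP, Filter.Eventually, ae_volume_withDensity]
  rfl

lemma chartVolume_le (p : M) : chartVolume n p ≤ riemannianVolume n M :=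
  le_iSup (fun p : M => chartVolume n p) p

lemma ae_chart_of_ae (p : M) {P : M → Prop} (h : ∀ᵐ x ∂(riemannianVolume n M), P x) :
    ∀ᵐ y ∂(volume.restrict (chartAt (EuclideanSpace ℝ (Fin n)) p).target),
        P ((chartAt (EuclideanSpace ℝ (Fin n)) p).symm y) := by
  have h1 := (chartVolume_le (n := n) p).absolutelyContinuous.ae_le h
  rw [chartVolume] at h1
  have h2 := ae_of_ae_map (aemeasurable_chartAt_symm p
    (withDensity_absolutelyContinuous _ _)) h1
  rwa [Filter.Eventually, ae_volume_withDensity] at h2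

/-- A supremum of measures has no simple value on a set. But chart measures carried by `{x | P x}`
are dominated by the restriction of the volume to that set, hence so is their supremum; evaluation
on the complement gives zero. -/
lemma ae_riemannianVolume_iff_chartVolume {P : M → Prop} (hP : MeasurableSet {x | P x}) :
    (∀ᵐ x ∂(riemannianVolume n M), P x) ↔ ∀ p : M, ∀ᵐ x ∂(chartVolume n p), P x := by
  refine ⟨fun h p => (chartVolume_le p).absolutelyContinuous.ae_le h, fun h => ?_⟩
  have h1 : riemannianVolume n M ≤ (riemannianVolume n M).restrict {x | P x} := by
    refine iSup_le fun p => ?_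
    rw [← Measure.restrict_eq_self_of_ae_mem (h p)]
    exact Measure.restrict_mono_measure (chartVolume_le p) _
  have h2 := h1 {x | P x}ᶜ
  rw [Measure.restrict_apply hP.compl, compl_inter_self, measure_empty] at h2
  exact le_antisymm h2 zero_le

/-- A set that is Lebesgue null in one chart is null for the Riemannian volume. -/
lemma riemannianVolume_chart_null (p : M) {N : Set (EuclideanSpace ℝ (Fin n))}
    (hN : MeasurableSet N) (hN0 : volume N = 0) :
    ∀ᵐ x ∂(riemannianVolume n M), x ∈ (chartAt (EuclideanSpace ℝ (Fin n)) p).source →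
      chartAt (EuclideanSpace ℝ (Fin n)) p x ∉ N := by
  set e := chartAt (EuclideanSpace ℝ (Fin n)) p with he
  -- The chart is continuous only on its source, so it is replaced by a measurable function with the
  -- same values there.
  have hms : MeasurableSet (e.source ∩ e ⁻¹' N) := by
    obtain ⟨f, hf, hf'⟩ : ∃ f : M → EuclideanSpace ℝ (Fin n), Measurable f ∧ EqOn f e e.source := by
      classical
      refine ⟨e.source.piecewise e (fun _ => 0), ?_, piecewise_eqOn _ _ _⟩
      exact ContinuousOn.measurable_piecewise e.continuousOn_toFun continuousOn_const
        e.open_source.measurableSet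
    have : e.source ∩ e ⁻¹' N = e.source ∩ f ⁻¹' N := by
      ext x
      simp only [mem_inter_iff, mem_preimage, and_congr_right_iff]
      intro hx
      rw [hf' hx]
    rw [this]
    exact e.open_source.measurableSet.inter (hf hN)
  have hset : {x | x ∈ e.source → e x ∉ N} = (e.source ∩ e ⁻¹' N)ᶜ := by
    ext x; simp
  rw [ae_riemannianVolume_iff_chartVolume (by rw [hset]; exact hms.compl)]
  intro q
  rw [ae_chartVolume_iff q (by rw [hset]; exact hms.compl)]
  set e' := chartAt (EuclideanSpace ℝ (Fin n)) q with he'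
  rw [ae_restrict_iff' e'.open_target.measurableSet, ae_iff]
  -- Seen in the chart `e'`, the set lies in the image of `N` under the transition map, which is
  -- differentiable and so preserves null sets.
  refine measure_mono_null (t := (e.symm ≫ₕ e') '' (N ∩ (e.symm ≫ₕ e').source)) ?_ ?_
  · intro y hy
    simp only [mem_ofPred_eq, Classical.not_imp, not_not] at hy
    obtain ⟨hy1, hy2, hy3⟩ := hy
    refine ⟨e (e'.symm y), ⟨hy3, ?_⟩, ?_⟩
    · simp [hy2, hy1]
    · simp [hy2, hy1]
  · refine addHaar_image_eq_zero_of_differentiableOn_of_addHaar_eq_zero _ ?_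
      (measure_mono_null inter_subset_left hN0)
    have h1 : e.symm ≫ₕ e' ∈ contDiffGroupoid ∞ (𝓡 n) :=
      HasGroupoid.compatible (chart_mem_atlas _ p) (chart_mem_atlas _ q)
    have h2 := ((mem_groupoid_of_pregroupoid).1 h1).1
    simp only [contDiffPregroupoid] at h2
    have h3 : ContDiffOn ℝ ∞ (e.symm ≫ₕ e') (e.symm ≫ₕ e').source := by
      simpa [ContDiffOn, modelWithCornersSelf_coe] using h2
    exact (h3.differentiableOn (by simp)).mono inter_subset_right

lemma ae_of_ae_chart (p : M) {P : M → Prop}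
    (h : ∀ᵐ y ∂(volume.restrict (chartAt (EuclideanSpace ℝ (Fin n)) p).target),
        P ((chartAt (EuclideanSpace ℝ (Fin n)) p).symm y)) :
    ∀ᵐ x ∂(riemannianVolume n M), x ∈ (chartAt (EuclideanSpace ℝ (Fin n)) p).source → P x := by
  rw [ae_restrict_iff' (chartAt (EuclideanSpace ℝ (Fin n)) p).open_target.measurableSet] at h
  obtain ⟨N, hN1, hN2, hN3⟩ := exists_measurable_superset_of_null (ae_iff.1 h)
  filter_upwards [riemannianVolume_chart_null p hN2 hN3] with x hx hxs
  by_contra hP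
  refine hx hxs (hN1 ?_)
  simp [hxs, hP]

/-- By second countability, countably many chart domains cover `M`. -/
lemma ae_of_forall_ae_source [SecondCountableTopology M] {μ : Measure M} {P : M → Prop}
    (h : ∀ p : M, ∀ᵐ x ∂μ, x ∈ (chartAt (EuclideanSpace ℝ (Fin n)) p).source → P x) :
    ∀ᵐ x ∂μ, P x := by
  obtain ⟨s, hs, hs'⟩ := TopologicalSpace.countable_cover_nhds
    (fun p : M => chart_source_mem_nhds (EuclideanSpace ℝ (Fin n)) p)
  have := (ae_ball_iff hs).2 (fun p _ => h p)
  filter_upwards [this] with x hx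
  have hxu : x ∈ ⋃ p ∈ s, (chartAt (EuclideanSpace ℝ (Fin n)) p).source := by rw [hs']; trivial
  simp only [mem_iUnion] at hxu
  obtain ⟨p, hp, hxp⟩ := hxu
  exact hx p hp hxp

lemma ae_riemannianVolume_iff [SecondCountableTopology M] {P : M → Prop} :
    (∀ᵐ x ∂(riemannianVolume n M), P x) ↔ ∀ p : M,
      ∀ᵐ y ∂(volume.restrict (chartAt (EuclideanSpace ℝ (Fin n)) p).target),
        P ((chartAt (EuclideanSpace ℝ (Fin n)) p).symm y) :=
  ⟨fun h p => ae_chart_of_ae p h, fun h => ae_of_forall_ae_source fun p => ae_of_ae_chart p (h p)⟩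

/-- Over a compact subset of a chart, Lebesgue integrals are controlled by the Riemannian volume. -/
lemma exists_lintegral_chart_le (p : M) {K : Set (EuclideanSpace ℝ (Fin n))} (hK : IsCompact K)
    (hKt : K ⊆ (chartAt (EuclideanSpace ℝ (Fin n)) p).target) :
    ∃ C : ℝ≥0, ∀ h : M → ℝ≥0∞, AEMeasurable h (riemannianVolume n M) →
      ∫⁻ y in K, h ((chartAt (EuclideanSpace ℝ (Fin n)) p).symm y)
        ≤ C * ∫⁻ x, h x ∂(riemannianVolume n M) := by
  set e := chartAt (EuclideanSpace ℝ (Fin n)) p with he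
  set d : EuclideanSpace ℝ (Fin n) → ℝ := fun y => Real.sqrt (metricCoeff n p y).det with hd
  -- The density is continuous and positive, so it has a positive minimum on `K`, whose reciprocal
  -- is the constant.
  obtain ⟨δ, hδ, hδ'⟩ : ∃ δ : ℝ, 0 < δ ∧ ∀ y ∈ K, δ ≤ d y := by
    rcases K.eq_empty_or_nonempty with rfl | hne
    · exact ⟨1, one_pos, by simp⟩
    · obtain ⟨y, hy, hy'⟩ := hK.exists_isMinOn hne ((continuousOn_volumeDensity p).mono hKt)
      exact ⟨d y, volumeDensity_pos p (hKt hy), fun z hz => hy' hz⟩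
  refine ⟨(Real.toNNReal δ)⁻¹, fun h hh => ?_⟩
  have hac : (volume.restrict e.target).withDensity (fun y => ENNReal.ofReal (d y)) ≪
    volume.restrict e.target := withDensity_absolutelyContinuous _ _
  have hcomp : AEMeasurable (fun y => h (e.symm y)) ((volume.restrict e.target).withDensity
      (fun y => ENNReal.ofReal (d y))) :=
    (hh.mono_measure (chartVolume_le p)).comp_aemeasurable (aemeasurable_chartAt_symm p hac)
  have hcomp' : AEMeasurable (fun y => h (e.symm y)) (volume.restrict e.target) :=
    hcomp.mono_ac (withDensity_absolutelyContinuous' (aemeasurable_volumeDensity p) (by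
      filter_upwards [ae_restrict_mem e.open_target.measurableSet] with y hy
      exact (ENNReal.ofReal_pos.2 (volumeDensity_pos p hy)).ne'))
  calc ∫⁻ y in K, h (e.symm y)
      ≤ ∫⁻ y in K, ((Real.toNNReal δ)⁻¹ : ℝ≥0) * (ENNReal.ofReal (d y) * h (e.symm y)) := by
        refine setLIntegral_mono' hK.measurableSet fun y hy => ?_
        rw [← mul_assoc]
        refine le_mul_of_one_le_left' ?_
        have h1 : Real.toNNReal δ ≠ 0 := by simpa using hδ
        rw [ENNReal.ofReal, ← ENNReal.coe_mul, ENNReal.one_le_coe_iff]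
        rw [inv_mul_eq_div, one_le_div₀ (by positivity)]
        exact Real.toNNReal_le_toNNReal (hδ' y hy)
    _ ≤ ∫⁻ y in e.target, ((Real.toNNReal δ)⁻¹ : ℝ≥0) * (ENNReal.ofReal (d y) * h (e.symm y)) :=
        lintegral_mono_set hKt
    _ = ((Real.toNNReal δ)⁻¹ : ℝ≥0) * ∫⁻ y in e.target, (ENNReal.ofReal (d y) * h (e.symm y)) :=
        lintegral_const_mul'' _ ((aemeasurable_volumeDensity p).mul hcomp')
    _ = ((Real.toNNReal δ)⁻¹ : ℝ≥0) * ∫⁻ x, h x ∂(chartVolume n p) := by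
        rw [chartVolume, lintegral_map' (hh.mono_measure (chartVolume_le p))
          (aemeasurable_chartAt_symm p hac),
          lintegral_withDensity_eq_lintegral_mul₀ (aemeasurable_volumeDensity p) hcomp']
        rfl
    _ ≤ _ := by
        gcongr
        exact chartVolume_le p

end Charts

/-! ### Integrals against compactly supported functions -/

section LocalIntegrals

variable {E : Type*} [NormedAddCommGroup E] [NormedSpace ℝ E] [FiniteDimensional ℝ E]
  [MeasurableSpace E] [BorelSpace E] {ν : Measure E}

lemma integrable_mul_of_tsupport_subset {U : Set E} {f ψ : E → ℝ}
    (hf : LocallyIntegrableOn f U ν) (hψ : ContinuousOn ψ U) (hc : HasCompactSupport ψ)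
    (hs : tsupport ψ ⊆ U) : Integrable (fun y => f y * ψ y) ν := by
  have h1 : IntegrableOn (fun y => f y * ψ y) (tsupport ψ) ν :=
    (hf.integrableOn_compact_subset hs hc.isCompact).mul_continuousOn (hψ.mono hs) hc.isCompact
  refine (integrableOn_iff_integrable_of_support_subset ?_).1 h1
  exact (Function.support_mul_subset_right _ _).trans (subset_tsupport _)

lemma tendsto_integral_mul_of_tsupport_subset {K : Set E}
    {f : ℕ → E → ℝ} {g ψ : E → ℝ} {C : ℝ}
    (hf : ∀ k, IntegrableOn (f k) K ν) (hg : IntegrableOn g K ν)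
    (hfg : Tendsto (fun k => ∫⁻ y in K, ‖f k y - g y‖ₑ ∂ν) atTop (𝓝 0))
    (hψm : AEStronglyMeasurable ψ ν)
    (hψ : ∀ y, ‖ψ y‖ ≤ C) (hs : Function.support ψ ⊆ K) :
    Tendsto (fun k => ∫ y, f k y * ψ y ∂ν) atTop (𝓝 (∫ y, g y * ψ y ∂ν)) := by
  have h0 : ∀ h : E → ℝ, ∫ y, h y * ψ y ∂ν = ∫ y in K, h y * ψ y ∂ν := fun h =>
    (setIntegral_eq_integral_of_forall_compl_eq_zero fun y hy => by
      have : ψ y = 0 := by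
        by_contra hne
        exact hy (hs hne)
      simp [this]).symm
  simp_rw [h0]
  have hC : 0 ≤ C := (norm_nonneg _).trans (hψ 0)
  refine tendsto_integral_of_L1 _
    (hg.mul_bdd (c := C) hψm.restrict (ae_of_all _ hψ)).aestronglyMeasurable ?_ ?_
  · exact Eventually.of_forall fun k => (hf k).mul_bdd (c := C) hψm.restrict (ae_of_all _ hψ)
  · have h1 : Tendsto (fun k => ENNReal.ofReal C * ∫⁻ y in K, ‖f k y - g y‖ₑ ∂ν) atTop (𝓝 0) := by
      simpa using ENNReal.Tendsto.const_mul hfg (Or.inr ENNReal.ofReal_ne_top)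
    refine tendsto_of_tendsto_of_tendsto_of_le_of_le tendsto_const_nhds h1 (fun _ => zero_le)
      fun k => ?_
    simp only
    rw [← lintegral_const_mul' _ _ ENNReal.ofReal_ne_top]
    refine lintegral_mono fun y => ?_
    rw [← sub_mul, enorm_mul, mul_comm]
    gcongr
    rw [← ofReal_norm]
    exact ENNReal.ofReal_le_ofReal (hψ y)

end LocalIntegrals

/-! ### Weak gradients: linearity, uniqueness, measurability -/

section WeakGradient

variable {n : ℕ} {M : Type*} [TopologicalSpace M] [ChartedSpace (EuclideanSpace ℝ (Fin n)) M]
  [IsManifold (𝓡 n) ∞ M] [RiemannianBundle (fun x : M => TangentSpace (𝓡 n) x)]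
  [IsContMDiffRiemannianBundle (𝓡 n) ∞ (EuclideanSpace ℝ (Fin n))
      (fun x : M => TangentSpace (𝓡 n) x)]
  [MeasurableSpace M] [BorelSpace M] [SecondCountableTopology M] [T2Space M]

lemma continuous_partialDeriv (i : Fin n) {φ : EuclideanSpace ℝ (Fin n) → ℝ}
    (hφ : ContDiff ℝ ∞ φ) : Continuous (partialDeriv n i φ) :=
  (hφ.continuous_fderiv (by simp)).clm_apply continuous_const

lemma tsupport_partialDeriv_subset (i : Fin n) (φ : EuclideanSpace ℝ (Fin n) → ℝ) :
    tsupport (partialDeriv n i φ) ⊆ tsupport φ := by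
  refine (closure_mono ?_).trans (tsupport_fderiv_subset ℝ (f := φ))
  intro y hy
  simp only [Function.mem_support, partialDeriv] at hy ⊢
  intro h
  simp [h] at hy

lemma hasCompactSupport_partialDeriv (i : Fin n) {φ : EuclideanSpace ℝ (Fin n) → ℝ}
    (hφ : HasCompactSupport φ) : HasCompactSupport (partialDeriv n i φ) :=
  hφ.isCompact.of_isClosed_subset (isClosed_tsupport _) (tsupport_partialDeriv_subset i φ)

variable {f f' : M → ℝ} {X X' Y : ∀ x : M, TangentSpace (𝓡 n) x}

lemma HasWeakGradient.congr_ae (h : HasWeakGradient n f X)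
    (hf : f =ᵐ[riemannianVolume n M] f') (hX : ∀ᵐ x ∂(riemannianVolume n M), X x = X' x) :
    HasWeakGradient n f' X' := by
  intro p
  set e := chartAt (EuclideanSpace ℝ (Fin n)) p with he
  obtain ⟨h1, h2⟩ := h p
  have hf' := ae_chart_of_ae p hf
  have hX' := ae_chart_of_ae p hX
  have hmt := e.open_target.measurableSet
  have hlc : IsLocallyClosed e.target := e.open_target.isLocallyClosed
  have key : ∀ (a b : EuclideanSpace ℝ (Fin n) → ℝ), (∀ᵐ y ∂(volume.restrict e.target), a y = b y) →
      LocallyIntegrableOn a e.target → LocallyIntegrableOn b e.target := by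
    intro a b hab ha
    rw [locallyIntegrableOn_iff hlc] at ha ⊢
    exact fun k hk hkc => (ha k hk hkc).congr_fun_ae (ae_restrict_of_ae_restrict_of_subset hk hab)
  refine ⟨key _ _ hf' h1, fun i => ⟨key _ _ ?_ (h2 i).1, fun φ hφ hφc hφs => ?_⟩⟩
  · filter_upwards [hX'] with y hy
    rw [hy]
  · have h3 := (h2 i).2 φ hφ hφc hφs
    have key2 : ∀ (a b ψ : EuclideanSpace ℝ (Fin n) → ℝ),
        (∀ᵐ y ∂(volume.restrict e.target), a y = b y) → tsupport ψ ⊆ e.target →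
        ∫ y, a y * ψ y = ∫ y, b y * ψ y := by
      intro a b ψ hab hψ
      refine integral_congr_ae ?_
      rw [ae_restrict_iff' hmt] at hab
      filter_upwards [hab] with y hy
      by_cases hyt : y ∈ e.target
      · rw [hy hyt]
      · have : ψ y = 0 := image_eq_zero_of_notMem_tsupport fun h => hyt (hψ h)
        simp [this]
    rw [← key2 _ _ _ hf' ((tsupport_partialDeriv_subset i φ).trans hφs), h3]
    congr 1
    refine key2 _ _ _ ?_ hφs
    filter_upwards [hX'] with y hy
    rw [hy]

lemma HasWeakGradient.add (h : HasWeakGradient n f X) (h' : HasWeakGradient n f' X') :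
    HasWeakGradient n (f + f') (X + X') := by
  intro p
  set e := chartAt (EuclideanSpace ℝ (Fin n)) p with he
  obtain ⟨h1, h2⟩ := h p
  obtain ⟨h1', h2'⟩ := h' p
  refine ⟨h1.add h1', fun i => ⟨?_, fun φ hφ hφc hφs => ?_⟩⟩
  · refine ((h2 i).1.add (h2' i).1).congr (ae_of_all _ fun y => ?_)
    exact (inner_add_left _ _ _).symm
  · have hd := (continuous_partialDeriv i hφ).continuousOn (s := e.target)
    have hdc := hasCompactSupport_partialDeriv i hφc
    have hds := (tsupport_partialDeriv_subset i φ).trans hφs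
    have hφ0 := hφ.continuous.continuousOn (s := e.target)
    simp only [Pi.add_apply, add_mul, inner_add_left]
    rw [integral_add (integrable_mul_of_tsupport_subset h1 hd hdc hds)
      (integrable_mul_of_tsupport_subset h1' hd hdc hds),
      integral_add (integrable_mul_of_tsupport_subset (h2 i).1 hφ0 hφc hφs)
      (integrable_mul_of_tsupport_subset (h2' i).1 hφ0 hφc hφs),
      (h2 i).2 φ hφ hφc hφs, (h2' i).2 φ hφ hφc hφs]
    ring

lemma HasWeakGradient.const_smul (c : ℝ) (h : HasWeakGradient n f X) :
    HasWeakGradient n (c • f) (c • X) := by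
  intro p
  obtain ⟨h1, h2⟩ := h p
  refine ⟨h1.smul c, fun i => ⟨?_, fun φ hφ hφc hφs => ?_⟩⟩
  · refine ((h2 i).1.smul c).congr (ae_of_all _ fun y => ?_)
    simp [inner_smul_left]
  · simp only [Pi.smul_apply, smul_eq_mul, mul_assoc, real_inner_smul_left, integral_const_mul]
    rw [(h2 i).2 φ hφ hφc hφs, mul_neg]

lemma HasWeakGradient.sub (h : HasWeakGradient n f X) (h' : HasWeakGradient n f' X') :
    HasWeakGradient n (f - f') (X - X') := by
  have := h.add (h'.const_smul (-1))
  simpa [sub_eq_add_neg] using this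

lemma eq_zero_of_inner_coordField_eq_zero (p : M) {y : EuclideanSpace ℝ (Fin n)}
    (hy : y ∈ (chartAt (EuclideanSpace ℝ (Fin n)) p).target)
    {v : TangentSpace (𝓡 n) ((chartAt (EuclideanSpace ℝ (Fin n)) p).symm y)}
    (h : ∀ i, inner ℝ v (coordField n p i y) = 0) : v = 0 := by
  obtain ⟨c, hc⟩ := span_coordField p hy v
  have : inner ℝ v v = 0 := by
    conv_lhs => rw [hc]
    rw [← hc, hc, inner_sum]
    simp only [real_inner_smul_right, ← hc, h, mul_zero, Finset.sum_const_zero]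
  exact inner_self_eq_zero.1 this

/-- Weak gradients are unique almost everywhere. -/
lemma HasWeakGradient.ae_unique (h : HasWeakGradient n f X) (h' : HasWeakGradient n f X') :
    ∀ᵐ x ∂(riemannianVolume n M), X x = X' x := by
  -- `X - X'` is a weak gradient of `f - f = 0`, so its components in each chart are orthogonal to
  -- all test functions.
  have h0 := h.sub h'
  rw [ae_riemannianVolume_iff]
  intro p
  set e := chartAt (EuclideanSpace ℝ (Fin n)) p with he
  have h1 : ∀ i, ∀ᵐ y ∂volume, y ∈ e.target →
      inner ℝ ((X - X') (e.symm y)) (coordField n p i y) = 0 := fun i => by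
    obtain ⟨h1, h2⟩ := (h0 p).2 i
    refine IsOpen.ae_eq_zero_of_integral_contDiff_smul_eq_zero e.open_target h1
      fun g hg hgc hgs => ?_
    have := h2 g hg hgc hgs
    simp only [Pi.sub_apply, sub_self, zero_mul, integral_zero, zero_eq_neg] at this
    simpa [mul_comm] using this
  rw [ae_restrict_iff' e.open_target.measurableSet]
  filter_upwards [ae_all_iff.2 h1] with y hy hyt
  exact sub_eq_zero.1 (eq_zero_of_inner_coordField_eq_zero p hyt fun i => hy i hyt)

variable (n) in
/-- Vector fields whose covariant components are measurable in every chart. -/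
def MeasurableField (X : ∀ x : M, TangentSpace (𝓡 n) x) : Prop :=
  ∀ p : M, ∀ i : Fin n, AEStronglyMeasurable
    (fun y => inner ℝ (X ((chartAt (EuclideanSpace ℝ (Fin n)) p).symm y)) (coordField n p i y))
    (volume.restrict (chartAt (EuclideanSpace ℝ (Fin n)) p).target)

lemma HasWeakGradient.measurableField (h : HasWeakGradient n f X) : MeasurableField n X :=
  fun p i => ((h p).2 i).1.aestronglyMeasurable

lemma MeasurableField.add (h : MeasurableField n X) (h' : MeasurableField n Y) :
    MeasurableField n (X + Y) := fun p i => by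
  simp only [Pi.add_apply, inner_add_left]
  exact (h p i).add (h' p i)

lemma MeasurableField.sub (h : MeasurableField n X) (h' : MeasurableField n Y) :
    MeasurableField n (X - Y) := fun p i => by
  simp only [Pi.sub_apply, inner_sub_left]
  exact (h p i).sub (h' p i)

lemma aestronglyMeasurable_chart (p : M) (hf : AEStronglyMeasurable f (riemannianVolume n M)) :
    AEStronglyMeasurable (fun y => f ((chartAt (EuclideanSpace ℝ (Fin n)) p).symm y))
      (volume.restrict (chartAt (EuclideanSpace ℝ (Fin n)) p).target) := by
  obtain ⟨g, hg, hfg⟩ := hf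
  exact (hg.aestronglyMeasurable.comp_aemeasurable
    (aemeasurable_chartAt_symm p (Measure.AbsolutelyContinuous.refl _))).congr
    (EventuallyEq.symm (ae_chart_of_ae p hfg))

lemma aestronglyMeasurable_of_chart
    (h : ∀ p : M, AEStronglyMeasurable
      (fun y => f ((chartAt (EuclideanSpace ℝ (Fin n)) p).symm y))
      (volume.restrict (chartAt (EuclideanSpace ℝ (Fin n)) p).target)) :
    AEStronglyMeasurable f (riemannianVolume n M) := by
  obtain ⟨s, hs, hs'⟩ := TopologicalSpace.countable_cover_nhds
    (fun p : M => chart_source_mem_nhds (EuclideanSpace ℝ (Fin n)) p)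
  have h1 : ∀ p : M, AEStronglyMeasurable f ((riemannianVolume n M).restrict
      (chartAt (EuclideanSpace ℝ (Fin n)) p).source) := fun p => by
    set e := chartAt (EuclideanSpace ℝ (Fin n)) p with he
    obtain ⟨g, hg, hfg⟩ := h p
    have hem : AEMeasurable e ((riemannianVolume n M).restrict e.source) :=
      e.continuousOn_toFun.aemeasurable e.open_source.measurableSet
    refine (hg.aestronglyMeasurable.comp_aemeasurable hem
      (μ := (riemannianVolume n M).restrict e.source)).congr ?_
    rw [EventuallyEq, ae_restrict_iff' e.open_source.measurableSet]
    have h2 : ∀ᵐ y ∂(volume.restrict e.target), f (e.symm y) = g (e (e.symm y)) := by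
      filter_upwards [hfg, ae_restrict_mem e.open_target.measurableSet] with y hy hyt
      rw [hy, e.right_inv hyt]
    filter_upwards [ae_of_ae_chart (P := fun x => f x = g (e x)) p h2] with x hx hxs
    exact (hx hxs).symm
  have h2 : AEStronglyMeasurable f ((riemannianVolume n M).restrict
      (⋃ p ∈ s, (chartAt (EuclideanSpace ℝ (Fin n)) p).source)) := by
    have := hs.to_subtype
    rw [biUnion_eq_iUnion]
    exact (aestronglyMeasurable_iUnion_iff).2 fun p => h1 p
  rwa [hs', Measure.restrict_univ] at h2

lemma continuousOn_metricCoeff_inv (p : M) (i j : Fin n) :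
    ContinuousOn (fun y => (metricCoeff n p y)⁻¹ i j)
      (chartAt (EuclideanSpace ℝ (Fin n)) p).target := by
  have h1 := continuousOn_metricCoeff_matrix (n := n) p
  have h2 : ContinuousOn (fun y => (metricCoeff n p y)⁻¹)
      (chartAt (EuclideanSpace ℝ (Fin n)) p).target := by
    simp only [Matrix.inv_def, Ring.inverse_eq_inv']
    refine ContinuousOn.smul (M := ℝ) ?_ (continuous_id.matrix_adjugate.comp_continuousOn h1)
    exact ((continuous_id.matrix_det).comp_continuousOn h1).inv₀
      fun y hy => (metricCoeff_posDef p hy).det_pos.ne'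
  exact continuousOn_pi.1 ((continuousOn_pi.1 h2) i) j

/-- A measurable field is known only through its covariant components. Raising an index with the
inverse metric, which is continuous on the chart target, expresses the pairing by these components
and thereby makes it measurable. -/
lemma inner_eq_sum_metricCoeff_inv (X Y : ∀ x : M, TangentSpace (𝓡 n) x) (p : M)
    {y : EuclideanSpace ℝ (Fin n)} (hy : y ∈ (chartAt (EuclideanSpace ℝ (Fin n)) p).target) :
    inner ℝ (X ((chartAt (EuclideanSpace ℝ (Fin n)) p).symm y))
      (Y ((chartAt (EuclideanSpace ℝ (Fin n)) p).symm y)) =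
    ∑ i, ∑ j, (metricCoeff n p y)⁻¹ i j *
      inner ℝ (X ((chartAt (EuclideanSpace ℝ (Fin n)) p).symm y)) (coordField n p j y) *
      inner ℝ (Y ((chartAt (EuclideanSpace ℝ (Fin n)) p).symm y)) (coordField n p i y) := by
  set e := chartAt (EuclideanSpace ℝ (Fin n)) p with he
  obtain ⟨c, hc⟩ := span_coordField p hy (X (e.symm y))
  have h1 : (fun j => inner ℝ (X (e.symm y)) (coordField n p j y)) =
      (metricCoeff n p y).mulVec c := by
    funext j
    rw [hc, sum_inner]
    simp only [Matrix.mulVec, dotProduct, real_inner_smul_left, metricCoeff, Matrix.of_apply]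
    refine Finset.sum_congr rfl fun i _ => ?_
    rw [mul_comm, real_inner_comm]
  have h2 : (metricCoeff n p y)⁻¹.mulVec
      (fun j => inner ℝ (X (e.symm y)) (coordField n p j y)) = c := by
    rw [h1, Matrix.mulVec_mulVec, Matrix.nonsing_inv_mul _
      (metricCoeff_posDef p hy).det_pos.ne'.isUnit, Matrix.one_mulVec]
  symm
  calc _ = ∑ i, (∑ j, (metricCoeff n p y)⁻¹ i j *
      inner ℝ (X (e.symm y)) (coordField n p j y)) * inner ℝ (Y (e.symm y)) (coordField n p i y) := by
        simp only [Finset.sum_mul]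
    _ = ∑ i, c i * inner ℝ (Y (e.symm y)) (coordField n p i y) := by
        refine Finset.sum_congr rfl fun i _ => ?_
        congr 1
        exact congrFun h2 i
    _ = _ := by
        conv_rhs => rw [hc]
        rw [sum_inner]
        refine Finset.sum_congr rfl fun i _ => ?_
        rw [real_inner_smul_left, real_inner_comm]

lemma MeasurableField.aestronglyMeasurable_inner (h : MeasurableField n X)
    (h' : MeasurableField n Y) :
    AEStronglyMeasurable (fun x => inner ℝ (X x) (Y x)) (riemannianVolume n M) := by
  refine aestronglyMeasurable_of_chart fun p => ?_
  set e := chartAt (EuclideanSpace ℝ (Fin n)) p with he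
  have hG : ∀ i j, AEStronglyMeasurable (fun y => (metricCoeff n p y)⁻¹ i j)
      (volume.restrict e.target) := fun i j =>
    (continuousOn_metricCoeff_inv p i j).aestronglyMeasurable e.open_target.measurableSet
  have hsum : AEStronglyMeasurable (fun y => ∑ i, ∑ j, (metricCoeff n p y)⁻¹ i j *
      inner ℝ (X (e.symm y)) (coordField n p j y) * inner ℝ (Y (e.symm y)) (coordField n p i y))
      (volume.restrict e.target) :=
    Finset.aestronglyMeasurable_fun_sum _ fun i _ => Finset.aestronglyMeasurable_fun_sum _ fun j _ =>
      ((hG i j).mul (h p j)).mul (h' p i)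
  refine hsum.congr ?_
  filter_upwards [ae_restrict_mem e.open_target.measurableSet] with y hy
  exact (inner_eq_sum_metricCoeff_inv X Y p hy).symm

lemma MeasurableField.aestronglyMeasurable_norm (h : MeasurableField n X) :
    AEStronglyMeasurable (fun x => ‖X x‖) (riemannianVolume n M) := by
  simp only [norm_eq_sqrt_real_inner]
  exact Real.continuous_sqrt.comp_aestronglyMeasurable (h.aestronglyMeasurable_inner h)

lemma MeasurableField.smul (hf : AEStronglyMeasurable f (riemannianVolume n M))
    (h : MeasurableField n X) : MeasurableField n (fun x => f x • X x) := fun p i => by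
  simp only [real_inner_smul_left]
  exact (aestronglyMeasurable_chart p hf).mul (h p i)

end WeakGradient

/-! ### Gradients of `C¹` functions and closedness of the weak gradient -/

section SmoothGradient

variable {n : ℕ} {M : Type*} [TopologicalSpace M] [ChartedSpace (EuclideanSpace ℝ (Fin n)) M]
  [IsManifold (𝓡 n) ∞ M] [RiemannianBundle (fun x : M => TangentSpace (𝓡 n) x)]
  [IsContMDiffRiemannianBundle (𝓡 n) ∞ (EuclideanSpace ℝ (Fin n))
      (fun x : M => TangentSpace (𝓡 n) x)]
  [MeasurableSpace M] [BorelSpace M] [SecondCountableTopology M] [T2Space M]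

lemma exists_inner_eq_mfderiv (f : M → ℝ) (x : M) :
    ∃ v : TangentSpace (𝓡 n) x, ∀ w : TangentSpace (𝓡 n) x,
      inner ℝ v w = mfderiv (𝓡 n) 𝓘(ℝ, ℝ) f x w := by
  have : FiniteDimensional ℝ (TangentSpace (𝓡 n) x) :=
    inferInstanceAs (FiniteDimensional ℝ (EuclideanSpace ℝ (Fin n)))
  have : CompleteSpace (TangentSpace (𝓡 n) x) := FiniteDimensional.complete ℝ _
  let l : TangentSpace (𝓡 n) x →L[ℝ] ℝ := mfderiv (𝓡 n) 𝓘(ℝ, ℝ) f x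
  exact ⟨(InnerProductSpace.toDual ℝ (TangentSpace (𝓡 n) x)).symm l, fun w => by
    exact InnerProductSpace.toDual_symm_apply⟩

variable (n) in
/-- The Riemannian gradient of a differentiable function. -/
def smoothGrad (f : M → ℝ) (x : M) : TangentSpace (𝓡 n) x := (exists_inner_eq_mfderiv f x).choose

lemma inner_smoothGrad (f : M → ℝ) (x : M) (w : TangentSpace (𝓡 n) x) :
    inner ℝ (smoothGrad n f x) w = mfderiv (𝓡 n) 𝓘(ℝ, ℝ) f x w :=
  (exists_inner_eq_mfderiv f x).choose_spec w

lemma gradPairing_eq_inner (f φ : M → ℝ) (x : M) :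
    gradPairing n f φ x = inner ℝ (weakGrad n f x) (smoothGrad n φ x) := by
  rw [real_inner_comm, inner_smoothGrad]
  rfl

lemma smoothGrad_ext {x : M} {v w : TangentSpace (𝓡 n) x}
    (h : ∀ z, inner ℝ v z = inner ℝ w z) : v = w :=
  ext_inner_right ℝ h

lemma smoothGrad_comp {f : M → ℝ} (hf : ContMDiff (𝓡 n) 𝓘(ℝ, ℝ) 1 f) {G : ℝ → ℝ} {G' : ℝ} {x : M}
    (hG : HasDerivAt G G' (f x)) : smoothGrad n (fun z => G (f z)) x = G' • smoothGrad n f x := by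
  refine smoothGrad_ext fun z => ?_
  rw [real_inner_smul_left, inner_smoothGrad, inner_smoothGrad]
  have h1 : HasMFDerivAt (𝓡 n) 𝓘(ℝ, ℝ) f x (mfderiv (𝓡 n) 𝓘(ℝ, ℝ) f x) :=
    ((hf x).mdifferentiableAt (by simp)).hasMFDerivAt
  have h2 := HasMFDerivAt.comp x (hG.hasFDerivAt.hasMFDerivAt) h1
  have h3 : mfderiv (𝓡 n) 𝓘(ℝ, ℝ) (fun z => G (f z)) x = _ := h2.mfderiv
  rw [h3]
  exact (mul_comm _ _)

lemma smoothGrad_mul {f g : M → ℝ} (hf : ContMDiff (𝓡 n) 𝓘(ℝ, ℝ) 1 f)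
    (hg : ContMDiff (𝓡 n) 𝓘(ℝ, ℝ) 1 g) (x : M) :
    smoothGrad n (fun z => f z * g z) x = f x • smoothGrad n g x + g x • smoothGrad n f x := by
  refine smoothGrad_ext fun z => ?_
  rw [inner_add_left, real_inner_smul_left, real_inner_smul_left, inner_smoothGrad,
    inner_smoothGrad, inner_smoothGrad]
  have h1 : HasMFDerivAt (𝓡 n) 𝓘(ℝ, ℝ) f x (mfderiv (𝓡 n) 𝓘(ℝ, ℝ) f x) :=
    ((hf x).mdifferentiableAt (by simp)).hasMFDerivAt
  have h2 : HasMFDerivAt (𝓡 n) 𝓘(ℝ, ℝ) g x (mfderiv (𝓡 n) 𝓘(ℝ, ℝ) g x) :=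
    ((hg x).mdifferentiableAt (by simp)).hasMFDerivAt
  have h3 : mfderiv (𝓡 n) 𝓘(ℝ, ℝ) (fun z => f z * g z) x = _ := (h1.mul h2).mfderiv
  rw [h3]
  rfl

lemma mfderiv_coordField {f : M → ℝ} (hf : ContMDiff (𝓡 n) 𝓘(ℝ, ℝ) 1 f) (p : M) (i : Fin n)
    {y : EuclideanSpace ℝ (Fin n)} (hy : y ∈ (chartAt (EuclideanSpace ℝ (Fin n)) p).target) :
    mfderiv (𝓡 n) 𝓘(ℝ, ℝ) f ((chartAt (EuclideanSpace ℝ (Fin n)) p).symm y) (coordField n p i y) =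
      partialDeriv n i (fun z => f ((chartAt (EuclideanSpace ℝ (Fin n)) p).symm z)) y := by
  have h2 : mfderiv (𝓡 n) 𝓘(ℝ, ℝ)
      (fun z => f ((chartAt (EuclideanSpace ℝ (Fin n)) p).symm z)) y =
      (mfderiv (𝓡 n) 𝓘(ℝ, ℝ) f ((chartAt (EuclideanSpace ℝ (Fin n)) p).symm y)).comp
        (mfderiv (𝓡 n) (𝓡 n) (chartAt (EuclideanSpace ℝ (Fin n)) p).symm y) :=
    mfderiv_comp y ((hf _).mdifferentiableAt (by simp))
      ((mdifferentiable_chartAt p).mdifferentiableAt_symm hy)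
  rw [partialDeriv, ← mfderiv_eq_fderiv, h2]
  rfl

lemma contDiffOn_chart {f : M → ℝ} (hf : ContMDiff (𝓡 n) 𝓘(ℝ, ℝ) 1 f) (p : M) :
    ContDiffOn ℝ 1 (fun z => f ((chartAt (EuclideanSpace ℝ (Fin n)) p).symm z))
      (chartAt (EuclideanSpace ℝ (Fin n)) p).target :=
  contMDiffOn_iff_contDiffOn.1
    (hf.comp_contMDiffOn (contMDiffOn_chart_symm (I := 𝓡 n) (n := 1) (x := p)))

/-- In a chart the components of the gradient are the partial derivatives, so this is integration by
parts against a function supported in the chart target. -/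
lemma hasWeakGradient_smoothGrad {f : M → ℝ} (hf : ContMDiff (𝓡 n) 𝓘(ℝ, ℝ) 1 f) :
    HasWeakGradient n f (smoothGrad n f) := by
  intro p
  set e := chartAt (EuclideanSpace ℝ (Fin n)) p with he
  have hF := contDiffOn_chart hf p
  rw [← he] at hF
  have hmt := e.open_target.measurableSet
  have hd : ∀ i, ContinuousOn (partialDeriv n i (fun z => f (e.symm z))) e.target := fun i =>
    (hF.continuousOn_fderiv_of_isOpen e.open_target le_rfl).clm_apply continuousOn_const
  have heq : ∀ i, ∀ y ∈ e.target, inner ℝ (smoothGrad n f (e.symm y)) (coordField n p i y) =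
      partialDeriv n i (fun z => f (e.symm z)) y := fun i y hy => by
    rw [inner_smoothGrad]; exact mfderiv_coordField hf p i hy
  refine ⟨hF.continuousOn.locallyIntegrableOn hmt, fun i => ⟨?_, fun φ hφ hφc hφs => ?_⟩⟩
  · exact ((hd i).congr (heq i)).locallyIntegrableOn hmt
  · have hφ0 := hφ.continuous.continuousOn (s := e.target)
    have h0 : (fun y => inner ℝ (smoothGrad n f (e.symm y)) (coordField n p i y) * φ y) =
        fun y => partialDeriv n i (fun z => f (e.symm z)) y * φ y := by
      funext y
      by_cases hy : y ∈ e.target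
      · rw [heq i y hy]
      · have : φ y = 0 := image_eq_zero_of_notMem_tsupport fun h => hy (hφs h)
        simp [this]
    rw [h0]
    refine integral_mul_fderiv_eq_neg_fderiv_mul_of_integrable ?_ ?_ ?_ ?_ ?_
    · exact integrable_mul_of_tsupport_subset ((hd i).locallyIntegrableOn hmt) hφ0 hφc hφs
    · exact integrable_mul_of_tsupport_subset (hF.continuousOn.locallyIntegrableOn hmt)
        (continuous_partialDeriv i hφ).continuousOn (hasCompactSupport_partialDeriv i hφc)
        ((tsupport_partialDeriv_subset i φ).trans hφs)
    · exact integrable_mul_of_tsupport_subset (hF.continuousOn.locallyIntegrableOn hmt) hφ0 hφc hφs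
    · exact fun y hy => (hF.differentiableOn (by simp)).differentiableAt
        (e.open_target.mem_nhds (hφs hy))
    · exact fun y _ => hφ.differentiable (by simp) y

lemma continuous_norm_smoothGrad {f : M → ℝ} (hf : ContMDiff (𝓡 n) 𝓘(ℝ, ℝ) 1 f) :
    Continuous (fun x => ‖smoothGrad n f x‖) := by
  simp only [norm_eq_sqrt_real_inner]
  refine Real.continuous_sqrt.comp (continuous_iff_continuousAt.2 fun p => ?_)
  set e := chartAt (EuclideanSpace ℝ (Fin n)) p with he
  have hd : ∀ i, ContinuousOn (fun y => (inner ℝ (smoothGrad n f (e.symm y))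
      (coordField n p i y) : ℝ)) e.target := fun i => by
    refine ContinuousOn.congr (((contDiffOn_chart hf p).continuousOn_fderiv_of_isOpen
      e.open_target le_rfl).clm_apply (continuousOn_const (c := EuclideanSpace.single i (1 : ℝ))))
      fun y hy => ?_
    rw [inner_smoothGrad]; exact mfderiv_coordField hf p i hy
  have h1 : ContinuousOn (fun y => (inner ℝ (smoothGrad n f (e.symm y))
      (smoothGrad n f (e.symm y)) : ℝ)) e.target := by
    refine ContinuousOn.congr ?_ fun y hy => inner_eq_sum_metricCoeff_inv _ _ p hy
    exact continuousOn_finsetSum _ fun i _ => continuousOn_finsetSum _ fun j _ =>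
      ((continuousOn_metricCoeff_inv p i j).mul (hd j)).mul (hd i)
  have h2 : ContinuousOn (fun x => (inner ℝ (smoothGrad n f x) (smoothGrad n f x) : ℝ))
      e.source := by
    refine (h1.comp e.continuousOn_toFun e.mapsTo).congr fun x hx => ?_
    change _ = (fun z => (inner ℝ (smoothGrad n f z) (smoothGrad n f z) : ℝ)) (e.symm (e x))
    rw [e.left_inv hx]
  exact h2.continuousAt (chart_source_mem_nhds _ p)

lemma integrableOn_chart (p : M) {f : M → ℝ} (hf : Integrable f (riemannianVolume n M))
    {K : Set (EuclideanSpace ℝ (Fin n))} (hK : IsCompact K)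
    (hKt : K ⊆ (chartAt (EuclideanSpace ℝ (Fin n)) p).target) :
    IntegrableOn (fun y => f ((chartAt (EuclideanSpace ℝ (Fin n)) p).symm y)) K := by
  obtain ⟨C, hC⟩ := exists_lintegral_chart_le p hK hKt
  refine ⟨(aestronglyMeasurable_chart p hf.1).mono_measure (Measure.restrict_mono hKt le_rfl), ?_⟩
  exact (hC _ hf.1.enorm).trans_lt (ENNReal.mul_lt_top ENNReal.coe_lt_top hf.2)

lemma continuousOn_norm_coordField (p : M) (i : Fin n) :
    ContinuousOn (fun y => ‖coordField n p i y‖)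
      (chartAt (EuclideanSpace ℝ (Fin n)) p).target := by
  simp only [norm_eq_sqrt_real_inner]
  exact Real.continuous_sqrt.comp_continuousOn (continuousOn_metricCoeff p i i)

lemma exists_norm_coordField_le (p : M) (i : Fin n) {K : Set (EuclideanSpace ℝ (Fin n))}
    (hK : IsCompact K) (hKt : K ⊆ (chartAt (EuclideanSpace ℝ (Fin n)) p).target) :
    ∃ C : ℝ≥0, ∀ y ∈ K, ‖coordField n p i y‖ₑ ≤ C := by
  obtain ⟨C, hC⟩ := hK.exists_bound_of_continuousOn ((continuousOn_norm_coordField p i).mono hKt)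
  refine ⟨C.toNNReal, fun y hy => ?_⟩
  rw [← ofReal_norm]
  exact ENNReal.ofReal_le_ofReal (by simpa using hC y hy)

lemma lintegral_inner_coordField_le (p : M) (i : Fin n) {K : Set (EuclideanSpace ℝ (Fin n))}
    (hK : IsCompact K) (hKt : K ⊆ (chartAt (EuclideanSpace ℝ (Fin n)) p).target) :
    ∃ C : ℝ≥0, ∀ X : ∀ x : M, TangentSpace (𝓡 n) x, MeasurableField n X →
      ∫⁻ y in K, ‖(inner ℝ (X ((chartAt (EuclideanSpace ℝ (Fin n)) p).symm y))
        (coordField n p i y) : ℝ)‖ₑ ≤ C * ∫⁻ x, ‖X x‖ₑ ∂(riemannianVolume n M) := by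
  obtain ⟨C, hC⟩ := exists_lintegral_chart_le p hK hKt
  obtain ⟨C', hC'⟩ := exists_norm_coordField_le p i hK hKt
  refine ⟨C' * C, fun X hX => ?_⟩
  have hXm : AEMeasurable (fun x => ‖X x‖ₑ) (riemannianVolume n M) := by
    have := hX.aestronglyMeasurable_norm.enorm
    simpa using this
  calc _ ≤ ∫⁻ y in K, C' * ‖X ((chartAt (EuclideanSpace ℝ (Fin n)) p).symm y)‖ₑ := by
        refine setLIntegral_mono' hK.measurableSet fun y hy => ?_
        refine le_trans ?_ (mul_le_mul_left (hC' y hy) _)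
        rw [← ofReal_norm, ← ofReal_norm, ← ofReal_norm, ← ENNReal.ofReal_mul (norm_nonneg _),
          mul_comm]
        exact ENNReal.ofReal_le_ofReal (norm_inner_le_norm _ _)
    _ = C' * ∫⁻ y in K, ‖X ((chartAt (EuclideanSpace ℝ (Fin n)) p).symm y)‖ₑ :=
        lintegral_const_mul' _ _ ENNReal.coe_ne_top
    _ ≤ C' * (C * ∫⁻ x, ‖X x‖ₑ ∂(riemannianVolume n M)) := by gcongr; exact hC _ hXm
    _ = _ := by push_cast; ring

/-- Weak gradients are closed under `L¹` convergence. -/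
lemma HasWeakGradient.of_tendsto {f : ℕ → M → ℝ} {X : ℕ → ∀ x : M, TangentSpace (𝓡 n) x}
    {g : M → ℝ} {Y : ∀ x : M, TangentSpace (𝓡 n) x} (h : ∀ k, HasWeakGradient n (f k) (X k))
    (hf : ∀ k, Integrable (f k) (riemannianVolume n M))
    (hg : Integrable g (riemannianVolume n M)) (hY : MeasurableField n Y)
    (hYi : ∫⁻ x, ‖Y x‖ₑ ∂(riemannianVolume n M) < ⊤)
    (hfg : Tendsto (fun k => ∫⁻ x, ‖f k x - g x‖ₑ ∂(riemannianVolume n M)) atTop (𝓝 0))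
    (hXY : Tendsto (fun k => ∫⁻ x, ‖X k x - Y x‖ₑ ∂(riemannianVolume n M)) atTop (𝓝 0)) :
    HasWeakGradient n g Y := by
  intro p
  set e := chartAt (EuclideanSpace ℝ (Fin n)) p with he
  have hlc : IsLocallyClosed e.target := e.open_target.isLocallyClosed
  have hYK : ∀ i K, K ⊆ e.target → IsCompact K →
      IntegrableOn (fun y => (inner ℝ (Y (e.symm y)) (coordField n p i y) : ℝ)) K := by
    intro i K hKt hK
    obtain ⟨C, hC⟩ := lintegral_inner_coordField_le p i hK hKt
    exact ⟨(hY p i).mono_measure (Measure.restrict_mono hKt le_rfl),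
      (hC Y hY).trans_lt (ENNReal.mul_lt_top ENNReal.coe_lt_top hYi)⟩
  refine ⟨(locallyIntegrableOn_iff hlc).2 fun K hKt hK => integrableOn_chart p hg hK hKt,
    fun i => ⟨(locallyIntegrableOn_iff hlc).2 (hYK i), fun φ hφ hφc hφs => ?_⟩⟩
  have hK : IsCompact (tsupport φ) := hφc.isCompact
  obtain ⟨C, hC⟩ := exists_lintegral_chart_le p hK hφs
  obtain ⟨C', hC'⟩ := lintegral_inner_coordField_le p i hK hφs
  have hzero : ∀ (C : ℝ≥0) (a : ℕ → ℝ≥0∞), Tendsto a atTop (𝓝 0) →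
      Tendsto (fun k => C * a k) atTop (𝓝 0) := fun C a ha => by
    simpa using ENNReal.Tendsto.const_mul ha (Or.inr (ENNReal.coe_ne_top (r := C)))
  have hbound : ∀ ψ : EuclideanSpace ℝ (Fin n) → ℝ, Continuous ψ → HasCompactSupport ψ →
      ∃ C, ∀ y, ‖ψ y‖ ≤ C := fun ψ h1 h2 => h2.exists_bound_of_continuous h1
  obtain ⟨B, hB⟩ := hbound φ hφ.continuous hφc
  obtain ⟨B', hB'⟩ := hbound _ (continuous_partialDeriv i hφ) (hasCompactSupport_partialDeriv i hφc)
  have lim1 : Tendsto (fun k => ∫ y, f k (e.symm y) * partialDeriv n i φ y) atTop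
      (𝓝 (∫ y, g (e.symm y) * partialDeriv n i φ y)) := by
    refine tendsto_integral_mul_of_tsupport_subset (K := tsupport φ)
      (fun k => integrableOn_chart p (hf k) hK hφs) (integrableOn_chart p hg hK hφs) ?_
      (continuous_partialDeriv i hφ).aestronglyMeasurable hB'
      ((subset_tsupport _).trans (tsupport_partialDeriv_subset i φ))
    exact tendsto_of_tendsto_of_tendsto_of_le_of_le tendsto_const_nhds (hzero C _ hfg)
      (fun _ => zero_le) fun k => hC (fun x => ‖f k x - g x‖ₑ) ((hf k).1.sub hg.1).enorm
  have lim2 : Tendsto (fun k => ∫ y, inner ℝ (X k (e.symm y)) (coordField n p i y) * φ y) atTop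
      (𝓝 (∫ y, inner ℝ (Y (e.symm y)) (coordField n p i y) * φ y)) := by
    refine tendsto_integral_mul_of_tsupport_subset (K := tsupport φ)
      (fun k => ((h k p).2 i).1.integrableOn_compact_subset hφs hK) (hYK i _ hφs hK) ?_
      hφ.continuous.aestronglyMeasurable hB (subset_tsupport _)
    refine tendsto_of_tendsto_of_tendsto_of_le_of_le tendsto_const_nhds (hzero C' _ hXY)
      (fun _ => zero_le) fun k => ?_
    refine le_trans (le_of_eq ?_) (hC' (X k - Y) ((h k).measurableField.sub hY))
    simp only [Pi.sub_apply, inner_sub_left]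
    rfl
  refine tendsto_nhds_unique lim1 ?_
  exact lim2.neg.congr fun k => (((h k p).2 i).2 φ hφ hφc hφs).symm

end SmoothGradient

/-! ### The space `H¹`, density of test functions and the chain rule -/

section SobolevCalculus

variable {n : ℕ} {M : Type*} [TopologicalSpace M] [ChartedSpace (EuclideanSpace ℝ (Fin n)) M]
  [IsManifold (𝓡 n) ∞ M] [RiemannianBundle (fun x : M => TangentSpace (𝓡 n) x)]
  [IsContMDiffRiemannianBundle (𝓡 n) ∞ (EuclideanSpace ℝ (Fin n))
      (fun x : M => TangentSpace (𝓡 n) x)]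
  [MeasurableSpace M] [BorelSpace M] [SecondCountableTopology M] [T2Space M]

variable (n) in
/-- `f ∈ H¹(M, g₀)` with weak gradient `X`. -/
structure HasH1Gradient (f : M → ℝ) (X : ∀ x : M, TangentSpace (𝓡 n) x) : Prop where
  weak : HasWeakGradient n f X
  memLp : MemLp f 2 (riemannianVolume n M)
  memLp_grad : MemLp (fun x => ‖X x‖) 2 (riemannianVolume n M)

variable {f g : M → ℝ} {X Y Z : ∀ x : M, TangentSpace (𝓡 n) x}

lemma HasH1Gradient.measurableField (h : HasH1Gradient n f X) : MeasurableField n X :=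
  h.weak.measurableField

lemma HasH1Gradient.congr_ae (h : HasH1Gradient n f X)
    (hf : f =ᵐ[riemannianVolume n M] g) (hX : ∀ᵐ x ∂(riemannianVolume n M), X x = Y x) :
    HasH1Gradient n g Y where
  weak := h.weak.congr_ae hf hX
  memLp := (memLp_congr_ae hf).1 h.memLp
  memLp_grad := (memLp_congr_ae (by filter_upwards [hX] with x hx; rw [hx])).1 h.memLp_grad

lemma memLp_norm_add (hX : MeasurableField n X) (hY : MeasurableField n Y)
    (h : MemLp (fun x => ‖X x‖) 2 (riemannianVolume n M))
    (h' : MemLp (fun x => ‖Y x‖) 2 (riemannianVolume n M)) :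
    MemLp (fun x => ‖(X + Y) x‖) 2 (riemannianVolume n M) := by
  refine (h.add h').mono (hX.add hY).aestronglyMeasurable_norm (ae_of_all _ fun x => ?_)
  rw [norm_norm]
  exact (norm_add_le (X x) (Y x)).trans (le_abs_self (‖X x‖ + ‖Y x‖))

lemma memLp_norm_smul_of_bound {a : M → ℝ} {C : ℝ}
    (ha : AEStronglyMeasurable a (riemannianVolume n M))
    (hC : ∀ᵐ x ∂(riemannianVolume n M), |a x| ≤ C) (hX : MeasurableField n X)
    (h : MemLp (fun x => ‖X x‖) 2 (riemannianVolume n M)) :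
    MemLp (fun x => ‖a x • X x‖) 2 (riemannianVolume n M) := by
  refine h.of_le_mul (c := C) (MeasurableField.smul ha hX).aestronglyMeasurable_norm ?_
  filter_upwards [hC] with x hx
  rw [norm_norm, norm_norm, norm_smul]
  exact mul_le_mul_of_nonneg_right hx (norm_nonneg _)

lemma HasH1Gradient.add (h : HasH1Gradient n f X) (h' : HasH1Gradient n g Y) :
    HasH1Gradient n (f + g) (X + Y) where
  weak := h.weak.add h'.weak
  memLp := h.memLp.add h'.memLp
  memLp_grad := memLp_norm_add h.measurableField h'.measurableField h.memLp_grad h'.memLp_grad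

lemma HasH1Gradient.const_smul (c : ℝ) (h : HasH1Gradient n f X) :
    HasH1Gradient n (c • f) (c • X) where
  weak := h.weak.const_smul c
  memLp := h.memLp.const_smul c
  memLp_grad := by
    have := h.memLp_grad.const_mul ‖c‖
    refine (memLp_congr_ae (ae_of_all _ fun x => ?_)).1 this
    simp [norm_smul]

lemma HasH1Gradient.sub (h : HasH1Gradient n f X) (h' : HasH1Gradient n g Y) :
    HasH1Gradient n (f - g) (X - Y) := by
  have := h.add (h'.const_smul (-1))
  simpa [sub_eq_add_neg] using this

lemma HasH1Gradient.ae_unique (h : HasH1Gradient n f X) (h' : HasH1Gradient n f Y) :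
    ∀ᵐ x ∂(riemannianVolume n M), X x = Y x := h.weak.ae_unique h'.weak

lemma hasWeakGradient_weakGrad (h : HasWeakGradient n f X) :
    HasWeakGradient n f (weakGrad n f) := by
  have h' : ∃ X : ∀ x : M, TangentSpace (𝓡 n) x, HasWeakGradient n f X := ⟨X, h⟩
  rw [weakGrad, dif_pos h']
  exact h'.choose_spec

lemma confVolume_one : confVolume n (1 : M → ℝ) = riemannianVolume n M := by
  simp [confVolume]

lemma gradNormSq_one (f : M → ℝ) :
    gradNormSq n 1 f = ∫⁻ x, ‖weakGrad n f x‖ₑ ^ 2 ∂(riemannianVolume n M) := by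
  simp [gradNormSq, confVolume_one]

lemma l2NormSq_one (f : M → ℝ) :
    l2NormSq n 1 f = ∫⁻ x, ‖f x‖ₑ ^ 2 ∂(riemannianVolume n M) := by
  simp [l2NormSq, confVolume_one]

lemma eLpNorm_two_sq {α : Type*} [MeasurableSpace α] (μ : Measure α) (f : α → ℝ) :
    eLpNorm f 2 μ ^ 2 = ∫⁻ x, ‖f x‖ₑ ^ 2 ∂μ := by
  rw [eLpNorm_eq_lintegral_rpow_enorm_toReal (by norm_num) (by norm_num)]
  rw [← ENNReal.rpow_natCast, ← ENNReal.rpow_mul]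
  simp

lemma memLp_two_iff {α : Type*} [MeasurableSpace α] {μ : Measure α} {f : α → ℝ}
    (hf : AEStronglyMeasurable f μ) : MemLp f 2 μ ↔ ∫⁻ x, ‖f x‖ₑ ^ 2 ∂μ < ⊤ := by
  rw [MemLp, ← eLpNorm_two_sq, ENNReal.pow_lt_top_iff]
  simp [hf]

lemma HasH1Gradient.weakGrad_ae (h : HasH1Gradient n f X) :
    ∀ᵐ x ∂(riemannianVolume n M), weakGrad n f x = X x :=
  (hasWeakGradient_weakGrad h.weak).ae_unique h.weak

lemma MemH1.hasH1Gradient (h : MemH1 n 1 f) : HasH1Gradient n f (weakGrad n f) := by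
  obtain ⟨⟨X, hX⟩, hm, hfin⟩ := h
  have hw := hasWeakGradient_weakGrad hX
  rw [h1NormSq, l2NormSq_one, gradNormSq_one, ENNReal.add_lt_top] at hfin
  refine ⟨hw, (memLp_two_iff hm).2 hfin.1, ?_⟩
  rw [memLp_two_iff hw.measurableField.aestronglyMeasurable_norm]
  simpa using hfin.2

lemma HasH1Gradient.h1NormSq_eq (h : HasH1Gradient n f X) :
    h1NormSq n 1 f = eLpNorm f 2 (riemannianVolume n M) ^ 2 +
      eLpNorm (fun x => ‖X x‖) 2 (riemannianVolume n M) ^ 2 := by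
  rw [h1NormSq, l2NormSq_one, gradNormSq_one, eLpNorm_two_sq, eLpNorm_two_sq]
  congr 1
  refine lintegral_congr_ae ?_
  filter_upwards [h.weakGrad_ae] with x hx
  rw [hx, enorm_norm]

lemma HasH1Gradient.memH1 (h : HasH1Gradient n f X) : MemH1 n 1 f := by
  refine ⟨⟨X, h.weak⟩, h.memLp.1, ?_⟩
  rw [h.h1NormSq_eq]
  exact ENNReal.add_lt_top.2 ⟨ENNReal.pow_lt_top h.memLp.2, ENNReal.pow_lt_top h.memLp_grad.2⟩

lemma IsTestFunction.contMDiff_one {φ : M → ℝ} (h : IsTestFunction n φ) :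
    ContMDiff (𝓡 n) 𝓘(ℝ, ℝ) 1 φ := h.1.of_le (by norm_cast)

lemma hasCompactSupport_norm_smoothGrad {φ : M → ℝ} (h : HasCompactSupport φ) :
    HasCompactSupport (fun x => ‖smoothGrad n φ x‖) := by
  refine h.of_isClosed_subset (isClosed_tsupport _) (closure_minimal ?_ (isClosed_tsupport _))
  intro x hx
  by_contra hxs
  refine hx ?_
  have h0 : φ =ᶠ[𝓝 x] fun _ => (0 : ℝ) := notMem_tsupport_iff_eventuallyEq.1 hxs
  have h1 : smoothGrad n φ x = 0 := by
    refine smoothGrad_ext fun z => ?_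
    rw [inner_smoothGrad, h0.mfderiv_eq, mfderiv_const, inner_zero_left]
    rfl
  simp [h1]

section Finite

variable [IsFiniteMeasure (riemannianVolume n M)]

lemma IsTestFunction.hasH1Gradient {φ : M → ℝ} (h : IsTestFunction n φ) :
    HasH1Gradient n φ (smoothGrad n φ) where
  weak := hasWeakGradient_smoothGrad h.contMDiff_one
  memLp := h.1.continuous.memLp_of_hasCompactSupport h.2
  memLp_grad := (continuous_norm_smoothGrad h.contMDiff_one).memLp_of_hasCompactSupport
    (hasCompactSupport_norm_smoothGrad h.2)

lemma hasH1Gradient_const (c : ℝ) :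
    HasH1Gradient n (fun _ : M => c) (fun _ => 0) := by
  have h1 : ∀ x : M, smoothGrad n (fun _ : M => c) x = 0 := fun x => by
    refine smoothGrad_ext fun z => ?_
    rw [inner_smoothGrad, mfderiv_const, inner_zero_left]
    rfl
  have h2 := hasWeakGradient_smoothGrad (n := n) (f := fun _ : M => c) contMDiff_const
  exact ⟨h2.congr_ae (EventuallyEq.refl _ _) (ae_of_all _ h1), memLp_const c, by simp⟩

lemma HasH1Gradient.integrable_norm (h : HasH1Gradient n f X) :
    Integrable (fun x => ‖X x‖) (riemannianVolume n M) :=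
  h.memLp_grad.integrable (by norm_num)

lemma HasH1Gradient.integrable (h : HasH1Gradient n f X) :
    Integrable f (riemannianVolume n M) :=
  h.memLp.integrable (by norm_num)

variable (n M) in
/-- `C_c^∞(M)` is dense in `H¹(M)`. -/
def TestFunctionsDense : Prop := ∀ f : M → ℝ, MemH1 n 1 f → ∀ ε : ℝ≥0∞, 0 < ε →
    ∃ φ : M → ℝ, IsTestFunction n φ ∧ h1NormSq n 1 (f - φ) < ε

variable (n) in
/-- `φ k → f` in `H¹(M)` and almost everywhere, together with the gradients. -/
structure TendstoH1 (φ : ℕ → M → ℝ) (W : ℕ → ∀ x : M, TangentSpace (𝓡 n) x) (f : M → ℝ)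
    (X : ∀ x : M, TangentSpace (𝓡 n) x) : Prop where
  tendsto : Tendsto (fun k => eLpNorm (φ k - f) 2 (riemannianVolume n M)) atTop (𝓝 0)
  tendsto_grad : Tendsto (fun k => eLpNorm (fun x => ‖W k x - X x‖) 2 (riemannianVolume n M))
    atTop (𝓝 0)
  ae_tendsto : ∀ᵐ x ∂(riemannianVolume n M), Tendsto (fun k => φ k x) atTop (𝓝 (f x))
  ae_tendsto_grad : ∀ᵐ x ∂(riemannianVolume n M),
    Tendsto (fun k => ‖W k x - X x‖) atTop (𝓝 0)

/-- Density provides convergence at the rate `1 / (k + 1)`. Two successive extractions of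
subsequences make the functions, and after them the gradients, converge almost everywhere. -/
lemma HasH1Gradient.exists_tendstoH1 (hd : TestFunctionsDense n M) (h : HasH1Gradient n f X) :
    ∃ φ : ℕ → M → ℝ, (∀ k, IsTestFunction n (φ k)) ∧
      TendstoH1 n φ (fun k => smoothGrad n (φ k)) f X := by
  have h1 : ∀ k : ℕ, ∃ φ : M → ℝ, IsTestFunction n φ ∧
      h1NormSq n 1 (f - φ) < ((k : ℝ≥0∞) + 1)⁻¹ ^ 2 := fun k =>
    hd f h.memH1 _ (ENNReal.pow_pos (ENNReal.inv_pos.2 (by finiteness)) 2)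
  choose φ hφ hφ' using h1
  have hsub : ∀ k, HasH1Gradient n (φ k - f) (smoothGrad n (φ k) - X) := fun k =>
    (hφ k).hasH1Gradient.sub h
  have hlim : Tendsto (fun k : ℕ => ((k : ℝ≥0∞) + 1)⁻¹) atTop (𝓝 0) := by
    have := (tendsto_add_atTop_iff_nat 1).2 ENNReal.tendsto_inv_nat_nhds_zero
    simpa using this
  have hb : ∀ k, eLpNorm (φ k - f) 2 (riemannianVolume n M) ≤ ((k : ℝ≥0∞) + 1)⁻¹ ∧
      eLpNorm (fun x => ‖(smoothGrad n (φ k) - X) x‖) 2 (riemannianVolume n M)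
        ≤ ((k : ℝ≥0∞) + 1)⁻¹ := fun k => by
    have h2 := ((h.sub (hφ k).hasH1Gradient).h1NormSq_eq).symm.trans_lt (hφ' k)
    constructor
    · rw [eLpNorm_sub_comm]
      exact (ENNReal.pow_le_pow_left_iff two_ne_zero).1 (le_self_add.trans h2.le)
    · have h3 : (fun x => ‖(smoothGrad n (φ k) - X) x‖) =
          fun x => ‖(X - smoothGrad n (φ k)) x‖ := by
        funext x; simp only [Pi.sub_apply]; exact norm_sub_rev _ _
      rw [h3]
      exact (ENNReal.pow_le_pow_left_iff two_ne_zero).1 (le_add_self.trans h2.le)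
  have t1 : Tendsto (fun k => eLpNorm (φ k - f) 2 (riemannianVolume n M)) atTop (𝓝 0) :=
    tendsto_of_tendsto_of_tendsto_of_le_of_le tendsto_const_nhds hlim (fun _ => zero_le)
      fun k => (hb k).1
  have t2 : Tendsto (fun k => eLpNorm (fun x => ‖(smoothGrad n (φ k) - X) x‖) 2
      (riemannianVolume n M)) atTop (𝓝 0) :=
    tendsto_of_tendsto_of_tendsto_of_le_of_le tendsto_const_nhds hlim (fun _ => zero_le)
      fun k => (hb k).2
  obtain ⟨a, ha, ha'⟩ := (tendstoInMeasure_of_tendsto_eLpNorm two_ne_zero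
    (fun k => (hφ k).hasH1Gradient.memLp.1) h.memLp.1 t1).exists_seq_tendsto_ae
  have t2' : Tendsto (fun k => eLpNorm ((fun x => ‖(smoothGrad n (φ (a k)) - X) x‖) -
      (fun _ => (0 : ℝ))) 2 (riemannianVolume n M)) atTop (𝓝 0) := by
    refine (t2.comp ha.tendsto_atTop).congr fun k => ?_
    rw [show (fun x => ‖(smoothGrad n (φ (a k)) - X) x‖) - (fun _ => (0 : ℝ)) =
      fun x => ‖(smoothGrad n (φ (a k)) - X) x‖ from funext fun x => by simp]
    rfl
  obtain ⟨b, hb, hb'⟩ := (tendstoInMeasure_of_tendsto_eLpNorm two_ne_zero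
    (fun k => (hsub (a k)).memLp_grad.1) aestronglyMeasurable_const t2').exists_seq_tendsto_ae
  refine ⟨fun k => φ (a (b k)), fun k => hφ _,
    t1.comp (ha.comp hb).tendsto_atTop, t2.comp (ha.comp hb).tendsto_atTop, ?_, hb'⟩
  filter_upwards [ha'] with x hx
  exact hx.comp hb.tendsto_atTop

lemma tendsto_lintegral_enorm_of_eLpNorm_two {α : Type*} [MeasurableSpace α] {μ : Measure α}
    [IsFiniteMeasure μ] {f : ℕ → α → ℝ} (hf : ∀ k, AEStronglyMeasurable (f k) μ)
    (h : Tendsto (fun k => eLpNorm (f k) 2 μ) atTop (𝓝 0)) :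
    Tendsto (fun k => ∫⁻ x, ‖f k x‖ₑ ∂μ) atTop (𝓝 0) := by
  have h1 : Tendsto (fun k => eLpNorm (f k) 2 μ * μ univ ^ (1 / (1 : ℝ≥0∞).toReal -
      1 / (2 : ℝ≥0∞).toReal)) atTop (𝓝 0) := by
    have hfin : μ univ ^ (1 / (1 : ℝ≥0∞).toReal - 1 / (2 : ℝ≥0∞).toReal) ≠ ⊤ :=
      ENNReal.rpow_ne_top_of_nonneg (by norm_num) (measure_ne_top μ _)
    simpa using ENNReal.Tendsto.mul_const h (Or.inr hfin)
  refine tendsto_of_tendsto_of_tendsto_of_le_of_le tendsto_const_nhds h1 (fun _ => zero_le)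
    fun k => ?_
  simp only
  rw [← eLpNorm_one_eq_lintegral_enorm]
  exact eLpNorm_le_eLpNorm_mul_rpow_measure_univ (by norm_num) (hf k)

lemma tendsto_lintegral_zero_of_dominated {α : Type*} [MeasurableSpace α] {μ : Measure α}
    {F : ℕ → α → ℝ} {b : α → ℝ} (hF : ∀ k, AEStronglyMeasurable (F k) μ) (hb : Integrable b μ)
    (hFb : ∀ k, ∀ᵐ x ∂μ, ‖F k x‖ ≤ b x) (h : ∀ᵐ x ∂μ, Tendsto (fun k => F k x) atTop (𝓝 0)) :
    Tendsto (fun k => ∫⁻ x, ‖F k x‖ₑ ∂μ) atTop (𝓝 0) := by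
  have h1 := tendsto_lintegral_of_dominated_convergence' (μ := μ) (F := fun k x => ‖F k x‖ₑ)
    (f := fun _ => 0) (fun x => ENNReal.ofReal (b x)) (fun k => (hF k).enorm)
    (fun k => by
      filter_upwards [hFb k] with x hx
      rw [← ofReal_norm]
      exact ENNReal.ofReal_le_ofReal hx)
    hb.lintegral_lt_top.ne (by
      filter_upwards [h] with x hx
      simpa using hx.enorm)
  simpa using h1

/-- Chain rule for `C¹` functions with bounded derivative. -/
theorem HasH1Gradient.comp (hd : TestFunctionsDense n M) (h : HasH1Gradient n f X) {G G' : ℝ → ℝ}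
    (hG : ∀ s, HasDerivAt G (G' s) s) (hG' : Continuous G') {K : ℝ} (hK : ∀ s, |G' s| ≤ K) :
    HasH1Gradient n (fun x => G (f x)) (fun x => G' (f x) • X x) := by
  obtain ⟨φ, hφ, hlim⟩ := h.exists_tendstoH1 hd
  have hK0 : 0 ≤ K := (abs_nonneg _).trans (hK 0)
  have hGc : Continuous G := continuous_iff_continuousAt.2 fun s => (hG s).continuousAt
  have hlip : ∀ s t, |G s - G t| ≤ K * |s - t| := fun s t => by
    have := Convex.norm_image_sub_le_of_norm_hasDerivWithin_le (f := G) (f' := G') (C := K)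
      (s := univ) (fun x _ => (hG x).hasDerivWithinAt) (fun x _ => hK x) convex_univ
      (mem_univ t) (mem_univ s)
    simpa using this
  have hC1 : ContDiff ℝ 1 G := contDiff_one_iff_deriv.2
    ⟨fun s => (hG s).differentiableAt, by
      rwa [show deriv G = G' from funext fun s => (hG s).deriv]⟩
  have hGf : ∀ u : M → ℝ, MemLp u 2 (riemannianVolume n M) →
      MemLp (fun x => G (u x)) 2 (riemannianVolume n M) := fun u hu => by
    refine ((hu.norm.const_mul K).add (memLp_const |G 0|)).mono
      (hGc.comp_aestronglyMeasurable hu.1) (ae_of_all _ fun x => ?_)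
    have h1 := hlip (u x) 0
    simp only [Pi.add_apply, Real.norm_eq_abs, sub_zero] at h1 ⊢
    calc |G (u x)| ≤ |G (u x) - G 0| + |G 0| := by
          have := abs_add_le (G (u x) - G 0) (G 0); simpa using this
      _ ≤ K * |u x| + |G 0| := by gcongr
      _ ≤ _ := le_abs_self _
  have hG'f : AEStronglyMeasurable (fun x => G' (f x)) (riemannianVolume n M) :=
    hG'.comp_aestronglyMeasurable h.memLp.1
  have hYm : MeasurableField n (fun x => G' (f x) • X x) :=
    MeasurableField.smul hG'f h.measurableField
  have hYL : MemLp (fun x => ‖G' (f x) • X x‖) 2 (riemannianVolume n M) :=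
    memLp_norm_smul_of_bound hG'f (ae_of_all _ fun x => hK _) h.measurableField h.memLp_grad
  refine ⟨?_, hGf f h.memLp, hYL⟩
  have hGφ : ∀ k, ContMDiff (𝓡 n) 𝓘(ℝ, ℝ) 1 (fun x => G (φ k x)) := fun k =>
    hC1.contMDiff.comp (hφ k).contMDiff_one
  have hgr : ∀ k, smoothGrad n (fun x => G (φ k x)) =
      fun x => G' (φ k x) • smoothGrad n (φ k) x := fun k => by
    funext x; exact smoothGrad_comp (hφ k).contMDiff_one (hG _)
  refine HasWeakGradient.of_tendsto (f := fun k x => G (φ k x))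
    (X := fun k => smoothGrad n (fun x => G (φ k x)))
    (fun k => hasWeakGradient_smoothGrad (hGφ k))
    (fun k => (hGf _ (hφ k).hasH1Gradient.memLp).integrable (by norm_num))
    ((hGf f h.memLp).integrable (by norm_num)) hYm ?_ ?_ ?_
  · have := (hYL.integrable (by norm_num)).2
    simpa [HasFiniteIntegral] using this
  · have h1 := tendsto_lintegral_enorm_of_eLpNorm_two
      (fun k => (hφ k).hasH1Gradient.memLp.1.sub h.memLp.1) hlim.tendsto
    have h2 := ENNReal.Tendsto.const_mul h1 (Or.inr (ENNReal.ofReal_ne_top (r := K)))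
    rw [mul_zero] at h2
    refine tendsto_of_tendsto_of_tendsto_of_le_of_le tendsto_const_nhds h2 (fun _ => zero_le)
      fun k => ?_
    simp only
    rw [← lintegral_const_mul' _ _ ENNReal.ofReal_ne_top]
    refine lintegral_mono fun x => ?_
    rw [← ofReal_norm, ← ofReal_norm, ← ENNReal.ofReal_mul hK0]
    exact ENNReal.ofReal_le_ofReal (hlip _ _)
  · have h1 := tendsto_lintegral_enorm_of_eLpNorm_two (fun k =>
      ((hφ k).hasH1Gradient.sub h).measurableField.aestronglyMeasurable_norm) hlim.tendsto_grad
    have h2 := ENNReal.Tendsto.const_mul h1 (Or.inr (ENNReal.ofReal_ne_top (r := K)))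
    rw [mul_zero] at h2
    have hdm : ∀ k, AEStronglyMeasurable (fun x => (G' (φ k x) - G' (f x)) * ‖X x‖)
        (riemannianVolume n M) := fun k =>
      ((hG'.comp_aestronglyMeasurable (hφ k).hasH1Gradient.memLp.1).sub hG'f).mul h.memLp_grad.1
    have h3 : Tendsto (fun k => ∫⁻ x, ‖(G' (φ k x) - G' (f x)) * ‖X x‖‖ₑ
        ∂(riemannianVolume n M)) atTop (𝓝 0) := by
      refine tendsto_lintegral_zero_of_dominated (b := fun x => 2 * K * ‖X x‖) hdm
        (h.integrable_norm.const_mul _)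
        (fun k => ae_of_all _ fun x => ?_) ?_
      · rw [norm_mul, norm_norm]
        gcongr
        have h4 := abs_sub (G' (φ k x)) (G' (f x))
        rw [Real.norm_eq_abs]
        linarith [hK (φ k x), hK (f x)]
      · filter_upwards [hlim.ae_tendsto] with x hx
        have h4 := ((hG'.tendsto (f x)).comp hx).sub_const (G' (f x))
        have h5 := h4.mul_const ‖X x‖
        simpa using h5
    have h4 := h2.add h3
    rw [add_zero] at h4
    refine tendsto_of_tendsto_of_tendsto_of_le_of_le tendsto_const_nhds h4 (fun _ => zero_le)
      fun k => ?_
    simp only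
    rw [← lintegral_const_mul' _ _ ENNReal.ofReal_ne_top, ← lintegral_add_right' _ (hdm k).enorm]
    refine lintegral_mono fun x => ?_
    rw [hgr]
    simp only
    -- The first summand is controlled by the bound on `G'` and the convergence of the gradients,
    -- the second by dominated convergence, since `φ k → f` almost everywhere.
    have h5 : G' (φ k x) • smoothGrad n (φ k) x - G' (f x) • X x =
        G' (φ k x) • (smoothGrad n (φ k) x - X x) + (G' (φ k x) - G' (f x)) • X x := by
      module
    rw [h5]
    refine (enorm_add_le _ _).trans ?_
    rw [enorm_smul, enorm_smul, enorm_mul, enorm_norm, enorm_norm]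
    refine add_le_add (mul_le_mul' ?_ le_rfl) le_rfl
    rw [← ofReal_norm]
    exact ENNReal.ofReal_le_ofReal (hK _)

end Finite
end SobolevCalculus

/-! ### Truncations, products and bounded approximation in `H¹` -/

section SobolevCalculus

variable {n : ℕ} {M : Type*} [TopologicalSpace M] [ChartedSpace (EuclideanSpace ℝ (Fin n)) M]
  [IsManifold (𝓡 n) ∞ M] [RiemannianBundle (fun x : M => TangentSpace (𝓡 n) x)]
  [IsContMDiffRiemannianBundle (𝓡 n) ∞ (EuclideanSpace ℝ (Fin n))
      (fun x : M => TangentSpace (𝓡 n) x)]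
  [MeasurableSpace M] [BorelSpace M] [SecondCountableTopology M] [T2Space M]
  [IsFiniteMeasure (riemannianVolume n M)]
  {f g : M → ℝ} {X Y Z : ∀ x : M, TangentSpace (𝓡 n) x}

/-- Chain rule for functions that are `C¹` on an interval containing the values. -/
theorem HasH1Gradient.comp_Icc (hd : TestFunctionsDense n M) (h : HasH1Gradient n f X)
    {G G' : ℝ → ℝ} {a b : ℝ} (hab : a ≤ b)
    (hf : ∀ᵐ x ∂(riemannianVolume n M), f x ∈ Icc a b)
    (hG : ∀ s ∈ Icc a b, HasDerivAt G (G' s) s) (hG' : ContinuousOn G' (Icc a b)) :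
    HasH1Gradient n (fun x => G (f x)) (fun x => G' (f x) • X x) := by
  -- `G'` is extended by constants outside `[a, b]` and integrated. This gives a function with
  -- bounded continuous derivative on the whole line that agrees with `G` on `[a, b]`.
  set H' : ℝ → ℝ := fun s => G' (max a (min s b)) with hH'
  have hmem : ∀ s, max a (min s b) ∈ Icc a b := fun s =>
    ⟨le_max_left _ _, max_le hab (min_le_right _ _)⟩
  have hid : ∀ s ∈ Icc a b, max a (min s b) = s := fun s hs => by
    rw [min_eq_left hs.2, max_eq_right hs.1]
  have hH'c : Continuous H' := hG'.comp_continuous (by fun_prop) hmem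
  set H : ℝ → ℝ := fun s => G a + ∫ t in a..s, H' t with hH
  have hHd : ∀ s, HasDerivAt H (H' s) s := fun s =>
    (intervalIntegral.integral_hasDerivAt_right (hH'c.intervalIntegrable _ _)
      (hH'c.stronglyMeasurableAtFilter _ _) hH'c.continuousAt).const_add _
  obtain ⟨K, hK⟩ := isCompact_Icc.exists_bound_of_continuousOn hG'
  have hHG : ∀ s ∈ Icc a b, H s = G s := fun s hs => by
    have h1 : ∫ t in a..s, H' t = ∫ t in a..s, G' t := by
      refine intervalIntegral.integral_congr fun t ht => ?_
      rw [uIcc_of_le hs.1] at ht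
      simp only [hH', hid t ⟨ht.1, ht.2.trans hs.2⟩]
    have h2 : ∫ t in a..s, G' t = G s - G a := by
      refine intervalIntegral.integral_eq_sub_of_hasDerivAt (fun t ht => ?_) ?_
      · rw [uIcc_of_le hs.1] at ht
        exact hG t ⟨ht.1, ht.2.trans hs.2⟩
      · refine ContinuousOn.intervalIntegrable (hG'.mono ?_)
        rw [uIcc_of_le hs.1]
        exact Icc_subset_Icc_right hs.2
    simp only [hH, h1, h2]
    ring
  refine (h.comp hd hHd hH'c (K := K) fun s => hK _ (hmem s)).congr_ae ?_ ?_
  · filter_upwards [hf] with x hx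
    exact hHG _ hx
  · filter_upwards [hf] with x hx
    simp only [hH', hid _ hx]

/-- Product rule for bounded functions. -/
theorem HasH1Gradient.mul (hd : TestFunctionsDense n M) (h : HasH1Gradient n f X)
    (h' : HasH1Gradient n g Y) {C : ℝ} (hf : ∀ᵐ x ∂(riemannianVolume n M), |f x| ≤ C)
    (hg : ∀ᵐ x ∂(riemannianVolume n M), |g x| ≤ C) (hC : 0 ≤ C) :
    HasH1Gradient n (fun x => f x * g x) (fun x => f x • Y x + g x • X x) := by
  have hs : ∀ s ∈ Icc (-(2 * C)) (2 * C), HasDerivAt (fun s : ℝ => s ^ 2) (2 * s) s :=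
    fun s _ => by simpa using hasDerivAt_pow 2 s
  -- Polarization: `4 f g = (f + g) ^ 2 - (f - g) ^ 2`, where boundedness confines `f ± g` to `[-2C,
  -- 2C]`.
  have h1 := (h.add h').comp_Icc hd (G := fun s => s ^ 2) (G' := fun s => 2 * s)
    (a := -(2 * C)) (b := 2 * C) (by linarith) (by
      filter_upwards [hf, hg] with x hx hx'
      rw [abs_le] at hx hx'
      simp only [Pi.add_apply, mem_Icc]
      constructor <;> linarith) hs (by fun_prop)
  have h2 := (h.sub h').comp_Icc hd (G := fun s => s ^ 2) (G' := fun s => 2 * s)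
    (a := -(2 * C)) (b := 2 * C) (by linarith) (by
      filter_upwards [hf, hg] with x hx hx'
      rw [abs_le] at hx hx'
      simp only [Pi.sub_apply, mem_Icc]
      constructor <;> linarith) hs (by fun_prop)
  refine ((h1.sub h2).const_smul (1 / 4)).congr_ae (ae_of_all _ fun x => ?_)
    (ae_of_all _ fun x => ?_)
  · simp only [Pi.smul_apply, Pi.sub_apply, Pi.add_apply, smul_eq_mul]
    ring
  · simp only [Pi.smul_apply, Pi.sub_apply, Pi.add_apply]
    module

lemma hasDerivAt_sqrt_sq_add (c : ℝ) {ε : ℝ} (hε : 0 < ε) (s : ℝ) :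
    HasDerivAt (fun s => Real.sqrt ((s - c) ^ 2 + ε)) ((s - c) / Real.sqrt ((s - c) ^ 2 + ε)) s := by
  have h1 : HasDerivAt (fun s => (s - c) ^ 2 + ε) (2 * (s - c)) s := by
    simpa using (((hasDerivAt_id s).sub_const c).pow 2).add_const ε
  convert h1.sqrt (by positivity) using 1
  field_simp

lemma abs_div_sqrt_sq_add_le (s : ℝ) {ε : ℝ} (hε : 0 < ε) :
    |s / Real.sqrt (s ^ 2 + ε)| ≤ 1 := by
  rw [abs_div, abs_of_nonneg (Real.sqrt_nonneg _), div_le_one (by positivity)]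
  exact Real.abs_le_sqrt (by linarith)

lemma tendsto_div_sqrt_sq_add (s : ℝ) {ε : ℕ → ℝ} (h0 : Tendsto ε atTop (𝓝 0)) :
    Tendsto (fun k => s / Real.sqrt (s ^ 2 + ε k)) atTop (𝓝 (SignType.sign s : ℝ)) := by
  rcases eq_or_ne s 0 with rfl | hs
  · simp
  · have h1 : Tendsto (fun k => s / Real.sqrt (s ^ 2 + ε k)) atTop
        (𝓝 (s / Real.sqrt (s ^ 2 + 0))) := by
      refine tendsto_const_nhds.div ((Real.continuous_sqrt.tendsto _).comp
        (tendsto_const_nhds.add h0)) ?_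
      rw [add_zero]
      exact (Real.sqrt_pos.2 (by positivity)).ne'
    have h2 : s / Real.sqrt (s ^ 2 + 0) = (SignType.sign s : ℝ) := by
      rw [add_zero, Real.sqrt_sq_eq_abs, div_eq_iff (abs_ne_zero.2 hs), sign_mul_abs]
    rwa [h2] at h1

lemma clamp_eq {a b : ℝ} (hab : a ≤ b) (s : ℝ) :
    max a (min s b) = (a + b) / 2 + (1 / 2) * (|s - a| - |s - b|) := by
  rcases le_total s a with h | h
  · rw [min_eq_left (h.trans hab), max_eq_left h, abs_of_nonpos (by linarith),
      abs_of_nonpos (by linarith)]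
    ring
  · rcases le_total s b with h' | h'
    · rw [min_eq_left h', max_eq_right h, abs_of_nonneg (by linarith),
        abs_of_nonpos (by linarith)]
      ring
    · rw [min_eq_right h', max_eq_right hab, abs_of_nonneg (by linarith),
        abs_of_nonneg (by linarith)]
      ring

/-- The weight with which `∇f` enters the gradient of the truncation of `f` to `[a, b]`. -/
def clampWeight (a b s : ℝ) : ℝ := (1 / 2) * ((SignType.sign (s - a) : ℝ) - SignType.sign (s - b))

lemma clampWeight_mem {a b : ℝ} (hab : a ≤ b) (s : ℝ) : clampWeight a b s ∈ Icc (0 : ℝ) 1 := by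
  unfold clampWeight
  rcases lt_trichotomy s a with h | h | h
  · rw [sign_neg (by linarith), sign_neg (by linarith)]; simp
  · subst h
    rcases hab.eq_or_lt with h' | h'
    · subst h'; simp
    · rw [sub_self, sign_zero, sign_neg (by linarith)]; norm_num
  · rcases lt_trichotomy s b with h' | h' | h'
    · rw [sign_pos (by linarith), sign_neg (by linarith)]; norm_num
    · subst h'
      rw [sub_self, sign_zero, sign_pos (by linarith)]; norm_num
    · rw [sign_pos (by linarith), sign_pos (by linarith)]; norm_num

lemma measurable_clampWeight (a b : ℝ) : Measurable (clampWeight a b) := by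
  have h1 : ∀ c : ℝ, Measurable (fun s : ℝ => (SignType.sign (s - c) : ℝ)) := fun c => by
    have : (fun s : ℝ => (SignType.sign (s - c) : ℝ)) =
        fun s => if c < s then 1 else if s < c then -1 else 0 := by
      funext s
      rcases lt_trichotomy s c with h | h | h
      · rw [sign_neg (by linarith), if_neg h.not_gt, if_pos h]; simp
      · subst h; simp
      · rw [sign_pos (by linarith), if_pos h]; simp
    rw [this]
    exact Measurable.ite measurableSet_Ioi measurable_const
      (Measurable.ite measurableSet_Iio measurable_const measurable_const)
  exact ((h1 a).sub (h1 b)).const_mul _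

/-- Chain rule for truncations. -/
theorem HasH1Gradient.clamp (hd : TestFunctionsDense n M) (h : HasH1Gradient n f X) {a b : ℝ}
    (hab : a ≤ b) : HasH1Gradient n (fun x => max a (min (f x) b))
      (fun x => clampWeight a b (f x) • X x) := by
  -- By `clamp_eq` the truncation is a combination of `|s - a|` and `|s - b|`, which are smoothed to
  -- `√((s - c) ^ 2 + ε)`. The derivatives converge to `clampWeight` at every point, also at the
  -- kinks since `sign 0 = 0`, so no discussion of the level sets of `f` is needed.
  set ε : ℕ → ℝ := fun k => 1 / ((k : ℝ) + 1) with hε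
  have hε0 : ∀ k, 0 < ε k := fun k => by positivity
  have hεt : Tendsto ε atTop (𝓝 0) := tendsto_one_div_add_atTop_nhds_zero_nat
  set G : ℕ → ℝ → ℝ := fun k s => (a + b) / 2 + (1 / 2) *
    (Real.sqrt ((s - a) ^ 2 + ε k) - Real.sqrt ((s - b) ^ 2 + ε k)) with hG
  set G' : ℕ → ℝ → ℝ := fun k s => (1 / 2) *
    ((s - a) / Real.sqrt ((s - a) ^ 2 + ε k) - (s - b) / Real.sqrt ((s - b) ^ 2 + ε k)) with hG'
  have hGd : ∀ k s, HasDerivAt (G k) (G' k s) s := fun k s =>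
    (((hasDerivAt_sqrt_sq_add a (hε0 k) s).sub
      (hasDerivAt_sqrt_sq_add b (hε0 k) s)).const_mul (1 / 2)).const_add _
  have hpos : ∀ k (c s : ℝ), Real.sqrt ((s - c) ^ 2 + ε k) ≠ 0 := fun k c s =>
    (Real.sqrt_pos.2 (by have := hε0 k; positivity)).ne'
  have hG'c : ∀ k, Continuous (G' k) := fun k => by
    refine continuous_const.mul (Continuous.sub ?_ ?_)
    · exact Continuous.div (by fun_prop) (by fun_prop) (hpos k a)
    · exact Continuous.div (by fun_prop) (by fun_prop) (hpos k b)
  have hG'b : ∀ k s, |G' k s| ≤ 1 := fun k s => by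
    have h1 := abs_div_sqrt_sq_add_le (s - a) (hε0 k)
    have h2 := abs_div_sqrt_sq_add_le (s - b) (hε0 k)
    rw [abs_le] at h1 h2 ⊢
    simp only [hG']
    constructor <;> linarith
  have hGlim : ∀ s, Tendsto (fun k => G k s) atTop (𝓝 (max a (min s b))) := fun s => by
    rw [clamp_eq hab]
    have h1 : ∀ c, Tendsto (fun k => Real.sqrt ((s - c) ^ 2 + ε k)) atTop (𝓝 |s - c|) := fun c => by
      have := (Real.continuous_sqrt.tendsto _).comp ((tendsto_const_nhds (x := (s - c) ^ 2)).add hεt)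
      rwa [add_zero, Real.sqrt_sq_eq_abs] at this
    exact (((h1 a).sub (h1 b)).const_mul _).const_add _
  have hG'lim : ∀ s, Tendsto (fun k => G' k s) atTop (𝓝 (clampWeight a b s)) := fun s =>
    ((tendsto_div_sqrt_sq_add (s - a) hεt).sub (tendsto_div_sqrt_sq_add (s - b) hεt)).const_mul _
  have hk : ∀ k, HasH1Gradient n (fun x => G k (f x)) (fun x => G' k (f x) • X x) := fun k =>
    h.comp hd (hGd k) (hG'c k) (hG'b k)
  have hwm : AEStronglyMeasurable (fun x => clampWeight a b (f x)) (riemannianVolume n M) :=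
    ((measurable_clampWeight a b).comp_aemeasurable h.memLp.1.aemeasurable).aestronglyMeasurable
  have hwb : ∀ s, |clampWeight a b s| ≤ 1 := fun s => by
    rw [abs_of_nonneg (clampWeight_mem hab s).1]; exact (clampWeight_mem hab s).2
  have hYm : MeasurableField n (fun x => clampWeight a b (f x) • X x) :=
    MeasurableField.smul hwm h.measurableField
  have hYL := memLp_norm_smul_of_bound hwm (ae_of_all _ fun x => hwb (f x)) h.measurableField
    h.memLp_grad
  have hcb : ∀ s, |max a (min s b)| ≤ |a| + |b| := fun s => by
    have h1 : a ≤ max a (min s b) := le_max_left _ _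
    have h2 : max a (min s b) ≤ b := max_le hab (min_le_right _ _)
    rw [abs_le]
    constructor
    · linarith [neg_abs_le a, abs_nonneg b]
    · linarith [le_abs_self b, abs_nonneg a]
  have hfm : AEStronglyMeasurable (fun x => max a (min (f x) b)) (riemannianVolume n M) :=
    (by fun_prop : Continuous fun s : ℝ => max a (min s b)).comp_aestronglyMeasurable h.memLp.1
  have hfL : MemLp (fun x => max a (min (f x) b)) 2 (riemannianVolume n M) :=
    MemLp.of_bound hfm (|a| + |b|) (ae_of_all _ fun x => hcb _)
  refine ⟨HasWeakGradient.of_tendsto (fun k => (hk k).weak) (fun k => (hk k).integrable)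
    (hfL.integrable (by norm_num)) hYm ?_ ?_ ?_, hfL, hYL⟩
  · have := (hYL.integrable (by norm_num)).2
    simpa [HasFiniteIntegral] using this
  · have hGbd : ∀ k s, |G k s - max a (min s b)| ≤ 1 := fun k s => by
      rw [clamp_eq hab]
      have h1 : ∀ c : ℝ, |s - c| ≤ Real.sqrt ((s - c) ^ 2 + ε k) ∧
          Real.sqrt ((s - c) ^ 2 + ε k) ≤ |s - c| + 1 := fun c => by
        have hle : ε k ≤ 1 := by
          simp only [hε]
          rw [div_le_one (by positivity)]
          linarith [Nat.cast_nonneg (α := ℝ) k]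
        constructor
        · exact Real.abs_le_sqrt (by linarith [hε0 k])
        · rw [Real.sqrt_le_left (by positivity), add_sq, sq_abs]
          linarith [abs_nonneg (s - c)]
      have ha := h1 a
      have hb := h1 b
      simp only [hG]
      rw [abs_le]
      constructor <;> linarith
    exact tendsto_lintegral_zero_of_dominated (b := fun _ => 1)
      (fun k => (hk k).memLp.1.sub hfm) (integrable_const _)
      (fun k => ae_of_all _ fun x => hGbd k (f x))
      (ae_of_all _ fun x => by simpa using (hGlim (f x)).sub_const (max a (min (f x) b)))
  · have h1 := tendsto_lintegral_zero_of_dominated (μ := riemannianVolume n M)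
      (F := fun k x => ‖G' k (f x) • X x - clampWeight a b (f x) • X x‖)
      (b := fun x => 2 * ‖X x‖)
      (fun k => ((hk k).measurableField.sub hYm).aestronglyMeasurable_norm)
      (h.integrable_norm.const_mul 2)
      (fun k => ae_of_all _ fun x => by
        rw [← sub_smul, norm_norm, norm_smul]
        gcongr
        have h4 := abs_sub (G' k (f x)) (clampWeight a b (f x))
        rw [Real.norm_eq_abs]
        linarith [hG'b k (f x), hwb (f x)])
      (ae_of_all _ fun x => by
        have h2 := (((hG'lim (f x)).sub_const (clampWeight a b (f x))).smul_const (X x)).norm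
        simpa [sub_smul] using h2)
    simpa using h1

lemma eLpNorm_two_const_mul {α : Type*} [MeasurableSpace α] {μ : Measure α} (c : ℝ) (f : α → ℝ) :
    eLpNorm (fun x => c * f x) 2 μ = ‖c‖ₑ * eLpNorm f 2 μ :=
  eLpNorm_const_smul c f 2 μ

lemma tendsto_eLpNorm_two_of_dominated {α : Type*} [MeasurableSpace α] {μ : Measure α}
    {F : ℕ → α → ℝ} {b : α → ℝ} (hF : ∀ k, AEStronglyMeasurable (F k) μ) (hb : MemLp b 2 μ)
    (hFb : ∀ k, ∀ᵐ x ∂μ, |F k x| ≤ b x) (h : ∀ᵐ x ∂μ, Tendsto (fun k => F k x) atTop (𝓝 0)) :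
    Tendsto (fun k => eLpNorm (F k) 2 μ) atTop (𝓝 0) := by
  have h1 := tendsto_lintegral_zero_of_dominated (F := fun k x => F k x ^ 2)
    (fun k => (hF k).pow 2) hb.integrable_sq (fun k => by
      filter_upwards [hFb k] with x hx
      rw [Real.norm_eq_abs, abs_pow]
      exact pow_le_pow_left₀ (abs_nonneg _) hx 2) (by
      filter_upwards [h] with x hx
      simpa using hx.pow 2)
  have h2 : Tendsto (fun k => eLpNorm (F k) 2 μ ^ 2) atTop (𝓝 0) := by
    simp_rw [eLpNorm_two_sq]
    simpa [enorm_pow] using h1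
  have h3 := (ENNReal.continuous_rpow_const (y := 1 / 2)).tendsto 0 |>.comp h2
  rw [ENNReal.zero_rpow_of_pos (by norm_num)] at h3
  refine h3.congr fun k => ?_
  simp only [Function.comp_apply]
  rw [← ENNReal.rpow_natCast, ← ENNReal.rpow_mul]
  norm_num

set_option maxHeartbeats 400000 in
/-- A bounded `H¹` function is the limit of uniformly bounded test functions. -/
theorem HasH1Gradient.exists_tendstoH1_bounded (hd : TestFunctionsDense n M)
    (h : HasH1Gradient n f X) {C : ℝ} (hC : 0 < C)
    (hf : ∀ᵐ x ∂(riemannianVolume n M), |f x| ≤ C) :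
    ∃ φ : ℕ → M → ℝ, (∀ k, IsTestFunction n (φ k)) ∧ (∀ k x, |φ k x| ≤ 2 * C) ∧
      (∀ᵐ x ∂(riemannianVolume n M), Tendsto (fun k => φ k x) atTop (𝓝 (f x))) ∧
      Tendsto (fun k => eLpNorm (fun x => ‖smoothGrad n (φ k) x - X x‖) 2 (riemannianVolume n M))
        atTop (𝓝 0) := by
  have hrange : ∀ s ∈ Icc (-C) C, s / (2 * C) ∈ Icc (-(1 / 2) : ℝ) (1 / 2) := fun s hs => by
    constructor
    · rw [le_div_iff₀ (by positivity)]; linarith [hs.1]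
    · rw [div_le_iff₀ (by positivity)]; linarith [hs.2]
  set D : ℝ → ℝ := fun s => 1 / Real.sqrt (1 - (s / (2 * C)) ^ 2) * (1 / (2 * C)) with hD
  have hpos : ∀ s ∈ Icc (-C) C, 0 < Real.sqrt (1 - (s / (2 * C)) ^ 2) := fun s hs => by
    have h1 := hrange s hs
    exact Real.sqrt_pos.2 (by nlinarith [h1.1, h1.2])
  have hfI : ∀ᵐ x ∂(riemannianVolume n M), f x ∈ Icc (-C) C := by
    filter_upwards [hf] with x hx using abs_le.1 hx
  -- Test functions `w k` approximating `arcsin (f / 2C)` are mapped back by `2C sin`. The results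
  -- are bounded by `2C`, and compactly supported because `sin 0 = 0`. Dividing by `2C` instead of
  -- `C` keeps the argument in `[-1/2, 1/2]`, where `arcsin` is `C¹`.
  set ψ : M → ℝ := fun x => Real.arcsin (f x / (2 * C)) with hψ
  have hψ1 : HasH1Gradient n ψ (fun x => D (f x) • X x) := by
    refine h.comp_Icc hd (G := fun s => Real.arcsin (s / (2 * C))) (G' := D) (a := -C) (b := C)
      (by linarith) hfI (fun s hs => ?_) ?_
    · have h1 := hrange s hs
      have h2 := Real.hasDerivAt_arcsin (x := s / (2 * C)) (by linarith [h1.1]) (by linarith [h1.2])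
      exact h2.comp s ((hasDerivAt_id s).div_const _)
    · refine ContinuousOn.mul (ContinuousOn.div continuousOn_const (by fun_prop)
        fun s hs => (hpos s hs).ne') continuousOn_const
  obtain ⟨w, hw, hlim⟩ := hψ1.exists_tendstoH1 hd
  set W : ∀ x : M, TangentSpace (𝓡 n) x := fun x => D (f x) • X x with hW
  have hXW : ∀ᵐ x ∂(riemannianVolume n M), X x = (2 * C * Real.cos (ψ x)) • W x := by
    filter_upwards [hfI] with x hx
    have h2 := (hpos _ hx).ne'
    have h3 : 2 * C * Real.cos (ψ x) * D (f x) = 1 := by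
      simp only [hψ, hD, Real.cos_arcsin]
      generalize Real.sqrt (1 - (f x / (2 * C)) ^ 2) = r at h2
      field_simp
    rw [hW]
    simp only [smul_smul, h3, one_smul]
  have hgr : ∀ k x, smoothGrad n (fun x => 2 * C * Real.sin (w k x)) x =
      (2 * C * Real.cos (w k x)) • smoothGrad n (w k) x := fun k x =>
    smoothGrad_comp (G := fun s => 2 * C * Real.sin s) (hw k).contMDiff_one
      ((Real.hasDerivAt_sin _).const_mul _)
  refine ⟨fun k x => 2 * C * Real.sin (w k x), fun k => ⟨?_, ?_⟩, fun k x => ?_, ?_, ?_⟩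
  · exact (contDiff_const.mul Real.contDiff_sin).contMDiff.comp (hw k).1
  · exact (hw k).2.comp_left (g := fun s => 2 * C * Real.sin s) (by simp)
  · rw [abs_mul, abs_of_pos (by positivity : 0 < 2 * C)]
    exact mul_le_of_le_one_right (by positivity) (Real.abs_sin_le_one _)
  · filter_upwards [hlim.ae_tendsto, hfI] with x hx hx'
    have h1 := ((Real.continuous_sin.tendsto _).comp hx).const_mul (2 * C)
    have h2 := hrange _ hx'
    have h3 : 2 * C * Real.sin (ψ x) = f x := by
      simp only [hψ]
      rw [Real.sin_arcsin (by linarith [h2.1]) (by linarith [h2.2])]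
      field_simp
    rwa [h3] at h1
  · have hcm : ∀ k, AEStronglyMeasurable (fun x => 2 * C * (Real.cos (w k x) - Real.cos (ψ x)))
        (riemannianVolume n M) := fun k =>
      ((Real.continuous_cos.comp_aestronglyMeasurable (hw k).hasH1Gradient.memLp.1).sub
        (Real.continuous_cos.comp_aestronglyMeasurable hψ1.memLp.1)).const_mul _
    have t1 : Tendsto (fun k => eLpNorm (fun x => 2 * C * ‖smoothGrad n (w k) x - W x‖) 2
        (riemannianVolume n M)) atTop (𝓝 0) := by
      have := ENNReal.Tendsto.const_mul hlim.tendsto_grad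
        (Or.inr (enorm_ne_top (x := 2 * C)))
      rw [mul_zero] at this
      refine this.congr fun k => ?_
      rw [eLpNorm_two_const_mul]
    have t2 : Tendsto (fun k => eLpNorm (fun x =>
        2 * C * (Real.cos (w k x) - Real.cos (ψ x)) * ‖W x‖) 2
        (riemannianVolume n M)) atTop (𝓝 0) := by
      refine tendsto_eLpNorm_two_of_dominated (b := fun x => 4 * C * ‖W x‖)
        (fun k => (hcm k).mul hψ1.memLp_grad.1) (hψ1.memLp_grad.const_mul _)
        (fun k => ae_of_all _ fun x => ?_) ?_
      · rw [abs_mul, abs_mul, abs_norm, abs_of_pos (by positivity : 0 < 2 * C)]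
        refine mul_le_mul_of_nonneg_right ?_ (norm_nonneg _)
        have h4 := abs_sub (Real.cos (w k x)) (Real.cos (ψ x))
        nlinarith [Real.abs_cos_le_one (w k x), Real.abs_cos_le_one (ψ x)]
      · filter_upwards [hlim.ae_tendsto] with x hx
        have h1 := ((((Real.continuous_cos.tendsto _).comp hx).sub_const (Real.cos (ψ x))).const_mul
          (2 * C)).mul_const ‖W x‖
        simpa using h1
    have t3 := t1.add t2
    rw [add_zero] at t3
    have hpt : ∀ k, ∀ᵐ x ∂(riemannianVolume n M),
        ‖smoothGrad n (fun x => 2 * C * Real.sin (w k x)) x - X x‖ ≤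
          2 * C * ‖smoothGrad n (w k) x - W x‖ +
            ‖2 * C * (Real.cos (w k x) - Real.cos (ψ x)) * ‖W x‖‖ := fun k => by
      filter_upwards [hXW] with x hx
      rw [hgr]
      nth_rewrite 1 [hx]
      have h5 : (2 * C * Real.cos (w k x)) • smoothGrad n (w k) x -
          (2 * C * Real.cos (ψ x)) • W x =
          (2 * C * Real.cos (w k x)) • (smoothGrad n (w k) x - W x) +
          (2 * C * (Real.cos (w k x) - Real.cos (ψ x))) • W x := by
        module
      rw [h5]
      refine (norm_add_le _ _).trans (add_le_add ?_ ?_)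
      · rw [norm_smul]
        refine mul_le_mul_of_nonneg_right ?_ (norm_nonneg _)
        rw [norm_mul, Real.norm_eq_abs, Real.norm_eq_abs, abs_of_pos (by positivity : 0 < 2 * C)]
        exact mul_le_of_le_one_right (by positivity) (Real.abs_cos_le_one _)
      · rw [norm_smul, norm_mul _ ‖W x‖, norm_norm]
    have hm1 : ∀ k, AEStronglyMeasurable (fun x => 2 * C * ‖smoothGrad n (w k) x - W x‖)
        (riemannianVolume n M) := fun k =>
      ((hw k).hasH1Gradient.sub hψ1).measurableField.aestronglyMeasurable_norm.const_mul _
    refine tendsto_of_tendsto_of_tendsto_of_le_of_le tendsto_const_nhds t3 (fun _ => zero_le)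
      fun k => ?_
    simp only
    rw [← eLpNorm_norm (fun x => 2 * C * (Real.cos (w k x) - Real.cos (ψ x)) * ‖W x‖)]
    refine le_trans ?_ (eLpNorm_add_le (hm1 k) ((hcm k).mul hψ1.memLp_grad.1).norm (by norm_num))
    refine eLpNorm_mono_ae_real ?_
    filter_upwards [hpt k] with x hx
    rw [norm_norm]
    exact hx

end SobolevCalculus

/-! ### Pointwise bounds of the conformal factor from equivalence of norms -/

section ConformalFactor

variable {n : ℕ} {M : Type*} [TopologicalSpace M] [ChartedSpace (EuclideanSpace ℝ (Fin n)) M]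
  [IsManifold (𝓡 n) ∞ M] [RiemannianBundle (fun x : M => TangentSpace (𝓡 n) x)]
  [IsContMDiffRiemannianBundle (𝓡 n) ∞ (EuclideanSpace ℝ (Fin n))
      (fun x : M => TangentSpace (𝓡 n) x)]
  [MeasurableSpace M] [BorelSpace M] [SecondCountableTopology M] [T2Space M]
  [IsFiniteMeasure (riemannianVolume n M)]
  {f g u : M → ℝ} {X Y Z : ∀ x : M, TangentSpace (𝓡 n) x}

lemma lintegral_confVolume (hu : AEStronglyMeasurable u (riemannianVolume n M)) (F : M → ℝ≥0∞)
    (hF : AEMeasurable F (riemannianVolume n M)) :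
    ∫⁻ x, F x ∂(confVolume n u) =
      ∫⁻ x, ENNReal.ofReal (u x ^ (2 * (n : ℝ) / ((n : ℝ) - 2))) * F x ∂(riemannianVolume n M) := by
  rw [confVolume, lintegral_withDensity_eq_lintegral_mul₀
    (hu.aemeasurable.pow_const _).ennreal_ofReal hF]
  rfl

lemma lintegral_confVolume_mul (hu : AEStronglyMeasurable u (riemannianVolume n M))
    {F G : M → ℝ≥0∞} (hF : AEMeasurable F (riemannianVolume n M))
    (hG : AEMeasurable G (riemannianVolume n M)) :
    ∫⁻ x, F x * G x ∂(confVolume n u) =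
      ∫⁻ x, ENNReal.ofReal (u x ^ (2 * (n : ℝ) / ((n : ℝ) - 2))) * (F x * G x)
        ∂(riemannianVolume n M) :=
  lintegral_confVolume hu _ (hF.mul hG)

lemma HasH1Gradient.l2NormSq_eq (h : HasH1Gradient n f X)
    (hu : AEStronglyMeasurable u (riemannianVolume n M)) :
    l2NormSq n u f =
      ∫⁻ x, ENNReal.ofReal (u x ^ (2 * (n : ℝ) / ((n : ℝ) - 2))) * ‖f x‖ₑ ^ 2
        ∂(riemannianVolume n M) :=
  lintegral_confVolume hu _ (h.memLp.1.enorm.pow_const 2)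

/-- The volume density and the conformal factor of the gradient norm combine, as `2n/(n-2) - 4/(n-2)
= 2`. -/
lemma HasH1Gradient.gradNormSq_eq (hn : 3 ≤ n) (h : HasH1Gradient n f X)
    (hu : AEStronglyMeasurable u (riemannianVolume n M))
    (hu0 : ∀ᵐ x ∂(riemannianVolume n M), 0 < u x) :
    gradNormSq n u f =
      ∫⁻ x, ENNReal.ofReal (u x ^ 2) * ‖X x‖ₑ ^ 2 ∂(riemannianVolume n M) := by
  have hn2 : (n : ℝ) - 2 ≠ 0 := by
    have : (3 : ℝ) ≤ n := by exact_mod_cast hn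
    linarith
  have hm : AEMeasurable (fun x => ‖weakGrad n f x‖ₑ ^ 2) (riemannianVolume n M) := by
    have := (hasWeakGradient_weakGrad h.weak).measurableField.aestronglyMeasurable_norm.enorm
    simp only [enorm_norm] at this
    exact this.pow_const 2
  have hm' : AEMeasurable (fun x => ENNReal.ofReal (u x ^ (-4 / ((n : ℝ) - 2))))
      (riemannianVolume n M) := (hu.aemeasurable.pow_const _).ennreal_ofReal
  refine (lintegral_confVolume_mul hu hm' hm).trans (lintegral_congr_ae ?_)
  filter_upwards [h.weakGrad_ae, hu0] with x hx hux
  rw [hx, ← mul_assoc, ← ENNReal.ofReal_mul (by positivity), ← Real.rpow_add hux]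
  congr 2
  rw [← Real.rpow_natCast]
  congr 1
  field_simp
  push_cast
  ring

/-- Finite measures are compared by testing with squares of test functions. -/
lemma measure_le_of_forall_test {ν₁ ν₂ : Measure M} [IsFiniteMeasure ν₁] [IsFiniteMeasure ν₂]
    (h : ∀ η : M → ℝ, IsTestFunction n η → ∫⁻ x, ‖η x‖ₑ ^ 2 ∂ν₁ ≤ ∫⁻ x, ‖η x‖ₑ ^ 2 ∂ν₂) :
    ν₁ ≤ ν₂ := by
  have := (𝓡 n).locallyCompactSpace
  have := ChartedSpace.locallyCompactSpace (EuclideanSpace ℝ (Fin n)) M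
  let _ : MetricSpace M := TopologicalSpace.metrizableSpaceMetric M
  -- An open set is exhausted by compact sets, and a smooth bump function between `K` and `U`
  -- compares the two measures. Outer regularity extends the comparison to all sets.
  have hopen : ∀ U : Set M, IsOpen U → ν₁ U ≤ ν₂ U := fun U hU => by
    rw [hU.measure_eq_iSup_isCompact]
    refine iSup₂_le fun K hKU => iSup_le fun hK => ?_
    obtain ⟨L, hL, hKL, hLU⟩ := exists_compact_between hK hU hKU
    obtain ⟨η, h1, h2, h3, h4⟩ := exists_contMDiff_support_eq_eq_one_iff (𝓡 n)
      (isOpen_interior (s := L)) hK.isClosed hKL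
    have hη : IsTestFunction n η := ⟨h1, HasCompactSupport.of_support_subset_isCompact hL
      (h3.subset.trans interior_subset)⟩
    calc ν₁ K = ∫⁻ x, K.indicator 1 x ∂ν₁ := by
          rw [lintegral_indicator_one hK.isClosed.measurableSet]
      _ ≤ ∫⁻ x, ‖η x‖ₑ ^ 2 ∂ν₁ := by
          refine lintegral_mono fun x => ?_
          by_cases hx : x ∈ K
          · rw [(h4 x).1 hx]; simp [hx]
          · simp [hx]
      _ ≤ ∫⁻ x, ‖η x‖ₑ ^ 2 ∂ν₂ := h η hη
      _ ≤ ∫⁻ x, U.indicator 1 x ∂ν₂ := by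
          refine lintegral_mono fun x => ?_
          by_cases hx : x ∈ U
          · have h5 := h2 (mem_range_self x)
            have h6 : ‖η x‖ₑ ≤ 1 := by
              rw [← ofReal_norm, Real.norm_of_nonneg h5.1]
              exact ENNReal.ofReal_le_one.2 h5.2
            simpa [hx] using pow_le_one' h6 2
          · have : η x = 0 := by
              by_contra hne
              exact hx (hLU (interior_subset (h3.subset hne)))
            simp [this]
      _ = ν₂ U := lintegral_indicator_one hU.measurableSet
  refine Measure.le_iff.2 fun s _ => ?_
  rw [s.measure_eq_iInf_isOpen ν₂]
  exact le_iInf₂ fun U hsU => le_iInf fun hU => (measure_mono hsU).trans (hopen U hU)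

/-- A coordinate function times a bump function is a coordinate near `p`. Such functions serve as
phases of oscillating test functions. -/
lemma exists_test_smoothGrad_ne_zero (hn : 0 < n) (p : M) :
    ∃ ψ : M → ℝ, IsTestFunction n ψ ∧ ∀ᶠ x in 𝓝 p, smoothGrad n ψ x ≠ 0 := by
  set e := chartAt (EuclideanSpace ℝ (Fin n)) p with he
  obtain ⟨χ⟩ : Nonempty (SmoothBumpFunction (𝓡 n) p) := inferInstance
  let i : Fin n := ⟨0, hn⟩
  have hcoord : ContDiff ℝ ∞ (fun y : EuclideanSpace ℝ (Fin n) => y i) :=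
    (EuclideanSpace.proj i : EuclideanSpace ℝ (Fin n) →L[ℝ] ℝ).contDiff
  have hgs : ContMDiffOn (𝓡 n) 𝓘(ℝ, ℝ) ∞ (fun x : M => (e x) i) e.source :=
    hcoord.contMDiff.comp_contMDiffOn (contMDiffOn_chart (I := 𝓡 n) (n := ∞) (x := p))
  have hsm : ContMDiff (𝓡 n) 𝓘(ℝ, ℝ) ∞ (fun x : M => χ x • (e x) i) := χ.contMDiff_smul hgs
  refine ⟨fun x => χ x • (e x) i, ⟨hsm, ?_⟩, ?_⟩
  · exact χ.hasCompactSupport.smul_right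
  · have h1 : ∀ᶠ x in 𝓝 p, χ =ᶠ[𝓝 x] 1 := eventually_eventually_nhds.2 χ.eventuallyEq_one
    filter_upwards [h1, chart_source_mem_nhds (EuclideanSpace ℝ (Fin n)) p] with x hx hxs h0
    have hy : e x ∈ e.target := e.map_source hxs
    have h2 := mfderiv_coordField (n := n) (f := fun x => χ x • (e x) i)
      (hsm.of_le (by norm_cast)) p i hy
    rw [← inner_smoothGrad, ← he] at h2
    have h3 : ∀ z, z = x → smoothGrad n (fun x => χ x • (e x) i) z = 0 := by
      rintro z rfl; exact h0
    rw [h3 _ (e.left_inv hxs), inner_zero_left] at h2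
    have h4 : (fun z => χ (e.symm z) • (e (e.symm z)) i) =ᶠ[𝓝 (e x)] fun z => z i := by
      have hc : Tendsto e.symm (𝓝 (e x)) (𝓝 x) := by
        have := (e.continuousAt_symm hy).tendsto
        rwa [e.left_inv hxs] at this
      filter_upwards [hc.eventually hx, e.open_target.mem_nhds hy] with z hz hzt
      rw [hz, e.right_inv hzt]
      simp
    have h5 : partialDeriv n i (fun z => χ (e.symm z) • (e (e.symm z)) i) (e x) = 1 := by
      rw [partialDeriv, h4.fderiv_eq]
      have : fderiv ℝ (fun z : EuclideanSpace ℝ (Fin n) => z i) (e x) =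
        (EuclideanSpace.proj i : EuclideanSpace ℝ (Fin n) →L[ℝ] ℝ) :=
        (EuclideanSpace.proj i : EuclideanSpace ℝ (Fin n) →L[ℝ] ℝ).fderiv
      rw [this]
      simp
    rw [h5] at h2
    exact zero_ne_one (α := ℝ) h2

lemma IsTestFunction.mul_cos {η ψ : M → ℝ} (hη : IsTestFunction n η) (hψ : IsTestFunction n ψ)
    (N : ℝ) : IsTestFunction n (fun x => η x * Real.cos (N * ψ x)) ∧
      IsTestFunction n (fun x => η x * Real.sin (N * ψ x)) := by
  have hc : ContDiff ℝ ∞ (fun s : ℝ => Real.cos (N * s)) := by fun_prop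
  have hs : ContDiff ℝ ∞ (fun s : ℝ => Real.sin (N * s)) := by fun_prop
  have hc' : ContMDiff (𝓡 n) 𝓘(ℝ, ℝ) ∞ (fun x => Real.cos (N * ψ x)) := hc.contMDiff.comp hψ.1
  have hs' : ContMDiff (𝓡 n) 𝓘(ℝ, ℝ) ∞ (fun x => Real.sin (N * ψ x)) := hs.contMDiff.comp hψ.1
  exact ⟨⟨ContMDiff.smul hη.1 hc', hη.2.mul_right⟩, ⟨ContMDiff.smul hη.1 hs', hη.2.mul_right⟩⟩

/-- Taking cosine and sine together cancels the cross terms and the oscillation, so the energy is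
exactly quadratic in the frequency `N`. -/
lemma norm_sq_smoothGrad_mul_cos_add {η ψ : M → ℝ} (hη : IsTestFunction n η)
    (hψ : IsTestFunction n ψ) (N : ℝ) (x : M) :
    ‖smoothGrad n (fun x => η x * Real.cos (N * ψ x)) x‖ ^ 2 +
      ‖smoothGrad n (fun x => η x * Real.sin (N * ψ x)) x‖ ^ 2 =
    ‖smoothGrad n η x‖ ^ 2 + N ^ 2 * (η x ^ 2 * ‖smoothGrad n ψ x‖ ^ 2) := by
  have hψ1 := hψ.contMDiff_one
  have hc : ContDiff ℝ 1 (fun s : ℝ => Real.cos (N * s)) := by fun_prop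
  have hs : ContDiff ℝ 1 (fun s : ℝ => Real.sin (N * s)) := by fun_prop
  have hc' : ContMDiff (𝓡 n) 𝓘(ℝ, ℝ) 1 (fun x => Real.cos (N * ψ x)) := hc.contMDiff.comp hψ1
  have hs' : ContMDiff (𝓡 n) 𝓘(ℝ, ℝ) 1 (fun x => Real.sin (N * ψ x)) := hs.contMDiff.comp hψ1
  have d0 : HasDerivAt (fun s : ℝ => N * s) N (ψ x) := by
    simpa using (hasDerivAt_id (ψ x)).const_mul N
  have dc : HasDerivAt (fun s : ℝ => Real.cos (N * s)) (-Real.sin (N * ψ x) * N) (ψ x) :=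
    d0.cos
  have ds : HasDerivAt (fun s : ℝ => Real.sin (N * s)) (Real.cos (N * ψ x) * N) (ψ x) :=
    d0.sin
  have gc : smoothGrad n (fun x => Real.cos (N * ψ x)) x = _ := smoothGrad_comp hψ1 dc
  have gs : smoothGrad n (fun x => Real.sin (N * ψ x)) x = _ := smoothGrad_comp hψ1 ds
  rw [smoothGrad_mul hη.contMDiff_one hc', smoothGrad_mul hη.contMDiff_one hs', gc, gs]
  set a := smoothGrad n η x
  set b := smoothGrad n ψ x
  have h1 := Real.sin_sq_add_cos_sq (N * ψ x)
  set s := Real.sin (N * ψ x)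
  set c := Real.cos (N * ψ x)
  rw [smul_smul, smul_smul, norm_add_sq_real, norm_add_sq_real, real_inner_smul_left,
    real_inner_smul_left, real_inner_smul_right, real_inner_smul_right]
  simp only [norm_smul, mul_pow, Real.norm_eq_abs, sq_abs]
  linear_combination (N ^ 2 * η x ^ 2 * ‖b‖ ^ 2 + ‖a‖ ^ 2) * h1

/-- A weighted `H¹` energy. -/
def weightedEnergy (w v : M → ℝ≥0∞) (f : M → ℝ) : ℝ≥0∞ :=
  ∫⁻ x, w x * ‖f x‖ₑ ^ 2 ∂(riemannianVolume n M) +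
    ∫⁻ x, v x * ‖smoothGrad n f x‖ₑ ^ 2 ∂(riemannianVolume n M)

lemma weightedEnergy_mul_cos_add {η ψ : M → ℝ} (hη : IsTestFunction n η)
    (hψ : IsTestFunction n ψ) (N : ℝ) {w v : M → ℝ≥0∞}
    (hw : AEMeasurable w (riemannianVolume n M)) (hv : AEMeasurable v (riemannianVolume n M)) :
    weightedEnergy (n := n) w v (fun x => η x * Real.cos (N * ψ x)) +
      weightedEnergy (n := n) w v (fun x => η x * Real.sin (N * ψ x)) =
    weightedEnergy (n := n) w v η + ENNReal.ofReal (N ^ 2) *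
      ∫⁻ x, v x * (‖smoothGrad n ψ x‖ₑ ^ 2 * ‖η x‖ₑ ^ 2) ∂(riemannianVolume n M) := by
  obtain ⟨t1, t2⟩ := hη.mul_cos hψ N
  have e1 : ∀ a : ℝ, ‖a‖ₑ ^ 2 = ENNReal.ofReal (a ^ 2) := fun a => by
    rw [← ofReal_norm, ← ENNReal.ofReal_pow (norm_nonneg _), Real.norm_eq_abs, sq_abs]
  have e2 : ∀ (f : M → ℝ) x, ‖smoothGrad n f x‖ₑ ^ 2 = ENNReal.ofReal (‖smoothGrad n f x‖ ^ 2) :=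
    fun f x => by rw [← ofReal_norm, ← ENNReal.ofReal_pow (norm_nonneg _)]
  have m1 : ∀ {f : M → ℝ}, IsTestFunction n f →
      AEMeasurable (fun x => ENNReal.ofReal (f x ^ 2)) (riemannianVolume n M) := fun h =>
    (h.1.continuous.measurable.pow_const 2).ennreal_ofReal.aemeasurable
  have m2 : ∀ {f : M → ℝ}, IsTestFunction n f →
      AEMeasurable (fun x => ENNReal.ofReal (‖smoothGrad n f x‖ ^ 2)) (riemannianVolume n M) :=
    fun h => ((continuous_norm_smoothGrad h.contMDiff_one).measurable.pow_const
      2).ennreal_ofReal.aemeasurable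
  unfold weightedEnergy
  simp only [e1, e2]
  have l1 := lintegral_add_left'
    (f := fun x => w x * ENNReal.ofReal ((η x * Real.cos (N * ψ x)) ^ 2)) (hw.mul (m1 t1))
    (fun x => w x * ENNReal.ofReal ((η x * Real.sin (N * ψ x)) ^ 2))
  have l2 := lintegral_add_left'
    (f := fun x => v x * ENNReal.ofReal (‖smoothGrad n (fun x => η x * Real.cos (N * ψ x)) x‖ ^ 2))
    (hv.mul (m2 t1))
    (fun x => v x * ENNReal.ofReal (‖smoothGrad n (fun x => η x * Real.sin (N * ψ x)) x‖ ^ 2))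
  have l3 := lintegral_const_mul'' (ENNReal.ofReal (N ^ 2))
    (f := fun x => v x * (ENNReal.ofReal (‖smoothGrad n ψ x‖ ^ 2) * ENNReal.ofReal (η x ^ 2)))
    (hv.mul ((m2 hψ).mul (m1 hη)))
  have l4 := lintegral_add_left'
    (f := fun x => v x * ENNReal.ofReal (‖smoothGrad n η x‖ ^ 2)) (hv.mul (m2 hη))
    (fun x => ENNReal.ofReal (N ^ 2) *
      (v x * (ENNReal.ofReal (‖smoothGrad n ψ x‖ ^ 2) * ENNReal.ofReal (η x ^ 2))))
  rw [add_add_add_comm, ← l1, ← l2, add_assoc, ← l3, ← l4]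
  congr 1
  · refine lintegral_congr fun x => ?_
    rw [← mul_add, ← ENNReal.ofReal_add (by positivity) (by positivity)]
    congr 2
    linear_combination (η x ^ 2) * Real.sin_sq_add_cos_sq (N * ψ x)
  · refine lintegral_congr fun x => ?_
    rw [← mul_add, ← ENNReal.ofReal_add (by positivity) (by positivity),
      norm_sq_smoothGrad_mul_cos_add hη hψ, ENNReal.ofReal_add (by positivity) (by positivity),
      mul_add, ← ENNReal.ofReal_mul (by positivity), mul_left_comm (ENNReal.ofReal (N ^ 2)),
      ← ENNReal.ofReal_mul (by positivity)]
    congr 4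
    ring

/-- Division by `k ^ 2` makes `d` negligible for large `k`, provided that `d` is finite; `c` is
discarded. -/
lemma ENNReal_le_of_forall_nat_mul {a b c d : ℝ≥0∞} (hd : d ≠ ⊤)
    (h : ∀ k : ℕ, c + ENNReal.ofReal ((k : ℝ) ^ 2) * a ≤ d + ENNReal.ofReal ((k : ℝ) ^ 2) * b) :
    a ≤ b := by
  refine ENNReal.le_of_forall_pos_le_add fun ε hε hb => ?_
  obtain ⟨k, hk⟩ := exists_nat_gt (d.toReal / ε + 1)
  have hεr : (0 : ℝ) < ε := hε
  have hk1 : (1 : ℝ) < k := by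
    have : 0 ≤ d.toReal / ε := by positivity
    linarith
  have hk2 : (0 : ℝ) < (k : ℝ) ^ 2 := by positivity
  have h1 : ENNReal.ofReal ((k : ℝ) ^ 2) * a ≤ ENNReal.ofReal ((k : ℝ) ^ 2) * (b + ε) := by
    refine (le_add_self.trans (h k)).trans ?_
    rw [mul_add, add_comm]
    gcongr
    rw [← ENNReal.ofReal_toReal hd, ← ENNReal.ofReal_coe_nnreal,
      ← ENNReal.ofReal_mul hk2.le]
    refine ENNReal.ofReal_le_ofReal ?_
    have h2 : d.toReal / ε < k := by linarith
    rw [div_lt_iff₀ hεr] at h2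
    have h3 : (k : ℝ) * ε ≤ (k : ℝ) ^ 2 * ε := by
      gcongr
      nlinarith
    linarith
  exact (ENNReal.mul_le_mul_iff_right (by simpa using (by linarith : (0 : ℝ) < k).ne')
    ENNReal.ofReal_ne_top).1 h1

lemma ae_mul_le_of_forall_test {v v' G : M → ℝ≥0∞} {C : ℝ≥0∞}
    (hv : AEMeasurable v (riemannianVolume n M)) (hv' : AEMeasurable v' (riemannianVolume n M))
    (hG : Measurable G) (hC : C ≠ ⊤) (hGC : ∀ x, G x ≤ C)
    (hvi : ∫⁻ x, v x ∂(riemannianVolume n M) ≠ ⊤)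
    (hvi' : ∫⁻ x, v' x ∂(riemannianVolume n M) ≠ ⊤)
    (h : ∀ η : M → ℝ, IsTestFunction n η →
      ∫⁻ x, v x * (G x * ‖η x‖ₑ ^ 2) ∂(riemannianVolume n M) ≤
        ∫⁻ x, v' x * (G x * ‖η x‖ₑ ^ 2) ∂(riemannianVolume n M)) :
    ∀ᵐ x ∂(riemannianVolume n M), v x * G x ≤ v' x * G x := by
  have hfinm : ∀ v : M → ℝ≥0∞, ∫⁻ x, v x ∂(riemannianVolume n M) ≠ ⊤ →
      IsFiniteMeasure ((riemannianVolume n M).withDensity fun x => v x * G x) := fun v hv => by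
    refine isFiniteMeasure_withDensity ?_
    refine ne_top_of_le_ne_top (b := (∫⁻ x, v x ∂(riemannianVolume n M)) * C) (by finiteness) ?_
    rw [← lintegral_mul_const' _ _ hC]
    exact lintegral_mono fun x => mul_le_mul_right (hGC x) _
  have := hfinm v hvi
  have := hfinm v' hvi'
  have hle := measure_le_of_forall_test (n := n)
    (ν₁ := (riemannianVolume n M).withDensity fun x => v x * G x)
    (ν₂ := (riemannianVolume n M).withDensity fun x => v' x * G x)
    fun η hη => by
      have hηm : AEMeasurable (fun x => ‖η x‖ₑ ^ 2) (riemannianVolume n M) :=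
        (hη.1.continuous.measurable.enorm.pow_const 2).aemeasurable
      rw [lintegral_withDensity_eq_lintegral_mul₀ (f := fun x => v x * G x)
          (hv.mul hG.aemeasurable) hηm,
        lintegral_withDensity_eq_lintegral_mul₀ (f := fun x => v' x * G x)
          (hv'.mul hG.aemeasurable) hηm]
      simpa only [Pi.mul_apply, mul_assoc] using h η hη
  refine ae_le_of_forall_setLIntegral_le_of_sigmaFinite₀ (hv.mul hG.aemeasurable)
    fun s hs _ => ?_
  have := hle s
  rwa [withDensity_apply _ hs, withDensity_apply _ hs] at this

/-- Comparison of weighted energies on test functions compares the weights of the gradients. -/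
lemma weight_ae_le_of_weightedEnergy_le (hn : 0 < n) {w v w' v' : M → ℝ≥0∞}
    (hw : AEMeasurable w (riemannianVolume n M)) (hv : AEMeasurable v (riemannianVolume n M))
    (hw' : AEMeasurable w' (riemannianVolume n M)) (hv' : AEMeasurable v' (riemannianVolume n M))
    (hvi : ∫⁻ x, v x ∂(riemannianVolume n M) ≠ ⊤)
    (hvi' : ∫⁻ x, v' x ∂(riemannianVolume n M) ≠ ⊤)
    (hfin : ∀ η, IsTestFunction n η → weightedEnergy (n := n) w' v' η ≠ ⊤)
    (h : ∀ η, IsTestFunction n η →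
      weightedEnergy (n := n) w v η ≤ weightedEnergy (n := n) w' v' η) :
    ∀ᵐ x ∂(riemannianVolume n M), v x ≤ v' x := by
  have key : ∀ ψ, IsTestFunction n ψ →
      ∀ᵐ x ∂(riemannianVolume n M), v x * ‖smoothGrad n ψ x‖ₑ ^ 2 ≤
        v' x * ‖smoothGrad n ψ x‖ₑ ^ 2 := fun ψ hψ => by
    have hcg := continuous_norm_smoothGrad hψ.contMDiff_one
    have hgm : Measurable (fun x => ‖smoothGrad n ψ x‖ₑ ^ 2) := by
      have := hcg.measurable.enorm
      simp only [enorm_norm] at this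
      exact this.pow_const 2
    obtain ⟨C, hC⟩ := (hasCompactSupport_norm_smoothGrad hψ.2).exists_bound_of_continuous hcg
    refine ae_mul_le_of_forall_test (C := ENNReal.ofReal C ^ 2) hv hv' hgm (by finiteness)
      (fun x => ?_) hvi hvi' fun η hη => ?_
    · gcongr
      rw [← ofReal_norm]
      exact ENNReal.ofReal_le_ofReal (by simpa using hC x)
    -- The hypothesis is added up for `η cos (kψ)` and `η sin (kψ)`; the terms of order `k ^ 2`
    -- contain only the gradient weights.
    · refine ENNReal_le_of_forall_nat_mul (c := weightedEnergy (n := n) w v η) (hfin η hη) fun k => ?_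
      rw [← weightedEnergy_mul_cos_add hη hψ k hw hv,
        ← weightedEnergy_mul_cos_add hη hψ k hw' hv']
      exact add_le_add (h _ (hη.mul_cos hψ k).1) (h _ (hη.mul_cos hψ k).2)
  -- Countably many phases suffice for some gradient to be nonzero at each point, so the factor
  -- `‖∇ψ‖ ^ 2` can be cancelled.
  choose ψ hψ hψ' using fun p : M => exists_test_smoothGrad_ne_zero (n := n) hn p
  obtain ⟨s, hs, hs'⟩ := TopologicalSpace.countable_cover_nhds (fun p : M => hψ' p)
  have := (ae_ball_iff hs).2 (fun p _ => key (ψ p) (hψ p))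
  filter_upwards [this] with x hx
  have hxu : x ∈ ⋃ p ∈ s, {x | smoothGrad n (ψ p) x ≠ 0} := by
    have h0 : (⋃ p ∈ s, {x | smoothGrad n (ψ p) x ≠ 0}) = univ := hs'
    rw [h0]; trivial
  simp only [mem_iUnion] at hxu
  obtain ⟨p, hp, hxp⟩ := hxu
  have h1 := hx p hp
  have h2 : ‖smoothGrad n (ψ p) x‖ₑ ^ 2 ≠ 0 := by simpa using hxp
  exact (ENNReal.mul_le_mul_iff_left h2 (by finiteness)).1 h1

lemma weightedEnergy_const_mul {c : ℝ≥0∞} (hc : c ≠ ⊤) (w v : M → ℝ≥0∞) (f : M → ℝ) :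
    weightedEnergy (n := n) (fun x => c * w x) (fun x => c * v x) f =
      c * weightedEnergy (n := n) w v f := by
  simp only [weightedEnergy, mul_assoc]
  rw [lintegral_const_mul' _ _ hc, lintegral_const_mul' _ _ hc, mul_add]

lemma IsTestFunction.weightedEnergy_eq (hn : 3 ≤ n) {η : M → ℝ} (hη : IsTestFunction n η)
    (hu : AEStronglyMeasurable u (riemannianVolume n M))
    (hu0 : ∀ᵐ x ∂(riemannianVolume n M), 0 < u x) :
    weightedEnergy (n := n)
      (fun x => ENNReal.ofReal (u x ^ (2 * (n : ℝ) / ((n : ℝ) - 2))))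
      (fun x => ENNReal.ofReal (u x ^ 2)) η = h1NormSq n u η := by
  rw [h1NormSq, hη.hasH1Gradient.l2NormSq_eq hu, hη.hasH1Gradient.gradNormSq_eq hn hu hu0]
  rfl

lemma IsTestFunction.weightedEnergy_one (hn : 3 ≤ n) {η : M → ℝ} (hη : IsTestFunction n η) :
    weightedEnergy (n := n) (fun _ => 1) (fun _ => 1) η = h1NormSq n 1 η := by
  rw [← hη.weightedEnergy_eq hn (u := 1) aestronglyMeasurable_const (by simp)]
  simp

/-- Equivalence of the `H¹` norms of `g₀` and `u ^ (4 / (n - 2)) g₀` bounds the conformal factor. -/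
theorem conformalFactor_bounds (hn : 3 ≤ n) (hu : MemLp u 2 (riemannianVolume n M))
    (hu0 : ∀ᵐ x ∂(riemannianVolume n M), 0 < u x) {K : ℝ≥0}
    (hK : ∀ f : M → ℝ, MemH1 n 1 f →
      h1NormSq n u f ≤ K * h1NormSq n 1 f ∧ h1NormSq n 1 f ≤ K * h1NormSq n u f) :
    ∀ᵐ x ∂(riemannianVolume n M), u x ^ 2 ≤ K ∧ 1 ≤ K * u x ^ 2 := by
  have hm := hu.1
  have m1 : AEMeasurable (fun x => ENNReal.ofReal (u x ^ (2 * (n : ℝ) / ((n : ℝ) - 2))))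
      (riemannianVolume n M) := (hm.aemeasurable.pow_const _).ennreal_ofReal
  have m2 : AEMeasurable (fun x => ENNReal.ofReal (u x ^ 2)) (riemannianVolume n M) :=
    (hm.aemeasurable.pow_const 2).ennreal_ofReal
  have hfin : ∫⁻ x, ENNReal.ofReal (u x ^ 2) ∂(riemannianVolume n M) ≠ ⊤ :=
    (hu.integrable_sq.lintegral_lt_top).ne
  have hKt : (K : ℝ≥0∞) ≠ ⊤ := ENNReal.coe_ne_top
  have h1 : ∀ η : M → ℝ, IsTestFunction n η → h1NormSq n 1 η ≠ ⊤ := fun η hη =>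
    hη.hasH1Gradient.memH1.2.2.ne
  have h2 : ∀ η : M → ℝ, IsTestFunction n η → h1NormSq n u η ≠ ⊤ := fun η hη =>
    ne_top_of_le_ne_top (ENNReal.mul_ne_top hKt (h1 η hη)) (hK η hη.hasH1Gradient.memH1).1
  have upper := weight_ae_le_of_weightedEnergy_le (n := n) (by omega) m1 m2
    (w' := fun _ : M => K * 1) (v' := fun _ : M => K * 1) aemeasurable_const aemeasurable_const hfin
    (by simp [measure_ne_top, ENNReal.mul_eq_top])
    (fun η hη => by
      rw [weightedEnergy_const_mul hKt, hη.weightedEnergy_one hn]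
      exact ENNReal.mul_ne_top hKt (h1 η hη))
    (fun η hη => by
      rw [weightedEnergy_const_mul hKt, hη.weightedEnergy_one hn, hη.weightedEnergy_eq hn hm hu0]
      exact (hK η hη.hasH1Gradient.memH1).1)
  have lower := weight_ae_le_of_weightedEnergy_le (n := n) (by omega)
    (w := fun _ : M => 1) (v := fun _ : M => 1) aemeasurable_const aemeasurable_const
    (m1.const_mul (K : ℝ≥0∞)) (m2.const_mul (K : ℝ≥0∞)) (by simp [measure_ne_top])
    (by rw [lintegral_const_mul' _ _ hKt]; exact ENNReal.mul_ne_top hKt hfin)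
    (fun η hη => by
      rw [weightedEnergy_const_mul hKt, hη.weightedEnergy_eq hn hm hu0]
      exact ENNReal.mul_ne_top hKt (h2 η hη))
    (fun η hη => by
      rw [weightedEnergy_const_mul hKt, hη.weightedEnergy_one hn, hη.weightedEnergy_eq hn hm hu0]
      exact (hK η hη.hasH1Gradient.memH1).2)
  filter_upwards [upper, lower] with x h3 h4
  rw [mul_one, ← ENNReal.ofReal_coe_nnreal,
    ENNReal.ofReal_le_ofReal_iff K.coe_nonneg] at h3
  rw [← ENNReal.ofReal_coe_nnreal, ← ENNReal.ofReal_mul K.coe_nonneg, ← ENNReal.ofReal_one,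
    ENNReal.ofReal_le_ofReal_iff (by positivity)] at h4
  exact ⟨h3, h4⟩

end ConformalFactor

/-! ### Limits of integrals of products -/

section LimitsOfIntegrals

variable {α ι : Type*} [MeasurableSpace α] {μ : Measure α}

lemma tendsto_integral_of_abs_sub_le_mul {l : Filter ι} {F d : ι → α → ℝ} {F₀ b : α → ℝ}
    (hF : ∀ᶠ i in l, Integrable (F i) μ) (hF₀ : AEStronglyMeasurable F₀ μ) (hb : MemLp b 2 μ)
    (hd : ∀ᶠ i in l, AEStronglyMeasurable (d i) μ)
    (hle : ∀ᶠ i in l, ∀ᵐ x ∂μ, |F i x - F₀ x| ≤ |b x| * |d i x|)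
    (hlim : Tendsto (fun i => eLpNorm (d i) 2 μ) l (𝓝 0)) :
    Tendsto (fun i => ∫ x, F i x ∂μ) l (𝓝 (∫ x, F₀ x ∂μ)) := by
  refine tendsto_integral_of_L1 F₀ hF₀ hF ?_
  have h1 : Tendsto (fun i => eLpNorm b 2 μ * eLpNorm (d i) 2 μ) l (𝓝 0) := by
    simpa using ENNReal.Tendsto.const_mul hlim (Or.inr hb.2.ne)
  refine tendsto_of_tendsto_of_tendsto_of_le_of_le' tendsto_const_nhds h1
    (Eventually.of_forall fun _ => zero_le) ?_
  filter_upwards [hd, hle] with i hi hi'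
  calc ∫⁻ x, ‖F i x - F₀ x‖ₑ ∂μ ≤ ∫⁻ x, ‖(b • d i) x‖ₑ ∂μ := by
        refine lintegral_mono_ae ?_
        filter_upwards [hi'] with x hx
        rw [Pi.smul_apply', smul_eq_mul, enorm_mul, ← ofReal_norm, ← ofReal_norm, ← ofReal_norm,
          ← ENNReal.ofReal_mul (norm_nonneg _)]
        exact ENNReal.ofReal_le_ofReal hx
    _ = eLpNorm (b • d i) 1 μ := eLpNorm_one_eq_lintegral_enorm.symm
    _ ≤ _ := eLpNorm_smul_le_mul_eLpNorm hi hb.1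

lemma tendsto_of_tendsto_sq {l : Filter ι} {f : ι → ℝ≥0∞}
    (h : Tendsto (fun i => f i ^ 2) l (𝓝 0)) : Tendsto f l (𝓝 0) := by
  have h1 := ((ENNReal.continuous_rpow_const (y := 1 / 2)).tendsto 0).comp h
  have h2 : (0 : ℝ≥0∞) ^ (1 / 2 : ℝ) = 0 := ENNReal.zero_rpow_of_pos (by norm_num)
  rw [h2] at h1
  refine h1.congr fun i => ?_
  rw [Function.comp_apply, ← ENNReal.rpow_natCast, ← ENNReal.rpow_mul]
  norm_num

lemma memLp_mul_of_bound {f a : α → ℝ} {C : ℝ} {p : ℝ≥0∞} (hf : MemLp f p μ)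
    (ha : AEStronglyMeasurable a μ) (hC : ∀ᵐ x ∂μ, |a x| ≤ C) :
    MemLp (fun x => f x * a x) p μ := by
  refine hf.of_le_mul (c := C) (hf.1.mul ha) ?_
  filter_upwards [hC] with x hx
  rw [norm_mul, mul_comm]
  exact mul_le_mul_of_nonneg_right hx (norm_nonneg _)

lemma integrable_mul_of_memLp_two {f g : α → ℝ} (hf : MemLp f 2 μ) (hg : MemLp g 2 μ) :
    Integrable (fun x => f x * g x) μ := hf.integrable_mul hg

end LimitsOfIntegrals

/-! ### Weak equations tested with functions in `H¹` -/

section WeakEquations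

variable {n : ℕ} {M : Type*} [TopologicalSpace M] [ChartedSpace (EuclideanSpace ℝ (Fin n)) M]
  [IsManifold (𝓡 n) ∞ M] [RiemannianBundle (fun x : M => TangentSpace (𝓡 n) x)]
  [IsContMDiffRiemannianBundle (𝓡 n) ∞ (EuclideanSpace ℝ (Fin n))
      (fun x : M => TangentSpace (𝓡 n) x)]
  [MeasurableSpace M] [BorelSpace M] [SecondCountableTopology M] [T2Space M]
  [IsFiniteMeasure (riemannianVolume n M)]
  {f g u : M → ℝ} {X Y Z : ∀ x : M, TangentSpace (𝓡 n) x}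

lemma integrable_inner (hX : MeasurableField n X) (hY : MeasurableField n Y)
    (h : MemLp (fun x => ‖X x‖) 2 (riemannianVolume n M))
    (h' : MemLp (fun x => ‖Y x‖) 2 (riemannianVolume n M)) :
    Integrable (fun x => inner ℝ (X x) (Y x)) (riemannianVolume n M) := by
  refine (h.integrable_mul h').mono (hX.aestronglyMeasurable_inner hY) (ae_of_all _ fun x => ?_)
  exact (norm_inner_le_norm (𝕜 := ℝ) (X x) (Y x)).trans (le_abs_self _)

lemma tendsto_integral_mul_inner {W : ℕ → ∀ x : M, TangentSpace (𝓡 n) x} {a : M → ℝ} {C : ℝ}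
    (ha : AEStronglyMeasurable a (riemannianVolume n M))
    (hC : ∀ᵐ x ∂(riemannianVolume n M), |a x| ≤ C) (hX : MeasurableField n X)
    (h : MemLp (fun x => ‖X x‖) 2 (riemannianVolume n M)) (hW : ∀ k, MeasurableField n (W k))
    (hW' : ∀ k, MemLp (fun x => ‖W k x‖) 2 (riemannianVolume n M)) (hZ : MeasurableField n Z)
    (hlim : Tendsto (fun k => eLpNorm (fun x => ‖W k x - Z x‖) 2 (riemannianVolume n M))
      atTop (𝓝 0)) :
    Tendsto (fun k => ∫ x, a x * inner ℝ (X x) (W k x) ∂(riemannianVolume n M)) atTop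
      (𝓝 (∫ x, a x * inner ℝ (X x) (Z x) ∂(riemannianVolume n M))) := by
  refine tendsto_integral_of_abs_sub_le_mul (b := fun x => ‖X x‖ * C)
    (d := fun k x => ‖W k x - Z x‖) (Eventually.of_forall fun k => ?_)
    (ha.mul (hX.aestronglyMeasurable_inner hZ)) (h.mul_const C)
    (Eventually.of_forall fun k => ((hW k).sub hZ).aestronglyMeasurable_norm)
    (Eventually.of_forall fun k => ?_) hlim
  · exact (integrable_inner hX (hW k) h (hW' k)).bdd_mul ha hC
  · filter_upwards [hC] with x hx
    rw [← mul_sub, ← inner_sub_right, abs_mul, abs_norm]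
    have h1 := abs_real_inner_le_norm (X x) (W k x - Z x)
    calc |a x| * |inner ℝ (X x) (W k x - Z x)| ≤ C * (‖X x‖ * ‖W k x - Z x‖) :=
          mul_le_mul hx h1 (abs_nonneg _) ((abs_nonneg _).trans hx)
      _ = ‖X x‖ * C * ‖W k x - Z x‖ := by ring
      _ ≤ _ := by gcongr; exact le_abs_self _

lemma integral_confVolume (hu : AEStronglyMeasurable u (riemannianVolume n M))
    (hu0 : ∀ᵐ x ∂(riemannianVolume n M), 0 < u x) (F : M → ℝ) :
    ∫ x, F x ∂(confVolume n u) =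
      ∫ x, F x * u x ^ (2 * (n : ℝ) / ((n : ℝ) - 2)) ∂(riemannianVolume n M) := by
  rw [confVolume, integral_withDensity_eq_integral_toReal_smul₀
    (hu.aemeasurable.pow_const _).ennreal_ofReal (by simp)]
  refine integral_congr_ae ?_
  filter_upwards [hu0] with x hx
  rw [ENNReal.toReal_ofReal (by positivity), smul_eq_mul, mul_comm]

/-- A weak equation against test functions extends to bounded functions in `H¹`. -/
lemma weakEquation_bounded (hd : TestFunctionsDense n M) {a b : M → ℝ} {C : ℝ}
    (ha : AEStronglyMeasurable a (riemannianVolume n M))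
    (haC : ∀ᵐ x ∂(riemannianVolume n M), |a x| ≤ C) (hX : MeasurableField n X)
    (h : MemLp (fun x => ‖X x‖) 2 (riemannianVolume n M))
    (hb : Integrable b (riemannianVolume n M))
    (heq : ∀ φ : M → ℝ, IsTestFunction n φ →
      ∫ x, a x * inner ℝ (X x) (smoothGrad n φ x) ∂(riemannianVolume n M) =
        ∫ x, b x * φ x ∂(riemannianVolume n M))
    {φ : M → ℝ} (hφ : HasH1Gradient n φ Z) {K : ℝ}
    (hK : ∀ᵐ x ∂(riemannianVolume n M), |φ x| ≤ K) :
    ∫ x, a x * inner ℝ (X x) (Z x) ∂(riemannianVolume n M) =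
      ∫ x, b x * φ x ∂(riemannianVolume n M) := by
  -- As `b` is only integrable, the right side passes to the limit only along uniformly bounded test
  -- functions; `|K| + 1` makes the bound positive.
  obtain ⟨ψ, hψ, hψK, hψt, hψg⟩ := hφ.exists_tendstoH1_bounded hd (C := |K| + 1) (by positivity)
    (by filter_upwards [hK] with x hx; exact hx.trans (by linarith [le_abs_self K]))
  have h1 := tendsto_integral_mul_inner ha haC hX h
    (fun k => (hψ k).hasH1Gradient.measurableField) (fun k => (hψ k).hasH1Gradient.memLp_grad)
    hφ.measurableField hψg
  have h2 : Tendsto (fun k => ∫ x, b x * ψ k x ∂(riemannianVolume n M)) atTop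
      (𝓝 (∫ x, b x * φ x ∂(riemannianVolume n M))) := by
    refine tendsto_integral_of_dominated_convergence (fun x => |b x| * (2 * (|K| + 1)))
      (fun k => hb.1.mul (hψ k).1.continuous.aestronglyMeasurable) (hb.abs.mul_const _)
      (fun k => ae_of_all _ fun x => ?_) ?_
    · rw [norm_mul]
      exact mul_le_mul_of_nonneg_left (hψK k x) (abs_nonneg _)
    · filter_upwards [hψt] with x hx
      exact hx.const_mul _
  exact tendsto_nhds_unique h1 (h2.congr fun k => (heq _ (hψ k)).symm)

/-- A weak equation against test functions extends to `H¹` if its right side is in `L²`. -/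
lemma weakEquation_memLp (hd : TestFunctionsDense n M) {b : M → ℝ} (hX : MeasurableField n X)
    (h : MemLp (fun x => ‖X x‖) 2 (riemannianVolume n M))
    (hb : MemLp b 2 (riemannianVolume n M))
    (heq : ∀ φ : M → ℝ, IsTestFunction n φ →
      ∫ x, inner ℝ (X x) (smoothGrad n φ x) ∂(riemannianVolume n M) =
        ∫ x, b x * φ x ∂(riemannianVolume n M))
    {φ : M → ℝ} (hφ : HasH1Gradient n φ Z) :
    ∫ x, inner ℝ (X x) (Z x) ∂(riemannianVolume n M) =
      ∫ x, b x * φ x ∂(riemannianVolume n M) := by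
  obtain ⟨ψ, hψ, hlim⟩ := hφ.exists_tendstoH1 hd
  have h1 := tendsto_integral_mul_inner (a := fun _ => 1) (C := 1) aestronglyMeasurable_const
    (by simp) hX h
    (fun k => (hψ k).hasH1Gradient.measurableField) (fun k => (hψ k).hasH1Gradient.memLp_grad)
    hφ.measurableField hlim.tendsto_grad
  simp only [one_mul] at h1
  have h2 : Tendsto (fun k => ∫ x, b x * ψ k x ∂(riemannianVolume n M)) atTop
      (𝓝 (∫ x, b x * φ x ∂(riemannianVolume n M))) := by
    refine tendsto_integral_of_abs_sub_le_mul (b := b) (d := fun k => ψ k - φ)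
      (Eventually.of_forall fun k => hb.integrable_mul (hψ k).hasH1Gradient.memLp)
      (hb.1.mul hφ.memLp.1) hb
      (Eventually.of_forall fun k => (hψ k).hasH1Gradient.memLp.1.sub hφ.memLp.1)
      (Eventually.of_forall fun k => ae_of_all _ fun x => ?_) hlim.tendsto
    rw [← mul_sub, abs_mul]
    rfl
  exact tendsto_nhds_unique h1 (h2.congr fun k => (heq _ (hψ k)).symm)

end WeakEquations

/-! ### The flow written in terms of the background metric -/

section RegularFlow

/-- The exponent `2n / (n - 2)`. -/
def volExp (n : ℕ) : ℝ := 2 * (n : ℝ) / ((n : ℝ) - 2)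

/-- The exponent `(n + 2) / (n - 2)`. -/
def scalExp (n : ℕ) : ℝ := ((n : ℝ) + 2) / ((n : ℝ) - 2)

variable (n : ℕ) {M : Type*} [TopologicalSpace M] [ChartedSpace (EuclideanSpace ℝ (Fin n)) M]
  [RiemannianBundle (fun x : M => TangentSpace (𝓡 n) x)] [MeasurableSpace M]

/-- The analytic properties of the normalized Yamabe flow: all equations are written with respect
to the background metric, and hold against functions in `H¹`. -/
structure RegularFlow (T K A B : ℝ) (u S S' : ℝ → M → ℝ) (ρ : ℝ → ℝ) : Prop where
  one_le : 1 ≤ K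
  u_mem : ∀ t ∈ Icc 0 T, ∀ᵐ x ∂(riemannianVolume n M), u t x ∈ Icc K⁻¹ K
  u_h1 : ∀ t ∈ Icc 0 T, HasH1Gradient n (u t) (weakGrad n (u t))
  S_h1 : ∀ t ∈ Icc 0 T, HasH1Gradient n (S t) (weakGrad n (S t))
  S'_memLp : ∀ t ∈ Ioo 0 T, MemLp (S' t) 2 (riemannianVolume n M)
  u_cont : ∀ t ∈ Icc 0 T,
    Tendsto (fun s => eLpNorm (u s - u t) 2 (riemannianVolume n M)) (𝓝[Icc 0 T] t) (𝓝 0)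
  S_cont : ∀ t ∈ Icc 0 T,
    Tendsto (fun s => eLpNorm (S s - S t) 2 (riemannianVolume n M)) (𝓝[Icc 0 T] t) (𝓝 0)
  u_deriv : ∀ t ∈ Ioo 0 T, Tendsto (fun s => eLpNorm (fun x => (s - t)⁻¹ * (u s x - u t x) -
      (-(((n : ℝ) - 2) / 4) * (S t x - ρ t) * u t x)) 2 (riemannianVolume n M)) (𝓝[≠] t) (𝓝 0)
  S_deriv : ∀ t ∈ Ioo 0 T, Tendsto (fun s => eLpNorm (fun x => (s - t)⁻¹ * (S s x - S t x) -
      S' t x) 2 (riemannianVolume n M)) (𝓝[≠] t) (𝓝 0)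
  u_zero : u 0 =ᵐ[riemannianVolume n M] fun _ => 1
  S_zero : S 0 =ᵐ[riemannianVolume n M] fun x => scalarCurvature n x
  scal_memLp : MemLp (fun x : M => scalarCurvature n x) 2 (riemannianVolume n M)
  evol : ∀ t ∈ Ioo 0 T, ∀ φ Z (C : ℝ), HasH1Gradient n φ Z →
    (∀ᵐ x ∂(riemannianVolume n M), |φ x| ≤ C) →
    ((n : ℝ) - 1) * ∫ x, u t x ^ 2 * inner ℝ (weakGrad n (S t) x) (Z x) ∂(riemannianVolume n M) =
      ∫ x, (S t x * (S t x - ρ t) - S' t x) * u t x ^ volExp n * φ x ∂(riemannianVolume n M)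
  scalar : ∀ t ∈ Icc 0 T, ∀ φ Z, HasH1Gradient n φ Z →
    4 * ((n : ℝ) - 1) / ((n : ℝ) - 2) *
        ∫ x, inner ℝ (weakGrad n (u t) x) (Z x) ∂(riemannianVolume n M) =
      ∫ x, (S t x * u t x ^ scalExp n - scalarCurvature n x * u t x) * φ x ∂(riemannianVolume n M)
  sobolev : ∀ t ∈ Icc 0 T, ∀ φ Z (C : ℝ), HasH1Gradient n φ Z →
    (∀ᵐ x ∂(riemannianVolume n M), |φ x| ≤ C) →
    (∫ x, |φ x| ^ volExp n * u t x ^ volExp n ∂(riemannianVolume n M)) ^ (2 / volExp n) ≤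
      A * ∫ x, u t x ^ 2 * ‖Z x‖ ^ 2 ∂(riemannianVolume n M) +
        B * ∫ x, φ x ^ 2 * u t x ^ volExp n ∂(riemannianVolume n M)
  average_eq : ∀ t ∈ Icc 0 T, ρ t = (∫ x, u t x ^ volExp n ∂(riemannianVolume n M))⁻¹ *
    ∫ x, S t x * u t x ^ volExp n ∂(riemannianVolume n M)
  total_nonneg : ∀ t ∈ Icc 0 T, 0 ≤ ∫ x, S t x * u t x ^ volExp n ∂(riemannianVolume n M)

end RegularFlow

/-! ### Sobolev inequality and evolution equation with respect to the background metric -/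

section Construction

variable {n : ℕ} {M : Type*} [TopologicalSpace M] [ChartedSpace (EuclideanSpace ℝ (Fin n)) M]
  [IsManifold (𝓡 n) ∞ M] [RiemannianBundle (fun x : M => TangentSpace (𝓡 n) x)]
  [IsContMDiffRiemannianBundle (𝓡 n) ∞ (EuclideanSpace ℝ (Fin n))
      (fun x : M => TangentSpace (𝓡 n) x)]
  [MeasurableSpace M] [BorelSpace M] [SecondCountableTopology M] [T2Space M]
  [IsProbabilityMeasure (riemannianVolume n M)]
  {f g u : M → ℝ} {X Y Z : ∀ x : M, TangentSpace (𝓡 n) x}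

lemma rpow_mem_of_mem_Icc {K : ℝ} (hK : 1 ≤ K) (r : ℝ) {w : ℝ} (hw : w ∈ Icc K⁻¹ K) :
    w ^ r ∈ Icc (K ^ |r|)⁻¹ (K ^ |r|) := by
  have hK0 : 0 < K := by linarith
  have hw0 : 0 < w := lt_of_lt_of_le (by positivity) hw.1
  have h1 : ∀ s : ℝ, 0 ≤ s → w ^ s ∈ Icc (K ^ s)⁻¹ (K ^ s) := fun s hs =>
    ⟨by rw [← Real.inv_rpow hK0.le]; exact Real.rpow_le_rpow (by positivity) hw.1 hs,
      Real.rpow_le_rpow hw0.le hw.2 hs⟩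
  rcases le_total 0 r with hr | hr
  · rw [abs_of_nonneg hr]; exact h1 r hr
  · rw [abs_of_nonpos hr]
    have h2 := h1 (-r) (by linarith)
    have h3 : w ^ r = (w ^ (-r))⁻¹ := by rw [Real.rpow_neg hw0.le, inv_inv]
    rw [h3]
    exact ⟨inv_anti₀ (by positivity) h2.2, by
      have := inv_anti₀ (by positivity) h2.1
      rwa [inv_inv] at this⟩

lemma rpow_abs_le_of_mem_Icc {K : ℝ} (hK : 1 ≤ K) (r : ℝ) {w : ℝ} (hw : w ∈ Icc K⁻¹ K) :
    |w ^ r| ≤ K ^ |r| := by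
  have hw0 : 0 < w := lt_of_lt_of_le (by positivity) hw.1
  rw [abs_of_pos (by positivity)]
  exact (rpow_mem_of_mem_Icc hK r hw).2

lemma mem_Icc_of_sq_bounds {K₀ w : ℝ} (hK₀ : 0 ≤ K₀) (hw : 0 < w) (h : w ^ 2 ≤ K₀)
    (h' : 1 ≤ K₀ * w ^ 2) : w ∈ Icc (K₀ + 1)⁻¹ (K₀ + 1) := by
  constructor
  · rw [inv_le_iff_one_le_mul₀ (by positivity)]
    by_contra! hc
    have h1 : ((K₀ + 1) * w) ^ 2 < 1 := by
      have : 0 ≤ (K₀ + 1) * w := by positivity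
      rw [mul_comm] at hc
      nlinarith
    nlinarith [sq_nonneg w, mul_nonneg hK₀ (sq_nonneg w)]
  · nlinarith

lemma volExp_pos (hn : 3 ≤ n) : 0 < volExp n := by
  have : (3 : ℝ) ≤ n := by exact_mod_cast hn
  unfold volExp
  have : (0 : ℝ) < n - 2 := by linarith
  positivity

lemma scalExp_add_one (hn : 3 ≤ n) : scalExp n + 1 = volExp n := by
  have : (3 : ℝ) ≤ n := by exact_mod_cast hn
  unfold scalExp volExp
  have : (n : ℝ) - 2 ≠ 0 := by linarith
  field_simp
  ring

/-- For bounded `f` and `u` all three norms are finite, which allows the inequality in `ℝ≥0∞` to be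
read in `ℝ`. -/
lemma sobolev_of_sobolevInequality (hn : 3 ≤ n) {A B K C : ℝ} (hA : 0 ≤ A) (hB : 0 ≤ B)
    (hK : 1 ≤ K) (hu : AEStronglyMeasurable u (riemannianVolume n M))
    (huK : ∀ᵐ x ∂(riemannianVolume n M), u x ∈ Icc K⁻¹ K)
    (hS : SobolevInequality n u A B) (hf : HasH1Gradient n f X) (hfu : MemH1 n u f)
    (hC : ∀ᵐ x ∂(riemannianVolume n M), |f x| ≤ C) :
    (∫ x, |f x| ^ volExp n * u x ^ volExp n ∂(riemannianVolume n M)) ^ (2 / volExp n) ≤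
      A * ∫ x, u x ^ 2 * ‖X x‖ ^ 2 ∂(riemannianVolume n M) +
        B * ∫ x, f x ^ 2 * u x ^ volExp n ∂(riemannianVolume n M) := by
  have hq := volExp_pos hn
  have hu0 : ∀ᵐ x ∂(riemannianVolume n M), 0 < u x := by
    filter_upwards [huK] with x hx
    exact lt_of_lt_of_le (by positivity) hx.1
  have hum : ∀ r : ℝ, AEStronglyMeasurable (fun x => u x ^ r) (riemannianVolume n M) := fun r =>
    (hu.aemeasurable.pow_const r).aestronglyMeasurable
  have hub : ∀ r : ℝ, ∀ᵐ x ∂(riemannianVolume n M), |u x ^ r| ≤ K ^ |r| := fun r => by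
    filter_upwards [huK] with x hx
    exact rpow_abs_le_of_mem_Icc hK r hx
  have hac : confVolume n u ≪ riemannianVolume n M := withDensity_absolutelyContinuous _ _
  have : IsFiniteMeasure (confVolume n u) := by
    refine isFiniteMeasure_withDensity_ofReal ?_
    exact (MemLp.of_bound (p := 1) (hum _) (K ^ |volExp n|) (hub _)).integrable le_rfl |>.2
  have h1 := hS f hfu
  have hp0 : ENNReal.ofReal (2 * (n : ℝ) / ((n : ℝ) - 2)) ≠ 0 := by
    simpa [volExp] using hq
  have hmem : MemLp f (ENNReal.ofReal (2 * (n : ℝ) / ((n : ℝ) - 2))) (confVolume n u) :=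
    MemLp.of_bound (hf.memLp.1.mono_ac hac) C (hac.ae_le hC)
  have e0 : 0 ≤ ∫ x, |f x| ^ volExp n * u x ^ volExp n ∂(riemannianVolume n M) := by
    refine integral_nonneg_of_ae ?_
    filter_upwards [hu0] with x hx
    simp only [Pi.zero_apply]
    positivity
  have e1 : eLpNorm f (ENNReal.ofReal (2 * (n : ℝ) / ((n : ℝ) - 2))) (confVolume n u) ^ 2 =
      ENNReal.ofReal ((∫ x, |f x| ^ volExp n * u x ^ volExp n ∂(riemannianVolume n M)) ^
        (2 / volExp n)) := by
    rw [hmem.eLpNorm_eq_integral_rpow_norm hp0 (by finiteness), integral_confVolume hu hu0,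
      ENNReal.toReal_ofReal (by simpa [volExp] using hq.le), ← ENNReal.ofReal_pow]
    · congr 1
      change ((∫ x, |f x| ^ volExp n * u x ^ volExp n ∂(riemannianVolume n M)) ^
        (volExp n)⁻¹) ^ 2 = _
      rw [← Real.rpow_natCast, ← Real.rpow_mul e0]
      congr 1
      rw [Nat.cast_two, inv_mul_eq_div]
    · exact Real.rpow_nonneg e0 _
  have e2 : l2NormSq n u f =
      ENNReal.ofReal (∫ x, f x ^ 2 * u x ^ volExp n ∂(riemannianVolume n M)) := by
    rw [hf.l2NormSq_eq hu, ofReal_integral_eq_lintegral_ofReal]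
    · refine lintegral_congr_ae ?_
      filter_upwards [hu0] with x hx
      rw [← ofReal_norm, ← ENNReal.ofReal_pow (norm_nonneg _), ← ENNReal.ofReal_mul (by positivity),
        Real.norm_eq_abs, sq_abs, mul_comm]
      rfl
    · exact hf.memLp.integrable_sq.mul_bdd (hum _) (hub _)
    · filter_upwards [hu0] with x hx
      simp only [Pi.zero_apply]
      positivity
  have e3 : gradNormSq n u f =
      ENNReal.ofReal (∫ x, u x ^ 2 * ‖X x‖ ^ 2 ∂(riemannianVolume n M)) := by
    rw [hf.gradNormSq_eq hn hu hu0, ofReal_integral_eq_lintegral_ofReal]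
    · refine lintegral_congr_ae (ae_of_all _ fun x => ?_)
      dsimp only
      rw [← ofReal_norm, ← ENNReal.ofReal_pow (norm_nonneg _), ← ENNReal.ofReal_mul (by positivity)]
    · have := hf.memLp_grad.integrable_sq.mul_bdd (hum (2 : ℕ)) (hub (2 : ℕ))
      simp only [Real.rpow_natCast] at this
      simpa only [mul_comm] using this
    · exact ae_of_all _ fun x => by positivity
  have n2 : 0 ≤ ∫ x, f x ^ 2 * u x ^ volExp n ∂(riemannianVolume n M) := by
    refine integral_nonneg_of_ae ?_
    filter_upwards [hu0] with x hx
    simp only [Pi.zero_apply]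
    positivity
  have n3 : 0 ≤ ∫ x, u x ^ 2 * ‖X x‖ ^ 2 ∂(riemannianVolume n M) :=
    integral_nonneg fun x => by positivity
  rw [e1, e2, e3, ← ENNReal.ofReal_mul hA, ← ENNReal.ofReal_mul hB,
    ← ENNReal.ofReal_add (by positivity) (by positivity),
    ENNReal.ofReal_le_ofReal_iff (by positivity)] at h1
  exact h1

/-- The conformal factors in the gradient term multiply to `u ^ 2`. Since `S (S - r)` is only
integrable, the extension beyond test functions reaches bounded functions in `H¹`. -/
lemma evolution_of_weakScalarEvolution (hn : 3 ≤ n) (hd : TestFunctionsDense n M) {K C r : ℝ}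
    {S S' φ : M → ℝ} (hK : 1 ≤ K) (hu : AEStronglyMeasurable u (riemannianVolume n M))
    (huK : ∀ᵐ x ∂(riemannianVolume n M), u x ∈ Icc K⁻¹ K)
    (hS : HasH1Gradient n S (weakGrad n S)) (hS' : MemLp S' 2 (riemannianVolume n M))
    (heq : ∀ φ : M → ℝ, IsTestFunction n φ → ∫ x, S' x * φ x ∂(confVolume n u)
      + ((n : ℝ) - 1) * ∫ x, u x ^ (-4 / ((n : ℝ) - 2)) * gradPairing n S φ x ∂(confVolume n u)
      = ∫ x, S x * (S x - r) * φ x ∂(confVolume n u))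
    (hφ : HasH1Gradient n φ Z) (hC : ∀ᵐ x ∂(riemannianVolume n M), |φ x| ≤ C) :
    ((n : ℝ) - 1) * ∫ x, u x ^ 2 * inner ℝ (weakGrad n S x) (Z x) ∂(riemannianVolume n M) =
      ∫ x, (S x * (S x - r) - S' x) * u x ^ volExp n * φ x ∂(riemannianVolume n M) := by
  have hn3 : (3 : ℝ) ≤ n := by exact_mod_cast hn
  have hu0 : ∀ᵐ x ∂(riemannianVolume n M), 0 < u x := by
    filter_upwards [huK] with x hx
    exact lt_of_lt_of_le (by positivity) hx.1
  have hum : ∀ r : ℝ, AEStronglyMeasurable (fun x => u x ^ r) (riemannianVolume n M) := fun r =>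
    (hu.aemeasurable.pow_const r).aestronglyMeasurable
  have hub : ∀ r : ℝ, ∀ᵐ x ∂(riemannianVolume n M), |u x ^ r| ≤ K ^ |r| := fun r => by
    filter_upwards [huK] with x hx
    exact rpow_abs_le_of_mem_Icc hK r hx
  have i1 : Integrable (fun x => S x * (S x - r) * u x ^ volExp n) (riemannianVolume n M) :=
    (hS.memLp.integrable_mul (hS.memLp.sub (memLp_const r))).mul_bdd (hum _) (hub _)
  have i2 : Integrable (fun x => S' x * u x ^ volExp n) (riemannianVolume n M) :=
    (hS'.integrable (by norm_num)).mul_bdd (hum _) (hub _)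
  have i3 : Integrable (fun x => (S x * (S x - r) - S' x) * u x ^ volExp n)
      (riemannianVolume n M) := by
    simpa only [sub_mul] using! i1.sub i2
  have h2 := weakEquation_bounded hd (a := fun x => u x ^ 2) (C := K ^ |((2 : ℕ) : ℝ)|)
    (b := fun x => ((n : ℝ) - 1)⁻¹ * ((S x * (S x - r) - S' x) * u x ^ volExp n))
    (by simpa only [Real.rpow_natCast] using hum (2 : ℕ))
    (by simpa only [Real.rpow_natCast] using hub (2 : ℕ)) hS.measurableField hS.memLp_grad
    (i3.const_mul _) (fun ψ hψ => ?_) hφ hC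
  · rw [h2]
    simp only [mul_assoc]
    rw [integral_const_mul, ← mul_assoc, mul_inv_cancel₀ (by linarith), one_mul]
  · obtain ⟨Cψ, hCψ⟩ := hψ.2.exists_bound_of_continuous hψ.1.continuous
    have h3 := heq ψ hψ
    rw [integral_confVolume hu hu0, integral_confVolume hu hu0, integral_confVolume hu hu0] at h3
    have e1 : ∫ x, u x ^ (-4 / ((n : ℝ) - 2)) * gradPairing n S ψ x *
        u x ^ (2 * (n : ℝ) / ((n : ℝ) - 2)) ∂(riemannianVolume n M) =
        ∫ x, u x ^ 2 * inner ℝ (weakGrad n S x) (smoothGrad n ψ x) ∂(riemannianVolume n M) := by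
      refine integral_congr_ae ?_
      filter_upwards [hu0] with x hx
      rw [gradPairing_eq_inner, mul_right_comm, ← Real.rpow_add hx, ← Real.rpow_natCast]
      congr 2
      have : (n : ℝ) - 2 ≠ 0 := by linarith
      field_simp
      push_cast
      ring
    rw [e1] at h3
    have hψm := hψ.1.continuous.aestronglyMeasurable (μ := riemannianVolume n M)
    have h4 : ∫ x, (S x * (S x - r) - S' x) * u x ^ volExp n * ψ x ∂(riemannianVolume n M) =
        ∫ x, S x * (S x - r) * ψ x * u x ^ volExp n ∂(riemannianVolume n M) -
        ∫ x, S' x * ψ x * u x ^ volExp n ∂(riemannianVolume n M) := by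
      have j1 := i1.mul_bdd hψm (ae_of_all _ hCψ)
      have j2 := i2.mul_bdd hψm (ae_of_all _ hCψ)
      simp only [mul_right_comm _ (u _ ^ volExp n) (ψ _)] at j1 j2
      rw [← integral_sub j1 j2]
      exact integral_congr_ae (ae_of_all _ fun x => by dsimp only; ring)
    have h5 : ∫ x, (S x * (S x - r) - S' x) * u x ^ volExp n * ψ x ∂(riemannianVolume n M) =
        ((n : ℝ) - 1) *
          ∫ x, u x ^ 2 * inner ℝ (weakGrad n S x) (smoothGrad n ψ x) ∂(riemannianVolume n M) := by
      rw [h4]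
      unfold volExp
      linarith
    simp only [mul_assoc] at h5 ⊢
    rw [integral_const_mul, h5, ← mul_assoc, inv_mul_cancel₀ (by linarith), one_mul]

end Construction

/-! ### The scalar curvature equation and the passage to a regular flow -/

section Construction

variable {n : ℕ} {M : Type*} [TopologicalSpace M] [ChartedSpace (EuclideanSpace ℝ (Fin n)) M]
  [IsManifold (𝓡 n) ∞ M] [RiemannianBundle (fun x : M => TangentSpace (𝓡 n) x)]
  [IsContMDiffRiemannianBundle (𝓡 n) ∞ (EuclideanSpace ℝ (Fin n))
      (fun x : M => TangentSpace (𝓡 n) x)]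
  [MeasurableSpace M] [BorelSpace M] [SecondCountableTopology M] [T2Space M]
  [IsProbabilityMeasure (riemannianVolume n M)]
  {f g u S : M → ℝ} {X Y Z : ∀ x : M, TangentSpace (𝓡 n) x}

/-- With `u` between positive bounds the right side is in `L²`, so here every function in `H¹` is
admissible, bounded or not. -/
lemma scalar_of_test (hn : 3 ≤ n) (hd : TestFunctionsDense n M) {K : ℝ} (hK : 1 ≤ K)
    (hu : HasH1Gradient n u X)
    (huK : ∀ᵐ x ∂(riemannianVolume n M), u x ∈ Icc K⁻¹ K)
    (hS : MemLp S 2 (riemannianVolume n M))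
    (hS₀ : MemLp (fun x : M => scalarCurvature n x) 2 (riemannianVolume n M))
    (heq : ∀ φ : M → ℝ, IsTestFunction n φ →
      ∫ x, S x * u x ^ scalExp n * φ x ∂(riemannianVolume n M)
      = 4 * ((n : ℝ) - 1) / ((n : ℝ) - 2)
          * ∫ x, inner ℝ (X x) (smoothGrad n φ x) ∂(riemannianVolume n M)
        + ∫ x, scalarCurvature n x * u x * φ x ∂(riemannianVolume n M))
    (hf : HasH1Gradient n f Z) :
    4 * ((n : ℝ) - 1) / ((n : ℝ) - 2) * ∫ x, inner ℝ (X x) (Z x) ∂(riemannianVolume n M) =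
      ∫ x, (S x * u x ^ scalExp n - scalarCurvature n x * u x) * f x ∂(riemannianVolume n M) := by
  have hn3 : (3 : ℝ) ≤ n := by exact_mod_cast hn
  have hD : 4 * ((n : ℝ) - 1) / ((n : ℝ) - 2) ≠ 0 :=
    (div_pos (by linarith) (by linarith)).ne'
  set D := 4 * ((n : ℝ) - 1) / ((n : ℝ) - 2)
  have hum := (hu.memLp.1.aemeasurable.pow_const (scalExp n)).aestronglyMeasurable
  have i1 : MemLp (fun x => S x * u x ^ scalExp n) 2 (riemannianVolume n M) :=
    memLp_mul_of_bound hS hum (C := K ^ |scalExp n|) (by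
      filter_upwards [huK] with x hx; exact rpow_abs_le_of_mem_Icc hK _ hx)
  have i2 : MemLp (fun x => scalarCurvature n x * u x) 2 (riemannianVolume n M) :=
    memLp_mul_of_bound hS₀ hu.memLp.1 (C := K) (by
      filter_upwards [huK] with x hx
      rw [abs_of_nonneg ((by positivity : 0 ≤ K⁻¹).trans hx.1)]; exact hx.2)
  have h1 := weakEquation_memLp hd hu.measurableField hu.memLp_grad
    (b := fun x => D⁻¹ * (S x * u x ^ scalExp n - scalarCurvature n x * u x))
    ((i1.sub i2).const_mul _) (fun φ hφ => ?_) hf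
  · rw [h1]
    simp only [mul_assoc]
    rw [integral_const_mul, ← mul_assoc, mul_inv_cancel₀ hD, one_mul]
  · have hφ2 := hφ.hasH1Gradient.memLp
    have h2 : ∫ x, (S x * u x ^ scalExp n - scalarCurvature n x * u x) * φ x
        ∂(riemannianVolume n M) = D * ∫ x, inner ℝ (X x) (smoothGrad n φ x)
          ∂(riemannianVolume n M) := by
      simp only [sub_mul]
      rw [integral_sub (integrable_mul_of_memLp_two i1 hφ2) (integrable_mul_of_memLp_two i2 hφ2), heq φ hφ]
      ring
    simp only [mul_assoc] at h2 ⊢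
    rw [integral_const_mul, h2, ← mul_assoc, inv_mul_cancel₀ hD, one_mul]

/-- A positive Yamabe constant makes the energy of a nonzero function nonnegative. -/
lemma yamabe_energy_nonneg (hY : 0 < yamabeConstant n M) (hu : HasH1Gradient n u (weakGrad n u))
    (hu0 : ¬ u =ᵐ[riemannianVolume n M] 0) :
    0 ≤ ∫ x, (4 * ((n : ℝ) - 1) / ((n : ℝ) - 2) * ‖weakGrad n u x‖ ^ 2
          + scalarCurvature n x * u x ^ 2) ∂(riemannianVolume n M) := by
  by_contra! hneg
  have hmem : _ ∈ {r : ℝ | ∃ v : M → ℝ, MemH1 n 1 v ∧ ¬ (v =ᵐ[riemannianVolume n M] 0) ∧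
    r = (∫ x, (4 * ((n : ℝ) - 1) / ((n : ℝ) - 2) * ‖weakGrad n v x‖ ^ 2
          + scalarCurvature n x * v x ^ 2) ∂(riemannianVolume n M)) /
        (eLpNorm v (ENNReal.ofReal (2 * (n : ℝ) / ((n : ℝ) - 2)))
          (riemannianVolume n M)).toReal ^ 2} := ⟨u, hu.memH1, hu0, rfl⟩
  unfold yamabeConstant at hY
  have hb : BddBelow {r : ℝ | ∃ v : M → ℝ, MemH1 n 1 v ∧ ¬ (v =ᵐ[riemannianVolume n M] 0) ∧
    r = (∫ x, (4 * ((n : ℝ) - 1) / ((n : ℝ) - 2) * ‖weakGrad n v x‖ ^ 2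
          + scalarCurvature n x * v x ^ 2) ∂(riemannianVolume n M)) /
        (eLpNorm v (ENNReal.ofReal (2 * (n : ℝ) / ((n : ℝ) - 2)))
          (riemannianVolume n M)).toReal ^ 2} := by
    by_contra hb
    rw [Real.sInf_of_not_bddBelow hb] at hY
    exact lt_irrefl _ hY
  have h1 := hY.trans_le (csInf_le hb hmem)
  exact absurd h1 (not_lt.2 (div_nonpos_of_nonpos_of_nonneg hneg.le (sq_nonneg _)))

lemma tendsto_eLpNorm_of_h1NormSq {ι : Type*} {l : Filter ι} {F : ι → M → ℝ} {K : ℝ≥0}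
    (hF : ∀ᶠ i in l, MemH1 n 1 (F i))
    (hK : ∀ f : M → ℝ, MemH1 n 1 f → h1NormSq n 1 f ≤ K * h1NormSq n u f)
    (h : Tendsto (fun i => h1NormSq n u (F i)) l (𝓝 0)) :
    Tendsto (fun i => eLpNorm (F i) 2 (riemannianVolume n M)) l (𝓝 0) := by
  refine tendsto_of_tendsto_sq ?_
  have h1 : Tendsto (fun i => K * h1NormSq n u (F i)) l (𝓝 0) := by
    simpa using ENNReal.Tendsto.const_mul h (Or.inr (ENNReal.coe_ne_top (r := K)))
  refine tendsto_of_tendsto_of_tendsto_of_le_of_le' tendsto_const_nhds h1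
    (Eventually.of_forall fun _ => zero_le) ?_
  filter_upwards [hF] with i hi
  refine le_trans ?_ (hK _ hi)
  rw [hi.hasH1Gradient.h1NormSq_eq]
  exact le_self_add

/-- The uniform equivalence of the `H¹` norms is used twice: it bounds `u` above and below, and it
turns convergence in `H¹(M, g(t))` into convergence in `L²(M)`. The resulting `K` depends on the
flow. -/
theorem exists_regularFlow (hn : 3 ≤ n) (hd : TestFunctionsDense n M)
    (hY : 0 < yamabeConstant n M)
    (hS₀ : MemLp (fun x : M => scalarCurvature n x) 2 (riemannianVolume n M))
    {T A B : ℝ} (hT : 0 < T) (hA : 0 ≤ A) (hB : 0 ≤ B) {u S S' : ℝ → M → ℝ}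
    (hflow : IsYamabeFlow n T u S) (hc : ContinuousInH1 n T u S) (hcd : ContDiffInH1 n T u S S')
    (hagree : SobolevSpacesAgree n T u) (hsob : ∀ t ∈ Icc 0 T, SobolevInequality n (u t) A B)
    (hev : WeakScalarEvolution n T u S S') :
    ∃ K, RegularFlow n T K A B u S S' (fun t => average n (u t) (S t)) := by
  obtain ⟨hag, K₀, hK₀⟩ := hagree
  have hn3 : (3 : ℝ) ≤ n := by exact_mod_cast hn
  have huh : ∀ t ∈ Icc 0 T, HasH1Gradient n (u t) (weakGrad n (u t)) := fun t ht =>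
    (hflow.memH1 t ht).hasH1Gradient
  have hSm : ∀ t ∈ Icc 0 T, MemH1 n 1 (S t) := fun t ht => (hag t ht _).2 (hc t ht).1
  have hSh : ∀ t ∈ Icc 0 T, HasH1Gradient n (S t) (weakGrad n (S t)) := fun t ht =>
    (hSm t ht).hasH1Gradient
  have hS'm : ∀ t ∈ Ioo 0 T, MemH1 n 1 (S' t) := fun t ht =>
    (hag t ⟨ht.1.le, ht.2.le⟩ _).2 (hcd t ht).1
  have hK : (1 : ℝ) ≤ K₀ + 1 := by linarith [K₀.coe_nonneg]
  have huK : ∀ t ∈ Icc 0 T, ∀ᵐ x ∂(riemannianVolume n M),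
      u t x ∈ Icc ((K₀ : ℝ) + 1)⁻¹ (K₀ + 1) := fun t ht => by
    filter_upwards [conformalFactor_bounds hn (huh t ht).memLp (hflow.pos t ht) (hK₀ t ht),
      hflow.pos t ht] with x hx hx0
    exact mem_Icc_of_sq_bounds K₀.coe_nonneg hx0 hx.1 hx.2
  have hscal : ∀ t ∈ Icc 0 T, ∀ φ Z, HasH1Gradient n φ Z →
      4 * ((n : ℝ) - 1) / ((n : ℝ) - 2) *
          ∫ x, inner ℝ (weakGrad n (u t) x) (Z x) ∂(riemannianVolume n M) =
        ∫ x, (S t x * u t x ^ scalExp n - scalarCurvature n x * u t x) * φ x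
          ∂(riemannianVolume n M) := fun t ht φ Z hφ =>
    scalar_of_test hn hd hK (huh t ht) (huK t ht) (hSh t ht).memLp hS₀ (fun φ hφ => by
      have := hflow.scalar t ht φ hφ
      simp only [gradPairing_eq_inner] at this
      exact this) hφ
  -- At time zero `u = 1` has vanishing gradient, so the weak equation says that `S 0 - S₀` is
  -- orthogonal to all test functions.
  have hinit : S 0 =ᵐ[riemannianVolume n M] fun x => scalarCurvature n x := by
    have h0 : (0 : ℝ) ∈ Icc 0 T := ⟨le_rfl, hT.le⟩
    have hg0 : ∀ᵐ x ∂(riemannianVolume n M), weakGrad n (u 0) x = 0 :=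
      (huh 0 h0).ae_unique ((hasH1Gradient_const 1).congr_ae
        (by filter_upwards [hflow.initial] with x hx; exact hx.symm) (ae_of_all _ fun _ => rfl))
    have h1 : Integrable (fun x => S 0 x - scalarCurvature n x) (riemannianVolume n M) :=
      ((hSh 0 h0).memLp.sub hS₀).integrable (by norm_num)
    have := (𝓡 n).locallyCompactSpace
    have := ChartedSpace.locallyCompactSpace (EuclideanSpace ℝ (Fin n)) M
    have h2 := ae_eq_zero_of_integral_contMDiff_smul_eq_zero (𝓡 n) (M := M)
      (μ := riemannianVolume n M) h1.locallyIntegrable (fun φ hφ hφc => by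
        have h3 := hscal 0 h0 φ _ (IsTestFunction.hasH1Gradient ⟨hφ, hφc⟩)
        have h4 : ∫ x, inner ℝ (weakGrad n (u 0) x) (smoothGrad n φ x)
            ∂(riemannianVolume n M) = 0 := by
          refine integral_eq_zero_of_ae ?_
          filter_upwards [hg0] with x hx
          rw [hx, inner_zero_left]
          rfl
        rw [h4, mul_zero] at h3
        refine Eq.trans (integral_congr_ae ?_) h3.symm
        filter_upwards [hflow.initial] with x hx
        simp only [hx, Real.one_rpow, smul_eq_mul]
        ring)
    filter_upwards [h2] with x hx
    linarith
  -- Testing the scalar curvature equation with `u` itself identifies `∫ S dVol_g` with the Yamabe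
  -- energy of `u`.
  have htot : ∀ t ∈ Icc 0 T, 0 ≤ ∫ x, S t x * u t x ^ volExp n ∂(riemannianVolume n M) :=
      fun t ht => by
    have h1 := hscal t ht _ _ (huh t ht)
    have hu0 : ¬ u t =ᵐ[riemannianVolume n M] 0 := fun h => by
      have : ∀ᵐ x ∂(riemannianVolume n M), False := by
        filter_upwards [h, hflow.pos t ht] with x hx hx0
        rw [hx] at hx0
        exact lt_irrefl _ hx0
      rw [ae_iff] at this
      simp at this
    have h2 := yamabe_energy_nonneg hY (huh t ht) hu0
    have hub : ∀ᵐ x ∂(riemannianVolume n M), |u t x| ≤ K₀ + 1 := by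
      filter_upwards [huK t ht] with x hx
      rw [abs_of_nonneg ((by positivity : (0 : ℝ) ≤ (K₀ + 1)⁻¹).trans hx.1)]; exact hx.2
    have i0 : MemLp (fun x => scalarCurvature n x * u t x) 2 (riemannianVolume n M) :=
      memLp_mul_of_bound hS₀ (huh t ht).memLp.1 hub
    have i1 : MemLp (fun x => S t x * u t x ^ scalExp n) 2 (riemannianVolume n M) :=
      memLp_mul_of_bound (hSh t ht).memLp
        ((huh t ht).memLp.1.aemeasurable.pow_const (scalExp n)).aestronglyMeasurable
        (C := (K₀ + 1) ^ |scalExp n|) (by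
          filter_upwards [huK t ht] with x hx; exact rpow_abs_le_of_mem_Icc hK _ hx)
    have i2 := integrable_mul_of_memLp_two i0 (huh t ht).memLp
    have i3 := integrable_mul_of_memLp_two i1 (huh t ht).memLp
    have i4 := (huh t ht).memLp_grad.integrable_sq
    simp only [sub_mul] at h1
    rw [integral_sub i3 i2] at h1
    simp only [real_inner_self_eq_norm_sq] at h1
    have h3 : ∫ x, (4 * ((n : ℝ) - 1) / ((n : ℝ) - 2) * ‖weakGrad n (u t) x‖ ^ 2
        + scalarCurvature n x * u t x ^ 2) ∂(riemannianVolume n M) =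
        4 * ((n : ℝ) - 1) / ((n : ℝ) - 2) *
          ∫ x, ‖weakGrad n (u t) x‖ ^ 2 ∂(riemannianVolume n M) +
        ∫ x, scalarCurvature n x * u t x * u t x ∂(riemannianVolume n M) := by
      rw [← integral_const_mul, ← integral_add (i4.const_mul _) i2]
      exact integral_congr_ae (ae_of_all _ fun x => by dsimp only; ring)
    have h4 : ∫ x, S t x * u t x ^ scalExp n * u t x ∂(riemannianVolume n M) =
        ∫ x, S t x * u t x ^ volExp n ∂(riemannianVolume n M) := by
      refine integral_congr_ae ?_
      filter_upwards [hflow.pos t ht] with x hx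
      rw [← scalExp_add_one hn, Real.rpow_add_one hx.ne', mul_assoc]
    rw [← h4]
    linarith
  refine ⟨K₀ + 1, hK, huK, huh, hSh, fun t ht => (hS'm t ht).hasH1Gradient.memLp,
    hflow.continuous, fun t ht => ?_, fun t ht => ?_, fun t ht => ?_, hflow.initial, hinit, hS₀,
    fun t ht φ Z C hφ hC => ?_, hscal, fun t ht φ Z C hφ hC => ?_, fun t ht => ?_, htot⟩
  · refine tendsto_eLpNorm_of_h1NormSq ?_ (fun f hf => (hK₀ t ht f hf).2) (hc t ht).2
    filter_upwards [self_mem_nhdsWithin] with s hs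
    exact ((hSh s hs).sub (hSh t ht)).memH1
  · exact hflow.flow t ht
  · have ht' : t ∈ Icc 0 T := ⟨ht.1.le, ht.2.le⟩
    refine tendsto_eLpNorm_of_h1NormSq ?_ (fun f hf => (hK₀ t ht' f hf).2) (hcd t ht).2.1
    filter_upwards [nhdsWithin_le_nhds (Ioo_mem_nhds ht.1 ht.2)] with s hs
    exact ((((hSh s ⟨hs.1.le, hs.2.le⟩).sub (hSh t ht')).const_smul _).sub
      (hS'm t ht).hasH1Gradient).memH1
  · have ht' : t ∈ Icc 0 T := ⟨ht.1.le, ht.2.le⟩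
    exact evolution_of_weakScalarEvolution hn hd hK (huh t ht').memLp.1 (huK t ht') (hSh t ht')
      (hS'm t ht).hasH1Gradient.memLp (hev t ht) hφ hC
  · exact sobolev_of_sobolevInequality hn hA hB hK (huh t ht).memLp.1 (huK t ht) (hsob t ht) hφ
      ((hag t ht φ).1 hφ.memH1) hC
  · have h1 := integral_confVolume (huh t ht).memLp.1 (hflow.pos t ht) (fun _ => 1)
    simp only [integral_const, smul_eq_mul, mul_one, one_mul] at h1
    rw [average, integral_confVolume (huh t ht).memLp.1 (hflow.pos t ht)]
    rw [measureReal_def] at h1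
    rw [h1]
    rfl

end Construction

/-! ### Differentiable curves in `L²` -/

section LTwoCurves

variable {α ι : Type*} [MeasurableSpace α] {μ : Measure α}

lemma lintegral_enorm_mul_le {f g : α → ℝ} (hf : AEStronglyMeasurable f μ)
    (hg : AEStronglyMeasurable g μ) :
    ∫⁻ x, ‖f x * g x‖ₑ ∂μ ≤ eLpNorm f 2 μ * eLpNorm g 2 μ := by
  have h : eLpNorm (f • g) 1 μ ≤ eLpNorm f 2 μ * eLpNorm g 2 μ := eLpNorm_smul_le_mul_eLpNorm hg hf
  rwa [eLpNorm_one_eq_lintegral_enorm] at h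

lemma tendsto_integral_mul_of_eLpNorm_two {l : Filter ι} {F G : ι → α → ℝ} {f g : α → ℝ}
    (hF : ∀ᶠ i in l, MemLp (F i) 2 μ) (hG : ∀ᶠ i in l, MemLp (G i) 2 μ) (hf : MemLp f 2 μ)
    (hg : MemLp g 2 μ) (hFf : Tendsto (fun i => eLpNorm (F i - f) 2 μ) l (𝓝 0))
    (hGg : Tendsto (fun i => eLpNorm (G i - g) 2 μ) l (𝓝 0)) :
    Tendsto (fun i => ∫ x, F i x * G i x ∂μ) l (𝓝 (∫ x, f x * g x ∂μ)) := by
  refine tendsto_integral_of_L1 _ (hf.1.mul hg.1) ?_ ?_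
  · filter_upwards [hF, hG] with i hi hi'
    exact integrable_mul_of_memLp_two hi hi'
  have h1 : Tendsto (fun i => eLpNorm (F i - f) 2 μ * eLpNorm (G i - g) 2 μ +
      (eLpNorm (F i - f) 2 μ * eLpNorm g 2 μ + eLpNorm f 2 μ * eLpNorm (G i - g) 2 μ)) l
      (𝓝 0) := by
    have t1 := ENNReal.Tendsto.mul hFf (Or.inr (by simp)) hGg (Or.inr (by simp))
    have t2 := ENNReal.Tendsto.mul_const hFf (b := eLpNorm g 2 μ) (Or.inr hg.2.ne)
    have t3 := ENNReal.Tendsto.const_mul hGg (a := eLpNorm f 2 μ) (Or.inr hf.2.ne)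
    simpa using t1.add (t2.add t3)
  refine tendsto_of_tendsto_of_tendsto_of_le_of_le' tendsto_const_nhds h1
    (Eventually.of_forall fun _ => zero_le) ?_
  filter_upwards [hF, hG] with i hi hi'
  have m1 := hi.1.sub hf.1
  have m2 := hi'.1.sub hg.1
  calc ∫⁻ x, ‖F i x * G i x - f x * g x‖ₑ ∂μ
      ≤ ∫⁻ x, (‖(F i - f) x * (G i - g) x‖ₑ + (‖(F i - f) x * g x‖ₑ +
          ‖f x * (G i - g) x‖ₑ)) ∂μ := by
        refine lintegral_mono fun x => ?_
        have : F i x * G i x - f x * g x = (F i - f) x * (G i - g) x +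
            ((F i - f) x * g x + f x * (G i - g) x) := by
          simp only [Pi.sub_apply]; ring
        rw [this]
        exact (enorm_add_le _ _).trans (add_le_add le_rfl (enorm_add_le _ _))
    _ = ∫⁻ x, ‖(F i - f) x * (G i - g) x‖ₑ ∂μ + (∫⁻ x, ‖(F i - f) x * g x‖ₑ ∂μ +
          ∫⁻ x, ‖f x * (G i - g) x‖ₑ ∂μ) := by
        rw [lintegral_add_left' (f := fun x => ‖(F i - f) x * (G i - g) x‖ₑ) (m1.mul m2).enorm,
          lintegral_add_left' (f := fun x => ‖(F i - f) x * g x‖ₑ) (m1.mul hg.1).enorm]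
    _ ≤ _ := add_le_add (lintegral_enorm_mul_le m1 m2)
        (add_le_add (lintegral_enorm_mul_le m1 hg.1) (lintegral_enorm_mul_le hf.1 m2))

/-- A product of an `L²`-small function with an unbounded `b` need not be small in `L²`. The cut at
`c` supplies the majorant `c |b|`, so that almost everywhere convergence along subsequences is
enough. This handles the remainder in the chain rule. -/
lemma tendsto_eLpNorm_min_mul {l : Filter ι} [l.IsCountablyGenerated] {d : ι → α → ℝ}
    {b : α → ℝ} (hd : ∀ᶠ i in l, AEStronglyMeasurable (d i) μ) (hb : MemLp b 2 μ)
    (h : Tendsto (fun i => eLpNorm (d i) 2 μ) l (𝓝 0)) {c L : ℝ} (hc : 0 ≤ c) (hL : 0 ≤ L) :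
    Tendsto (fun i => eLpNorm (fun x => min c (L * |d i x|) * b x) 2 μ) l (𝓝 0) := by
  classical
  set d' : ι → α → ℝ := fun i => if AEStronglyMeasurable (d i) μ then d i else 0 with hd'
  have hdd : ∀ᶠ i in l, d' i = d i := by
    filter_upwards [hd] with i hi
    simp [hd', hi]
  have hm : ∀ i, AEStronglyMeasurable (d' i) μ := fun i => by
    by_cases hi : AEStronglyMeasurable (d i) μ
    · simp [hd', hi]
    · simp only [hd', if_neg hi]; exact aestronglyMeasurable_const
  have h' : Tendsto (fun i => eLpNorm (d' i) 2 μ) l (𝓝 0) :=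
    h.congr' (by filter_upwards [hdd] with i hi; rw [hi])
  suffices hs : Tendsto (fun i => eLpNorm (fun x => min c (L * |d' i x|) * b x) 2 μ) l (𝓝 0) from
    hs.congr' (by filter_upwards [hdd] with i hi; rw [hi])
  refine tendsto_of_subseq_tendsto fun ns hns => ?_
  have h1 : TendstoInMeasure μ (fun k => d' (ns k)) atTop (0 : α → ℝ) := by
    refine tendstoInMeasure_of_tendsto_eLpNorm (p := 2) (by norm_num) (fun k => hm _)
      aestronglyMeasurable_const ?_
    simp only [sub_zero]
    exact h'.comp hns
  obtain ⟨ms, -, hms⟩ := h1.exists_seq_tendsto_ae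
  refine ⟨ms, tendsto_eLpNorm_two_of_dominated (b := fun x => c * |b x|) (fun k => ?_)
    (hb.abs.const_mul c) (fun k => ae_of_all _ fun x => ?_) ?_⟩
  · refine AEStronglyMeasurable.mul ?_ hb.1
    exact (continuous_const.min (continuous_const.mul continuous_abs)).comp_aestronglyMeasurable
      (hm _)
  · rw [abs_mul, abs_of_nonneg (le_min hc (by positivity))]
    exact mul_le_mul_of_nonneg_right (min_le_left _ _) (abs_nonneg _)
  · filter_upwards [hms] with x hx
    have : Tendsto (fun k => min c (L * |d' (ns (ms k)) x|) * b x) atTop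
        (𝓝 (min c (L * |(0 : ℝ)|) * b x)) :=
      (tendsto_const_nhds.min ((hx.abs).const_mul L)).mul_const _
    simpa [hc] using this

/-- The curve `f` in `L²(μ)` has derivative `f'` at `t`. -/
structure HasL2DerivAt (μ : Measure α) (f : ℝ → α → ℝ) (f' : α → ℝ) (t : ℝ) : Prop where
  memLp : ∀ᶠ s in 𝓝 t, MemLp (f s) 2 μ
  memLp' : MemLp f' 2 μ
  tendsto : Tendsto (fun s => eLpNorm (fun x => (s - t)⁻¹ * (f s x - f t x) - f' x) 2 μ)
    (𝓝[≠] t) (𝓝 0)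

variable {f g : ℝ → α → ℝ} {f' g' : α → ℝ} {t : ℝ}

lemma HasL2DerivAt.memLp_self (h : HasL2DerivAt μ f f' t) : MemLp (f t) 2 μ :=
  h.memLp.self_of_nhds

lemma HasL2DerivAt.tendsto_sub (h : HasL2DerivAt μ f f' t) :
    Tendsto (fun s => eLpNorm (f s - f t) 2 μ) (𝓝[≠] t) (𝓝 0) := by
  have h1 : Tendsto (fun s => ‖s - t‖ₑ * (eLpNorm (fun x => (s - t)⁻¹ * (f s x - f t x) - f' x) 2 μ
      + eLpNorm f' 2 μ)) (𝓝[≠] t) (𝓝 0) := by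
    have t1 : Tendsto (fun s : ℝ => ‖s - t‖ₑ) (𝓝[≠] t) (𝓝 0) := by
      have : Continuous fun s : ℝ => ‖s - t‖ₑ := by fun_prop
      have h2 := (this.tendsto t).mono_left (nhdsWithin_le_nhds (s := {t}ᶜ))
      simpa using h2
    have t2 := h.tendsto.add_const (eLpNorm f' 2 μ)
    have := ENNReal.Tendsto.mul t1 (Or.inr (by simpa using h.memLp'.2.ne)) t2 (Or.inr (by simp))
    simpa using this
  refine tendsto_of_tendsto_of_tendsto_of_le_of_le' tendsto_const_nhds h1
    (Eventually.of_forall fun _ => zero_le) ?_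
  filter_upwards [nhdsWithin_le_nhds h.memLp, self_mem_nhdsWithin] with s hs hst
  have hst' : s - t ≠ 0 := sub_ne_zero.2 hst
  have e1 : f s - f t = (s - t) • ((fun x => (s - t)⁻¹ * (f s x - f t x) - f' x) + f') := by
    funext x
    simp only [Pi.sub_apply, Pi.smul_apply, Pi.add_apply, smul_eq_mul]
    field_simp
    ring
  rw [e1, eLpNorm_const_smul]
  gcongr
  refine eLpNorm_add_le ?_ h.memLp'.1 (by norm_num)
  exact ((hs.1.sub h.memLp_self.1).const_mul _).sub h.memLp'.1

/-- The derivative of the `L²` inner product of two differentiable curves. -/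
lemma HasL2DerivAt.hasDerivAt_integral_mul (hf : HasL2DerivAt μ f f' t)
    (hg : HasL2DerivAt μ g g' t) :
    HasDerivAt (fun s => ∫ x, f s x * g s x ∂μ) (∫ x, f' x * g t x ∂μ + ∫ x, f t x * g' x ∂μ) t := by
  rw [hasDerivAt_iff_tendsto_slope]
  have hq : ∀ {f : ℝ → α → ℝ} {f' : α → ℝ}, HasL2DerivAt μ f f' t →
      ∀ᶠ s in 𝓝[≠] t, MemLp (fun x => (s - t)⁻¹ * (f s x - f t x)) 2 μ := fun hf => by
    filter_upwards [nhdsWithin_le_nhds hf.memLp] with s hs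
    exact (hs.sub hf.memLp_self).const_mul _
  have h1 := tendsto_integral_mul_of_eLpNorm_two (hq hf) (nhdsWithin_le_nhds hg.memLp) hf.memLp'
    hg.memLp_self hf.tendsto hg.tendsto_sub
  have h2 := tendsto_integral_mul_of_eLpNorm_two (F := fun _ => f t) (l := 𝓝[≠] t)
    (Eventually.of_forall fun _ => hf.memLp_self) (hq hg) hf.memLp_self hg.memLp'
    (by simp) hg.tendsto
  refine (h1.add h2).congr' ?_
  filter_upwards [hq hf, hq hg, nhdsWithin_le_nhds hf.memLp, nhdsWithin_le_nhds hg.memLp]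
    with s hs1 hs2 hs3 hs4
  rw [slope_def_field, ← integral_sub (integrable_mul_of_memLp_two hs3 hs4)
    (integrable_mul_of_memLp_two hf.memLp_self hg.memLp_self), div_eq_inv_mul, ← integral_const_mul,
    ← integral_add (integrable_mul_of_memLp_two hs1 hs4)
    (integrable_mul_of_memLp_two hf.memLp_self hs2)]
  exact integral_congr_ae (ae_of_all _ fun x => by dsimp only; ring)

/-- `G` is differentiable on `I` with bounded Lipschitz derivative `G'`, in quantitative form. -/
structure IsC11On (G G' : ℝ → ℝ) (I : Set ℝ) (C L : ℝ) : Prop where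
  measurable : Measurable G
  measurable' : Measurable G'
  nonneg : 0 ≤ C
  nonneg' : 0 ≤ L
  lipschitz : ∀ a ∈ I, ∀ b ∈ I, |G a - G b| ≤ C * |a - b|
  bound : ∀ b ∈ I, |G' b| ≤ C
  quadratic : ∀ a ∈ I, ∀ b ∈ I, |G a - G b - G' b * (a - b)| ≤ L * |a - b| ^ 2

lemma isC11On_of_hasDerivWithinAt {G G' : ℝ → ℝ} {I : Set ℝ} {C L : ℝ} (hI : Convex ℝ I)
    (hm : Measurable G) (hm' : Measurable G') (hC : 0 ≤ C) (hL : 0 ≤ L)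
    (hG : ∀ x ∈ I, HasDerivWithinAt G (G' x) I x) (hb : ∀ x ∈ I, |G' x| ≤ C)
    (hlip : ∀ x ∈ I, ∀ y ∈ I, |G' x - G' y| ≤ L * |x - y|) : IsC11On G G' I C L where
  measurable := hm
  measurable' := hm'
  nonneg := hC
  nonneg' := hL
  lipschitz := fun a ha b hb' => hI.norm_image_sub_le_of_norm_hasDerivWithin_le hG hb hb' ha
  bound := hb
  quadratic := fun a ha b hb' => by
    have hsub : uIcc b a ⊆ I := hI.ordConnected.uIcc_subset hb' ha
    have h1 := (convex_uIcc b a).norm_image_sub_le_of_norm_hasDerivWithin_le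
      (f := fun x => G x - G' b * x) (f' := fun x => G' x - G' b) (C := L * |a - b|)
      (fun x hx => by
        have := ((hG x (hsub hx)).mono hsub).sub
          (((hasDerivAt_id x).const_mul (G' b)).hasDerivWithinAt (s := uIcc b a))
        simpa using! this)
      (fun x hx => (hlip x (hsub hx) b hb').trans (mul_le_mul_of_nonneg_left (abs_sub_left_of_mem_uIcc hx) hL))
      left_mem_uIcc right_mem_uIcc
    simp only [Real.norm_eq_abs] at h1
    calc |G a - G b - G' b * (a - b)| = |G a - G' b * a - (G b - G' b * b)| := by congr 1; ring
      _ ≤ L * |a - b| * |a - b| := h1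
      _ = L * |a - b| ^ 2 := by ring

variable {G G' : ℝ → ℝ} {I : Set ℝ} {C L : ℝ}

lemma IsC11On.memLp_comp [IsFiniteMeasure μ] (hG : IsC11On G G' I C L) {b₀ : ℝ} (hb₀ : b₀ ∈ I)
    {h : α → ℝ} (hh : MemLp h 2 μ) (hI : ∀ᵐ x ∂μ, h x ∈ I) : MemLp (fun x => G (h x)) 2 μ := by
  refine ((memLp_const |G b₀|).add ((hh.sub (memLp_const b₀)).norm.const_mul C)).mono
    (hG.measurable.comp_aemeasurable hh.1.aemeasurable).aestronglyMeasurable ?_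
  filter_upwards [hI] with x hx
  have h1 := hG.lipschitz _ hx _ hb₀
  simp only [Pi.add_apply, Pi.sub_apply, Real.norm_eq_abs]
  have h2 : |G (h x)| ≤ |G b₀| + C * |h x - b₀| := by
    have := abs_sub_abs_le_abs_sub (G (h x)) (G b₀)
    linarith
  exact h2.trans (le_abs_self _)

lemma IsC11On.tendsto_comp {l : Filter ι} (hG : IsC11On G G' I C L) {F : ι → α → ℝ} {f : α → ℝ}
    (hF : ∀ᶠ i in l, ∀ᵐ x ∂μ, F i x ∈ I) (hf : ∀ᵐ x ∂μ, f x ∈ I)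
    (h : Tendsto (fun i => eLpNorm (F i - f) 2 μ) l (𝓝 0)) :
    Tendsto (fun i => eLpNorm ((fun x => G (F i x)) - fun x => G (f x)) 2 μ) l (𝓝 0) := by
  have h1 : Tendsto (fun i => ENNReal.ofReal C * eLpNorm (F i - f) 2 μ) l (𝓝 0) := by
    simpa using ENNReal.Tendsto.const_mul h (Or.inr (ENNReal.ofReal_ne_top (r := C)))
  refine tendsto_of_tendsto_of_tendsto_of_le_of_le' tendsto_const_nhds h1
    (Eventually.of_forall fun _ => zero_le) ?_
  filter_upwards [hF] with i hi
  refine eLpNorm_le_mul_eLpNorm_of_ae_le_mul ?_ 2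
  filter_upwards [hi, hf] with x hx hx'
  exact hG.lipschitz _ hx _ hx'

/-- The quadratic remainder divided by the time step need not tend to zero in `L²`. Combined with
the Lipschitz bound it is at most `min (2C) (L|a - b|) * |a - b|`: the factor `|a - b|` forms the
difference quotient, the other one stays inside the bounded minimum. -/
lemma IsC11On.abs_quotient_le (hG : IsC11On G G' I C L) {a b : ℝ} (ha : a ∈ I) (hb : b ∈ I)
    (h e : ℝ) :
    |h * (G a - G b) - G' b * e| ≤
      3 * C * |h * (a - b) - e| + |min (2 * C) (L * |a - b|) * e| := by
  have q1 := hG.quadratic _ ha _ hb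
  have q2 := hG.lipschitz _ ha _ hb
  have q3 := hG.bound _ hb
  have hC := hG.nonneg
  have q4 : |G a - G b - G' b * (a - b)| ≤ min (2 * C) (L * |a - b|) * |a - b| := by
    rcases min_choice (2 * C) (L * |a - b|) with hmin | hmin
    · rw [hmin]
      calc |G a - G b - G' b * (a - b)| ≤ |G a - G b| + |G' b * (a - b)| := abs_sub _ _
        _ ≤ C * |a - b| + C * |a - b| := by
            rw [abs_mul]
            gcongr
        _ = _ := by ring
    · rw [hmin]; linarith
  set m := min (2 * C) (L * |a - b|)
  have hm0 : 0 ≤ m := le_min (by linarith) (mul_nonneg hG.nonneg' (abs_nonneg _))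
  have hm2 : m ≤ 2 * C := min_le_left _ _
  calc |h * (G a - G b) - G' b * e|
      = |h * (G a - G b - G' b * (a - b)) + G' b * (h * (a - b) - e)| := by congr 1; ring
    _ ≤ |h| * |G a - G b - G' b * (a - b)| + |G' b| * |h * (a - b) - e| := by
        rw [← abs_mul, ← abs_mul]; exact abs_add_le _ _
    _ ≤ |h| * (m * |a - b|) + C * |h * (a - b) - e| := by gcongr
    _ = m * |h * (a - b)| + C * |h * (a - b) - e| := by rw [abs_mul]; ring
    _ ≤ m * (|h * (a - b) - e| + |e|) + C * |h * (a - b) - e| := by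
        gcongr
        have := abs_sub_abs_le_abs_sub (h * (a - b)) (e)
        linarith
    _ ≤ 2 * C * |h * (a - b) - e| + m * |e| + C * |h * (a - b) - e| := by
        rw [mul_add]; gcongr
    _ = 3 * C * |h * (a - b) - e| + |m * e| := by rw [abs_mul, abs_of_nonneg hm0]; ring

lemma eLpNorm_le_of_abs_le_add {F p q : α → ℝ} {c : ℝ} (hc : 0 ≤ c)
    (hp : AEStronglyMeasurable p μ) (hq : AEStronglyMeasurable q μ)
    (h : ∀ᵐ x ∂μ, |F x| ≤ c * |p x| + |q x|) :
    eLpNorm F 2 μ ≤ ENNReal.ofReal c * eLpNorm p 2 μ + eLpNorm q 2 μ := by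
  have h1 : eLpNorm F 2 μ ≤ eLpNorm ((fun x => c * ‖p x‖) + fun x => ‖q x‖) 2 μ :=
    eLpNorm_mono_ae_real h
  refine h1.trans ((eLpNorm_add_le (hp.norm.const_mul c) hq.norm (by norm_num)).trans ?_)
  rw [eLpNorm_norm]
  gcongr
  refine eLpNorm_le_mul_eLpNorm_of_ae_le_mul (ae_of_all _ fun x => ?_) 2
  rw [norm_mul, norm_norm, Real.norm_of_nonneg hc]

/-- The chain rule for curves in `L²`. -/
lemma HasL2DerivAt.comp [IsFiniteMeasure μ] (hf : HasL2DerivAt μ f f' t) (hG : IsC11On G G' I C L)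
    {b₀ : ℝ} (hb₀ : b₀ ∈ I) (hI : ∀ᶠ s in 𝓝 t, ∀ᵐ x ∂μ, f s x ∈ I) :
    HasL2DerivAt μ (fun s x => G (f s x)) (fun x => G' (f t x) * f' x) t := by
  have hIt := hI.self_of_nhds
  have hm' : AEStronglyMeasurable (fun x => G' (f t x)) μ :=
    (hG.measurable'.comp_aemeasurable hf.memLp_self.1.aemeasurable).aestronglyMeasurable
  have hfm' : MemLp (fun x => G' (f t x) * f' x) 2 μ := by
    have := memLp_mul_of_bound hf.memLp' hm' (C := C) (by
      filter_upwards [hIt] with x hx; exact hG.bound _ hx)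
    simpa only [mul_comm] using this
  refine ⟨?_, hfm', ?_⟩
  · filter_upwards [hf.memLp, hI] with s hs hs'
    exact hG.memLp_comp hb₀ hs hs'
  have hmd : ∀ᶠ s in 𝓝[≠] t, AEStronglyMeasurable (f s - f t) μ := by
    filter_upwards [nhdsWithin_le_nhds hf.memLp] with s hs
    exact hs.1.sub hf.memLp_self.1
  have h2 := tendsto_eLpNorm_min_mul hmd hf.memLp' hf.tendsto_sub
    (c := 2 * C) (L := L) (by linarith [hG.nonneg]) hG.nonneg'
  have h1 : Tendsto (fun s => ENNReal.ofReal (3 * C) *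
      eLpNorm (fun x => (s - t)⁻¹ * (f s x - f t x) - f' x) 2 μ) (𝓝[≠] t) (𝓝 0) := by
    simpa using ENNReal.Tendsto.const_mul hf.tendsto
      (Or.inr (ENNReal.ofReal_ne_top (r := 3 * C)))
  have h3 := h1.add h2
  rw [add_zero] at h3
  refine tendsto_of_tendsto_of_tendsto_of_le_of_le' tendsto_const_nhds h3
    (Eventually.of_forall fun _ => zero_le) ?_
  filter_upwards [nhdsWithin_le_nhds hf.memLp, nhdsWithin_le_nhds hI, hmd] with s hs hsI hsd
  have m1 : AEStronglyMeasurable (fun x => (s - t)⁻¹ * (f s x - f t x) - f' x) μ :=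
    (hsd.const_mul _).sub hf.memLp'.1
  have m2 : AEStronglyMeasurable (fun x => min (2 * C) (L * |(f s - f t) x|) * f' x) μ :=
    ((continuous_const.min (continuous_const.mul continuous_abs)).comp_aestronglyMeasurable
      hsd).mul hf.memLp'.1
  refine eLpNorm_le_of_abs_le_add (by linarith [hG.nonneg]) m1 m2 ?_
  filter_upwards [hsI, hIt] with x hx hx'
  exact hG.abs_quotient_le hx hx' (s - t)⁻¹ (f' x)

end LTwoCurves

/-! ### Gronwall's inequality and affine extensions -/

section CalculusLemmas

lemma antitoneOn_Icc_of_hasDerivAt {f : ℝ → ℝ} {a b : ℝ} (hf : ContinuousOn f (Icc a b))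
    (h : ∀ t ∈ Ioo a b, ∃ f', HasDerivAt f f' t ∧ f' ≤ 0) : AntitoneOn f (Icc a b) := by
  refine antitoneOn_of_deriv_nonpos (convex_Icc a b) hf ?_ ?_
  · rw [interior_Icc]
    intro t ht
    obtain ⟨f', hf', -⟩ := h t ht
    exact hf'.differentiableAt.differentiableWithinAt
  · rw [interior_Icc]
    intro t ht
    obtain ⟨f', hf', hle⟩ := h t ht
    rwa [hf'.deriv]

/-- The product `exp (-c t) f t` is nonincreasing; no sign of `c` or `f` is required. -/
lemma le_exp_mul_of_hasDerivAt {f : ℝ → ℝ} {a b c : ℝ} (hab : a ≤ b)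
    (hf : ContinuousOn f (Icc a b))
    (h : ∀ t ∈ Ioo a b, ∃ f', HasDerivAt f f' t ∧ f' ≤ c * f t) :
    f b ≤ Real.exp (c * (b - a)) * f a := by
  have h1 : AntitoneOn (fun t => Real.exp (-c * t) * f t) (Icc a b) := by
    refine antitoneOn_Icc_of_hasDerivAt (by fun_prop) fun t ht => ?_
    obtain ⟨f', hf', hle⟩ := h t ht
    have h2 : HasDerivAt (fun t => Real.exp (-c * t)) (Real.exp (-c * t) * -c) t := by
      simpa using ((hasDerivAt_id t).const_mul (-c)).exp
    refine ⟨_, h2.mul hf', ?_⟩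
    have := mul_le_mul_of_nonneg_left hle (Real.exp_pos (-c * t)).le
    linarith
  have h2 := h1 (left_mem_Icc.2 hab) (right_mem_Icc.2 hab) hab
  simp only at h2
  have h3 : f b = Real.exp (c * b) * (Real.exp (-c * b) * f b) := by
    rw [← mul_assoc, ← Real.exp_add]; simp
  rw [h3]
  calc Real.exp (c * b) * (Real.exp (-c * b) * f b)
      ≤ Real.exp (c * b) * (Real.exp (-c * a) * f a) :=
        mul_le_mul_of_nonneg_left h2 (Real.exp_pos _).le
    _ = Real.exp (c * (b - a)) * f a := by
        rw [← mul_assoc, ← Real.exp_add]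
        ring_nf

lemma isC11On_id : IsC11On (fun s => s) (fun _ => 1) univ 1 0 :=
  ⟨measurable_id, measurable_const, zero_le_one, le_rfl, by simp, by simp, by simp⟩

lemma isC11On_const (c : ℝ) : IsC11On (fun _ => c) (fun _ => 0) univ 0 0 :=
  ⟨measurable_const, measurable_const, le_rfl, le_rfl, by simp, by simp, by simp⟩

lemma isC11On_rpow {K : ℝ} (hK : 1 ≤ K) (r : ℝ) :
    ∃ C L, IsC11On (fun w => w ^ r) (fun w => r * w ^ (r - 1)) (Icc K⁻¹ K) C L := by
  have hpos : ∀ x ∈ Icc K⁻¹ K, 0 < x := fun x hx => lt_of_lt_of_le (by positivity) hx.1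
  have hd : ∀ r : ℝ, ∀ x ∈ Icc K⁻¹ K,
      HasDerivWithinAt (fun w : ℝ => w ^ r) (r * x ^ (r - 1)) (Icc K⁻¹ K) x := fun r x hx =>
    (Real.hasDerivAt_rpow_const (Or.inl (hpos x hx).ne')).hasDerivWithinAt
  have hb : ∀ r : ℝ, ∀ x ∈ Icc K⁻¹ K, |r * x ^ (r - 1)| ≤ |r| * K ^ |r - 1| := fun r x hx => by
    rw [abs_mul]
    exact mul_le_mul_of_nonneg_left (rpow_abs_le_of_mem_Icc hK _ hx) (abs_nonneg _)
  refine ⟨|r| * K ^ |r - 1|, |r| * (|r - 1| * K ^ |r - 1 - 1|),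
    isC11On_of_hasDerivWithinAt (convex_Icc _ _) (by fun_prop) (by fun_prop) (by positivity)
    (by positivity) (hd r) (hb r) fun x hx y hy => ?_⟩
  have h1 := (convex_Icc K⁻¹ K).norm_image_sub_le_of_norm_hasDerivWithin_le (hd (r - 1))
    (hb (r - 1)) hy hx
  rw [Real.norm_eq_abs, Real.norm_eq_abs] at h1
  rw [← mul_sub, abs_mul, mul_assoc]
  exact mul_le_mul_of_nonneg_left h1 (abs_nonneg _)

/-- The `C¹` extension of `g` from `[a, b]` by affine functions. -/
def affineExt (g g' : ℝ → ℝ) (a b s : ℝ) : ℝ :=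
  g (max a (min s b)) + g' (max a (min s b)) * (s - max a (min s b))

lemma affineExt_of_le {g g' : ℝ → ℝ} {a b s : ℝ} (hab : a ≤ b) (hs : s ≤ a) :
    affineExt g g' a b s = g a + g' a * (s - a) := by
  rw [affineExt, min_eq_left (hs.trans hab), max_eq_left hs]

lemma affineExt_of_mem {g g' : ℝ → ℝ} {a b s : ℝ} (hs : s ∈ Icc a b) :
    affineExt g g' a b s = g s := by
  rw [affineExt, min_eq_left hs.2, max_eq_right hs.1]
  simp

lemma affineExt_of_ge {g g' : ℝ → ℝ} {a b s : ℝ} (hab : a ≤ b) (hs : b ≤ s) :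
    affineExt g g' a b s = g b + g' b * (s - b) := by
  rw [affineExt, min_eq_right hs, max_eq_right hab]

lemma clamp_mem {a b : ℝ} (hab : a ≤ b) (s : ℝ) : max a (min s b) ∈ Icc a b :=
  ⟨le_max_left _ _, max_le hab (min_le_right _ _)⟩

lemma abs_clamp_sub_le (a b s t : ℝ) : |max a (min s b) - max a (min t b)| ≤ |s - t| := by
  refine (abs_max_sub_max_le_max _ _ _ _).trans ?_
  rw [sub_self, abs_zero]
  refine max_le (abs_nonneg _) ((abs_min_sub_min_le_max _ _ _ _).trans ?_)
  rw [sub_self, abs_zero]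
  exact max_le le_rfl (abs_nonneg _)

lemma hasDerivWithinAt_of_notMem_isClosed {f : ℝ → ℝ} {f' : ℝ} {s : Set ℝ} {x : ℝ}
    (hs : IsClosed s) (hx : x ∉ s) : HasDerivWithinAt f f' s x :=
  HasFDerivWithinAt.of_notMem_closure (by rwa [hs.closure_eq])

/-- Three closed sets cover the line. Within each the derivative is elementary, and at points
outside a closed set differentiability within it is vacuous, so the three one-sided statements can
be joined. -/
lemma hasDerivAt_affineExt {g g' : ℝ → ℝ} {a b : ℝ} (hab : a ≤ b)
    (hg : ∀ s ∈ Icc a b, HasDerivWithinAt g (g' s) (Icc a b) s) (s : ℝ) :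
    HasDerivAt (affineExt g g' a b) (g' (max a (min s b))) s := by
  have haff : ∀ c s : ℝ, HasDerivAt (fun s => g c + g' c * (s - c)) (g' c) s := fun c s => by
    simpa using (((hasDerivAt_id s).sub_const c).const_mul (g' c)).const_add (g c)
  have h1 : HasDerivWithinAt (affineExt g g' a b) (g' (max a (min s b))) (Iic a) s := by
    by_cases hs : s ≤ a
    · rw [min_eq_left (hs.trans hab), max_eq_left hs]
      exact (haff a s).hasDerivWithinAt.congr (fun y hy => affineExt_of_le hab hy)
        (affineExt_of_le hab hs)
    · exact hasDerivWithinAt_of_notMem_isClosed isClosed_Iic hs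
  have h2 : HasDerivWithinAt (affineExt g g' a b) (g' (max a (min s b))) (Icc a b) s := by
    by_cases hs : s ∈ Icc a b
    · rw [min_eq_left hs.2, max_eq_right hs.1]
      exact (hg s hs).congr (fun y hy => affineExt_of_mem hy) (affineExt_of_mem hs)
    · exact hasDerivWithinAt_of_notMem_isClosed isClosed_Icc hs
  have h3 : HasDerivWithinAt (affineExt g g' a b) (g' (max a (min s b))) (Ici b) s := by
    by_cases hs : b ≤ s
    · rw [min_eq_right hs, max_eq_right hab]
      exact (haff b s).hasDerivWithinAt.congr (fun y hy => affineExt_of_ge hab hy)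
        (affineExt_of_ge hab hs)
    · exact hasDerivWithinAt_of_notMem_isClosed isClosed_Ici hs
  have h4 := (h1.union h2).union h3
  rwa [Iic_union_Icc_eq_Iic hab, Iic_union_Ici, hasDerivWithinAt_univ] at h4

lemma isC11On_affineExt {g g' : ℝ → ℝ} {a b C L : ℝ} (hab : a ≤ b)
    (hg : ∀ s ∈ Icc a b, HasDerivWithinAt g (g' s) (Icc a b) s)
    (hC : ∀ s ∈ Icc a b, |g' s| ≤ C)
    (hL : ∀ s ∈ Icc a b, ∀ t ∈ Icc a b, |g' s - g' t| ≤ L * |s - t|) (hL0 : 0 ≤ L) :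
    IsC11On (affineExt g g' a b) (fun s => g' (max a (min s b))) univ C L := by
  have hC0 : 0 ≤ C := (abs_nonneg _).trans (hC a (left_mem_Icc.2 hab))
  have hlip : ∀ s t, |g' (max a (min s b)) - g' (max a (min t b))| ≤ L * |s - t| := fun s t =>
    (hL _ (clamp_mem hab s) _ (clamp_mem hab t)).trans
      (mul_le_mul_of_nonneg_left (abs_clamp_sub_le a b s t) hL0)
  have hc' : Continuous fun s => g' (max a (min s b)) := by
    have : LipschitzWith ⟨L, hL0⟩ fun s => g' (max a (min s b)) :=
      LipschitzWith.of_dist_le_mul fun s t => hlip s t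
    exact this.continuous
  have hc : Continuous (affineExt g g' a b) := continuous_iff_continuousAt.2 fun s =>
    (hasDerivAt_affineExt hab hg s).continuousAt
  exact isC11On_of_hasDerivWithinAt convex_univ hc.measurable hc'.measurable hC0 hL0
    (fun s _ => (hasDerivAt_affineExt hab hg s).hasDerivWithinAt)
    (fun s _ => hC _ (clamp_mem hab s)) fun s _ t _ => hlip s t

end CalculusLemmas

/-! ### Volume, average and energy identities along the flow -/

section Functionals

variable {n : ℕ} {M : Type*} [TopologicalSpace M] [ChartedSpace (EuclideanSpace ℝ (Fin n)) M]
  [IsManifold (𝓡 n) ∞ M] [RiemannianBundle (fun x : M => TangentSpace (𝓡 n) x)]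
  [IsContMDiffRiemannianBundle (𝓡 n) ∞ (EuclideanSpace ℝ (Fin n))
      (fun x : M => TangentSpace (𝓡 n) x)]
  [MeasurableSpace M] [BorelSpace M] [SecondCountableTopology M] [T2Space M]
  [IsProbabilityMeasure (riemannianVolume n M)]
  {T K A B : ℝ} {u S S' : ℝ → M → ℝ} {ρ : ℝ → ℝ} {t : ℝ}

lemma RegularFlow.u_pos (h : RegularFlow n T K A B u S S' ρ) (ht : t ∈ Icc 0 T) :
    ∀ᵐ x ∂(riemannianVolume n M), 0 < u t x := by
  have := h.one_le
  filter_upwards [h.u_mem t ht] with x hx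
  exact lt_of_lt_of_le (by positivity) hx.1

lemma RegularFlow.aestronglyMeasurable_rpow (h : RegularFlow n T K A B u S S' ρ)
    (ht : t ∈ Icc 0 T) (r : ℝ) :
    AEStronglyMeasurable (fun x => u t x ^ r) (riemannianVolume n M) :=
  ((h.u_h1 t ht).memLp.1.aemeasurable.pow_const r).aestronglyMeasurable

lemma RegularFlow.abs_rpow_le (h : RegularFlow n T K A B u S S' ρ) (ht : t ∈ Icc 0 T) (r : ℝ) :
    ∀ᵐ x ∂(riemannianVolume n M), |u t x ^ r| ≤ K ^ |r| := by
  filter_upwards [h.u_mem t ht] with x hx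
  exact rpow_abs_le_of_mem_Icc h.one_le r hx

lemma RegularFlow.memLp_rpow (h : RegularFlow n T K A B u S S' ρ) (ht : t ∈ Icc 0 T) (r : ℝ)
    (p : ℝ≥0∞) : MemLp (fun x => u t x ^ r) p (riemannianVolume n M) :=
  MemLp.of_bound (h.aestronglyMeasurable_rpow ht r) _ (h.abs_rpow_le ht r)

lemma RegularFlow.integrable_mul_rpow (h : RegularFlow n T K A B u S S' ρ) (ht : t ∈ Icc 0 T)
    (r : ℝ) {f : M → ℝ} (hf : Integrable f (riemannianVolume n M)) :
    Integrable (fun x => f x * u t x ^ r) (riemannianVolume n M) :=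
  hf.mul_bdd (h.aestronglyMeasurable_rpow ht r) (h.abs_rpow_le ht r)

lemma RegularFlow.memLp_sub (h : RegularFlow n T K A B u S S' ρ) (ht : t ∈ Icc 0 T) :
    MemLp (fun x => S t x - ρ t) 2 (riemannianVolume n M) :=
  (h.S_h1 t ht).memLp.sub (memLp_const _)

lemma RegularFlow.S_hasL2DerivAt (h : RegularFlow n T K A B u S S' ρ) (ht : t ∈ Ioo 0 T) :
    HasL2DerivAt (riemannianVolume n M) S (S' t) t where
  memLp := by
    filter_upwards [Ioo_mem_nhds ht.1 ht.2] with s hs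
    exact (h.S_h1 s (Ioo_subset_Icc_self hs)).memLp
  memLp' := h.S'_memLp t ht
  tendsto := h.S_deriv t ht

lemma RegularFlow.u_hasL2DerivAt (h : RegularFlow n T K A B u S S' ρ) (ht : t ∈ Ioo 0 T) :
    HasL2DerivAt (riemannianVolume n M) u
      (fun x => -(((n : ℝ) - 2) / 4) * (S t x - ρ t) * u t x) t where
  memLp := by
    filter_upwards [Ioo_mem_nhds ht.1 ht.2] with s hs
    exact (h.u_h1 s (Ioo_subset_Icc_self hs)).memLp
  memLp' := by
    have ht' := Ioo_subset_Icc_self ht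
    have h1 := h.abs_rpow_le ht' 1
    simp only [Real.rpow_one] at h1
    exact memLp_mul_of_bound ((h.memLp_sub ht').const_mul _) (h.u_h1 t ht').memLp.1 h1
  tendsto := h.u_deriv t ht

/-- Both `F (S)` and `u ^ r` are differentiable curves in `L²`. For the second, any real `r` is
allowed because `u` stays in a compact interval of positive numbers. -/
lemma RegularFlow.hasDerivAt_integral (h : RegularFlow n T K A B u S S' ρ) (ht : t ∈ Ioo 0 T)
    {F F' : ℝ → ℝ} {C L : ℝ} (hF : IsC11On F F' univ C L) (r : ℝ) :
    HasDerivAt (fun s => ∫ x, F (S s x) * u s x ^ r ∂(riemannianVolume n M))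
      (∫ x, F' (S t x) * S' t x * u t x ^ r ∂(riemannianVolume n M) -
        r * (((n : ℝ) - 2) / 4) *
          ∫ x, F (S t x) * (S t x - ρ t) * u t x ^ r ∂(riemannianVolume n M)) t := by
  have ht' := Ioo_subset_Icc_self ht
  obtain ⟨C₁, L₁, hr⟩ := isC11On_rpow h.one_le r
  have hK := h.one_le
  have h1 := (h.S_hasL2DerivAt ht).comp hF (mem_univ 0) (by simp)
  have h2 := (h.u_hasL2DerivAt ht).comp hr (b₀ := 1) ⟨inv_le_one_of_one_le₀ hK, hK⟩ (by
    filter_upwards [Ioo_mem_nhds ht.1 ht.2] with s hs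
    exact h.u_mem s (Ioo_subset_Icc_self hs))
  have h3 := h1.hasDerivAt_integral_mul h2
  refine h3.congr_deriv ?_
  rw [← integral_const_mul, sub_eq_add_neg (∫ x, F' (S t x) * S' t x * u t x ^ r
    ∂(riemannianVolume n M)), ← integral_neg]
  congr 1
  refine integral_congr_ae ?_
  filter_upwards [h.u_pos ht'] with x hx
  have : u t x ^ r = u t x ^ (r - 1) * u t x := by
    rw [← Real.rpow_add_one hx.ne', sub_add_cancel]
  rw [this]
  ring

lemma RegularFlow.continuousOn_integral (h : RegularFlow n T K A B u S S' ρ)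
    {F F' : ℝ → ℝ} {C L : ℝ} (hF : IsC11On F F' univ C L) (r : ℝ) :
    ContinuousOn (fun s => ∫ x, F (S s x) * u s x ^ r ∂(riemannianVolume n M)) (Icc 0 T) := by
  intro t ht
  obtain ⟨C₁, L₁, hr⟩ := isC11On_rpow h.one_le r
  have hS : ∀ s ∈ Icc 0 T, MemLp (fun x => F (S s x)) 2 (riemannianVolume n M) := fun s hs =>
    hF.memLp_comp (mem_univ 0) (h.S_h1 s hs).memLp (by simp)
  refine tendsto_integral_mul_of_eLpNorm_two ?_ ?_ (hS t ht) (h.memLp_rpow ht r 2)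
    (hF.tendsto_comp (by simp) (by simp) (h.S_cont t ht))
    (hr.tendsto_comp ?_ (h.u_mem t ht) (h.u_cont t ht))
  · filter_upwards [self_mem_nhdsWithin] with s hs using hS s hs
  · filter_upwards [self_mem_nhdsWithin] with s hs using h.memLp_rpow hs r 2
  · filter_upwards [self_mem_nhdsWithin] with s hs using h.u_mem s hs

lemma RegularFlow.integral_at_zero (h : RegularFlow n T K A B u S S' ρ) (F : ℝ → ℝ) (r : ℝ) :
    ∫ x, F (S 0 x) * u 0 x ^ r ∂(riemannianVolume n M) =
      ∫ x, F (scalarCurvature n x) ∂(riemannianVolume n M) := by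
  refine integral_congr_ae ?_
  filter_upwards [h.u_zero, h.S_zero] with x hx hx'
  rw [hx, hx', Real.one_rpow, mul_one]

lemma RegularFlow.volume_pos (h : RegularFlow n T K A B u S S' ρ) (ht : t ∈ Icc 0 T) (r : ℝ) :
    0 < ∫ x, u t x ^ r ∂(riemannianVolume n M) := by
  have hK := h.one_le
  have h1 : ∫ _, (K ^ |r|)⁻¹ ∂(riemannianVolume n M) ≤ ∫ x, u t x ^ r ∂(riemannianVolume n M) := by
    refine integral_mono_ae (integrable_const _) ((h.memLp_rpow ht r 1).integrable le_rfl) ?_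
    filter_upwards [h.u_mem t ht] with x hx
    exact (rpow_mem_of_mem_Icc hK r hx).1
  refine lt_of_lt_of_le ?_ h1
  simp only [integral_const, probReal_univ, one_smul]
  positivity

lemma RegularFlow.integral_sub_average (h : RegularFlow n T K A B u S S' ρ) (ht : t ∈ Icc 0 T) :
    ∫ x, (S t x - ρ t) * u t x ^ volExp n ∂(riemannianVolume n M) = 0 := by
  have h1 := h.average_eq t ht
  have h2 := h.volume_pos ht (volExp n)
  simp only [sub_mul]
  rw [integral_sub (h.integrable_mul_rpow ht _ ((h.S_h1 t ht).integrable))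
    (h.integrable_mul_rpow ht _ (integrable_const _)), integral_const_mul, h1]
  field_simp
  ring

/-- The derivative of the volume is a multiple of the integral of `S - ρ`, which vanishes by the
choice of `ρ`, and the initial volume is 1. -/
lemma RegularFlow.volume_eq_one (h : RegularFlow n T K A B u S S' ρ) (ht : t ∈ Icc 0 T) :
    ∫ x, u t x ^ volExp n ∂(riemannianVolume n M) = 1 := by
  have hT : (0 : ℝ) ≤ T := ht.1.trans ht.2
  have hc := h.continuousOn_integral (isC11On_const 1) (volExp n)
  have hd : ∀ t ∈ Ioo 0 T, HasDerivAt
      (fun s => ∫ x, 1 * u s x ^ volExp n ∂(riemannianVolume n M)) 0 t := fun t ht => by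
    refine (h.hasDerivAt_integral ht (isC11On_const 1) (volExp n)).congr_deriv ?_
    simp only [one_mul]
    rw [h.integral_sub_average (Ioo_subset_Icc_self ht)]
    simp
  simp only [one_mul] at hc hd
  have h1 := antitoneOn_Icc_of_hasDerivAt hc fun t ht => ⟨0, hd t ht, le_rfl⟩
  have h2 := antitoneOn_Icc_of_hasDerivAt hc.neg fun t ht => ⟨_, (hd t ht).neg, by simp⟩
  have h0 : (0 : ℝ) ∈ Icc 0 T := ⟨le_rfl, hT⟩
  have h3 := h1 h0 ht ht.1
  have h4 := h2 h0 ht ht.1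
  have h5 := h.integral_at_zero (fun _ => 1) (volExp n)
  simp only [one_mul, integral_const, probReal_univ, smul_eq_mul, mul_one] at h5
  simp only [Pi.neg_apply] at h4
  linarith

lemma RegularFlow.average_eq_integral (h : RegularFlow n T K A B u S S' ρ) (ht : t ∈ Icc 0 T) :
    ρ t = ∫ x, S t x * u t x ^ volExp n ∂(riemannianVolume n M) := by
  rw [h.average_eq t ht, h.volume_eq_one ht, inv_one, one_mul]

lemma RegularFlow.average_nonneg (h : RegularFlow n T K A B u S S' ρ) (ht : t ∈ Icc 0 T) :
    0 ≤ ρ t := by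
  rw [h.average_eq_integral ht]
  exact h.total_nonneg t ht

lemma RegularFlow.continuousOn_average (h : RegularFlow n T K A B u S S' ρ) :
    ContinuousOn ρ (Icc 0 T) :=
  (h.continuousOn_integral isC11On_id (volExp n)).congr fun _ ht => h.average_eq_integral ht

lemma RegularFlow.integral_sq (h : RegularFlow n T K A B u S S' ρ) (ht : t ∈ Icc 0 T) :
    ∫ x, S t x * (S t x - ρ t) * u t x ^ volExp n ∂(riemannianVolume n M) =
      ∫ x, S t x ^ 2 * u t x ^ volExp n ∂(riemannianVolume n M) - ρ t ^ 2 := by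
  have h1 := h.average_eq_integral ht
  have i1 := h.integrable_mul_rpow ht (volExp n) (h.S_h1 t ht).memLp.integrable_sq
  have i2 := (h.integrable_mul_rpow ht (volExp n) (h.S_h1 t ht).integrable).const_mul (ρ t)
  have : ∀ x, S t x * (S t x - ρ t) * u t x ^ volExp n =
      S t x ^ 2 * u t x ^ volExp n - ρ t * (S t x * u t x ^ volExp n) := fun x => by ring
  simp only [this]
  rw [integral_sub i1 i2, integral_const_mul, ← h1]
  ring

/-- At unit volume the difference of the two sides is the variance of `S`. -/
lemma RegularFlow.average_sq_le (h : RegularFlow n T K A B u S S' ρ) (ht : t ∈ Icc 0 T) :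
    ρ t ^ 2 ≤ ∫ x, S t x ^ 2 * u t x ^ volExp n ∂(riemannianVolume n M) := by
  have i1 := h.integrable_mul_rpow ht (volExp n)
    (integrable_mul_of_memLp_two (h.S_h1 t ht).memLp (h.memLp_sub ht))
  have i2 := (h.integrable_mul_rpow ht (volExp n)
    ((h.memLp_sub ht).integrable (by norm_num))).const_mul (ρ t)
  have h2 : 0 ≤ ∫ x, (S t x * (S t x - ρ t) * u t x ^ volExp n -
      ρ t * ((S t x - ρ t) * u t x ^ volExp n)) ∂(riemannianVolume n M) := by
    refine integral_nonneg_of_ae ?_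
    filter_upwards [h.u_pos ht] with x hx
    have : S t x * (S t x - ρ t) * u t x ^ volExp n -
      ρ t * ((S t x - ρ t) * u t x ^ volExp n) = (S t x - ρ t) ^ 2 * u t x ^ volExp n := by ring
    rw [this]
    simp only [Pi.zero_apply]
    positivity
  rw [integral_sub i1 i2, integral_const_mul, h.integral_sub_average ht, h.integral_sq ht] at h2
  linarith

/-- The energy identity obtained by testing the evolution equation with `F'(S)`. -/
lemma RegularFlow.hasDerivAt_integral_volExp (hn : 3 ≤ n) (h : RegularFlow n T K A B u S S' ρ)
    (ht : t ∈ Ioo 0 T) {F F' : ℝ → ℝ} {C L : ℝ} (hF : IsC11On F F' univ C L)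
    {Z : ∀ x : M, TangentSpace (𝓡 n) x} (hZ : HasH1Gradient n (fun x => F' (S t x)) Z) :
    HasDerivAt (fun s => ∫ x, F (S s x) * u s x ^ volExp n ∂(riemannianVolume n M))
      (∫ x, (F' (S t x) * S t x - n / 2 * F (S t x)) * (S t x - ρ t) * u t x ^ volExp n
          ∂(riemannianVolume n M) -
        ((n : ℝ) - 1) * ∫ x, u t x ^ 2 * inner ℝ (weakGrad n (S t) x) (Z x)
          ∂(riemannianVolume n M)) t := by
  have ht' := Ioo_subset_Icc_self ht
  have hn3 : (3 : ℝ) ≤ n := by exact_mod_cast hn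
  have hb : ∀ᵐ x ∂(riemannianVolume n M), ‖F' (S t x)‖ ≤ C :=
    ae_of_all _ fun x => hF.bound _ (mem_univ _)
  refine (h.hasDerivAt_integral ht hF (volExp n)).congr_deriv ?_
  rw [h.evol t ht _ Z C hZ hb]
  have hexp : volExp n * (((n : ℝ) - 2) / 4) = n / 2 := by
    unfold volExp
    have : (n : ℝ) - 2 ≠ 0 := by linarith
    field_simp
    ring
  rw [hexp]
  have hS := (h.S_h1 t ht').memLp
  have hFm := hZ.memLp.1
  have i1 : Integrable (fun x => S t x * (S t x - ρ t) * F' (S t x) * u t x ^ volExp n)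
      (riemannianVolume n M) := h.integrable_mul_rpow ht' _
    ((integrable_mul_of_memLp_two hS (h.memLp_sub ht')).mul_bdd hFm hb)
  have i2 : Integrable (fun x => S' t x * F' (S t x) * u t x ^ volExp n) (riemannianVolume n M) :=
    h.integrable_mul_rpow ht' _ (((h.S'_memLp t ht).integrable (by norm_num)).mul_bdd hFm hb)
  have i3 : Integrable (fun x => F (S t x) * (S t x - ρ t) * u t x ^ volExp n)
      (riemannianVolume n M) := h.integrable_mul_rpow ht' _
    (integrable_mul_of_memLp_two (hF.memLp_comp (mem_univ 0) hS (by simp)) (h.memLp_sub ht'))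
  have e1 : ∫ x, (S t x * (S t x - ρ t) - S' t x) * u t x ^ volExp n * F' (S t x)
      ∂(riemannianVolume n M) =
      ∫ x, S t x * (S t x - ρ t) * F' (S t x) * u t x ^ volExp n ∂(riemannianVolume n M) -
      ∫ x, S' t x * F' (S t x) * u t x ^ volExp n ∂(riemannianVolume n M) := by
    rw [← integral_sub i1 i2]
    exact integral_congr_ae (ae_of_all _ fun x => by dsimp only; ring)
  have e2 : ∫ x, (F' (S t x) * S t x - n / 2 * F (S t x)) * (S t x - ρ t) * u t x ^ volExp n
      ∂(riemannianVolume n M) =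
      ∫ x, S t x * (S t x - ρ t) * F' (S t x) * u t x ^ volExp n ∂(riemannianVolume n M) -
      n / 2 * ∫ x, F (S t x) * (S t x - ρ t) * u t x ^ volExp n ∂(riemannianVolume n M) := by
    rw [← integral_const_mul, ← integral_sub i1 (i3.const_mul _)]
    exact integral_congr_ae (ae_of_all _ fun x => by dsimp only; ring)
  have e3 : ∫ x, F' (S t x) * S' t x * u t x ^ volExp n ∂(riemannianVolume n M) =
      ∫ x, S' t x * F' (S t x) * u t x ^ volExp n ∂(riemannianVolume n M) :=
    integral_congr_ae (ae_of_all _ fun x => by dsimp only; ring)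
  rw [e1, e2, e3]
  ring

/-- The evolution of the average scalar curvature. -/
lemma RegularFlow.hasDerivAt_average (hn : 3 ≤ n) (h : RegularFlow n T K A B u S S' ρ)
    (ht : t ∈ Ioo 0 T) :
    HasDerivAt ρ (-(((n : ℝ) - 2) / 2) *
      (∫ x, S t x ^ 2 * u t x ^ volExp n ∂(riemannianVolume n M) - ρ t ^ 2)) t := by
  -- For `F = id` the test function `F' (S) = 1` is constant, so the gradient term disappears.
  have h1 := h.hasDerivAt_integral_volExp hn ht isC11On_id (Z := fun _ => 0)
    (hasH1Gradient_const 1)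
  have h2 : ρ =ᶠ[𝓝 t] fun s => ∫ x, S s x * u s x ^ volExp n ∂(riemannianVolume n M) := by
    filter_upwards [Ioo_mem_nhds ht.1 ht.2] with s hs
    exact h.average_eq_integral (Ioo_subset_Icc_self hs)
  refine (h1.congr_of_eventuallyEq h2).congr_deriv ?_
  simp only [inner_zero_right, mul_zero, integral_zero, sub_zero]
  rw [← h.integral_sq (Ioo_subset_Icc_self ht), ← integral_const_mul]
  exact integral_congr_ae (ae_of_all _ fun x => by dsimp only; ring)

/-- The derivative of `ρ` is a negative multiple of a variance, and `ρ 0` is the mean of `S₀`. The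
bound therefore does not depend on the flow. -/
lemma RegularFlow.average_le (hn : 3 ≤ n) (h : RegularFlow n T K A B u S S' ρ)
    (ht : t ∈ Icc 0 T) : ρ t ≤ ∫ x, scalarCurvature n x ∂(riemannianVolume n M) := by
  have hn3 : (3 : ℝ) ≤ n := by exact_mod_cast hn
  have h1 : AntitoneOn ρ (Icc 0 T) := antitoneOn_Icc_of_hasDerivAt h.continuousOn_average
    fun s hs => ⟨_, h.hasDerivAt_average hn hs, by
      have := h.average_sq_le (Ioo_subset_Icc_self hs)
      nlinarith⟩
  have h0 : (0 : ℝ) ∈ Icc 0 T := ⟨le_rfl, ht.1.trans ht.2⟩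
  refine (h1 h0 ht ht.1).trans ?_
  rw [h.average_eq_integral h0, h.integral_at_zero (fun s => s)]

end Functionals

/-! ### A convex penalty for values below `-m` -/

section Huber

/-- The function that vanishes on `[-m, ∞)`, is quadratic on `[-m - 1, -m]` and affine below. -/
def huber (m : ℝ) : ℝ → ℝ := affineExt (fun s => (s + m) ^ 2 / 2) (fun s => s + m) (-m - 1) (-m)

variable {m : ℝ}

lemma isC11On_huber (m : ℝ) :
    IsC11On (huber m) (fun s => max (-m - 1) (min s (-m)) + m) univ 1 1 := by
  refine isC11On_affineExt (g' := fun s => s + m) (by linarith) (fun s _ => ?_) (fun s hs => ?_)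
    (fun s _ t _ => ?_) zero_le_one
  · have := (((hasDerivAt_id s).add_const m).pow 2).div_const 2
    refine (this.congr_deriv ?_).hasDerivWithinAt
    simp
  · rw [abs_le]; constructor <;> linarith [hs.1, hs.2]
  · rw [add_sub_add_right_eq_sub, one_mul]

lemma hasDerivAt_huber (m s : ℝ) :
    HasDerivAt (huber m) (max (-m - 1) (min s (-m)) + m) s :=
  hasDerivAt_affineExt (g' := fun s => s + m) (by linarith) (fun s _ => by
    have := (((hasDerivAt_id s).add_const m).pow 2).div_const 2
    refine (this.congr_deriv ?_).hasDerivWithinAt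
    simp) s

lemma huber_of_ge {s : ℝ} (hs : -m ≤ s) : huber m s = 0 := by
  rw [huber, affineExt_of_ge (by linarith) hs]
  simp

lemma huber_facts {s : ℝ} (hs : s < -m) :
    0 < huber m s ∧ max (-m - 1) (min s (-m)) + m ≤ 0 ∧
      huber m s ≤ (max (-m - 1) (min s (-m)) + m) * (s + m) := by
  rw [huber, affineExt, min_eq_left hs.le]
  rcases le_total s (-m - 1) with h | h
  · rw [max_eq_left h]
    refine ⟨?_, ?_, ?_⟩ <;> nlinarith
  · rw [max_eq_right h]
    refine ⟨?_, ?_, ?_⟩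
    · have : (s + m) ^ 2 > 0 := by
        have : s + m < 0 := by linarith
        nlinarith
      linarith
    · linarith
    · nlinarith [sq_nonneg (s + m)]

lemma huber_nonneg (s : ℝ) : 0 ≤ huber m s := by
  rcases le_or_gt (-m) s with h | h
  · rw [huber_of_ge h]
  · exact (huber_facts h).1.le

/-- Below `-m` both `s` and the derivative are nonpositive, so the terms with `r` and `m` have a
favourable sign, and convexity gives `F ≤ F' (s + m)`. The right side has the form that later
cancels. -/
lemma huber_reaction_le (hm : 0 ≤ m) {r : ℝ} (hr : 0 ≤ r) (s : ℝ) :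
    s * (s - r) * (max (-m - 1) (min s (-m)) + m) ≤ s * huber m s := by
  rcases le_or_gt (-m) s with h | h
  · rw [huber_of_ge h, min_eq_right h, max_eq_right (by linarith)]
    simp
  · obtain ⟨h1, h2, h3⟩ := huber_facts h
    set d := max (-m - 1) (min s (-m)) + m
    have hs : s < 0 := by linarith
    have h4 : s * (d * (s + m)) ≤ s * huber m s := mul_le_mul_of_nonpos_left h3 hs.le
    have h5 : 0 ≤ s * d := mul_nonneg_of_nonpos_of_nonpos hs.le h2
    nlinarith [mul_nonneg h5 hr, mul_nonneg h5 hm]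

end Huber

/-! ### The lower bound of the scalar curvature -/

section LowerBound

variable {n : ℕ} {M : Type*} [TopologicalSpace M] [ChartedSpace (EuclideanSpace ℝ (Fin n)) M]
  [IsManifold (𝓡 n) ∞ M] [RiemannianBundle (fun x : M => TangentSpace (𝓡 n) x)]
  [IsContMDiffRiemannianBundle (𝓡 n) ∞ (EuclideanSpace ℝ (Fin n))
      (fun x : M => TangentSpace (𝓡 n) x)]
  [MeasurableSpace M] [BorelSpace M] [SecondCountableTopology M] [T2Space M]
  [IsProbabilityMeasure (riemannianVolume n M)]
  {T K A B m : ℝ} {u S S' : ℝ → M → ℝ} {ρ : ℝ → ℝ} {t : ℝ}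

lemma hasH1Gradient_inv (hd : TestFunctionsDense n M) {K : ℝ} (hK : 1 ≤ K) {f : M → ℝ}
    {X : ∀ x : M, TangentSpace (𝓡 n) x} (hf : HasH1Gradient n f X)
    (hfK : ∀ᵐ x ∂(riemannianVolume n M), f x ∈ Icc K⁻¹ K) :
    HasH1Gradient n (fun x => (f x)⁻¹) (fun x => (-(f x ^ 2)⁻¹) • X x) := by
  have hpos : ∀ s ∈ Icc K⁻¹ K, s ≠ 0 := fun s hs =>
    (lt_of_lt_of_le (by positivity : 0 < K⁻¹) hs.1).ne'
  refine hf.comp_Icc hd (G := fun s => s⁻¹) (G' := fun s => -(s ^ 2)⁻¹) (a := K⁻¹) (b := K)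
    ((inv_le_one_of_one_le₀ hK).trans hK) hfK (fun s hs => hasDerivAt_inv (hpos s hs)) ?_
  exact ((continuousOn_pow 2).inv₀ fun s hs => pow_ne_zero 2 (hpos s hs)).neg

/-- The inequality obtained by testing the evolution equation with `huber' (S) / u`. -/
lemma RegularFlow.integral_huber_le (hn : 3 ≤ n) (hd : TestFunctionsDense n M)
    (h : RegularFlow n T K A B u S S' ρ) (ht : t ∈ Ioo 0 T) :
    ∫ x, (max (-m - 1) (min (S t x) (-m)) + m) * S' t x * u t x ^ scalExp n
        ∂(riemannianVolume n M) ≤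
      ∫ x, S t x * (S t x - ρ t) * (max (-m - 1) (min (S t x) (-m)) + m) * u t x ^ scalExp n
        ∂(riemannianVolume n M) +
      ((n : ℝ) - 2) / 4 * ∫ x, (S t x * u t x ^ scalExp n - scalarCurvature n x * u t x) *
        huber m (S t x) ∂(riemannianVolume n M) := by
  have ht' := Ioo_subset_Icc_self ht
  have hn3 : (3 : ℝ) ≤ n := by exact_mod_cast hn
  have hSh := h.S_h1 t ht'
  have huh := h.u_h1 t ht'
  have hK := h.one_le
  set X := weakGrad n (S t)
  set U := weakGrad n (u t)
  set d : M → ℝ := fun x => max (-m - 1) (min (S t x) (-m)) + m with hdd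
  have hdb : ∀ x, |d x| ≤ 1 := fun x => by
    have := clamp_mem (a := -m - 1) (b := -m) (by linarith) (S t x)
    rw [abs_le]; constructor <;> simp only [hdd] <;> linarith [this.1, this.2]
  have hdh : HasH1Gradient n d (fun x => clampWeight (-m - 1) (-m) (S t x) • X x) :=
    ((hSh.clamp hd (a := -m - 1) (b := -m) (by linarith)).add (hasH1Gradient_const m)).congr_ae
      (EventuallyEq.refl _ _) (ae_of_all _ fun x => add_zero (M := TangentSpace (𝓡 n) x) _)
  have hinv := hasH1Gradient_inv hd hK huh (h.u_mem t ht')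
  have hφ := hdh.mul hd hinv (C := K) (ae_of_all _ fun x => (hdb x).trans hK) (by
    filter_upwards [h.u_mem t ht', h.u_pos ht'] with x hx hx0
    rw [abs_of_pos (by positivity)]
    exact inv_le_of_inv_le₀ (by positivity) hx.1) (by linarith)
  have hφb : ∀ᵐ x ∂(riemannianVolume n M), |d x * (u t x)⁻¹| ≤ K := by
    filter_upwards [h.u_mem t ht', h.u_pos ht'] with x hx hx0
    rw [abs_mul, abs_of_pos (by positivity : 0 < (u t x)⁻¹)]
    calc |d x| * (u t x)⁻¹ ≤ 1 * K := mul_le_mul (hdb x)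
          (inv_le_of_inv_le₀ (by positivity) hx.1) (by positivity) zero_le_one
      _ = K := one_mul K
  have hev := h.evol t ht _ _ K hφ hφb
  have hFS : HasH1Gradient n (fun x => huber m (S t x)) (fun x => d x • X x) :=
    hSh.comp hd (G' := fun s => max (-m - 1) (min s (-m)) + m) (hasDerivAt_huber m) (by fun_prop)
      (K := 1) fun s => by
        have := clamp_mem (a := -m - 1) (b := -m) (by linarith) s
        rw [abs_le]; constructor <;> linarith [this.1, this.2]
  have hsc := h.scalar t ht' _ _ hFS
  have i0 : Integrable (fun x => d x * inner ℝ (U x) (X x)) (riemannianVolume n M) :=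
    (integrable_inner huh.measurableField hSh.measurableField huh.memLp_grad
      hSh.memLp_grad).bdd_mul hdh.memLp.1 (ae_of_all _ hdb)
  have hwm : AEStronglyMeasurable (fun x => clampWeight (-m - 1) (-m) (S t x))
      (riemannianVolume n M) :=
    ((measurable_clampWeight _ _).comp_aemeasurable hSh.memLp.1.aemeasurable).aestronglyMeasurable
  have hw := fun x => clampWeight_mem (a := -m - 1) (b := -m) (by linarith) (S t x)
  set w : M → ℝ := fun x => clampWeight (-m - 1) (-m) (S t x)
  have i1 : Integrable (fun x => w x * u t x * ‖X x‖ ^ 2) (riemannianVolume n M) := by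
    refine hSh.memLp_grad.integrable_sq.bdd_mul (c := K) (hwm.mul huh.memLp.1) ?_
    filter_upwards [h.u_mem t ht', h.u_pos ht'] with x hx hx0
    rw [Real.norm_eq_abs, abs_of_nonneg (mul_nonneg (hw x).1 hx0.le)]
    calc w x * u t x ≤ 1 * K := mul_le_mul (hw x).2 hx.2 hx0.le zero_le_one
      _ = K := one_mul K
  -- The gradient of `d / u` has two parts. The one from `∇S` gives a nonnegative term to be
  -- dropped. The one from `∇u` is minus the left side of the scalar curvature equation tested with
  -- `huber m (S)`, up to a constant, and so becomes a term without derivatives.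
  have e1 : ∫ x, u t x ^ 2 * inner ℝ (X x) (d x • (-(u t x ^ 2)⁻¹) • U x +
      (u t x)⁻¹ • (w x • X x)) ∂(riemannianVolume n M) =
      ∫ x, w x * u t x * ‖X x‖ ^ 2 ∂(riemannianVolume n M) -
      ∫ x, d x * inner ℝ (U x) (X x) ∂(riemannianVolume n M) := by
    rw [← integral_sub i1 i0]
    refine integral_congr_ae ?_
    filter_upwards [h.u_pos ht'] with x hx
    rw [inner_add_right]
    simp only [real_inner_smul_right, real_inner_self_eq_norm_sq]
    rw [real_inner_comm (U x) (X x)]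
    field_simp
    ring
  have e2 : ∫ x, inner ℝ (U x) (d x • X x) ∂(riemannianVolume n M) =
      ∫ x, d x * inner ℝ (U x) (X x) ∂(riemannianVolume n M) := by
    simp only [real_inner_smul_right]
  have hpos1 : 0 ≤ ∫ x, w x * u t x * ‖X x‖ ^ 2 ∂(riemannianVolume n M) := by
    refine integral_nonneg_of_ae ?_
    filter_upwards [h.u_pos ht'] with x hx
    exact mul_nonneg (mul_nonneg (hw x).1 hx.le) (sq_nonneg _)
  have i2 : Integrable (fun x => S t x * (S t x - ρ t) * d x * u t x ^ scalExp n)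
      (riemannianVolume n M) := h.integrable_mul_rpow ht' _
    ((integrable_mul_of_memLp_two hSh.memLp (h.memLp_sub ht')).mul_bdd hdh.memLp.1
      (ae_of_all _ hdb))
  have i3 : Integrable (fun x => d x * S' t x * u t x ^ scalExp n) (riemannianVolume n M) :=
    h.integrable_mul_rpow ht' _ (((h.S'_memLp t ht).integrable (by norm_num)).bdd_mul hdh.memLp.1
      (ae_of_all _ hdb))
  have e3 : ∫ x, (S t x * (S t x - ρ t) - S' t x) * u t x ^ volExp n * (d x * (u t x)⁻¹)
      ∂(riemannianVolume n M) =
      ∫ x, S t x * (S t x - ρ t) * d x * u t x ^ scalExp n ∂(riemannianVolume n M) -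
      ∫ x, d x * S' t x * u t x ^ scalExp n ∂(riemannianVolume n M) := by
    rw [← integral_sub i2 i3]
    refine integral_congr_ae ?_
    filter_upwards [h.u_pos ht'] with x hx
    rw [← scalExp_add_one hn, Real.rpow_add_one hx.ne']
    field_simp
  have e4 : ((n : ℝ) - 1) = ((n : ℝ) - 2) / 4 * (4 * ((n : ℝ) - 1) / ((n : ℝ) - 2)) := by
    have : (n : ℝ) - 2 ≠ 0 := by linarith
    field_simp
  rw [e1, e3] at hev
  rw [e2] at hsc
  have e5 : ((n : ℝ) - 1) * ∫ x, d x * inner ℝ (U x) (X x) ∂(riemannianVolume n M) =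
      ((n : ℝ) - 2) / 4 * ∫ x, (S t x * u t x ^ scalExp n - scalarCurvature n x * u t x) *
        huber m (S t x) ∂(riemannianVolume n M) := by
    rw [← hsc, ← mul_assoc, ← e4]
  rw [← e5]
  have : 0 ≤ ((n : ℝ) - 1) * ∫ x, w x * u t x * ‖X x‖ ^ 2 ∂(riemannianVolume n M) :=
    mul_nonneg (by linarith) hpos1
  linarith

/-- A lower bound of the initial scalar curvature is preserved. -/
theorem RegularFlow.neg_le (hn : 3 ≤ n) (hd : TestFunctionsDense n M)
    (h : RegularFlow n T K A B u S S' ρ) (hm : 0 ≤ m)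
    (hS₀ : ∀ᵐ x ∂(riemannianVolume n M), -m ≤ scalarCurvature n x) (ht : t ∈ Icc 0 T) :
    ∀ᵐ x ∂(riemannianVolume n M), -m ≤ S t x := by
  have hn3 : (3 : ℝ) ≤ n := by exact_mod_cast hn
  have hK := h.one_le
  set J : ℝ → ℝ := fun s => ∫ x, huber m (S s x) * u s x ^ scalExp n ∂(riemannianVolume n M)
    with hJ
  set R := ∫ x, scalarCurvature n x ∂(riemannianVolume n M)
  -- `Λ` involves the flow-dependent `K`, which does no harm because `J` starts at zero.
  set Λ : ℝ := ((n : ℝ) + 2) / 4 * R + ((n : ℝ) - 2) / 4 * m * K ^ |1 - scalExp n| with hΛ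
  have hJc : ContinuousOn J (Icc 0 T) := h.continuousOn_integral (isC11On_huber m) _
  have hint : ∀ s ∈ Icc 0 T, Integrable (fun x => huber m (S s x) * u s x ^ scalExp n)
      (riemannianVolume n M) := fun s hs => h.integrable_mul_rpow hs _
    (((isC11On_huber m).memLp_comp (mem_univ 0) (h.S_h1 s hs).memLp (by simp)).integrable
      (by norm_num))
  -- The terms `S * huber m S * u ^ scalExp n` come with the coefficients `1` (reaction), `(n - 2) /
  -- 4` (scalar curvature equation) and `-(n + 2) / 4` (derivative of the weight), whose sum is
  -- zero. This is the reason for the weight `u ^ scalExp n` in place of the volume density; the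
  -- remaining terms are linear in `J`.
  have hder : ∀ s ∈ Ioo 0 T, ∃ J', HasDerivAt J J' s ∧ J' ≤ Λ * J s := fun s hs => by
    have hs' := Ioo_subset_Icc_self hs
    refine ⟨_, h.hasDerivAt_integral hs (isC11On_huber m) (scalExp n), ?_⟩
    have h1 := h.integral_huber_le (m := m) hn hd hs
    have hexp : scalExp n * (((n : ℝ) - 2) / 4) = ((n : ℝ) + 2) / 4 := by
      unfold scalExp
      have : (n : ℝ) - 2 ≠ 0 := by linarith
      field_simp
    rw [hexp]
    have hS := (h.S_h1 s hs').memLp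
    have hF : MemLp (fun x => huber m (S s x)) 2 (riemannianVolume n M) :=
      (isC11On_huber m).memLp_comp (mem_univ 0) hS (by simp)
    have i1 : Integrable (fun x => S s x * (S s x - ρ s) *
        (max (-m - 1) (min (S s x) (-m)) + m) * u s x ^ scalExp n) (riemannianVolume n M) :=
      h.integrable_mul_rpow hs' _ ((integrable_mul_of_memLp_two hS (h.memLp_sub hs')).mul_bdd
        ((isC11On_huber m).measurable'.comp_aemeasurable hS.1.aemeasurable).aestronglyMeasurable
        (ae_of_all _ fun x => (isC11On_huber m).bound _ (mem_univ _)))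
    have i2 : Integrable (fun x => (S s x * u s x ^ scalExp n - scalarCurvature n x * u s x) *
        huber m (S s x)) (riemannianVolume n M) := by
      have hu1 := h.abs_rpow_le hs' 1
      simp only [Real.rpow_one] at hu1
      refine integrable_mul_of_memLp_two (MemLp.sub ?_ ?_) hF
      · exact memLp_mul_of_bound hS (h.aestronglyMeasurable_rpow hs' _) (h.abs_rpow_le hs' _)
      · exact memLp_mul_of_bound h.scal_memLp (h.u_h1 s hs').memLp.1 hu1
    have i3 : Integrable (fun x => huber m (S s x) * (S s x - ρ s) * u s x ^ scalExp n)
        (riemannianVolume n M) :=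
      h.integrable_mul_rpow hs' _ (integrable_mul_of_memLp_two hF (h.memLp_sub hs'))
    have h2 : ∫ x, (S s x * (S s x - ρ s) *
          (max (-m - 1) (min (S s x) (-m)) + m) * u s x ^ scalExp n +
        ((n : ℝ) - 2) / 4 * ((S s x * u s x ^ scalExp n - scalarCurvature n x * u s x) *
          huber m (S s x)) -
        ((n : ℝ) + 2) / 4 * (huber m (S s x) * (S s x - ρ s) * u s x ^ scalExp n))
          ∂(riemannianVolume n M) ≤
        ∫ x, Λ * (huber m (S s x) * u s x ^ scalExp n) ∂(riemannianVolume n M) := by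
      refine integral_mono_ae ((i1.add (i2.const_mul _)).sub (i3.const_mul _))
        ((hint s hs').const_mul _) ?_
      filter_upwards [h.u_pos hs', h.u_mem s hs', hS₀] with x hx hxK hx0
      have hr0 := h.average_nonneg hs'
      have hrR := h.average_le hn hs'
      have p1 := huber_reaction_le hm hr0 (S s x)
      have p2 := huber_nonneg (m := m) (S s x)
      have p3 : u s x ≤ K ^ |1 - scalExp n| * u s x ^ scalExp n := by
        have e : u s x = u s x ^ (1 - scalExp n) * u s x ^ scalExp n := by
          rw [← Real.rpow_add hx, sub_add_cancel, Real.rpow_one]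
        nth_rewrite 1 [e]
        exact mul_le_mul_of_nonneg_right (rpow_mem_of_mem_Icc hK _ hxK).2 (by positivity)
      have hv : 0 < u s x ^ scalExp n := by positivity
      have hKp : 0 ≤ K ^ |1 - scalExp n| := by positivity
      set f := huber m (S s x)
      set d := max (-m - 1) (min (S s x) (-m)) + m
      set v := u s x ^ scalExp n
      set κ := K ^ |1 - scalExp n|
      have q1 : S s x * (S s x - ρ s) * d * v ≤ S s x * f * v :=
        mul_le_mul_of_nonneg_right p1 hv.le
      have q2 : -(scalarCurvature n x * u s x * f) ≤ m * (κ * v) * f := by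
        have : -(scalarCurvature n x) * u s x ≤ m * (κ * v) :=
          mul_le_mul (by linarith) p3 hx.le hm
        nlinarith
      have q3 : ρ s * (f * v) ≤ R * (f * v) := mul_le_mul_of_nonneg_right hrR (by positivity)
      have q4 := mul_le_mul_of_nonneg_left q2 (by linarith : 0 ≤ ((n : ℝ) - 2) / 4)
      have q5 := mul_le_mul_of_nonneg_left q3 (by linarith : 0 ≤ ((n : ℝ) + 2) / 4)
      rw [hΛ]
      linarith
    have h3 : ∫ x, (S s x * (S s x - ρ s) *
          (max (-m - 1) (min (S s x) (-m)) + m) * u s x ^ scalExp n +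
        ((n : ℝ) - 2) / 4 * ((S s x * u s x ^ scalExp n - scalarCurvature n x * u s x) *
          huber m (S s x)) -
        ((n : ℝ) + 2) / 4 * (huber m (S s x) * (S s x - ρ s) * u s x ^ scalExp n))
          ∂(riemannianVolume n M) =
        ∫ x, S s x * (S s x - ρ s) * (max (-m - 1) (min (S s x) (-m)) + m) * u s x ^ scalExp n
          ∂(riemannianVolume n M) +
        ((n : ℝ) - 2) / 4 * ∫ x, (S s x * u s x ^ scalExp n - scalarCurvature n x * u s x) *
          huber m (S s x) ∂(riemannianVolume n M) -
        ((n : ℝ) + 2) / 4 * ∫ x, huber m (S s x) * (S s x - ρ s) * u s x ^ scalExp n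
          ∂(riemannianVolume n M) := by
      have j2 := i2.const_mul (((n : ℝ) - 2) / 4)
      have i12 : Integrable (fun x => S s x * (S s x - ρ s) *
          (max (-m - 1) (min (S s x) (-m)) + m) * u s x ^ scalExp n +
          ((n : ℝ) - 2) / 4 * ((S s x * u s x ^ scalExp n - scalarCurvature n x * u s x) *
          huber m (S s x))) (riemannianVolume n M) := i1.add j2
      rw [integral_sub i12 (i3.const_mul _), integral_add i1 j2, integral_const_mul,
        integral_const_mul]
    rw [integral_const_mul] at h2
    linarith
  have hT : (0 : ℝ) ≤ T := ht.1.trans ht.2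
  have h0 : J 0 = 0 := by
    rw [hJ]
    simp only
    rw [h.integral_at_zero]
    refine integral_eq_zero_of_ae ?_
    filter_upwards [hS₀] with x hx using huber_of_ge hx
  have h1 : J t ≤ Real.exp (Λ * (t - 0)) * J 0 :=
    le_exp_mul_of_hasDerivAt ht.1 (hJc.mono (Icc_subset_Icc_right ht.2))
      fun s hs => hder s ⟨hs.1, hs.2.trans_le ht.2⟩
  rw [h0, mul_zero] at h1
  have hpos : 0 ≤ᵐ[riemannianVolume n M] fun x => huber m (S t x) * u t x ^ scalExp n := by
    filter_upwards [h.u_pos ht] with x hx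
    exact mul_nonneg (huber_nonneg _) (by positivity)
  have h2 := (integral_eq_zero_iff_of_nonneg_ae hpos (hint t ht)).1
    (le_antisymm h1 (integral_nonneg_of_ae hpos))
  filter_upwards [h2, h.u_pos ht] with x hx hx0
  by_contra! hc
  have := (huber_facts hc).1
  have : 0 < huber m (S t x) * u t x ^ scalExp n := by positivity
  exact this.ne' hx

end LowerBound

/-! ### Truncated powers and their reaction terms -/

section PowExt

/-- The truncation of `s` to `[1, L]`. -/
def trunc (L s : ℝ) : ℝ := max 1 (min s L)

/-- The convex function that vanishes on `(-∞, 1]`, equals `s ^ p - 1 - p * (s - 1)` on `[1, L]`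
and is affine on `[L, ∞)`. -/
def powExt (p L : ℝ) : ℝ → ℝ :=
  affineExt (fun s => s ^ p - 1 - p * (s - 1)) (fun s => p * (s ^ (p - 1) - 1)) 1 L

variable {p L s : ℝ}

lemma trunc_mem (hL : 1 ≤ L) (s : ℝ) : trunc L s ∈ Icc 1 L := clamp_mem hL s

lemma one_le_trunc (L s : ℝ) : 1 ≤ trunc L s := le_max_left _ _

lemma trunc_pos (L s : ℝ) : 0 < trunc L s := zero_lt_one.trans_le (one_le_trunc L s)

lemma trunc_le (hL : 1 ≤ L) (s : ℝ) : trunc L s ≤ L := (trunc_mem hL s).2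

lemma continuous_trunc (L : ℝ) : Continuous (trunc L) := by unfold trunc; fun_prop

lemma trunc_of_le_one (hL : 1 ≤ L) (hs : s ≤ 1) : trunc L s = 1 := by
  rw [trunc, min_eq_left (hs.trans hL), max_eq_left hs]

lemma trunc_of_mem (hs : s ∈ Icc 1 L) : trunc L s = s := by
  rw [trunc, min_eq_left hs.2, max_eq_right hs.1]

lemma trunc_of_ge (hL : 1 ≤ L) (hs : L ≤ s) : trunc L s = L := by
  rw [trunc, min_eq_right hs, max_eq_right hL]

lemma powExt_of_le_one (hL : 1 ≤ L) (hs : s ≤ 1) : powExt p L s = 0 := by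
  rw [powExt, affineExt_of_le hL hs]; simp

lemma powExt_of_mem (hs : s ∈ Icc 1 L) : powExt p L s = s ^ p - 1 - p * (s - 1) :=
  affineExt_of_mem hs

lemma powExt_of_ge (hL : 1 ≤ L) (hs : L ≤ s) :
    powExt p L s = L ^ p - 1 - p * (L - 1) + p * (L ^ (p - 1) - 1) * (s - L) :=
  affineExt_of_ge hL hs

lemma isC11On_powExt (hL : 1 ≤ L) (p : ℝ) :
    ∃ C Λ, IsC11On (powExt p L) (fun s => p * (trunc L s ^ (p - 1) - 1)) univ C Λ := by
  obtain ⟨C, Λ, h⟩ := isC11On_rpow hL (p - 1)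
  have hsub : Icc 1 L ⊆ Icc L⁻¹ L := Icc_subset_Icc_left (inv_le_one_of_one_le₀ hL)
  have h1 : ∀ s ∈ Icc 1 L, ∀ t ∈ Icc 1 L,
      |p * (s ^ (p - 1) - 1) - p * (t ^ (p - 1) - 1)| ≤ |p| * C * |s - t| := fun s hs t ht => by
    rw [← mul_sub, sub_sub_sub_cancel_right, abs_mul, mul_assoc]
    exact mul_le_mul_of_nonneg_left (h.lipschitz _ (hsub hs) _ (hsub ht)) (abs_nonneg _)
  refine ⟨|p| * C * L, |p| * C, isC11On_affineExt (g' := fun s => p * (s ^ (p - 1) - 1)) hL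
    (fun s hs => ?_) (fun s hs => ?_) h1 (mul_nonneg (abs_nonneg _) h.nonneg)⟩
  · have hs0 : s ≠ 0 := by linarith [hs.1]
    have := ((Real.hasDerivAt_rpow_const (p := p) (Or.inl hs0)).sub_const 1).sub
      (((hasDerivAt_id s).sub_const 1).const_mul p)
    refine (this.congr_deriv ?_).hasDerivWithinAt
    ring
  · have h2 := h1 s hs 1 (left_mem_Icc.2 hL)
    simp only [Real.one_rpow, sub_self, mul_zero, sub_zero] at h2
    refine h2.trans (mul_le_mul_of_nonneg_left ?_ (mul_nonneg (abs_nonneg _) h.nonneg))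
    rw [abs_of_nonneg (by linarith [hs.1])]
    linarith [hs.2]

lemma one_add_mul_sub_le_rpow (hp : 1 ≤ p) (hs : 0 ≤ s) : 1 + p * (s - 1) ≤ s ^ p := by
  have := one_add_mul_self_le_rpow_one_add (s := s - 1) (by linarith) hp
  simpa using this

/-- Bernoulli's inequality at `s / L`, rescaled: the tangent at `L` lies below the convex power. -/
lemma rpow_add_mul_sub_le_rpow (hp : 1 ≤ p) (hL : 0 < L) (hs : 0 ≤ s) :
    L ^ p + p * L ^ (p - 1) * (s - L) ≤ s ^ p := by
  have h1 := one_add_mul_sub_le_rpow hp (div_nonneg hs hL.le)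
  have h2 : s ^ p = L ^ p * (s / L) ^ p := by
    rw [← Real.mul_rpow hL.le (by positivity), mul_div_cancel₀ _ hL.ne']
  have h3 : L ^ p = L ^ (p - 1) * L := by rw [← Real.rpow_add_one hL.ne', sub_add_cancel]
  calc L ^ p + p * L ^ (p - 1) * (s - L) = L ^ p * (1 + p * (s / L - 1)) := by
        rw [h3]; field_simp
    _ ≤ s ^ p := by rw [h2]; exact mul_le_mul_of_nonneg_left h1 (by positivity)

lemma powExt_nonneg (hp : 1 ≤ p) (hL : 1 ≤ L) (s : ℝ) : 0 ≤ powExt p L s := by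
  rcases le_total s 1 with h | h
  · rw [powExt_of_le_one hL h]
  rcases le_total s L with h' | h'
  · rw [powExt_of_mem ⟨h, h'⟩]
    linarith [one_add_mul_sub_le_rpow hp (by linarith : 0 ≤ s)]
  · rw [powExt_of_ge hL h']
    have h1 := one_add_mul_sub_le_rpow hp (by linarith : 0 ≤ L)
    have h2 := Real.one_le_rpow hL (by linarith : 0 ≤ p - 1)
    have : 0 ≤ p * (L ^ (p - 1) - 1) * (s - L) :=
      mul_nonneg (mul_nonneg (by linarith) (by linarith)) (by linarith)
    linarith

lemma powExt_le_rpow (hp : 1 ≤ p) (hL : 1 ≤ L) (s : ℝ) : powExt p L s ≤ max s 1 ^ p := by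
  rcases le_total s 1 with h | h
  · rw [powExt_of_le_one hL h]; positivity
  rw [max_eq_left h]
  rcases le_total s L with h' | h'
  · rw [powExt_of_mem ⟨h, h'⟩]
    have : 0 ≤ p * (s - 1) := mul_nonneg (by linarith) (by linarith)
    linarith
  · rw [powExt_of_ge hL h']
    have h1 := rpow_add_mul_sub_le_rpow hp (by linarith : 0 < L) (by linarith : 0 ≤ s)
    have : 0 ≤ p * (s - 1) := mul_nonneg (by linarith) (by linarith)
    linarith

/-- The threshold is `4 p ^ 2`. Above it `s ^ (p - 1) ≥ √s ≥ 2p`, by `p ≥ 3 / 2`, so half of the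
power absorbs the linear term; below it the linear term is at most `4 p ^ 3`. -/
lemma trunc_rpow_le (hp : 3 / 2 ≤ p) (hL : 1 ≤ L) (s : ℝ) :
    trunc L s ^ p ≤ 2 * powExt p L s + 8 * p ^ 3 := by
  have hp3 : 1 ≤ p ^ 3 := one_le_pow₀ (by linarith)
  have key : ∀ s, 1 ≤ s → s ^ p ≤ 2 * (s ^ p - 1 - p * (s - 1)) + 8 * p ^ 3 := fun s hs => by
    have hs0 : 0 < s := by linarith
    rcases le_total s (4 * p ^ 2) with h | h
    · have : 0 < s ^ p := by positivity
      have h2 : p * s ≤ p * (4 * p ^ 2) := mul_le_mul_of_nonneg_left h (by linarith)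
      nlinarith
    · have h1 : 2 * p ≤ s ^ (p - 1) := by
        calc 2 * p = Real.sqrt (4 * p ^ 2) := by
              rw [show 4 * p ^ 2 = (2 * p) ^ 2 by ring, Real.sqrt_sq (by linarith)]
          _ ≤ Real.sqrt s := Real.sqrt_le_sqrt h
          _ = s ^ (1 / 2 : ℝ) := Real.sqrt_eq_rpow s
          _ ≤ s ^ (p - 1) := Real.rpow_le_rpow_of_exponent_le hs (by linarith)
      have h2 : s ^ p = s ^ (p - 1) * s := by rw [← Real.rpow_add_one hs0.ne', sub_add_cancel]
      have h3 : 2 * p * s ≤ s ^ p := by rw [h2]; exact mul_le_mul_of_nonneg_right h1 hs0.le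
      nlinarith
  rcases le_total s 1 with h | h
  · rw [trunc_of_le_one hL h, powExt_of_le_one hL h, Real.one_rpow]; linarith
  rcases le_total s L with h' | h'
  · rw [powExt_of_mem ⟨h, h'⟩, trunc_of_mem ⟨h, h'⟩]
    exact key s h
  · rw [powExt_of_ge hL h', trunc_of_ge hL h']
    have h2 := Real.one_le_rpow hL (by linarith : 0 ≤ p - 1)
    have : 0 ≤ p * (L ^ (p - 1) - 1) * (s - L) :=
      mul_nonneg (mul_nonneg (by linarith) (by linarith)) (by linarith)
    linarith [key L hL]

/-- The reaction term of the energy inequality for the exponent `n / 2`. -/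
lemma powExt_reaction_le_sq (hp : 1 ≤ p) (hL : 1 ≤ L) {r : ℝ} (hr : 0 ≤ r) (hrL : r ≤ L) (s : ℝ) :
    (p * (trunc L s ^ (p - 1) - 1) * s - p * powExt p L s) * (s - r) ≤ p ^ 2 * s ^ 2 := by
  have hpp : 0 ≤ p * (p - 1) := mul_nonneg (by linarith) (by linarith)
  rcases le_total s 1 with h | h
  · rw [trunc_of_le_one hL h, powExt_of_le_one hL h, Real.one_rpow]
    simp only [sub_self, mul_zero, zero_mul]
    positivity
  have hs0 : 0 < s := by linarith
  have h3 : p * (p - 1) * s * s ≤ p ^ 2 * s ^ 2 := by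
    have : 0 ≤ p * s ^ 2 := by positivity
    nlinarith
  rcases le_total s L with h' | h'
  · rw [powExt_of_mem ⟨h, h'⟩, trunc_of_mem ⟨h, h'⟩]
    have h2 : s ^ p = s ^ (p - 1) * s := by rw [← Real.rpow_add_one hs0.ne', sub_add_cancel]
    -- With the factor `p` in front of `powExt`, that is for `p = n / 2` in the application, the
    -- powers `s ^ p` cancel and only a linear function of `s` remains.
    have e : p * (s ^ (p - 1) - 1) * s - p * (s ^ p - 1 - p * (s - 1)) = p * (p - 1) * (s - 1) := by
      rw [h2]; ring
    rw [e]
    refine le_trans ?_ h3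
    have h4 : 0 ≤ p * (p - 1) * (s - 1) := mul_nonneg hpp (by linarith)
    calc p * (p - 1) * (s - 1) * (s - r) ≤ p * (p - 1) * (s - 1) * s :=
          mul_le_mul_of_nonneg_left (by linarith) h4
      _ ≤ p * (p - 1) * s * s := by
          apply mul_le_mul_of_nonneg_right _ hs0.le
          exact mul_le_mul_of_nonneg_left (by linarith) hpp
  · rw [powExt_of_ge hL h', trunc_of_ge hL h']
    have hL0 : 0 < L := by linarith
    have h2 : L ^ p = L ^ (p - 1) * L := by rw [← Real.rpow_add_one hL0.ne', sub_add_cancel]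
    have e : p * (L ^ (p - 1) - 1) * s -
        p * (L ^ p - 1 - p * (L - 1) + p * (L ^ (p - 1) - 1) * (s - L)) =
        p * (p - 1) * (L - 1 - (L ^ (p - 1) - 1) * (s - L)) := by
      rw [h2]; ring
    rw [e]
    refine le_trans ?_ h3
    have h4 := Real.one_le_rpow hL (by linarith : 0 ≤ p - 1)
    have h5 : 0 ≤ (L ^ (p - 1) - 1) * (s - L) := mul_nonneg (by linarith) (by linarith)
    calc p * (p - 1) * (L - 1 - (L ^ (p - 1) - 1) * (s - L)) * (s - r)
        ≤ p * (p - 1) * s * (s - r) := by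
          apply mul_le_mul_of_nonneg_right _ (by linarith)
          exact mul_le_mul_of_nonneg_left (by linarith) hpp
      _ ≤ p * (p - 1) * s * s :=
          mul_le_mul_of_nonneg_left (by linarith) (mul_nonneg hpp hs0.le)

/-- The reaction term of the energy inequality for large exponents. -/
lemma powExt_reaction_le_rpow {ν : ℝ} (hν : 3 ≤ ν) (hp : ν / 2 ≤ p) (hL : 4 ≤ L) {r : ℝ}
    (hr : 0 ≤ r) (hrL : r ≤ L) (s : ℝ) :
    (p * (trunc L s ^ (p - 1) - 1) * s - ν / 2 * powExt p L s) * (s - r) ≤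
      ν ^ 2 * p * trunc L s ^ (p + 1) := by
  have hL1 : 1 ≤ L := by linarith
  have hp0 : 0 < p := by linarith
  have hν2 : 9 ≤ ν ^ 2 := by nlinarith
  rcases le_total s 1 with h | h
  · rw [trunc_of_le_one hL1 h, powExt_of_le_one hL1 h, Real.one_rpow]
    simp only [sub_self, mul_zero, zero_mul]
    positivity
  have hs0 : 0 < s := by linarith
  rcases le_total s L with h' | h'
  · have h1 := powExt_nonneg (p := p) (by linarith) hL1 s
    have hB := one_add_mul_sub_le_rpow (p := p) (by linarith) hs0.le
    have h2 : s ^ p = s ^ (p - 1) * s := by rw [← Real.rpow_add_one hs0.ne', sub_add_cancel]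
    have hF := powExt_of_mem (p := p) ⟨h, h'⟩
    rw [trunc_of_mem ⟨h, h'⟩, Real.rpow_add_one hs0.ne']
    have hsp : 0 < s ^ p := by positivity
    have e1 : p * (s ^ (p - 1) - 1) * s - ν / 2 * powExt p L s ≤ p * s ^ p := by
      rw [h2]; nlinarith
    have e2 : 0 ≤ p * (s ^ (p - 1) - 1) * s - ν / 2 * powExt p L s := by
      rw [hF]
      have e3 : p * (s ^ (p - 1) - 1) * s - ν / 2 * (s ^ p - 1 - p * (s - 1)) =
        (p - ν / 2) * (s ^ p - 1 - p * (s - 1)) + p * (p - 1) * (s - 1) := by rw [h2]; ring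
      rw [e3]
      exact add_nonneg (mul_nonneg (by linarith) (by linarith))
        (mul_nonneg (mul_nonneg hp0.le (by linarith)) (by linarith))
    calc _ ≤ (p * (s ^ (p - 1) - 1) * s - ν / 2 * powExt p L s) * s :=
          mul_le_mul_of_nonneg_left (by linarith) e2
      _ ≤ p * s ^ p * s := mul_le_mul_of_nonneg_right e1 hs0.le
      _ ≤ ν ^ 2 * (p * s ^ p * s) := le_mul_of_one_le_left (by positivity) (by linarith)
      _ = _ := by ring
  · rw [powExt_of_ge hL1 h', trunc_of_ge hL1 h']
    have hL0 : 0 < L := by linarith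
    have hB := one_add_mul_sub_le_rpow (p := p) (by linarith) hL0.le
    have h2 : L ^ p = L ^ (p - 1) * L := by rw [← Real.rpow_add_one hL0.ne', sub_add_cancel]
    rw [Real.rpow_add_one hL0.ne']
    -- `L ≥ 4` and `p ≥ 3 / 2` give `P ≥ 2`, hence `P - 1 ≥ P / 2`.
    have hP : 2 ≤ L ^ (p - 1) := by
      calc (2 : ℝ) = Real.sqrt 4 := by
            rw [show (4 : ℝ) = 2 ^ 2 by norm_num, Real.sqrt_sq (by norm_num)]
        _ ≤ Real.sqrt L := Real.sqrt_le_sqrt hL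
        _ = L ^ (1 / 2 : ℝ) := Real.sqrt_eq_rpow L
        _ ≤ L ^ (p - 1) := Real.rpow_le_rpow_of_exponent_le hL1 (by linarith)
    rw [h2] at hB ⊢
    set P := L ^ (p - 1)
    -- Beyond `L` both parts are affine in `s`, and for `ν ≥ 3` the coefficient of `s` is negative.
    -- The product with `s - r` is thus a quadratic bounded above by a multiple of `p P L ^ 2`,
    -- although `s` is unbounded.
    have hE : p * (P - 1) * s - ν / 2 * (P * L - 1 - p * (L - 1) + p * (P - 1) * (s - L)) ≤
        p * P * (ν / 2 * L - s / 4) := by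
      have e : p * (P - 1) * s - ν / 2 * (P * L - 1 - p * (L - 1) + p * (P - 1) * (s - L)) =
        ν / 2 * (p * (P - 1) * L - (P * L - 1 - p * (L - 1))) - (ν / 2 - 1) * (p * (P - 1)) * s := by
        ring
      have e1 : ν / 2 * (p * (P - 1) * L - (P * L - 1 - p * (L - 1))) ≤ ν / 2 * (p * P * L) :=
        mul_le_mul_of_nonneg_left (by nlinarith) (by linarith)
      have e2 : p * P / 4 * s ≤ (ν / 2 - 1) * (p * (P - 1)) * s := by
        apply mul_le_mul_of_nonneg_right _ hs0.le
        have : 1 / 2 * (p * (P / 2)) ≤ (ν / 2 - 1) * (p * (P - 1)) := by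
          apply mul_le_mul (by linarith) (mul_le_mul_of_nonneg_left (by linarith) hp0.le)
            (by positivity) (by linarith)
        linarith
      rw [e]
      nlinarith
    have hpP : 0 < p * P := by positivity
    have hsr : 0 ≤ s - r := by linarith
    refine (mul_le_mul_of_nonneg_right hE hsr).trans ?_
    have h5 : (ν / 2 * L - s / 4) * (s - r) ≤ ν ^ 2 * L ^ 2 := by
      rcases le_total (ν / 2 * L - s / 4) 0 with h6 | h6
      · exact (mul_nonpos_of_nonpos_of_nonneg h6 hsr).trans (by positivity)
      · calc (ν / 2 * L - s / 4) * (s - r) ≤ (ν / 2 * L - s / 4) * s :=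
              mul_le_mul_of_nonneg_left (by linarith) h6
          _ ≤ ν ^ 2 * L ^ 2 := by nlinarith [sq_nonneg (s / 2 - ν * L / 2), sq_nonneg (ν * L)]
    calc p * P * (ν / 2 * L - s / 4) * (s - r) = p * P * ((ν / 2 * L - s / 4) * (s - r)) := by ring
      _ ≤ p * P * (ν ^ 2 * L ^ 2) := mul_le_mul_of_nonneg_left h5 hpP.le
      _ = ν ^ 2 * p * (P * L * L) := by ring

end PowExt

/-! ### The energy inequality for truncated powers -/

section Energy

variable {n : ℕ} {M : Type*} [TopologicalSpace M] [ChartedSpace (EuclideanSpace ℝ (Fin n)) M]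
  [IsManifold (𝓡 n) ∞ M] [RiemannianBundle (fun x : M => TangentSpace (𝓡 n) x)]
  [IsContMDiffRiemannianBundle (𝓡 n) ∞ (EuclideanSpace ℝ (Fin n))
      (fun x : M => TangentSpace (𝓡 n) x)]
  [MeasurableSpace M] [BorelSpace M] [SecondCountableTopology M] [T2Space M]
  [IsProbabilityMeasure (riemannianVolume n M)]
  {T K A B : ℝ} {u S S' : ℝ → M → ℝ} {ρ : ℝ → ℝ} {t p L : ℝ}

lemma HasH1Gradient.trunc_rpow (hd : TestFunctionsDense n M) {f : M → ℝ}
    {X : ∀ x : M, TangentSpace (𝓡 n) x} (h : HasH1Gradient n f X) (hL : 1 ≤ L) (r : ℝ) :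
    HasH1Gradient n (fun x => trunc L (f x) ^ r)
      (fun x => (r * trunc L (f x) ^ (r - 1)) • clampWeight 1 L (f x) • X x) := by
  have h0 : ∀ s ∈ Icc 1 L, s ≠ 0 := fun s hs => by linarith [hs.1]
  refine (h.clamp hd hL).comp_Icc hd (G := fun s => s ^ r) (G' := fun s => r * s ^ (r - 1)) hL
    (ae_of_all _ fun x => trunc_mem hL (f x))
    (fun s hs => Real.hasDerivAt_rpow_const (Or.inl (h0 s hs))) ?_
  exact continuousOn_const.mul (continuousOn_id.rpow_const fun s hs => Or.inl (h0 s hs))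

lemma RegularFlow.integrable_trunc (h : RegularFlow n T K A B u S S' ρ) (ht : t ∈ Icc 0 T)
    (hL : 1 ≤ L) (r : ℝ) :
    Integrable (fun x => trunc L (S t x) ^ r * u t x ^ volExp n) (riemannianVolume n M) := by
  refine h.integrable_mul_rpow ht _ (Integrable.of_bound (C := L ^ |r|) ?_
    (ae_of_all _ fun x => ?_))
  · exact (((continuous_trunc L).measurable.comp_aemeasurable
      (h.S_h1 t ht).memLp.1.aemeasurable).pow_const r).aestronglyMeasurable
  · exact rpow_abs_le_of_mem_Icc hL r
      ⟨(inv_le_one_of_one_le₀ hL).trans (one_le_trunc _ _), trunc_le hL _⟩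

lemma RegularFlow.one_le_integral_trunc (h : RegularFlow n T K A B u S S' ρ) (ht : t ∈ Icc 0 T)
    (hL : 1 ≤ L) {r : ℝ} (hr : 0 ≤ r) :
    1 ≤ ∫ x, trunc L (S t x) ^ r * u t x ^ volExp n ∂(riemannianVolume n M) := by
  rw [← h.volume_eq_one ht]
  refine integral_mono_ae ((h.memLp_rpow ht (volExp n) 1).integrable le_rfl)
    (h.integrable_trunc ht hL r) ?_
  filter_upwards [h.u_pos ht] with x hx
  exact le_mul_of_one_le_left (by positivity) (Real.one_le_rpow (one_le_trunc _ _) hr)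

/-- The energy inequality for powers of the truncated scalar curvature. -/
lemma RegularFlow.hasDerivAt_powExt_le (hn : 3 ≤ n) (hd : TestFunctionsDense n M) (hA : 0 < A)
    (h : RegularFlow n T K A B u S S' ρ) (ht : t ∈ Ioo 0 T) (hp : 3 / 2 ≤ p) (hL : 1 ≤ L) :
    ∃ Y', HasDerivAt (fun s => ∫ x, powExt p L (S s x) * u s x ^ volExp n
        ∂(riemannianVolume n M)) Y' t ∧
      Y' ≤ ∫ x, (p * (trunc L (S t x) ^ (p - 1) - 1) * S t x - n / 2 * powExt p L (S t x)) *
          (S t x - ρ t) * u t x ^ volExp n ∂(riemannianVolume n M) -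
        A⁻¹ * (∫ x, trunc L (S t x) ^ (p * (volExp n / 2)) * u t x ^ volExp n
          ∂(riemannianVolume n M)) ^ (2 / volExp n) +
        B / A * ∫ x, trunc L (S t x) ^ p * u t x ^ volExp n ∂(riemannianVolume n M) := by
  have ht' := Ioo_subset_Icc_self ht
  have hn3 : (3 : ℝ) ≤ n := by exact_mod_cast hn
  obtain ⟨C, Λ, hF⟩ := isC11On_powExt hL p
  have hS := h.S_h1 t ht'
  set X := weakGrad n (S t)
  set w : M → ℝ := fun x => clampWeight 1 L (S t x) with hw
  set c : M → ℝ := fun x => trunc L (S t x) with hc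
  have hw01 : ∀ x, w x ∈ Icc (0 : ℝ) 1 := fun x => clampWeight_mem hL _
  have hc1 : ∀ x, 1 ≤ c x := fun x => one_le_trunc _ _
  have hZ : HasH1Gradient n (fun x => p * (c x ^ (p - 1) - 1))
      (fun x => p • (((p - 1) * c x ^ (p - 1 - 1)) • w x • X x)) :=
    (((hS.trunc_rpow hd hL (p - 1)).sub (hasH1Gradient_const 1)).const_smul p).congr_ae
      (EventuallyEq.refl _ _)
      (ae_of_all _ fun x => congrArg (p • ·) (sub_zero (G := TangentSpace (𝓡 n) x) _))
  have hv : HasH1Gradient n (fun x => c x ^ (p / 2))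
      (fun x => (p / 2 * c x ^ (p / 2 - 1)) • w x • X x) := hS.trunc_rpow hd hL (p / 2)
  have hvb : ∀ᵐ x ∂(riemannianVolume n M), |c x ^ (p / 2)| ≤ L ^ |p / 2| :=
    ae_of_all _ fun x => rpow_abs_le_of_mem_Icc hL _
      ⟨(inv_le_one_of_one_le₀ hL).trans (one_le_trunc _ _), trunc_le hL _⟩
  -- The Sobolev inequality is applied to the truncated scalar curvature to the power `p / 2`.
  have hsob := h.sobolev t ht' _ _ _ hv hvb
  refine ⟨_, h.hasDerivAt_integral_volExp hn ht hF hZ, ?_⟩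
  have e1 : ∫ x, |c x ^ (p / 2)| ^ volExp n * u t x ^ volExp n ∂(riemannianVolume n M) =
      ∫ x, c x ^ (p * (volExp n / 2)) * u t x ^ volExp n ∂(riemannianVolume n M) := by
    refine integral_congr_ae (ae_of_all _ fun x => ?_)
    have := hc1 x
    dsimp only
    rw [abs_of_nonneg (by positivity), ← Real.rpow_mul (by linarith)]
    congr 2
    ring
  have e2 : ∫ x, (c x ^ (p / 2)) ^ 2 * u t x ^ volExp n ∂(riemannianVolume n M) =
      ∫ x, c x ^ p * u t x ^ volExp n ∂(riemannianVolume n M) := by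
    refine integral_congr_ae (ae_of_all _ fun x => ?_)
    have := hc1 x
    dsimp only
    rw [← Real.rpow_natCast, ← Real.rpow_mul (by linarith)]
    congr 2
    push_cast
    ring
  have hu2 := h.abs_rpow_le ht' 2
  have hu2m := h.aestronglyMeasurable_rpow ht' 2
  simp only [Real.rpow_two] at hu2 hu2m
  have hgi : Integrable (fun x => u t x ^ 2 * ‖(p / 2 * c x ^ (p / 2 - 1)) • w x • X x‖ ^ 2)
      (riemannianVolume n M) := hv.memLp_grad.integrable_sq.bdd_mul hu2m hu2
  have hgi2 : Integrable (fun x => u t x ^ 2 *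
      inner ℝ (X x) (p • (((p - 1) * c x ^ (p - 1 - 1)) • w x • X x)))
      (riemannianVolume n M) := (integrable_inner hS.measurableField hZ.measurableField
        hS.memLp_grad hZ.memLp_grad).bdd_mul hu2m hu2
  -- Up to common factors the sides are `p ^ 2 / 4 * w ^ 2` and `(n - 1) p (p - 1) w`. The first is
  -- smaller as `w` is in `[0, 1]`, `p ≥ 3 / 2` and `n ≥ 3`; so the dissipation controls the
  -- gradient term of the Sobolev inequality with constant one.
  have e3 : ∫ x, u t x ^ 2 * ‖(p / 2 * c x ^ (p / 2 - 1)) • w x • X x‖ ^ 2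
      ∂(riemannianVolume n M) ≤ ((n : ℝ) - 1) * ∫ x, u t x ^ 2 *
      inner ℝ (X x) (p • (((p - 1) * c x ^ (p - 1 - 1)) • w x • X x))
      ∂(riemannianVolume n M) := by
    rw [← integral_const_mul]
    refine integral_mono hgi (hgi2.const_mul _) fun x => ?_
    have hc0 : 0 < c x := by linarith [hc1 x]
    have h1 : (c x ^ (p / 2 - 1)) ^ 2 = c x ^ (p - 1 - 1) := by
      rw [← Real.rpow_natCast, ← Real.rpow_mul hc0.le]
      congr 1
      push_cast
      ring
    dsimp only
    rw [norm_smul, norm_smul, Real.norm_eq_abs, Real.norm_eq_abs, mul_pow, mul_pow, sq_abs, sq_abs,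
      mul_pow, h1]
    simp only [real_inner_smul_right, real_inner_self_eq_norm_sq]
    set Q := u t x ^ 2 * (c x ^ (p - 1 - 1) * ‖X x‖ ^ 2)
    have hQ : 0 ≤ Q := by positivity
    have hw2 : w x ^ 2 ≤ w x := by nlinarith [(hw01 x).1, (hw01 x).2]
    have h2 : (p / 2) ^ 2 * w x ^ 2 ≤ ((n : ℝ) - 1) * (p * (p - 1)) * w x := by
      have : (p / 2) ^ 2 ≤ ((n : ℝ) - 1) * (p * (p - 1)) := by
        have : 2 * (p * (p - 1)) ≤ ((n : ℝ) - 1) * (p * (p - 1)) :=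
          mul_le_mul_of_nonneg_right (by linarith) (mul_nonneg (by linarith) (by linarith))
        nlinarith
      exact mul_le_mul this hw2 (sq_nonneg _) (mul_nonneg (by linarith)
        (mul_nonneg (by linarith) (by linarith)))
    calc _ = (p / 2) ^ 2 * w x ^ 2 * Q := by ring
      _ ≤ ((n : ℝ) - 1) * (p * (p - 1)) * w x * Q := mul_le_mul_of_nonneg_right h2 hQ
      _ = _ := by ring
  rw [e1, e2] at hsob
  have h4 := mul_le_mul_of_nonneg_left hsob (inv_nonneg.2 hA.le)
  rw [mul_add, ← mul_assoc, ← mul_assoc, inv_mul_cancel₀ hA.ne', one_mul] at h4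
  rw [div_eq_inv_mul B A]
  change _ - ((n : ℝ) - 1) * (∫ x, u t x ^ 2 *
      inner ℝ (X x) (p • (((p - 1) * c x ^ (p - 1 - 1)) • w x • X x)) ∂(riemannianVolume n M)) ≤
    _ - A⁻¹ * (∫ x, c x ^ (p * (volExp n / 2)) * u t x ^ volExp n ∂(riemannianVolume n M)) ^
      (2 / volExp n) + A⁻¹ * B * ∫ x, c x ^ p * u t x ^ volExp n ∂(riemannianVolume n M)
  linarith

end Energy

/-! ### Interpolation of exponents and Young's inequality -/

section Interpolation

/-- The gain of integrability `n / (n - 2)` in the Sobolev inequality. -/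
def gainExp (n : ℕ) : ℝ := (n : ℝ) / ((n : ℝ) - 2)

/-- The exponent `n² / (2 (n - 2))`. -/
def critExp (n : ℕ) : ℝ := (n : ℝ) / 2 * gainExp n

variable {n : ℕ}

lemma volExp_div_two (n : ℕ) : volExp n / 2 = gainExp n := by
  unfold volExp gainExp; ring

lemma two_div_volExp (n : ℕ) : 2 / volExp n = (gainExp n)⁻¹ := by
  rw [← volExp_div_two, inv_div]

lemma one_lt_gainExp (hn : 3 ≤ n) : 1 < gainExp n := by
  have hn3 : (3 : ℝ) ≤ n := by exact_mod_cast hn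
  rw [gainExp, one_lt_div (by linarith)]
  linarith

lemma gainExp_inv (n : ℕ) : (gainExp n)⁻¹ = ((n : ℝ) - 2) / n := by rw [gainExp, inv_div]

lemma half_le_critExp (hn : 3 ≤ n) : (n : ℝ) / 2 ≤ critExp n :=
  le_mul_of_one_le_right (by positivity) (one_lt_gainExp hn).le

/-- The weights `2(n-2)/n²`, `2/n`, `(n-2)²/n²` add up to one, and the corresponding average of
`critExp n`, `p` and `p * gainExp n` is `p + 1`. The weighted mean inequality with normalizations
`a`, `e`, `f` is the pointwise form of Hölder's inequality. -/
lemma rpow_add_one_le_interpolation (hn : 3 ≤ n) {p c a e f : ℝ} (hc : 0 < c) (ha : 0 < a)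
    (he : 0 < e) (hf : 0 < f) :
    c ^ (p + 1) ≤ (a ^ (gainExp n)⁻¹ * e) ^ (2 / (n : ℝ)) * (f ^ (gainExp n)⁻¹) ^ (1 - 2 / (n : ℝ)) *
      (2 * (n - 2) / n ^ 2 * (c ^ critExp n / a) + 2 / n * (c ^ p / e) +
        ((n : ℝ) - 2) ^ 2 / n ^ 2 * (c ^ (p * gainExp n) / f)) := by
  have hn3 : (3 : ℝ) ≤ n := by exact_mod_cast hn
  have hn0 : (n : ℝ) ≠ 0 := by linarith
  have hn2 : (n : ℝ) - 2 ≠ 0 := by linarith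
  have h1 := Real.geom_mean_le_arith_mean3_weighted (w₁ := 2 * ((n : ℝ) - 2) / n ^ 2)
    (w₂ := 2 / (n : ℝ)) (w₃ := ((n : ℝ) - 2) ^ 2 / n ^ 2) (p₁ := c ^ critExp n / a)
    (p₂ := c ^ p / e) (p₃ := c ^ (p * gainExp n) / f)
    (div_nonneg (by linarith) (by positivity)) (by positivity) (by positivity) (by positivity)
    (by positivity) (by positivity) (by field_simp; ring)
  refine le_trans (le_of_eq ?_) (mul_le_mul_of_nonneg_left h1 (by positivity))
  rw [Real.div_rpow (by positivity) ha.le, Real.div_rpow (by positivity) he.le,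
    Real.div_rpow (by positivity) hf.le, Real.mul_rpow (by positivity) he.le, ← Real.rpow_mul ha.le,
    ← Real.rpow_mul hf.le, ← Real.rpow_mul hc.le, ← Real.rpow_mul hc.le, ← Real.rpow_mul hc.le,
    gainExp_inv]
  have e1 : ((n : ℝ) - 2) / n * (2 / n) = 2 * ((n : ℝ) - 2) / n ^ 2 := by field_simp
  have e2 : ((n : ℝ) - 2) / n * (1 - 2 / n) = ((n : ℝ) - 2) ^ 2 / n ^ 2 := by field_simp
  have e3 : c ^ (p + 1) = c ^ (critExp n * (2 * ((n : ℝ) - 2) / n ^ 2)) * c ^ (p * (2 / n)) *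
      c ^ (p * gainExp n * (((n : ℝ) - 2) ^ 2 / n ^ 2)) := by
    rw [← Real.rpow_add hc, ← Real.rpow_add hc]
    congr 1
    unfold critExp gainExp
    field_simp
    ring
  rw [e1, e2, e3]
  field_simp

/-- Young's inequality in the form in which it absorbs the reaction term. -/
lemma mul_interpolation_le (hn : 3 ≤ n) {A g x W : ℝ} (hA : 0 < A) (hg : 0 ≤ g) (hx : 0 ≤ x)
    (hW : 0 ≤ W) :
    g * (x ^ (2 / (n : ℝ)) * W ^ (1 - 2 / (n : ℝ))) ≤
      (2 * A)⁻¹ * W + g ^ ((n : ℝ) / 2) * (2 * A) ^ (((n : ℝ) - 2) / 2) * x := by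
  have hn3 : (3 : ℝ) ≤ n := by exact_mod_cast hn
  have hn0 : (n : ℝ) ≠ 0 := by linarith
  have hθ : 0 ≤ 1 - 2 / (n : ℝ) := by
    rw [sub_nonneg, div_le_one (by linarith)]; linarith
  have hX : 0 ≤ g ^ ((n : ℝ) / 2) * (2 * A) ^ (((n : ℝ) - 2) / 2) * x := by positivity
  have hY : 0 ≤ (2 * A)⁻¹ * W := by positivity
  have h1 := Real.geom_mean_le_arith_mean2_weighted (w₁ := 2 / (n : ℝ)) (w₂ := 1 - 2 / (n : ℝ))
    (by positivity) hθ hX hY (by ring)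
  have h2 : (g ^ ((n : ℝ) / 2) * (2 * A) ^ (((n : ℝ) - 2) / 2) * x) ^ (2 / (n : ℝ)) *
      ((2 * A)⁻¹ * W) ^ (1 - 2 / (n : ℝ)) = g * (x ^ (2 / (n : ℝ)) * W ^ (1 - 2 / (n : ℝ))) := by
    rw [Real.mul_rpow (by positivity) hx, Real.mul_rpow (by positivity) (by positivity),
      Real.mul_rpow (by positivity) hW, ← Real.rpow_mul hg, ← Real.rpow_mul (by positivity),
      Real.inv_rpow (by positivity)]
    have e1 : (n : ℝ) / 2 * (2 / n) = 1 := by field_simp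
    have e2 : ((n : ℝ) - 2) / 2 * (2 / n) = 1 - 2 / n := by field_simp
    rw [e1, e2, Real.rpow_one]
    have : (2 * A) ^ (1 - 2 / (n : ℝ)) ≠ 0 := by positivity
    field_simp
  rw [h2] at h1
  have h3 : 2 / (n : ℝ) * (g ^ ((n : ℝ) / 2) * (2 * A) ^ (((n : ℝ) - 2) / 2) * x) ≤
      1 * (g ^ ((n : ℝ) / 2) * (2 * A) ^ (((n : ℝ) - 2) / 2) * x) :=
    mul_le_mul_of_nonneg_right (by rw [div_le_one (by linarith)]; linarith) hX
  have h4 : (1 - 2 / (n : ℝ)) * ((2 * A)⁻¹ * W) ≤ 1 * ((2 * A)⁻¹ * W) :=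
    mul_le_mul_of_nonneg_right (by linarith [(by positivity : 0 ≤ 2 / (n : ℝ))]) hY
  linarith

end Interpolation

/-! ### Differential inequalities for the energies -/

section Energy

variable {n : ℕ} {M : Type*} [TopologicalSpace M] [ChartedSpace (EuclideanSpace ℝ (Fin n)) M]
  [IsManifold (𝓡 n) ∞ M] [RiemannianBundle (fun x : M => TangentSpace (𝓡 n) x)]
  [IsContMDiffRiemannianBundle (𝓡 n) ∞ (EuclideanSpace ℝ (Fin n))
      (fun x : M => TangentSpace (𝓡 n) x)]
  [MeasurableSpace M] [BorelSpace M] [SecondCountableTopology M] [T2Space M]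
  [IsProbabilityMeasure (riemannianVolume n M)]

variable (n) in
/-- The integral of `trunc L S ^ r` with respect to the volume of the metric at time `t`. -/
def truncEnergy (u S : ℝ → M → ℝ) (r L t : ℝ) : ℝ :=
  ∫ x, trunc L (S t x) ^ r * u t x ^ volExp n ∂(riemannianVolume n M)

variable (n) in
/-- The integral of `powExt p L S` with respect to the volume of the metric at time `t`. -/
def powEnergy (u S : ℝ → M → ℝ) (p L t : ℝ) : ℝ :=
  ∫ x, powExt p L (S t x) * u t x ^ volExp n ∂(riemannianVolume n M)

variable {T K A B : ℝ} {u S S' : ℝ → M → ℝ} {ρ : ℝ → ℝ} {t p L : ℝ}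

lemma RegularFlow.integrable_powExt (h : RegularFlow n T K A B u S S' ρ) (ht : t ∈ Icc 0 T)
    (hL : 1 ≤ L) (p : ℝ) :
    Integrable (fun x => powExt p L (S t x) * u t x ^ volExp n) (riemannianVolume n M) := by
  obtain ⟨C, Λ, hF⟩ := isC11On_powExt hL p
  exact h.integrable_mul_rpow ht _
    ((hF.memLp_comp (mem_univ 0) (h.S_h1 t ht).memLp (by simp)).integrable (by norm_num))

lemma RegularFlow.continuousOn_powEnergy (h : RegularFlow n T K A B u S S' ρ) (hL : 1 ≤ L)
    (p : ℝ) : ContinuousOn (powEnergy n u S p L) (Icc 0 T) := by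
  obtain ⟨C, Λ, hF⟩ := isC11On_powExt hL p
  exact h.continuousOn_integral hF _

lemma RegularFlow.powEnergy_nonneg (h : RegularFlow n T K A B u S S' ρ) (ht : t ∈ Icc 0 T)
    (hp : 1 ≤ p) (hL : 1 ≤ L) : 0 ≤ powEnergy n u S p L t := by
  refine integral_nonneg_of_ae ?_
  filter_upwards [h.u_pos ht] with x hx
  exact mul_nonneg (powExt_nonneg hp hL _) (by positivity)

lemma RegularFlow.truncEnergy_le (h : RegularFlow n T K A B u S S' ρ) (ht : t ∈ Icc 0 T)
    (hp : 3 / 2 ≤ p) (hL : 1 ≤ L) :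
    truncEnergy n u S p L t ≤ 2 * powEnergy n u S p L t + 8 * p ^ 3 := by
  have i1 := (h.integrable_powExt ht hL p).const_mul 2
  have i2 := ((h.memLp_rpow ht (volExp n) 1).integrable le_rfl).const_mul (8 * p ^ 3)
  have h1 : truncEnergy n u S p L t ≤ ∫ x, (2 * (powExt p L (S t x) * u t x ^ volExp n) +
      8 * p ^ 3 * u t x ^ volExp n) ∂(riemannianVolume n M) := by
    refine integral_mono_ae (h.integrable_trunc ht hL p) (i1.add i2) ?_
    filter_upwards [h.u_pos ht] with x hx
    have := mul_le_mul_of_nonneg_right (trunc_rpow_le hp hL (S t x))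
      (by positivity : 0 ≤ u t x ^ volExp n)
    linarith
  rwa [integral_add i1 i2, integral_const_mul, integral_const_mul, h.volume_eq_one ht, mul_one]
    at h1

lemma RegularFlow.one_le_truncEnergy (h : RegularFlow n T K A B u S S' ρ) (ht : t ∈ Icc 0 T)
    (hL : 1 ≤ L) {r : ℝ} (hr : 0 ≤ r) : 1 ≤ truncEnergy n u S r L t :=
  h.one_le_integral_trunc ht hL hr

lemma RegularFlow.integrable_reaction (h : RegularFlow n T K A B u S S' ρ) (ht : t ∈ Icc 0 T)
    (hL : 1 ≤ L) (p : ℝ) :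
    Integrable (fun x => (p * (trunc L (S t x) ^ (p - 1) - 1) * S t x -
      n / 2 * powExt p L (S t x)) * (S t x - ρ t) * u t x ^ volExp n) (riemannianVolume n M) := by
  obtain ⟨C, Λ, hF⟩ := isC11On_powExt hL p
  have hS := (h.S_h1 t ht).memLp
  refine h.integrable_mul_rpow ht _ (integrable_mul_of_memLp_two ?_ (h.memLp_sub ht))
  refine MemLp.sub ?_ ((hF.memLp_comp (mem_univ 0) hS (by simp)).const_mul _)
  have := memLp_mul_of_bound hS
    (hF.measurable'.comp_aemeasurable hS.1.aemeasurable).aestronglyMeasurable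
    (ae_of_all _ fun x => hF.bound _ (mem_univ (S t x)))
  simpa only [mul_comm, Function.comp_def] using this

/-- The energy inequality for the exponent `n / 2`. -/
lemma RegularFlow.hasDerivAt_powEnergy_half_le (hn : 3 ≤ n) (hd : TestFunctionsDense n M)
    (hA : 0 < A) (hB : 0 < B) (h : RegularFlow n T K A B u S S' ρ) (ht : t ∈ Ioo 0 T) (hL : 1 ≤ L)
    (hρ : ρ t ≤ L) :
    ∃ Y', HasDerivAt (powEnergy n u S (n / 2) L) Y' t ∧
      Y' ≤ -(A⁻¹ * truncEnergy n u S (critExp n) L t ^ (gainExp n)⁻¹) +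
        2 * B / A * powEnergy n u S (n / 2) L t + 8 * ((n : ℝ) / 2) ^ 3 * (B / A) +
        ((n : ℝ) / 2) ^ 2 * ∫ x, S t x ^ 2 * u t x ^ volExp n ∂(riemannianVolume n M) := by
  have ht' := Ioo_subset_Icc_self ht
  have hn3 : (3 : ℝ) ≤ n := by exact_mod_cast hn
  obtain ⟨Y', hY, hle⟩ := h.hasDerivAt_powExt_le (p := n / 2) hn hd hA ht (by linarith) hL
  refine ⟨Y', hY, hle.trans ?_⟩
  have h1 : ∫ x, (n / 2 * (trunc L (S t x) ^ ((n : ℝ) / 2 - 1) - 1) * S t x -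
      n / 2 * powExt (n / 2) L (S t x)) * (S t x - ρ t) * u t x ^ volExp n
      ∂(riemannianVolume n M) ≤ ((n : ℝ) / 2) ^ 2 *
      ∫ x, S t x ^ 2 * u t x ^ volExp n ∂(riemannianVolume n M) := by
    rw [← integral_const_mul]
    refine integral_mono_ae (h.integrable_reaction ht' hL _)
      ((h.integrable_mul_rpow ht' _ (h.S_h1 t ht').memLp.integrable_sq).const_mul _) ?_
    filter_upwards [h.u_pos ht'] with x hx
    rw [← mul_assoc]
    exact mul_le_mul_of_nonneg_right (powExt_reaction_le_sq (by linarith) hL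
      (h.average_nonneg ht') hρ _) (by positivity)
  have h2 := mul_le_mul_of_nonneg_left (h.truncEnergy_le (p := n / 2) ht' (by linarith) hL)
    (div_nonneg hB.le hA.le)
  rw [volExp_div_two, two_div_volExp]
  change _ - A⁻¹ * truncEnergy n u S (critExp n) L t ^ (gainExp n)⁻¹ +
    B / A * truncEnergy n u S (n / 2) L t ≤ _
  have h3 : B / A * (2 * powEnergy n u S (n / 2) L t + 8 * ((n : ℝ) / 2) ^ 3) =
      2 * B / A * powEnergy n u S (n / 2) L t + 8 * ((n : ℝ) / 2) ^ 3 * (B / A) := by ring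
  linarith

/-- Hölder's inequality for three moments: the pointwise interpolation is integrated with the
moments themselves as normalizations, and the weights add up to one. -/
lemma RegularFlow.truncEnergy_add_one_le (hn : 3 ≤ n) (h : RegularFlow n T K A B u S S' ρ)
    (ht : t ∈ Icc 0 T) (hp : 0 ≤ p) (hL : 1 ≤ L) :
    truncEnergy n u S (p + 1) L t ≤ (truncEnergy n u S (critExp n) L t ^ (gainExp n)⁻¹ *
      truncEnergy n u S p L t) ^ (2 / (n : ℝ)) *
      (truncEnergy n u S (p * gainExp n) L t ^ (gainExp n)⁻¹) ^ (1 - 2 / (n : ℝ)) := by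
  have hn3 : (3 : ℝ) ≤ n := by exact_mod_cast hn
  have hχ := one_lt_gainExp hn
  have hc0 : 0 ≤ critExp n := le_trans (by positivity) (half_le_critExp hn)
  have ha := zero_lt_one.trans_le (h.one_le_truncEnergy ht hL hc0)
  have he := zero_lt_one.trans_le (h.one_le_truncEnergy ht hL hp)
  have hf := zero_lt_one.trans_le (h.one_le_truncEnergy ht hL
    (mul_nonneg hp (by linarith) : 0 ≤ p * gainExp n))
  set a := truncEnergy n u S (critExp n) L t with ha'
  set e := truncEnergy n u S p L t with he'
  set f := truncEnergy n u S (p * gainExp n) L t with hf'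
  set P := (a ^ (gainExp n)⁻¹ * e) ^ (2 / (n : ℝ)) * (f ^ (gainExp n)⁻¹) ^ (1 - 2 / (n : ℝ))
  have i1 := (h.integrable_trunc ht hL (critExp n)).const_mul (P * (2 * (n - 2) / n ^ 2 / a))
  have i2 := (h.integrable_trunc ht hL p).const_mul (P * (2 / n / e))
  have i3 := (h.integrable_trunc ht hL (p * gainExp n)).const_mul
    (P * (((n : ℝ) - 2) ^ 2 / n ^ 2 / f))
  have i12 : Integrable (fun x => P * (2 * (n - 2) / n ^ 2 / a) *
      (trunc L (S t x) ^ critExp n * u t x ^ volExp n) +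
      P * (2 / n / e) * (trunc L (S t x) ^ p * u t x ^ volExp n)) (riemannianVolume n M) := i1.add i2
  have h1 : truncEnergy n u S (p + 1) L t ≤ ∫ x, (P * (2 * (n - 2) / n ^ 2 / a) *
      (trunc L (S t x) ^ critExp n * u t x ^ volExp n) +
      P * (2 / n / e) * (trunc L (S t x) ^ p * u t x ^ volExp n) +
      P * (((n : ℝ) - 2) ^ 2 / n ^ 2 / f) *
        (trunc L (S t x) ^ (p * gainExp n) * u t x ^ volExp n)) ∂(riemannianVolume n M) := by
    refine integral_mono_ae (h.integrable_trunc ht hL (p + 1)) (i12.add i3) ?_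
    filter_upwards [h.u_pos ht] with x hx
    have := mul_le_mul_of_nonneg_right
      (rpow_add_one_le_interpolation hn (p := p) (trunc_pos L (S t x)) ha he hf)
      (by positivity : 0 ≤ u t x ^ volExp n)
    refine this.trans (le_of_eq ?_)
    ring
  rw [integral_add i12 i3, integral_add i1 i2, integral_const_mul, integral_const_mul,
    integral_const_mul] at h1
  refine h1.trans (le_of_eq ?_)
  change P * (2 * (n - 2) / n ^ 2 / a) * a + P * (2 / n / e) * e +
    P * (((n : ℝ) - 2) ^ 2 / n ^ 2 / f) * f = P
  have hn0 : (n : ℝ) ≠ 0 := by linarith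
  field_simp
  ring

/-- The constant of the energy inequality for large exponents. -/
def energyConst (n : ℕ) (A B : ℝ) : ℝ :=
  B / A + ((n : ℝ) ^ 2) ^ ((n : ℝ) / 2) * (2 * A) ^ (((n : ℝ) - 2) / 2)

lemma energyConst_pos (n : ℕ) (hA : 0 < A) (hB : 0 < B) : 0 < energyConst n A B := by
  unfold energyConst; positivity

/-- The energy inequality for exponents `p ≥ n / 2`. -/
lemma RegularFlow.hasDerivAt_powEnergy_le (hn : 3 ≤ n) (hd : TestFunctionsDense n M)
    (hA : 0 < A) (hB : 0 < B) (h : RegularFlow n T K A B u S S' ρ) (ht : t ∈ Ioo 0 T)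
    (hp : (n : ℝ) / 2 ≤ p) (hL : 4 ≤ L) (hρ : ρ t ≤ L) :
    ∃ Y', HasDerivAt (powEnergy n u S p L) Y' t ∧
      Y' ≤ -((2 * A)⁻¹ * truncEnergy n u S (p * gainExp n) L t ^ (gainExp n)⁻¹) +
        energyConst n A B * p ^ ((n : ℝ) / 2) *
          truncEnergy n u S (critExp n) L t ^ (gainExp n)⁻¹ * truncEnergy n u S p L t := by
  have ht' := Ioo_subset_Icc_self ht
  have hn3 : (3 : ℝ) ≤ n := by exact_mod_cast hn
  have hL1 : 1 ≤ L := by linarith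
  have hp0 : 0 < p := by linarith
  have hχ := one_lt_gainExp hn
  obtain ⟨Y', hY, hle⟩ := h.hasDerivAt_powExt_le (p := p) hn hd hA ht (by linarith) hL1
  refine ⟨Y', hY, hle.trans ?_⟩
  have h1 : ∫ x, (p * (trunc L (S t x) ^ (p - 1) - 1) * S t x -
      n / 2 * powExt p L (S t x)) * (S t x - ρ t) * u t x ^ volExp n
      ∂(riemannianVolume n M) ≤ (n : ℝ) ^ 2 * p * truncEnergy n u S (p + 1) L t := by
    rw [truncEnergy, ← integral_const_mul]
    refine integral_mono_ae (h.integrable_reaction ht' hL1 _)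
      ((h.integrable_trunc ht' hL1 _).const_mul _) ?_
    filter_upwards [h.u_pos ht'] with x hx
    rw [← mul_assoc]
    exact mul_le_mul_of_nonneg_right (powExt_reaction_le_rpow hn3 hp hL
      (h.average_nonneg ht') hρ _) (by positivity)
  have hc0 : 0 ≤ critExp n := le_trans (by positivity) (half_le_critExp hn)
  have ha := h.one_le_truncEnergy ht' hL1 hc0
  have he := h.one_le_truncEnergy ht' hL1 hp0.le
  have hf := h.one_le_truncEnergy ht' hL1 (by positivity : 0 ≤ p * gainExp n)
  have h2 := h.truncEnergy_add_one_le hn ht' hp0.le hL1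
  rw [volExp_div_two, two_div_volExp]
  change _ - A⁻¹ * truncEnergy n u S (p * gainExp n) L t ^ (gainExp n)⁻¹ +
    B / A * truncEnergy n u S p L t ≤ _
  set e := truncEnergy n u S p L t
  have hb : 1 ≤ truncEnergy n u S (critExp n) L t ^ (gainExp n)⁻¹ :=
    Real.one_le_rpow ha (by positivity)
  set b := truncEnergy n u S (critExp n) L t ^ (gainExp n)⁻¹
  have hW : 0 ≤ truncEnergy n u S (p * gainExp n) L t ^ (gainExp n)⁻¹ := by positivity
  set W := truncEnergy n u S (p * gainExp n) L t ^ (gainExp n)⁻¹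
  -- Young's inequality charges half of the dissipation `A⁻¹ * W`; the other half remains in the
  -- conclusion.
  have h3 := mul_interpolation_le hn hA (by positivity : 0 ≤ (n : ℝ) ^ 2 * p)
    (by positivity : 0 ≤ b * e) hW
  have h4 := mul_le_mul_of_nonneg_left h2 (by positivity : 0 ≤ (n : ℝ) ^ 2 * p)
  rw [Real.mul_rpow (by positivity) hp0.le] at h3
  have hpn : 1 ≤ p ^ ((n : ℝ) / 2) := Real.one_le_rpow (by linarith) (by positivity)
  -- Truncation from below at 1 and unit volume make `b ≥ 1`, so the lower order term of the Sobolev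
  -- inequality can be merged with the reaction term.
  have h5 : B / A * e ≤ B / A * p ^ ((n : ℝ) / 2) * b * e := by
    apply mul_le_mul_of_nonneg_right _ (by linarith)
    rw [mul_assoc]
    exact le_mul_of_one_le_right (by positivity) (one_le_mul_of_one_le_of_one_le hpn hb)
  have h6 : A⁻¹ * W = (2 * A)⁻¹ * W + (2 * A)⁻¹ * W := by field_simp; ring
  unfold energyConst
  linarith

end Energy

/-! ### Two coupled differential inequalities -/

section ComparisonLemma

/-- A bound for `YB` from two coupled differential inequalities: the quantity `b` that drives the
growth of `YB` is dissipated by `YA`. -/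
lemma le_mul_exp_of_coupled {YA YB ρ Q b : ℝ → ℝ} {T A c k a ν k₂ R D Λ I₀ t : ℝ}
    (hA : 0 < A) (hc : 0 ≤ c) (hk : 0 ≤ k) (ha : 0 ≤ a) (hk₂ : 0 ≤ k₂) (hν : k₂ * ν = a)
    (hD : 0 < D) (hΛ : 0 < Λ) (hYAc : ContinuousOn YA (Icc 0 T)) (hYBc : ContinuousOn YB (Icc 0 T))
    (hρc : ContinuousOn ρ (Icc 0 T)) (hYA0 : ∀ s ∈ Icc 0 T, 0 ≤ YA s)
    (hYB0 : ∀ s ∈ Icc 0 T, 0 ≤ YB s) (hρ0 : ∀ s ∈ Icc 0 T, 0 ≤ ρ s) (hρR : ∀ s ∈ Icc 0 T, ρ s ≤ R)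
    (hQ : ∀ s ∈ Ioo 0 T, 0 ≤ Q s) (hb : ∀ s ∈ Ioo 0 T, 0 ≤ b s)
    (hA' : ∀ s ∈ Ioo 0 T, ∃ Y', HasDerivAt YA Y' s ∧ Y' ≤ -(A⁻¹ * b s) + c * YA s + k + a * Q s)
    (hB' : ∀ s ∈ Ioo 0 T, ∃ Y', HasDerivAt YB Y' s ∧ 2 * Y' ≤ Λ * b s * (2 * YB s + D))
    (hρ' : ∀ s ∈ Ioo 0 T, HasDerivAt ρ (-ν * (Q s - ρ s ^ 2)) s)
    (hYA : YA 0 ≤ I₀) (hYB : YB 0 ≤ I₀) (ht : t ∈ Icc 0 T) :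
    2 * YB t + D ≤ (2 * I₀ + D) * Real.exp (Λ * A * Real.exp (c * T) *
      (I₀ + k₂ * R + (k + a * R ^ 2) * T)) := by
  have h0 : (0 : ℝ) ∈ Icc 0 T := ⟨le_rfl, ht.1.trans ht.2⟩
  obtain ⟨κ, hκ⟩ : ∃ κ, κ = Λ * A * Real.exp (c * T) := ⟨_, rfl⟩
  have hκ0 : 0 < κ := by rw [hκ]; positivity
  obtain ⟨k₃, hk₃⟩ : ∃ k₃, k₃ = k + a * R ^ 2 := ⟨_, rfl⟩
  have hk₃0 : 0 ≤ k₃ := by rw [hk₃]; positivity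
  rw [← hκ, ← hk₃]
  -- A Lyapunov function. The logarithm grows at rate at most `Λ b`, which the dissipation of `YA`
  -- compensates; the factor `exp (-c s)` removes the term `c YA`, and `κ = Λ A exp (cT)` makes up
  -- for this factor. The multiple of `ρ` cancels `a Q`, leaving `a ρ ^ 2 ≤ a R ^ 2`, and `k₃ s`
  -- collects the constants.
  have hanti : AntitoneOn (fun s => Real.log (2 * YB s + D) +
      κ * (Real.exp (-c * s) * YA s + k₂ * ρ s - k₃ * s)) (Icc 0 T) := by
    refine antitoneOn_Icc_of_hasDerivAt ?_ fun s hs => ?_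
    · refine ContinuousOn.add (ContinuousOn.log (by fun_prop) fun s hs => ?_) (by fun_prop)
      have := hYB0 s hs
      positivity
    · have hs' := Ioo_subset_Icc_self hs
      obtain ⟨YA', hYA', hA'⟩ := hA' s hs
      obtain ⟨YB', hYB', hB'⟩ := hB' s hs
      have hpos : 0 < 2 * YB s + D := by have := hYB0 s hs'; positivity
      have hexp : HasDerivAt (fun s => Real.exp (-c * s)) (Real.exp (-c * s) * -c) s := by
        simpa using ((hasDerivAt_id s).const_mul (-c)).exp
      have hlog := ((hYB'.const_mul 2).add_const D).log hpos.ne'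
      refine ⟨_, hlog.add ((((hexp.mul hYA').add ((hρ' s hs).const_mul k₂)).sub
        ((hasDerivAt_id s).const_mul k₃)).const_mul κ), ?_⟩
      have hQ0 := hQ s hs
      have hb0 := hb s hs
      have h1 : 2 * YB' / (2 * YB s + D) ≤ Λ * b s := by
        rwa [div_le_iff₀ hpos]
      have hes : Real.exp (-c * s) ≤ 1 := Real.exp_le_one_iff.2 (by nlinarith [hs.1])
      have hes2 : Real.exp (-(c * T)) ≤ Real.exp (-c * s) :=
        Real.exp_le_exp.2 (by nlinarith [hs.2])
      have he0 := Real.exp_pos (-c * s)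
      generalize Real.exp (-c * s) = ε at *
      have h6 : ε * YA' ≤ ε * (-(A⁻¹ * b s) + c * YA s + k + a * Q s) :=
        mul_le_mul_of_nonneg_left hA' he0.le
      have h7 : Real.exp (-(c * T)) * (A⁻¹ * b s) ≤ ε * (A⁻¹ * b s) :=
        mul_le_mul_of_nonneg_right hes2 (by positivity)
      have h8 : ε * (k + a * Q s) ≤ 1 * (k + a * Q s) :=
        mul_le_mul_of_nonneg_right hes (by positivity)
      have h9 : k₂ * (-ν * (Q s - ρ s ^ 2)) = -(a * (Q s - ρ s ^ 2)) := by rw [← hν]; ring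
      have h10 : a * ρ s ^ 2 ≤ a * R ^ 2 :=
        mul_le_mul_of_nonneg_left (pow_le_pow_left₀ (hρ0 s hs') (hρR s hs') 2) ha
      have h11 : κ * (ε * -c * YA s + ε * YA' + k₂ * (-ν * (Q s - ρ s ^ 2)) -
          k₃ * 1) ≤ κ * -(Real.exp (-(c * T)) * (A⁻¹ * b s)) := by
        refine mul_le_mul_of_nonneg_left ?_ hκ0.le
        rw [h9, hk₃]
        linarith
      have h12 : κ * -(Real.exp (-(c * T)) * (A⁻¹ * b s)) = -(Λ * b s) := by
        rw [hκ, Real.exp_neg]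
        have := (Real.exp_pos (c * T)).ne'
        field_simp
      linarith
  have h1 := hanti h0 ht ht.1
  simp only [mul_zero, Real.exp_zero, one_mul, sub_zero] at h1
  have hI0 : 0 ≤ I₀ := (hYB0 0 h0).trans hYB
  have hpos : 0 < 2 * YB t + D := by have := hYB0 t ht; positivity
  have hpos0 : 0 < 2 * YB 0 + D := by have := hYB0 0 h0; positivity
  have h2 : Real.log (2 * YB t + D) ≤ Real.log (2 * I₀ + D) +
      κ * (I₀ + k₂ * R + k₃ * T) := by
    have h3 : Real.log (2 * YB 0 + D) ≤ Real.log (2 * I₀ + D) :=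
      Real.log_le_log hpos0 (by linarith)
    have h4 : κ * (YA 0 + k₂ * ρ 0) ≤ κ * (I₀ + k₂ * R) :=
      mul_le_mul_of_nonneg_left (add_le_add hYA (mul_le_mul_of_nonneg_left (hρR 0 h0) hk₂)) hκ0.le
    have h5 : -(κ * (k₃ * T)) ≤
        κ * (Real.exp (-c * t) * YA t + k₂ * ρ t - k₃ * t) := by
      rw [← mul_neg]
      refine mul_le_mul_of_nonneg_left ?_ hκ0.le
      have e1 : 0 ≤ Real.exp (-c * t) * YA t := mul_nonneg (Real.exp_pos _).le (hYA0 t ht)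
      have e2 : 0 ≤ k₂ * ρ t := mul_nonneg hk₂ (hρ0 t ht)
      have e3 : k₃ * t ≤ k₃ * T := mul_le_mul_of_nonneg_left ht.2 hk₃0
      linarith
    linarith
  have h6 := Real.exp_le_exp.2 h2
  rwa [Real.exp_add, Real.exp_log hpos, Real.exp_log (by positivity)] at h6

end ComparisonLemma

/-! ### Propagation of the critical integrability -/

section CriticalBound

variable {n : ℕ} {M : Type*} [TopologicalSpace M] [ChartedSpace (EuclideanSpace ℝ (Fin n)) M]
  [IsManifold (𝓡 n) ∞ M] [RiemannianBundle (fun x : M => TangentSpace (𝓡 n) x)]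
  [IsContMDiffRiemannianBundle (𝓡 n) ∞ (EuclideanSpace ℝ (Fin n))
      (fun x : M => TangentSpace (𝓡 n) x)]
  [MeasurableSpace M] [BorelSpace M] [SecondCountableTopology M] [T2Space M]
  [IsProbabilityMeasure (riemannianVolume n M)]
  {T K A B : ℝ} {u S S' : ℝ → M → ℝ} {ρ : ℝ → ℝ} {t p L : ℝ}

variable (n M) in
/-- The integral of `max S₀ 1 ^ (n² / (2 (n - 2)))`. -/
def initialEnergy : ℝ :=
  ∫ x : M, max (scalarCurvature n x) 1 ^ critExp n ∂(riemannianVolume n M)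

/-- Since the base `max S₀ 1` is at least 1, the integral with the largest exponent dominates the
others. -/
lemma RegularFlow.powEnergy_zero_le (h : RegularFlow n T K A B u S S' ρ) (hT : 0 ≤ T)
    (hi : Integrable (fun x : M => max (scalarCurvature n x) 1 ^ critExp n) (riemannianVolume n M))
    (hp : 1 ≤ p) (hpc : p ≤ critExp n) (hL : 1 ≤ L) :
    powEnergy n u S p L 0 ≤ initialEnergy n M := by
  have h0 : (0 : ℝ) ∈ Icc 0 T := ⟨le_rfl, hT⟩
  refine integral_mono_ae (h.integrable_powExt h0 hL p) hi ?_
  filter_upwards [h.u_zero, h.S_zero] with x hx hx'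
  rw [hx, hx', Real.one_rpow, mul_one]
  exact (powExt_le_rpow hp hL _).trans
    (Real.rpow_le_rpow_of_exponent_le (le_max_right _ _) hpc)

/-- The integral of the power `n² / (2 (n - 2))` of the scalar curvature is bounded on `[0, T]`. -/
theorem RegularFlow.truncEnergy_critExp_le (hn : 3 ≤ n) (hd : TestFunctionsDense n M)
    (hA : 0 < A) (hB : 0 < B) (h : RegularFlow n T K A B u S S' ρ)
    (hi : Integrable (fun x : M => max (scalarCurvature n x) 1 ^ critExp n) (riemannianVolume n M))
    (ht : t ∈ Icc 0 T) (hL : 4 ≤ L)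
    (hR : ∫ x : M, scalarCurvature n x ∂(riemannianVolume n M) ≤ L) :
    truncEnergy n u S (critExp n) L t ≤
      (2 * initialEnergy n M + 8 * critExp n ^ 3) *
        Real.exp (2 * energyConst n A B * critExp n ^ ((n : ℝ) / 2) * A * Real.exp (2 * B / A * T) *
          (initialEnergy n M + ((n : ℝ) / 2) ^ 2 * (2 / ((n : ℝ) - 2)) *
            ∫ x : M, scalarCurvature n x ∂(riemannianVolume n M) +
            (8 * ((n : ℝ) / 2) ^ 3 * (B / A) + ((n : ℝ) / 2) ^ 2 *
              (∫ x : M, scalarCurvature n x ∂(riemannianVolume n M)) ^ 2) * T)) := by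
  have hn3 : (3 : ℝ) ≤ n := by exact_mod_cast hn
  have hL1 : 1 ≤ L := by linarith
  have hT : 0 ≤ T := ht.1.trans ht.2
  have hhc := half_le_critExp hn
  have hq1 : 3 / 2 ≤ critExp n := by linarith
  have hq0 : 0 < critExp n := by linarith
  have hC := energyConst_pos n hA hB
  have hχ := one_lt_gainExp hn
  have hρR : ∀ s ∈ Icc 0 T, ρ s ≤ ∫ x : M, scalarCurvature n x ∂(riemannianVolume n M) :=
    fun s hs => h.average_le hn hs
  have hone : ∀ s ∈ Icc 0 T, 1 ≤ truncEnergy n u S (critExp n) L s := fun s hs =>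
    h.one_le_truncEnergy hs hL1 hq0.le
  refine (h.truncEnergy_le ht hq1 hL1).trans ?_
  -- `YA` is the energy of exponent `n / 2` and `YB` that of exponent `critExp n`. As `critExp n = n
  -- / 2 * gainExp n`, the dissipation of the former is the growth rate `b` of the latter.
  refine le_mul_exp_of_coupled (ν := ((n : ℝ) - 2) / 2)
    (b := fun s => truncEnergy n u S (critExp n) L s ^ (gainExp n)⁻¹)
    (Q := fun s => ∫ x, S s x ^ 2 * u s x ^ volExp n ∂(riemannianVolume n M)) hA (by positivity)
    (by positivity) (sq_nonneg _)
    (mul_nonneg (sq_nonneg _) (div_nonneg zero_le_two (by linarith))) ?_ (by positivity)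
    (by positivity) (h.continuousOn_powEnergy hL1 (n / 2)) (h.continuousOn_powEnergy hL1 _)
    h.continuousOn_average (fun s hs => h.powEnergy_nonneg hs (by linarith) hL1)
    (fun s hs => h.powEnergy_nonneg hs (by linarith) hL1) (fun s hs => h.average_nonneg hs) hρR
    (fun s hs => ?_) (fun s hs => ?_) (fun s hs => ?_) (fun s hs => ?_)
    (fun s hs => h.hasDerivAt_average hn hs) (h.powEnergy_zero_le hT hi (by linarith) hhc hL1)
    (h.powEnergy_zero_le hT hi (by linarith) le_rfl hL1) ht
  · have : (n : ℝ) - 2 ≠ 0 := by linarith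
    field_simp
  · refine integral_nonneg_of_ae ?_
    filter_upwards [h.u_pos (Ioo_subset_Icc_self hs)] with x hx
    exact mul_nonneg (sq_nonneg _) (by positivity)
  · have := hone s (Ioo_subset_Icc_self hs)
    positivity
  · exact h.hasDerivAt_powEnergy_half_le hn hd hA hB hs hL1
      ((hρR s (Ioo_subset_Icc_self hs)).trans hR)
  · have hs' := Ioo_subset_Icc_self hs
    obtain ⟨Y', hY, hle⟩ := h.hasDerivAt_powEnergy_le hn hd hA hB hs hhc hL
      ((hρR s hs').trans hR)
    refine ⟨Y', hY, ?_⟩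
    have h1 := hone s hs'
    have h2 := h.one_le_truncEnergy hs' hL1 (by positivity : 0 ≤ critExp n * gainExp n)
    have h3 : 0 ≤ (2 * A)⁻¹ * truncEnergy n u S (critExp n * gainExp n) L s ^ (gainExp n)⁻¹ := by
      positivity
    have h4 := mul_le_mul_of_nonneg_left (h.truncEnergy_le hs' hq1 hL1)
      (by positivity : 0 ≤ energyConst n A B * critExp n ^ ((n : ℝ) / 2) *
        truncEnergy n u S (critExp n) L s ^ (gainExp n)⁻¹)
    linarith

end CriticalBound

/-! ### Abstract steps of the Moser iteration -/

section Iteration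

/-- The solution of the recursion of the Moser iteration. -/
lemma exists_le_rpow_pow_of_recursion {χ C D m : ℝ} (hχ : 1 < χ) (hC : 1 ≤ C) (hD : 1 ≤ D)
    (hm : 1 ≤ m) :
    ∃ N : ℝ, 1 ≤ N ∧ ∀ b : ℕ → ℝ, b 0 = m → (∀ k, b (k + 1) = C * D ^ k * b k ^ χ) →
      ∀ k, b k ≤ N ^ (χ ^ k) := by
  have hχ0 : 0 < χ - 1 := by linarith
  -- `C' * D' ^ k * b k` satisfies the pure recursion `x (k + 1) = x k ^ χ` if `D' ^ (χ - 1) = D`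
  -- and `C' ^ (χ - 1) = C * D'`.
  obtain ⟨D', hD'⟩ : ∃ D', D' = D ^ (χ - 1)⁻¹ := ⟨_, rfl⟩
  have hD'1 : 1 ≤ D' := by rw [hD']; exact Real.one_le_rpow hD (by positivity)
  have hDD : D' ^ χ = D' * D := by
    have : D' ^ (χ - 1) = D := by
      rw [hD', ← Real.rpow_mul (by linarith), inv_mul_cancel₀ hχ0.ne', Real.rpow_one]
    rw [← this, mul_comm, ← Real.rpow_add_one (by linarith), sub_add_cancel]
  obtain ⟨C', hC'⟩ : ∃ C', C' = (C * D') ^ (χ - 1)⁻¹ := ⟨_, rfl⟩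
  have hC'1 : 1 ≤ C' := by
    rw [hC']; exact Real.one_le_rpow (one_le_mul_of_one_le_of_one_le hC hD'1) (by positivity)
  have hCC : C' ^ χ = C' * (C * D') := by
    have : C' ^ (χ - 1) = C * D' := by
      rw [hC', ← Real.rpow_mul (by positivity), inv_mul_cancel₀ hχ0.ne', Real.rpow_one]
    rw [← this, mul_comm, ← Real.rpow_add_one (by linarith), sub_add_cancel]
  refine ⟨C' * m, one_le_mul_of_one_le_of_one_le hC'1 hm, fun b hb0 hb k => ?_⟩
  have hpos : ∀ k, 0 < b k := fun k => by
    induction k with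
    | zero => rw [hb0]; linarith
    | succ k ih => rw [hb]; positivity
  have key : ∀ k, C' * D' ^ k * b k = (C' * m) ^ (χ ^ k) := fun k => by
    induction k with
    | zero => simp [hb0]
    | succ k ih =>
      have hbk := hpos k
      rw [pow_succ χ, Real.rpow_mul (by positivity), ← ih, Real.mul_rpow (by positivity) hbk.le,
        Real.mul_rpow (by positivity) (by positivity), hCC, ← Real.rpow_natCast D' k,
        ← Real.rpow_mul (by positivity), mul_comm (k : ℝ), Real.rpow_mul (by positivity), hDD,
        Real.rpow_natCast, hb, mul_pow, pow_succ]
      ring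
  rw [← key k]
  exact le_mul_of_one_le_left (hpos k).le
    (one_le_mul_of_one_le_of_one_le hC'1 (one_le_pow₀ hD'1))

/-- If the dissipation of a bounded quantity is large on an interval, then it is moderate at some
time of the interval. -/
lemma exists_le_of_dissipation {Y W : ℝ → ℝ} {a b κ m m₀ : ℝ} (hab : a < b) (hκ : 0 < κ)
    (hm₀ : 0 < m₀) (hY : ContinuousOn Y (Icc a b)) (hYb : 0 ≤ Y b) (hYa : Y a ≤ m₀)
    (hd : ∀ s ∈ Ioo a b, ∃ Y', HasDerivAt Y Y' s ∧ Y' ≤ -(κ * W s) + m) :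
    ∃ s ∈ Icc a b, W s ≤ κ⁻¹ * (2 * m₀ / (b - a) + m) := by
  by_contra! hc
  -- If `W` were large throughout, `Y` would lose at least `2 m₀` on the interval, but it starts
  -- below `m₀` and ends nonnegative. The factor 2 makes the contradiction strict.
  have hanti : AntitoneOn (fun s => Y s + 2 * m₀ / (b - a) * s) (Icc a b) := by
    refine antitoneOn_Icc_of_hasDerivAt (by fun_prop) fun s hs => ?_
    obtain ⟨Y', hY', hle⟩ := hd s hs
    refine ⟨_, hY'.add ((hasDerivAt_id s).const_mul _), ?_⟩
    have h1 := mul_lt_mul_of_pos_left (hc s (Ioo_subset_Icc_self hs)) hκ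
    rw [← mul_assoc, mul_inv_cancel₀ hκ.ne', one_mul] at h1
    linarith
  have h1 := hanti (left_mem_Icc.2 hab.le) (right_mem_Icc.2 hab.le) hab.le
  simp only at h1
  have h2 : 2 * m₀ / (b - a) * b - 2 * m₀ / (b - a) * a = 2 * m₀ := by
    have : b - a ≠ 0 := by linarith
    field_simp
  linarith

/-- A function all of whose moments of exponents tending to infinity are at most one is at most
one. -/
lemma ae_le_one_of_integral_rpow_le {α : Type*} [MeasurableSpace α] {μ : Measure α} {f w : α → ℝ}
    {r : ℕ → ℝ} (hr : Tendsto r atTop atTop) (hf : ∀ᵐ x ∂μ, 0 < f x) (hw : ∀ᵐ x ∂μ, 0 < w x)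
    (hi : ∀ k, Integrable (fun x => f x ^ r k * w x) μ)
    (h : ∀ k, ∫ x, f x ^ r k * w x ∂μ ≤ 1) : ∀ᵐ x ∂μ, f x ≤ 1 := by
  -- Fatou's lemma bounds the integral of the lower limit, which is infinite wherever `f > 1` and `w
  -- > 0`.
  have h1 : ∫⁻ x, liminf (fun k => ENNReal.ofReal (f x ^ r k * w x)) atTop ∂μ ≤ 1 := by
    refine (lintegral_liminf_le' fun k => (hi k).1.aemeasurable.ennreal_ofReal).trans ?_
    refine liminf_le_of_le (by isBoundedDefault) fun b hb => ?_
    obtain ⟨k, hk⟩ := hb.exists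
    refine hk.trans ?_
    rw [← ofReal_integral_eq_lintegral_ofReal (hi k)]
    · exact ENNReal.ofReal_le_one.2 (h k)
    · filter_upwards [hf, hw] with x hx hx'
      exact mul_nonneg (by positivity) hx'.le
  have hm : AEMeasurable (fun x => liminf (fun k => ENNReal.ofReal (f x ^ r k * w x)) atTop) μ := by
    simp only [liminf_eq_iSup_iInf_of_nat']
    exact AEMeasurable.iSup fun _ => AEMeasurable.iInf fun _ =>
      (hi _).1.aemeasurable.ennreal_ofReal
  have h2 := ae_lt_top' hm (h1.trans_lt ENNReal.one_lt_top).ne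
  filter_upwards [h2, hw] with x hx hx'
  by_contra! hc
  have h3 : Tendsto (fun k => f x ^ r k * w x) atTop atTop :=
    ((tendsto_rpow_atTop_of_base_gt_one _ hc).comp hr).atTop_mul_const hx'
  exact hx.ne (ENNReal.tendsto_ofReal_atTop.comp h3).liminf_eq

end Iteration

/-! ### Dependence of the truncation on its level -/

section Truncation

variable {L L' s : ℝ}

lemma trunc_mono (h : L ≤ L') (s : ℝ) : trunc L s ≤ trunc L' s :=
  max_le_max le_rfl (min_le_min le_rfl h)

lemma trunc_eq_max (h : s ≤ L) : trunc L s = max s 1 := by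
  rw [trunc, min_eq_left h, max_comm]

lemma lipschitz_trunc_rpow (hL : 1 ≤ L) (r : ℝ) :
    ∃ C, 0 ≤ C ∧ ∀ s t, |trunc L s ^ r - trunc L t ^ r| ≤ C * |s - t| := by
  obtain ⟨C, Λ, h⟩ := isC11On_rpow hL r
  have hm : ∀ s, trunc L s ∈ Icc L⁻¹ L := fun s =>
    ⟨(inv_le_one_of_one_le₀ hL).trans (one_le_trunc _ _), trunc_le hL _⟩
  exact ⟨C, h.nonneg, fun s t => (h.lipschitz _ (hm s) _ (hm t)).trans
    (mul_le_mul_of_nonneg_left (abs_clamp_sub_le _ _ _ _) h.nonneg)⟩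

end Truncation

/-! ### Moments as functions of time and truncation level -/

section Moments

variable {n : ℕ} {M : Type*} [TopologicalSpace M] [ChartedSpace (EuclideanSpace ℝ (Fin n)) M]
  [IsManifold (𝓡 n) ∞ M] [RiemannianBundle (fun x : M => TangentSpace (𝓡 n) x)]
  [IsContMDiffRiemannianBundle (𝓡 n) ∞ (EuclideanSpace ℝ (Fin n))
      (fun x : M => TangentSpace (𝓡 n) x)]
  [MeasurableSpace M] [BorelSpace M] [SecondCountableTopology M] [T2Space M]
  [IsProbabilityMeasure (riemannianVolume n M)]
  {T K A B : ℝ} {u S S' : ℝ → M → ℝ} {ρ : ℝ → ℝ} {t p L : ℝ}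

lemma RegularFlow.truncEnergy_mono (h : RegularFlow n T K A B u S S' ρ) (ht : t ∈ Icc 0 T)
    (hp : 0 ≤ p) (hL : 1 ≤ L) {L' : ℝ} (hLL : L ≤ L') :
    truncEnergy n u S p L t ≤ truncEnergy n u S p L' t := by
  refine integral_mono_ae (h.integrable_trunc ht hL p) (h.integrable_trunc ht (hL.trans hLL) p) ?_
  filter_upwards [h.u_pos ht] with x hx
  exact mul_le_mul_of_nonneg_right (Real.rpow_le_rpow (trunc_pos _ _).le (trunc_mono hLL _) hp)
    (by positivity)

lemma RegularFlow.continuousOn_truncEnergy (h : RegularFlow n T K A B u S S' ρ) (hL : 1 ≤ L)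
    (p : ℝ) : ContinuousOn (truncEnergy n u S p L) (Icc 0 T) := by
  intro t ht
  obtain ⟨C₁, L₁, hr⟩ := isC11On_rpow h.one_le (volExp n)
  obtain ⟨C, hC, hlip⟩ := lipschitz_trunc_rpow hL p
  have hS : ∀ s ∈ Icc 0 T, MemLp (fun x => trunc L (S s x) ^ p) 2 (riemannianVolume n M) :=
    fun s hs => MemLp.of_bound (((continuous_trunc L).measurable.comp_aemeasurable
      (h.S_h1 s hs).memLp.1.aemeasurable).pow_const p).aestronglyMeasurable (L ^ |p|)
      (ae_of_all _ fun x => rpow_abs_le_of_mem_Icc hL p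
        ⟨(inv_le_one_of_one_le₀ hL).trans (one_le_trunc _ _), trunc_le hL _⟩)
  have h1 : Tendsto (fun s => ENNReal.ofReal C * eLpNorm (S s - S t) 2 (riemannianVolume n M))
      (𝓝[Icc 0 T] t) (𝓝 0) := by
    simpa using ENNReal.Tendsto.const_mul (h.S_cont t ht) (Or.inr (ENNReal.ofReal_ne_top (r := C)))
  refine tendsto_integral_mul_of_eLpNorm_two ?_ ?_ (hS t ht) (h.memLp_rpow ht (volExp n) 2) ?_
    (hr.tendsto_comp ?_ (h.u_mem t ht) (h.u_cont t ht))
  · filter_upwards [self_mem_nhdsWithin] with s hs using hS s hs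
  · filter_upwards [self_mem_nhdsWithin] with s hs using h.memLp_rpow hs (volExp n) 2
  · exact tendsto_of_tendsto_of_tendsto_of_le_of_le tendsto_const_nhds h1 (fun _ => zero_le)
      fun s => eLpNorm_le_mul_eLpNorm_of_ae_le_mul (ae_of_all _ fun x => hlip _ _) 2
  · filter_upwards [self_mem_nhdsWithin] with s hs using h.u_mem s hs

/-- `powExt p L` is affine at infinity and exceeds `trunc L ^ p` there, so all higher truncation
levels are needed. Its minimum with `trunc k ^ p` equals `powExt p L` as soon as `k` exceeds the
value of `S`, and dominated convergence applies. -/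
lemma RegularFlow.powEnergy_le_of_truncEnergy_le (h : RegularFlow n T K A B u S S' ρ)
    (ht : t ∈ Icc 0 T) (hp : 1 ≤ p) (hL : 1 ≤ L) {L₀ m : ℝ}
    (hm : ∀ L', L₀ ≤ L' → truncEnergy n u S p L' t ≤ m) : powEnergy n u S p L t ≤ m := by
  set F : ℕ → M → ℝ := fun k x =>
    min (powExt p L (S t x)) (trunc k (S t x) ^ p) * u t x ^ volExp n with hF
  have hcont : Continuous (powExt p L) := by
    obtain ⟨C, Λ, hC⟩ := isC11On_powExt hL p
    exact (LipschitzWith.of_dist_le_mul (K := ⟨C, hC.nonneg⟩) fun a b =>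
      hC.lipschitz a (mem_univ _) b (mem_univ _)).continuous
  have hSm := (h.S_h1 t ht).memLp.1.aemeasurable
  have hFm : ∀ k, AEStronglyMeasurable (F k) (riemannianVolume n M) := fun k =>
    (((hcont.measurable.comp_aemeasurable hSm).min
      (((continuous_trunc k).measurable.comp_aemeasurable hSm).pow_const p)).mul
      ((h.u_h1 t ht).memLp.1.aemeasurable.pow_const _)).aestronglyMeasurable
  have hnn : ∀ k x, 0 ≤ min (powExt p L (S t x)) (trunc k (S t x) ^ p) := fun k x =>
    le_min (powExt_nonneg hp hL _) (by have := trunc_pos k (S t x); positivity)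
  have hlim : Tendsto (fun k => ∫ x, F k x ∂(riemannianVolume n M)) atTop
      (𝓝 (powEnergy n u S p L t)) := by
    refine tendsto_integral_of_dominated_convergence
      (fun x => powExt p L (S t x) * u t x ^ volExp n) hFm (h.integrable_powExt ht hL p)
      (fun k => ?_) (ae_of_all _ fun x => ?_)
    · filter_upwards [h.u_pos ht] with x hx
      rw [Real.norm_of_nonneg (mul_nonneg (hnn k x) (by positivity))]
      exact mul_le_mul_of_nonneg_right (min_le_left _ _) (by positivity)
    · refine tendsto_const_nhds.congr' ?_
      obtain ⟨k₀, hk₀⟩ := exists_nat_ge (S t x)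
      filter_upwards [eventually_ge_atTop k₀] with k hk
      rw [hF]
      simp only
      rw [trunc_eq_max (hk₀.trans (by exact_mod_cast hk)), min_eq_left (powExt_le_rpow hp hL _)]
  refine le_of_tendsto hlim ?_
  obtain ⟨k₀, hk₀⟩ := exists_nat_ge (max L₀ 1)
  filter_upwards [eventually_ge_atTop k₀] with k hk
  have hk' : max L₀ 1 ≤ (k : ℝ) := hk₀.trans (by exact_mod_cast hk)
  refine le_trans ?_ (hm k ((le_max_left _ _).trans hk'))
  refine integral_mono_of_nonneg ?_
    (h.integrable_trunc ht ((le_max_right _ _).trans hk') p) ?_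
  · filter_upwards [h.u_pos ht] with x hx
    exact mul_nonneg (hnn k x) (by positivity)
  · filter_upwards [h.u_pos ht] with x hx
    exact mul_le_mul_of_nonneg_right (min_le_right _ _) (by positivity)

end Moments

/-! ### One step of the Moser iteration -/

section MoserIteration

variable {n : ℕ} {M : Type*} [TopologicalSpace M] [ChartedSpace (EuclideanSpace ℝ (Fin n)) M]
  [IsManifold (𝓡 n) ∞ M] [RiemannianBundle (fun x : M => TangentSpace (𝓡 n) x)]
  [IsContMDiffRiemannianBundle (𝓡 n) ∞ (EuclideanSpace ℝ (Fin n))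
      (fun x : M => TangentSpace (𝓡 n) x)]
  [MeasurableSpace M] [BorelSpace M] [SecondCountableTopology M] [T2Space M]
  [IsProbabilityMeasure (riemannianVolume n M)]
  {T K A B : ℝ} {u S S' : ℝ → M → ℝ} {ρ : ℝ → ℝ} {t p L Γ L₀ m t₀ d : ℝ}

/-- At some time of an interval on which the `p`-th moments are bounded, the moments of exponent
`p * gainExp n` are bounded. -/
lemma RegularFlow.exists_truncEnergy_gain_le (hn : 3 ≤ n) (hd : TestFunctionsDense n M)
    (hA : 0 < A) (hB : 0 < B) (h : RegularFlow n T K A B u S S' ρ) (hp : (n : ℝ) / 2 ≤ p)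
    (hL₀ : 4 ≤ L₀) (hR : ∫ x : M, scalarCurvature n x ∂(riemannianVolume n M) ≤ L₀) (hΓ0 : 0 ≤ Γ)
    (hΓ : ∀ s ∈ Icc 0 T, ∀ L, L₀ ≤ L →
      energyConst n A B * truncEnergy n u S (critExp n) L s ^ (gainExp n)⁻¹ ≤ Γ)
    (ht₀ : 0 ≤ t₀) (hd0 : 0 < d) (htT : t₀ + d ≤ T)
    (hm : ∀ s ∈ Icc t₀ T, ∀ L, L₀ ≤ L → truncEnergy n u S p L s ≤ m) :
    ∃ s ∈ Icc t₀ (t₀ + d), ∀ L, L₀ ≤ L → truncEnergy n u S (p * gainExp n) L s ≤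
      (2 * A * (2 * m / d + Γ * p ^ ((n : ℝ) / 2) * m)) ^ gainExp n := by
  have hn3 : (3 : ℝ) ≤ n := by exact_mod_cast hn
  have hp0 : 0 < p := by linarith
  have hχ := one_lt_gainExp hn
  have hsub : Icc t₀ (t₀ + d) ⊆ Icc 0 T := Icc_subset_Icc ht₀ htT
  have hC := energyConst_pos n hA hB
  have hm1 : 1 ≤ m := (h.one_le_truncEnergy (hsub (left_mem_Icc.2 (by linarith)))
    (by linarith : 1 ≤ L₀) hp0.le).trans (hm _ ⟨le_rfl, by linarith⟩ _ le_rfl)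
  set w := 2 * A * (2 * m / d + Γ * p ^ ((n : ℝ) / 2) * m) with hw
  have hw0 : 0 ≤ w := by positivity
  -- At a fixed level the good time may depend on `L`.
  have hone : ∀ L, L₀ ≤ L → ∃ s ∈ Icc t₀ (t₀ + d),
      truncEnergy n u S (p * gainExp n) L s ≤ w ^ gainExp n := fun L hL => by
    have hL1 : 1 ≤ L := by linarith
    obtain ⟨s, hs, hle⟩ := exists_le_of_dissipation (a := t₀) (b := t₀ + d) (κ := (2 * A)⁻¹)
      (m := Γ * p ^ ((n : ℝ) / 2) * m) (m₀ := m) (Y := powEnergy n u S p L)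
      (W := fun s => truncEnergy n u S (p * gainExp n) L s ^ (gainExp n)⁻¹)
      (by linarith) (by positivity) (by linarith) ((h.continuousOn_powEnergy hL1 p).mono hsub)
      (h.powEnergy_nonneg (hsub (right_mem_Icc.2 (by linarith))) (by linarith) hL1)
      (h.powEnergy_le_of_truncEnergy_le (hsub (left_mem_Icc.2 (by linarith))) (by linarith) hL1
        fun L' hL' => hm t₀ ⟨le_rfl, by linarith⟩ L' hL') fun s hs => by
        have hs0 : s ∈ Ioo 0 T := ⟨ht₀.trans_lt hs.1, hs.2.trans_le htT⟩
        have hs' := Ioo_subset_Icc_self hs0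
        obtain ⟨Y', hY, hle⟩ := h.hasDerivAt_powEnergy_le hn hd hA hB hs0 hp (hL₀.trans hL)
          ((h.average_le hn hs').trans (hR.trans hL))
        refine ⟨Y', hY, hle.trans (add_le_add le_rfl ?_)⟩
        have h1 := hΓ s hs' L hL
        have h2 := hm s ⟨hs.1.le, hs'.2⟩ L hL
        have h3 := h.one_le_truncEnergy hs' hL1 hp0.le
        calc energyConst n A B * p ^ ((n : ℝ) / 2) *
              truncEnergy n u S (critExp n) L s ^ (gainExp n)⁻¹ * truncEnergy n u S p L s
            = energyConst n A B * truncEnergy n u S (critExp n) L s ^ (gainExp n)⁻¹ *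
              p ^ ((n : ℝ) / 2) * truncEnergy n u S p L s := by ring
          _ ≤ Γ * p ^ ((n : ℝ) / 2) * m := by gcongr
    refine ⟨s, hs, ?_⟩
    have h1 := h.one_le_truncEnergy (hsub hs) hL1 (by positivity : 0 ≤ p * gainExp n)
    rw [inv_inv, add_sub_cancel_left] at hle
    exact (Real.rpow_inv_le_iff_of_pos (by linarith) hw0 (by linarith)).1 hle
  -- The sets of good times are nonempty, compact by continuity of the moments in time, and
  -- decreasing because the moments increase with the level. Their intersection contains a time that
  -- is good at all levels.
  set G : ℕ → Set ℝ := fun k => {s | s ∈ Icc t₀ (t₀ + d) ∧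
    truncEnergy n u S (p * gainExp n) (L₀ + k) s ≤ w ^ gainExp n} with hG
  have hLk : ∀ k : ℕ, L₀ ≤ L₀ + k := fun k => le_add_of_nonneg_right k.cast_nonneg
  have hcl : ∀ k, IsClosed (G k) := fun k =>
    ((h.continuousOn_truncEnergy (by linarith [hLk k] : 1 ≤ L₀ + k) (p * gainExp n)).mono
      hsub).preimage_isClosed_of_isClosed isClosed_Icc isClosed_Iic
  obtain ⟨s, hs⟩ := IsCompact.nonempty_iInter_of_sequence_nonempty_isCompact_isClosed G
    (fun k s hs => ⟨hs.1, (h.truncEnergy_mono (hsub hs.1) (by positivity) (by linarith [hLk k])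
      (by push_cast; linarith)).trans hs.2⟩)
    (fun k => hone _ (hLk k)) (isCompact_Icc.of_isClosed_subset (hcl 0) fun s hs => hs.1) hcl
  rw [mem_iInter] at hs
  refine ⟨s, (hs 0).1, fun L hL => ?_⟩
  obtain ⟨k, hk⟩ := exists_nat_ge (L - L₀)
  exact (h.truncEnergy_mono (hsub (hs 0).1) (by positivity) (by linarith) (by linarith)).trans
    (hs k).2

/-- One step of the Moser iteration. -/
lemma RegularFlow.truncEnergy_gain_le (hn : 3 ≤ n) (hd : TestFunctionsDense n M)
    (hA : 0 < A) (hB : 0 < B) (h : RegularFlow n T K A B u S S' ρ) (hp : (n : ℝ) / 2 ≤ p)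
    (hL₀ : 4 ≤ L₀) (hR : ∫ x : M, scalarCurvature n x ∂(riemannianVolume n M) ≤ L₀) (hΓ0 : 0 ≤ Γ)
    (hΓ : ∀ s ∈ Icc 0 T, ∀ L, L₀ ≤ L →
      energyConst n A B * truncEnergy n u S (critExp n) L s ^ (gainExp n)⁻¹ ≤ Γ)
    (ht₀ : 0 ≤ t₀) (hd0 : 0 < d)
    (hm : ∀ s ∈ Icc t₀ T, ∀ L, L₀ ≤ L → truncEnergy n u S p L s ≤ m)
    (ht : t ∈ Icc (t₀ + d) T) (hL : L₀ ≤ L) :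
    truncEnergy n u S (p * gainExp n) L t ≤
      Real.exp (2 * Γ * (p * gainExp n) ^ ((n : ℝ) / 2) * d) *
        (2 * (2 * A * (2 * m / d + Γ * p ^ ((n : ℝ) / 2) * m)) ^ gainExp n +
          8 * (p * gainExp n) ^ 3) := by
  have hn3 : (3 : ℝ) ≤ n := by exact_mod_cast hn
  have hp0 : 0 < p := by linarith
  have hχ := one_lt_gainExp hn
  have hL1 : 1 ≤ L := by linarith
  have htd : t₀ ≤ t - d := by linarith [ht.1]
  -- The good time is sought in `[t - d, t]`, so that the bound has to be carried forward over a
  -- time of at most `d`.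
  obtain ⟨s, hs, hle⟩ := h.exists_truncEnergy_gain_le hn hd hA hB hp hL₀ hR hΓ0 hΓ
    (ht₀.trans htd) hd0 (by linarith [ht.2]) fun s hs => hm s ⟨htd.trans hs.1, hs.2⟩
  rw [sub_add_cancel] at hs
  have hs0 : s ∈ Icc 0 T := ⟨ht₀.trans (htd.trans hs.1), hs.2.trans ht.2⟩
  have ht0 : t ∈ Icc 0 T := ⟨hs0.1.trans hs.2, ht.2⟩
  set w := (2 * A * (2 * m / d + Γ * p ^ ((n : ℝ) / 2) * m)) ^ gainExp n
  set q := p * gainExp n with hq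
  have hpq : p ≤ q := le_mul_of_one_le_right hp0.le hχ.le
  have hq0 : 0 < q := by linarith
  have hYs : powEnergy n u S q L s ≤ w :=
    h.powEnergy_le_of_truncEnergy_le hs0 (by linarith) hL1 hle
  -- The additive constant turns the energy into a majorant of the moment of exponent `q`, so the
  -- inequality becomes linear with rate `2 Γ q ^ (n / 2)`.
  have hgr := le_exp_mul_of_hasDerivAt (f := fun r => 2 * powEnergy n u S q L r + 8 * q ^ 3)
    (a := s) (b := t) (c := 2 * Γ * q ^ ((n : ℝ) / 2)) hs.2
    (((h.continuousOn_powEnergy hL1 q).mono (Icc_subset_Icc hs0.1 ht.2)).const_mul 2 |>.add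
      continuousOn_const) fun r hr => by
      have hr0 : r ∈ Ioo 0 T := ⟨hs0.1.trans_lt hr.1, hr.2.trans_le ht.2⟩
      have hr' := Ioo_subset_Icc_self hr0
      obtain ⟨Y', hY, hle⟩ := h.hasDerivAt_powEnergy_le hn hd hA hB hr0 (hp.trans hpq)
        (hL₀.trans hL) ((h.average_le hn hr').trans (hR.trans hL))
      refine ⟨_, (hY.const_mul 2).add_const _, ?_⟩
      have h1 := hΓ r hr' L hL
      have h2 := h.truncEnergy_le hr' (by linarith : 3 / 2 ≤ q) hL1
      have h3 := h.one_le_truncEnergy hr' hL1 hq0.le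
      have h4 := h.one_le_truncEnergy hr' hL1 (by positivity : 0 ≤ q * gainExp n)
      have h5 : 0 ≤ (2 * A)⁻¹ * truncEnergy n u S (q * gainExp n) L r ^ (gainExp n)⁻¹ := by
        positivity
      have h6 : energyConst n A B * q ^ ((n : ℝ) / 2) *
          truncEnergy n u S (critExp n) L r ^ (gainExp n)⁻¹ * truncEnergy n u S q L r ≤
          Γ * q ^ ((n : ℝ) / 2) * (2 * powEnergy n u S q L r + 8 * q ^ 3) := by
        calc _ = energyConst n A B * truncEnergy n u S (critExp n) L r ^ (gainExp n)⁻¹ *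
              q ^ ((n : ℝ) / 2) * truncEnergy n u S q L r := by ring
          _ ≤ _ := by gcongr
      linarith
  refine (h.truncEnergy_le ht0 (by linarith) hL1).trans (hgr.trans ?_)
  have h7 : 0 ≤ powEnergy n u S q L s := h.powEnergy_nonneg hs0 (by linarith) hL1
  have h8 : t - s ≤ d := by linarith [hs.1]
  gcongr

end MoserIteration

/-! ### The iteration and the upper bound -/

section UpperBound

/-- With geometrically shrinking time steps, the bounds of the Moser iteration satisfy a recursion
of the form `b (k + 1) = C * D ^ k * b k ^ χ`. -/
lemma exists_recursion_const {χ ν q A Γ T : ℝ} (hχ : 1 < χ) (hν : 0 < ν) (hq : 0 < q) (hA : 0 < A)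
    (hΓ : 0 ≤ Γ) (hT : 0 < T) :
    ∃ C D r : ℝ, 1 ≤ C ∧ 1 ≤ D ∧ 0 < r ∧ r < 1 ∧ ∀ (k : ℕ) (m : ℝ), 1 ≤ m →
      Real.exp (2 * Γ * (q * χ ^ k * χ) ^ ν * (T / 2 * (1 - r) * r ^ k)) *
        (2 * (2 * A * (2 * m / (T / 2 * (1 - r) * r ^ k) + Γ * (q * χ ^ k) ^ ν * m)) ^ χ +
          8 * (q * χ ^ k * χ) ^ 3) ≤ C * D ^ k * m ^ χ := by
  have hχ0 : 0 < χ := by linarith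
  -- The ratio of the time steps is `r = s⁻¹`: they shrink as fast as the coefficient `(q χ ^ k) ^
  -- ν` grows. The exponent in `exp` is then the same number `g` for all `k`, and dividing by the
  -- time step costs only the factor `s ^ k`.
  obtain ⟨s, hs⟩ : ∃ s, s = χ ^ ν := ⟨_, rfl⟩
  have hs1 : 1 < s := by rw [hs]; exact Real.one_lt_rpow hχ hν
  have hs0 : 0 < s := by linarith
  have hr1 : s⁻¹ < 1 := inv_lt_one_of_one_lt₀ hs1
  have h1r : 0 < 1 - s⁻¹ := by linarith
  set g := 2 * Γ * q ^ ν * s * (T / 2 * (1 - s⁻¹)) with hg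
  set H := 2 * A * (2 / (T / 2 * (1 - s⁻¹)) + Γ * q ^ ν) with hH
  have hH0 : 0 ≤ H := by positivity
  refine ⟨max 1 (Real.exp g * (2 * H ^ χ + 8 * (q * χ) ^ 3)), max (s ^ χ) (χ ^ 3), s⁻¹,
    le_max_left _ _, le_max_of_le_right (one_le_pow₀ hχ.le), by positivity, hr1, fun k m hm => ?_⟩
  have hm0 : 0 < m := by linarith
  have hsk : (χ ^ k) ^ ν = s ^ k := by
    rw [hs, ← Real.rpow_natCast, ← Real.rpow_natCast, ← Real.rpow_mul hχ0.le,
      ← Real.rpow_mul hχ0.le, mul_comm]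
  have e1 : 2 * Γ * (q * χ ^ k * χ) ^ ν * (T / 2 * (1 - s⁻¹) * s⁻¹ ^ k) = g := by
    rw [Real.mul_rpow (by positivity) hχ0.le, Real.mul_rpow hq.le (by positivity), hsk, ← hs,
      inv_pow, hg]
    field_simp
  have e2 : 2 * A * (2 * m / (T / 2 * (1 - s⁻¹) * s⁻¹ ^ k) + Γ * (q * χ ^ k) ^ ν * m) =
      H * s ^ k * m := by
    rw [Real.mul_rpow hq.le (by positivity), hsk, hH, inv_pow]
    field_simp
  have e3 : (H * s ^ k * m) ^ χ = H ^ χ * (s ^ χ) ^ k * m ^ χ := by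
    rw [Real.mul_rpow (by positivity) hm0.le, Real.mul_rpow hH0 (by positivity),
      ← Real.rpow_natCast, ← Real.rpow_natCast, ← Real.rpow_mul hs0.le, ← Real.rpow_mul hs0.le,
      mul_comm (k : ℝ)]
  have e4 : 8 * (q * χ ^ k * χ) ^ 3 = 8 * (q * χ) ^ 3 * (χ ^ 3) ^ k := by
    rw [← pow_mul, mul_comm 3 k, pow_mul]; ring
  rw [e1, e2, e3, e4]
  set D := max (s ^ χ) (χ ^ 3)
  have hD0 : 0 < D := lt_max_of_lt_right (by positivity)
  have hmχ : 1 ≤ m ^ χ := Real.one_le_rpow hm hχ0.le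
  have h1 : (s ^ χ) ^ k ≤ D ^ k := pow_le_pow_left₀ (by positivity) (le_max_left _ _) k
  have h2 : (χ ^ 3) ^ k ≤ D ^ k := pow_le_pow_left₀ (by positivity) (le_max_right _ _) k
  have h3 : H ^ χ * (s ^ χ) ^ k * m ^ χ ≤ H ^ χ * D ^ k * m ^ χ := by gcongr
  have h4 : 8 * (q * χ) ^ 3 * (χ ^ 3) ^ k ≤ 8 * (q * χ) ^ 3 * (D ^ k * m ^ χ) := by
    gcongr
    exact h2.trans (le_mul_of_one_le_right (by positivity) hmχ)
  calc Real.exp g * (2 * (H ^ χ * (s ^ χ) ^ k * m ^ χ) + 8 * (q * χ) ^ 3 * (χ ^ 3) ^ k)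
      ≤ Real.exp g * (2 * (H ^ χ * D ^ k * m ^ χ) + 8 * (q * χ) ^ 3 * (D ^ k * m ^ χ)) := by
        gcongr
    _ = Real.exp g * (2 * H ^ χ + 8 * (q * χ) ^ 3) * D ^ k * m ^ χ := by ring
    _ ≤ _ := by
        gcongr
        exact le_max_right _ _

variable {n : ℕ} {M : Type*} [TopologicalSpace M] [ChartedSpace (EuclideanSpace ℝ (Fin n)) M]
  [IsManifold (𝓡 n) ∞ M] [RiemannianBundle (fun x : M => TangentSpace (𝓡 n) x)]
  [IsContMDiffRiemannianBundle (𝓡 n) ∞ (EuclideanSpace ℝ (Fin n))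
      (fun x : M => TangentSpace (𝓡 n) x)]
  [MeasurableSpace M] [BorelSpace M] [SecondCountableTopology M] [T2Space M]
  [IsProbabilityMeasure (riemannianVolume n M)]
  {T K A B : ℝ} {u S S' : ℝ → M → ℝ} {ρ : ℝ → ℝ} {t L m₀ N : ℝ}

/-- The `k`-th moment bound holds from time `T / 2 * (1 - r ^ k)` on. These times stay below `T /
2`, so all the bounds hold on `[T / 2, T]`. The number `N` is fixed before the flow is given. -/
lemma RegularFlow.truncEnergy_iterate_le (hn : 3 ≤ n) (hd : TestFunctionsDense n M)
    (hA : 0 < A) (hB : 0 < B) (hT : 0 < T) (hm₀ : 1 ≤ m₀) {L₀ : ℝ} (hL₀ : 4 ≤ L₀)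
    (hR : ∫ x : M, scalarCurvature n x ∂(riemannianVolume n M) ≤ L₀) :
    ∃ N : ℝ, 1 ≤ N ∧ ∀ (K : ℝ) (u S S' : ℝ → M → ℝ) (ρ : ℝ → ℝ),
      RegularFlow n T K A B u S S' ρ →
      (∀ s ∈ Icc 0 T, ∀ L, L₀ ≤ L → truncEnergy n u S (critExp n) L s ≤ m₀) →
      ∀ t ∈ Icc (T / 2) T, ∀ L, L₀ ≤ L → ∀ k : ℕ,
        truncEnergy n u S (critExp n * gainExp n ^ k) L t ≤ N ^ (gainExp n ^ k) := by
  have hn3 : (3 : ℝ) ≤ n := by exact_mod_cast hn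
  have hχ := one_lt_gainExp hn
  have hq := half_le_critExp hn
  have hq0 : 0 < critExp n := by linarith
  have hC := energyConst_pos n hA hB
  set Γ := energyConst n A B * m₀ ^ (gainExp n)⁻¹ with hΓ
  have hΓ0 : 0 ≤ Γ := by positivity
  obtain ⟨C, D, r, hC1, hD1, hr0, hr1, hrec⟩ := exists_recursion_const (ν := (n : ℝ) / 2) hχ
    (by positivity) hq0 hA hΓ0 hT
  obtain ⟨N, hN1, hN⟩ := exists_le_rpow_pow_of_recursion hχ hC1 hD1 hm₀
  refine ⟨N, hN1, fun K u S S' ρ h hcrit t ht L hL k => ?_⟩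
  set b : ℕ → ℝ := fun k => Nat.rec m₀ (fun k x => C * D ^ k * x ^ gainExp n) k with hb
  have hbs : ∀ k, b (k + 1) = C * D ^ k * b k ^ gainExp n := fun k => rfl
  have hb1 : ∀ k, 1 ≤ b k := fun k => by
    induction k with
    | zero => exact hm₀
    | succ k ih =>
      rw [hbs]
      exact one_le_mul_of_one_le_of_one_le
        (one_le_mul_of_one_le_of_one_le hC1 (one_le_pow₀ hD1)) (Real.one_le_rpow ih (by linarith))
  have key : ∀ k, ∀ s ∈ Icc (T / 2 * (1 - r ^ k)) T, ∀ L, L₀ ≤ L →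
      truncEnergy n u S (critExp n * gainExp n ^ k) L s ≤ b k := fun k => by
    induction k with
    | zero =>
      intro s hs L hL
      simp only [pow_zero, sub_self, mul_zero] at hs
      rw [pow_zero, mul_one]
      exact hcrit s hs L hL
    | succ k ih =>
      intro s hs L hL
      have hrk : 0 < r ^ k := by positivity
      have hrk1 : r ^ k ≤ 1 := pow_le_one₀ hr0.le hr1.le
      have hp : (n : ℝ) / 2 ≤ critExp n * gainExp n ^ k :=
        hq.trans (le_mul_of_one_le_right hq0.le (one_le_pow₀ hχ.le))
      have hs' : s ∈ Icc (T / 2 * (1 - r ^ k) + T / 2 * (1 - r) * r ^ k) T := by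
        refine ⟨le_trans (le_of_eq ?_) hs.1, hs.2⟩
        rw [pow_succ]; ring
      rw [pow_succ, ← mul_assoc, hbs]
      refine (h.truncEnergy_gain_le hn hd hA hB hp hL₀ hR hΓ0 (fun s hs L hL => ?_)
        (mul_nonneg (by linarith) (by linarith))
        (mul_pos (mul_pos (by linarith) (by linarith)) hrk) ih hs' hL).trans (hrec k _ (hb1 k))
      have := h.one_le_truncEnergy hs (by linarith : 1 ≤ L) hq0.le
      have := hcrit s hs L hL
      rw [hΓ]
      gcongr
  refine (key k t ⟨le_trans ?_ ht.1, ht.2⟩ L hL).trans (hN b rfl hbs k)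
  exact mul_le_of_le_one_right (by linarith) (by linarith [(by positivity : 0 < r ^ k)])

/-- The moments of `trunc L S ^ q / N` of exponents `gainExp n ^ k → ∞` are at most one, hence so is
the function. -/
lemma RegularFlow.ae_le_of_truncEnergy_le (hn : 3 ≤ n) (h : RegularFlow n T K A B u S S' ρ)
    (ht : t ∈ Icc 0 T) (hN : 1 ≤ N) {q : ℝ} (hq : 0 < q) {L₀ : ℝ} (hL₀ : 1 ≤ L₀)
    (hmom : ∀ L, L₀ ≤ L → ∀ k : ℕ,
      truncEnergy n u S (q * gainExp n ^ k) L t ≤ N ^ (gainExp n ^ k)) :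
    ∀ᵐ x ∂(riemannianVolume n M), S t x ≤ N ^ q⁻¹ := by
  have hχ := one_lt_gainExp hn
  have hN0 : 0 < N := by linarith
  -- The level exceeds the bound to be proved, so the bound on the truncation excludes `S ≥ L`.
  set L := max L₀ (N ^ q⁻¹ + 1) with hLdef
  have hL1 : 1 ≤ L := hL₀.trans (le_max_left _ _)
  have e1 : ∀ (k : ℕ) x, (trunc L (S t x) ^ q / N) ^ (gainExp n ^ k) * u t x ^ volExp n =
      (N ^ (gainExp n ^ k))⁻¹ * (trunc L (S t x) ^ (q * gainExp n ^ k) * u t x ^ volExp n) :=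
    fun k x => by
      have := trunc_pos L (S t x)
      rw [Real.div_rpow (by positivity) hN0.le, ← Real.rpow_mul this.le]
      ring
  have h1 : ∀ᵐ x ∂(riemannianVolume n M), trunc L (S t x) ^ q / N ≤ 1 := by
    refine ae_le_one_of_integral_rpow_le (r := fun k => gainExp n ^ k)
      (w := fun x => u t x ^ volExp n) (tendsto_pow_atTop_atTop_of_one_lt hχ)
      (ae_of_all _ fun x => ?_) ?_ (fun k => ?_) (fun k => ?_)
    · have := trunc_pos L (S t x)
      positivity
    · filter_upwards [h.u_pos ht] with x hx
      positivity
    · simp only [e1]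
      exact (h.integrable_trunc ht hL1 _).const_mul _
    · simp only [e1]
      rw [integral_const_mul, inv_mul_le_iff₀ (by positivity), mul_one]
      exact hmom L (le_max_left _ _) k
  filter_upwards [h1] with x hx
  rw [div_le_one hN0] at hx
  have h2 : trunc L (S t x) ≤ N ^ q⁻¹ :=
    (Real.le_rpow_inv_iff_of_pos (trunc_pos _ _).le hN0.le hq).2 hx
  rcases le_total (S t x) L with h3 | h3
  · rw [trunc_eq_max h3] at h2
    exact (le_max_left _ _).trans h2
  · rw [trunc_of_ge hL1 h3] at h2
    linarith [le_max_right L₀ (N ^ q⁻¹ + 1)]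

/-- A uniform upper bound of the scalar curvature on `[T / 2, T]`. -/
theorem RegularFlow.exists_upper_bound (hn : 3 ≤ n) (hd : TestFunctionsDense n M)
    (hA : 0 < A) (hB : 0 < B) (hT : 0 < T)
    (hi : Integrable (fun x : M => max (scalarCurvature n x) 1 ^ critExp n)
      (riemannianVolume n M)) :
    ∃ C : ℝ, 0 < C ∧ ∀ (K : ℝ) (u S S' : ℝ → M → ℝ) (ρ : ℝ → ℝ),
      RegularFlow n T K A B u S S' ρ → ∀ t ∈ Icc (T / 2) T,
        ∀ᵐ x ∂(riemannianVolume n M), S t x ≤ C := by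
  have hn3 : (3 : ℝ) ≤ n := by exact_mod_cast hn
  have hq0 : 0 < critExp n := lt_of_lt_of_le (by positivity) (half_le_critExp hn)
  set R := ∫ x : M, scalarCurvature n x ∂(riemannianVolume n M)
  -- The explicit bound from `truncEnergy_critExp_le` contains neither `K` nor `L` nor the flow, so
  -- it can be chosen in advance.
  obtain ⟨m₁, hm₁⟩ : ∃ m₁ : ℝ, ∀ (K : ℝ) (u S S' : ℝ → M → ℝ) (ρ : ℝ → ℝ),
      RegularFlow n T K A B u S S' ρ → ∀ s ∈ Icc 0 T, ∀ L, max 4 R ≤ L →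
        truncEnergy n u S (critExp n) L s ≤ m₁ :=
    ⟨_, fun K u S S' ρ h s hs L hL => h.truncEnergy_critExp_le hn hd hA hB hi hs
      ((le_max_left _ _).trans hL) ((le_max_right _ _).trans hL)⟩
  obtain ⟨N, hN1, hN⟩ := RegularFlow.truncEnergy_iterate_le (M := M) (m₀ := max 1 m₁)
    (L₀ := max 4 R) hn hd hA hB hT (le_max_left _ _) (le_max_left _ _) (le_max_right _ _)
  refine ⟨N ^ (critExp n)⁻¹, by positivity, fun K u S S' ρ h t ht => ?_⟩
  exact h.ae_le_of_truncEnergy_le hn ⟨by linarith [ht.1], ht.2⟩ hN1 hq0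
    ((by norm_num : (1 : ℝ) ≤ 4).trans (le_max_left 4 R))
    (hN K u S S' ρ h (fun s hs L hL => (hm₁ K u S S' ρ h s hs L hL).trans (le_max_right _ _)) t ht)

end UpperBound

/-! ### The critical exponent, the norm on the product and the theorem -/

lemma critExp_eq (n : ℕ) : critExp n = (n : ℝ) ^ 2 / (2 * ((n : ℝ) - 2)) := by
  unfold critExp gainExp
  rw [div_mul_div_comm, sq]

/-- On a space of finite volume this places `S₀` in `L²`, as the weak equations require. -/
lemma two_le_critExp {n : ℕ} (hn : 3 ≤ n) : 2 ≤ critExp n := by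
  have hn3 : (3 : ℝ) ≤ n := by exact_mod_cast hn
  rw [critExp_eq, le_div_iff₀ (by linarith)]
  nlinarith [sq_nonneg ((n : ℝ) - 2)]

/-- Bounds on almost every slice yield a null set in the product only for a measurable set, hence
the passage to a measurable representative. -/
lemma eLpNorm_top_prod_le {α β : Type*} [MeasurableSpace α] [MeasurableSpace β] {μ : Measure α}
    {ν : Measure β} [SFinite ν] {f : α × β → ℝ} (hf : AEStronglyMeasurable f (μ.prod ν)) {C : ℝ}
    (h : ∀ᵐ a ∂μ, ∀ᵐ b ∂ν, |f (a, b)| ≤ C) : eLpNorm f ⊤ (μ.prod ν) ≤ ENNReal.ofReal C := by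
  rw [eLpNorm_exponent_top]
  refine eLpNormEssSup_le_of_ae_bound ?_
  have hms : MeasurableSet {q | |hf.mk f q| ≤ C} :=
    hf.stronglyMeasurable_mk.measurable.abs measurableSet_Iic
  have h1 : ∀ᵐ q ∂(μ.prod ν), |hf.mk f q| ≤ C := by
    rw [Measure.ae_prod_iff_ae_ae hms]
    filter_upwards [h, Measure.ae_ae_of_ae_prod hf.ae_eq_mk] with a ha ha'
    filter_upwards [ha, ha'] with b hb hb'
    rwa [← hb']
  filter_upwards [h1, hf.ae_eq_mk] with q hq hq'
  rwa [hq', Real.norm_eq_abs]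

end YamabeFlow

end

open YamabeFlow

theorem theorem3 (n : ℕ) (hn : 3 ≤ n) {M : Type*} [EMetricSpace M]
    [ChartedSpace (EuclideanSpace ℝ (Fin n)) M] [IsManifold (𝓡 n) ∞ M]
    [RiemannianBundle (fun x : M => TangentSpace (𝓡 n) x)]
    [IsContMDiffRiemannianBundle (𝓡 n) ∞ (EuclideanSpace ℝ (Fin n))
      (fun x : M => TangentSpace (𝓡 n) x)]
    [IsRiemannianManifold (𝓡 n) M] [SecondCountableTopology M]
    [MeasurableSpace M] [BorelSpace M]
    (hvol : riemannianVolume n M univ = 1)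
    (hadm : IsAdmissible n M)
    (hY : 0 < yamabeConstant n M)
    (hS₀ : MemLp (fun x : M => scalarCurvature n x)
      (ENNReal.ofReal ((n : ℝ) ^ 2 / (2 * ((n : ℝ) - 2)))) (riemannianVolume n M))
    (hS₀neg : MemLp (fun x : M => max (-scalarCurvature n x) 0) ⊤ (riemannianVolume n M))
    (T : ℝ) (hT : 0 < T) (A B : ℝ) (hA : 0 < A) (hB : 0 < B) :
    ∃ C : ℝ, 0 < C ∧ ∀ u S S' : ℝ → M → ℝ,
      IsYamabeFlow n T u S →
      ContinuousInH1 n T u S →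
      ContDiffInH1 n T u S S' →
      SobolevSpacesAgree n T u →
      (∀ t ∈ Icc 0 T, SobolevInequality n (u t) A B) →
      WeakScalarEvolution n T u S S' →
      (∀ t ∈ Icc (T / 2) T, eLpNorm (S t) ⊤ (riemannianVolume n M) ≤ ENNReal.ofReal C) ∧
      (AEStronglyMeasurable (fun q : ℝ × M => S q.1 q.2)
          ((volume.restrict (Icc (T / 2) T)).prod (riemannianVolume n M)) →
        eLpNorm (fun q : ℝ × M => S q.1 q.2) ⊤
          ((volume.restrict (Icc (T / 2) T)).prod (riemannianVolume n M))
            ≤ ENNReal.ofReal C) := by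
  
  have hn3 : (3 : ℝ) ≤ n := by exact_mod_cast hn
  have : IsProbabilityMeasure (riemannianVolume n M) := ⟨hvol⟩
  have hd : TestFunctionsDense n M := hadm.dense
  rw [← critExp_eq] at hS₀
  have hc2 := two_le_critExp hn
  have hS₂ : MemLp (fun x : M => scalarCurvature n x) 2 (riemannianVolume n M) :=
    hS₀.mono_exponent (by
      rw [← ENNReal.ofReal_ofNat]
      exact ENNReal.ofReal_le_ofReal hc2)
  have hi : Integrable (fun x : M => max (scalarCurvature n x) 1 ^ critExp n)
      (riemannianVolume n M) := by
    have h1 : MemLp (fun x : M => max (scalarCurvature n x) 1) (ENNReal.ofReal (critExp n))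
      (riemannianVolume n M) := hS₀.sup (memLp_const 1)
    have h2 := h1.integrable_norm_rpow (by simpa using by linarith) ENNReal.ofReal_ne_top
    rw [ENNReal.toReal_ofReal (by linarith)] at h2
    refine h2.congr (ae_of_all _ fun x => ?_)
    dsimp only
    rw [Real.norm_of_nonneg (zero_le_one.trans (le_max_right _ _))]
  -- `m` is the essential supremum of the negative part of `S₀`.
  obtain ⟨m, hm0, hm⟩ : ∃ m : ℝ, 0 ≤ m ∧ ∀ᵐ x ∂(riemannianVolume n M),
      -m ≤ scalarCurvature n x := by
    refine ⟨(eLpNorm (fun x : M => max (-scalarCurvature n x) 0) ⊤ (riemannianVolume n M)).toReal,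
      ENNReal.toReal_nonneg, ?_⟩
    filter_upwards [ae_le_eLpNormEssSup (f := fun x : M => max (-scalarCurvature n x) 0)
      (μ := riemannianVolume n M)] with x hx
    have h1 := ENNReal.toReal_mono hS₀neg.2.ne (eLpNorm_exponent_top (ε := ℝ) ▸ hx)
    rw [toReal_enorm, Real.norm_of_nonneg (le_max_right _ _)] at h1
    linarith [le_max_left (-scalarCurvature n x) 0]
  obtain ⟨C, hC, hbound⟩ := RegularFlow.exists_upper_bound (M := M) hn hd hA hB hT hi
  -- `C` bounds `S` above and `-m` bounds it below; both are fixed before the flow is introduced.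
  refine ⟨max C m, lt_max_of_lt_left hC,
    fun u S S' hflow hcont hcd hagree hsob hev => ?_⟩
  obtain ⟨K, hK⟩ := exists_regularFlow hn hd hY hS₂ hT hA.le hB.le hflow hcont hcd hagree hsob hev
  have habs : ∀ t ∈ Icc (T / 2) T, ∀ᵐ x ∂(riemannianVolume n M), |S t x| ≤ max C m :=
    fun t ht => by
      filter_upwards [hbound K u S S' _ hK t ht,
        hK.neg_le hn hd hm0 hm ⟨by linarith [ht.1], ht.2⟩] with x hx hx'
      exact abs_le.2 ⟨by linarith [le_max_right C m], hx.trans (le_max_left _ _)⟩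
  refine ⟨fun t ht => ?_, fun hmeas => eLpNorm_top_prod_le hmeas
    ((ae_restrict_iff' measurableSet_Icc).2 (ae_of_all _ habs))⟩
  rw [eLpNorm_exponent_top]
  exact eLpNormEssSup_le_of_ae_bound (habs t ht)
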